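/- Let $n\ge 0$, let $\mathbb K=\mathbb C(q)$, and put $[s]=\frac{q^s-q^{-s}}{q-q^{-1}}$ and $[z;s]_d=\frac{zq^{ds}-z^{-1}q^{-ds}}{q^d-q^{-d}}$. All categories are $\mathbb K$-linear and all functors are $\mathbb K$-linear. **Representations.** $U=U_q(\mathfrak{gl}_n)$ is generated by $\mathbf q^h$ ($h\in\mathbb Z^n$), $E_i,F_i$ ($1\le i<n$) with the usual relations, $K_i=\mathbf q^{\varepsilon_i-\varepsilon_{i+1}}$, and $\Delta(\mathbf q^h)=\mathbf q^h\otimes\mathbf q^h$, $\Delta(E_i)=E_i\otimes K_i+1\otimes E_i$, $\Delta(F_i)=F_i\otimes 1+K_i^{-1}\otimes F_i$. Its vector representation $V$ has basis $v_1,\dots,v_n$ with $\mathbf q^hv_j=q^{h_j}v_j$, $E_iv_{i+1}=v_i$, $F_iv_i=v_{i+1}$ (and $E_i,F_i$ zero on the other basis vectors). Let $\Lambda^\bullet V=TV/\langle v_i\otimes v_i,\ q^{-1}v_i\otimes v_j+v_j\otimes v_i\ (i<j)\rangle$ and $S^\bullet V=TV/\langle qv_i\otimes v_j-v_j\otimes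 v_i\ (i<j)\rangle$, with homogeneous parts $\Lambda^aV$, $S^aV$. They carry the multiplication induced from $TV$ and the comultiplication whose component in degrees $(a,b)$ sends $v_{i_1}\cdots v_{i_{a+b}}$ (indices strictly increasing for $\Lambda$, weakly increasing for $S$) to $\sum_T c_T\,v_{i_T}\otimes v_{i_{T^c}}$, the sum being over all $a$-element sets $T$ of positions, where $v_{i_T}$ is the product of the factors at the positions in $T$, in increasing order, and where $c_T=q^{\#\{(t,u):t<u\}}(-1)^{\#\{(t,u):t>u\}}$ for $\Lambda$ and $c_T=q^{-\#\{(t,u):t<u\}+\#\{(t,u):t>u,\ i_t=i_u\}}$ for $S$, with $t\in T$, $u\notin T$. $U'=U'_q(\mathfrak{so}_n)\subset U$ is the subalgebra generated by $B_i=F_i-K_i^{-1}E_i$, $1\le i<n$. Since $\Delta(U')\subset U\otimes U'$, the category $\mathrm{Rep}(U')$ of finite-dimensional $U'$-representations is a left module category over the monoidal category $\mathrm{Rep}(U)$ of finite-dimensional $U$-representations. **Webs.** $\mathbf{Web}$ is the additive closure of the strict monoidal $\mathbb K$-linear category generated by objects $a\in\mathbb Z_{>0}$ and merges $a\otimes b\to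 a+b$ and splits $a+b\to a\otimes b$, modulo associativity of merges, coassociativity of splits, and the thin square switch on $a\otimes b$: moving a thin strand (thickness $1$) from left to right and then one back equals moving a thin strand from right to left and then one back, plus $[a-b]\,\mathrm{id}$ (edges of thickness $0$ are erased, diagrams with an edge of negative thickness are $0$). Let $\mathrm{ms}$ denote a merge followed by a split, write $\mathrm{ms}_i$ for $\mathrm{ms}$ on the adjacent thin strands $i,i+1$, and let $\beta^{\pm1}$ be the crossings $-q^{\mp1}\mathrm{id}+\mathrm{ms}$ of two thin strands. Compositions below are read from right to left. $\mathbf{Web}^{\cup}_z$ is the additive closure of the left $\mathbf{Web}$-module category generated by one object $\varnothing$ and morphisms $\cup:\varnothing\to 1\otimes1$, $\cap:1\otimes1\to\varnothing$, modulo the left ideal generated by $\cap\cup=[z;0]_1$; $(1\otimes\cap)\,\mathrm{ms}_1(1\otimes\cup)=[z;-1]_1\,\mathrm{id}_1$; $(1\otimes1\otimes\cap)\,\beta_2\,(\mathrm{ms}_1\mathrm{ms}_3)\,\beta_2^{-1}\,(1\otimes1\otimes\cup)=\cup\cap+[z;-2]_1\,\mathrm{id}_{1\otimes1}$; $\mathrm{merge}\circ\cup=0$,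 $\cap\circ\mathrm{split}=0$; $(\cap\otimes\cap)\,\mathrm{ms}_2\mathrm{ms}_1=(\cap\otimes\cap)\,\mathrm{ms}_2\mathrm{ms}_3$ and $\mathrm{ms}_1\mathrm{ms}_2(\cup\otimes\cup)=\mathrm{ms}_3\mathrm{ms}_2(\cup\otimes\cup)$, where $\cap\otimes\cap=\cap\circ(1\otimes1\otimes\cap)$ and $\cup\otimes\cup=(1\otimes1\otimes\cup)\circ\cup$. $\mathbf{Web}^{\bullet}_z$ is defined in the same way with generators a start dot $s:\varnothing\to2$ and an end dot $e:2\to\varnothing$ and relations $es=[z;0]_2$; $(1\otimes e)\,\mathrm{ms}\,(1\otimes s)=[z;-1]_2\,\mathrm{id}_1$; $(2\otimes e)\,\mathrm{ms}\,(2\otimes s)=se+[z;-2]_2\,\mathrm{id}_2$; and the last two displayed relations of $\mathbf{Web}^\cup_z$ for $\cup=\mathrm{split}\circ s$, $\cap=e\circ\mathrm{merge}$. **Proposition.** (i) There are monoidal functors $\Gamma_A^{\mathrm{ext}},\Gamma_A^{\mathrm{sym}}:\mathbf{Web}\to\mathrm{Rep}(U)$ sending $a$ to $\Lambda^aV$,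 respectively to $S^aV$, and merges and splits to the components of the multiplication and of the comultiplication. (ii) (Exterior case) For each such $\Gamma_A^{\mathrm{ext}}$ there is, up to natural isomorphism, exactly one functor $\Gamma^{\mathrm{ext}}_{BD}:\mathbf{Web}^{\cup}_{q^n}\to\mathrm{Rep}(U')$ that is a functor of module categories over $\Gamma_A^{\mathrm{ext}}$ (that is, compatible with the actions of $\mathbf{Web}$ and of $\mathrm{Rep}(U)$ on its source and target), sends $\varnothing$ to the trivial representation and $a$ to $\Lambda^aV$, and sends $\cup$ to $1\mapsto\sum_iv_i\otimes v_i$ and $\cap$ to $v_i\otimes v_j\mapsto\delta_{ij}q^{n+1-2i}$. (iii) (Symmetric case) For each such $\Gamma_A^{\mathrm{sym}}$ there is, up to natural isomorphism, exactly one functor $\Gamma^{\mathrm{sym}}_{BD}:\mathbf{Web}^{\bullet}_{-q^{-n}}\to\mathrm{Rep}(U')$ that is a functor of module categories over $\Gamma_A^{\mathrm{sym}}$, sends $\varnothing$ to the trivial representation and $a$ to $S^aV$, and sends the start dot to $1\mapsto\frac1{[2]}\sum_iv_iv_i$ and the end dot to $v_iv_j\mapsto\delta_{ij}q^{n+1-2i}$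 ($i\le j$). -/

import Mathlib

open CategoryTheory MonoidalCategory
open scoped MonoidalLeftAction TensorProduct
noncomputable section

/-- A left action of a preadditive monoidal category on a preadditive category that is biadditive
on morphisms. -/
class BiadditiveAction (C D : Type*) [Category C] [Category D] [Preadditive C] [Preadditive D]
    [MonoidalCategory C] [MonoidalLeftAction C D] : Prop where
  add_left : ∀ {c c' : C} (f g : c ⟶ c') (d : D), (f + g) ⊵ₗ d = f ⊵ₗ d + g ⊵ₗ d
  add_right : ∀ (c : C) {d d' : D} (f g : d ⟶ d'), c ⊴ₗ (f + g) = c ⊴ₗ f + c ⊴ₗ g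


/-- The ground field `ℂ(q)`. -/
abbrev Kq : Type := RatFunc ℂ

/-- The indeterminate `q`. -/
def q : Kq := RatFunc.X

/-- The quantum integer `[s] = (q^s - q^{-s}) / (q - q^{-1})`. -/
def qnum (s : ℤ) : Kq := (q ^ s - q ^ (-s)) / (q - q⁻¹)

/-- `[z; s]_d = (z q^{ds} - z⁻¹ q^{-ds}) / (q^d - q^{-d})`. -/
def zqnum (d : ℕ) (z : Kq) (s : ℤ) : Kq :=
  (z * q ^ (d * s) - z⁻¹ * q ^ (-(d * s))) / (q ^ d - (q ^ d)⁻¹)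

namespace AWeb

/-- Formal expressions for morphisms between words in the generating objects `a ∈ ℤ_{>0}`, built
from merges, splits, identities, compositions (written in diagrammatic order), tensor products and
linear combinations. -/
inductive Pre : List ℕ+ → List ℕ+ → Type
  | id (X : List ℕ+) : Pre X X
  | comp {X Y Z : List ℕ+} (f : Pre X Y) (g : Pre Y Z) : Pre X Z
  | tensor {X Y X' Y' : List ℕ+} (f : Pre X Y) (g : Pre X' Y') : Pre (X ++ X') (Y ++ Y')
  | merge (a b c : ℕ+) (h : a + b = c) : Pre [a, b] [c]
  | split (a b c : ℕ+) (h : a + b = c) : Pre [c] [a, b]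
  | zero {X Y : List ℕ+} : Pre X Y
  | add {X Y : List ℕ+} (f g : Pre X Y) : Pre X Y
  | smul {X Y : List ℕ+} (k : Kq) (f : Pre X Y) : Pre X Y

namespace Pre

/-- The identity morphism between two equal words. -/
def eqHom {X Y : List ℕ+} (h : X = Y) : Pre X Y := h ▸ id X

/-- `(a, b) → (a + b) → (a, b)`. -/
def ms (a b : ℕ+) : Pre [a, b] [a, b] := comp (merge a b _ rfl) (split a b _ rfl)

/-- The congruence generated by the axioms of a strict monoidal `ℂ(q)`-linear category and by the
web relations. -/
inductive Rel : ∀ {X Y : List ℕ+}, Pre X Y → Pre X Y → Prop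
  | refl {X Y} (f : Pre X Y) : Rel f f
  | symm {X Y} {f g : Pre X Y} : Rel f g → Rel g f
  | trans {X Y} {f g h : Pre X Y} : Rel f g → Rel g h → Rel f h
  | comp_congr {X Y Z} {f f' : Pre X Y} {g g' : Pre Y Z} :
      Rel f f' → Rel g g' → Rel (comp f g) (comp f' g')
  | tensor_congr {X Y X' Y'} {f f' : Pre X Y} {g g' : Pre X' Y'} :
      Rel f f' → Rel g g' → Rel (tensor f g) (tensor f' g')
  | add_congr {X Y} {f f' g g' : Pre X Y} : Rel f f' → Rel g g' → Rel (add f g) (add f' g')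
  | smul_congr {X Y} (k : Kq) {f f' : Pre X Y} : Rel f f' → Rel (smul k f) (smul k f')
  -- category
  | id_comp {X Y} (f : Pre X Y) : Rel (comp (id X) f) f
  | comp_id {X Y} (f : Pre X Y) : Rel (comp f (id Y)) f
  | comp_assoc {W X Y Z} (f : Pre W X) (g : Pre X Y) (h : Pre Y Z) :
      Rel (comp (comp f g) h) (comp f (comp g h))
  -- vector space structure on morphisms
  | add_assoc {X Y} (f g h : Pre X Y) : Rel (add (add f g) h) (add f (add g h))
  | add_comm {X Y} (f g : Pre X Y) : Rel (add f g) (add g f)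
  | zero_add {X Y} (f : Pre X Y) : Rel (add zero f) f
  | zero_smul {X Y} (f : Pre X Y) : Rel (smul 0 f) zero
  | one_smul {X Y} (f : Pre X Y) : Rel (smul 1 f) f
  | mul_smul {X Y} (k l : Kq) (f : Pre X Y) : Rel (smul (k * l) f) (smul k (smul l f))
  | add_smul {X Y} (k l : Kq) (f : Pre X Y) : Rel (smul (k + l) f) (add (smul k f) (smul l f))
  | smul_add {X Y} (k : Kq) (f g : Pre X Y) :
      Rel (smul k (add f g)) (add (smul k f) (smul k g))
  -- bilinearity of composition and tensor product
  | add_comp {X Y Z} (f f' : Pre X Y) (g : Pre Y Z) :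
      Rel (comp (add f f') g) (add (comp f g) (comp f' g))
  | comp_add {X Y Z} (f : Pre X Y) (g g' : Pre Y Z) :
      Rel (comp f (add g g')) (add (comp f g) (comp f g'))
  | smul_comp {X Y Z} (k : Kq) (f : Pre X Y) (g : Pre Y Z) :
      Rel (comp (smul k f) g) (smul k (comp f g))
  | comp_smul {X Y Z} (k : Kq) (f : Pre X Y) (g : Pre Y Z) :
      Rel (comp f (smul k g)) (smul k (comp f g))
  | add_tensor {X Y X' Y'} (f f' : Pre X Y) (g : Pre X' Y') :
      Rel (tensor (add f f') g) (add (tensor f g) (tensor f' g))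
  | tensor_add {X Y X' Y'} (f : Pre X Y) (g g' : Pre X' Y') :
      Rel (tensor f (add g g')) (add (tensor f g) (tensor f g'))
  | smul_tensor {X Y X' Y'} (k : Kq) (f : Pre X Y) (g : Pre X' Y') :
      Rel (tensor (smul k f) g) (smul k (tensor f g))
  | tensor_smul {X Y X' Y'} (k : Kq) (f : Pre X Y) (g : Pre X' Y') :
      Rel (tensor f (smul k g)) (smul k (tensor f g))
  -- strict monoidal category
  | tensor_id (X Y) : Rel (tensor (id X) (id Y)) (id (X ++ Y))
  | interchange {X Y Z X' Y' Z'} (f : Pre X Y) (g : Pre Y Z) (f' : Pre X' Y') (g' : Pre Y' Z') :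
      Rel (tensor (comp f g) (comp f' g')) (comp (tensor f f') (tensor g g'))
  | unit_tensor {X Y} (f : Pre X Y) : Rel (tensor (id []) f) f
  | tensor_unit {X Y} (f : Pre X Y) : Rel (tensor f (id []))
      (comp (eqHom (List.append_nil X)) (comp f (eqHom (List.append_nil Y).symm)))
  | tensor_assoc {X Y X' Y' X'' Y''} (f : Pre X Y) (g : Pre X' Y') (h : Pre X'' Y'') :
      Rel (tensor (tensor f g) h) (comp (eqHom (List.append_assoc X X' X''))
        (comp (tensor f (tensor g h)) (eqHom (List.append_assoc Y Y' Y'').symm)))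
  -- associativity and coassociativity
  | merge_assoc (a b c ab bc abc : ℕ+) (h₁ : a + b = ab) (h₂ : ab + c = abc) (h₃ : b + c = bc)
      (h₄ : a + bc = abc) :
      Rel (X := [a, b, c]) (comp (tensor (merge a b ab h₁) (id [c])) (merge ab c abc h₂))
        (comp (tensor (id [a]) (merge b c bc h₃)) (merge a bc abc h₄))
  | split_coassoc (a b c ab bc abc : ℕ+) (h₁ : a + b = ab) (h₂ : ab + c = abc) (h₃ : b + c = bc)
      (h₄ : a + bc = abc) :
      Rel (Y := [a, b, c]) (comp (split ab c abc h₂) (tensor (split a b ab h₁) (id [c])))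
        (comp (split a bc abc h₄) (tensor (id [a]) (split b c bc h₃)))
  -- the thin square switch on two strands of thickness `(a + 1, b + 1)`
  | square (a b : ℕ+) : Rel (X := [a + 1, b + 1]) (Y := [a + 1, b + 1])
      (comp (tensor (split a 1 (a + 1) rfl) (id [b + 1]))
        (comp (tensor (id [a]) (ms 1 (b + 1)) :) (tensor (merge a 1 (a + 1) rfl) (id [b + 1]))))
      (add
        (comp (tensor (id [a + 1]) (split 1 b (b + 1) (_root_.add_comm 1 b)))
          (comp (tensor (ms (a + 1) 1) (id [b]) :)
            (tensor (id [a + 1]) (merge 1 b (b + 1) (_root_.add_comm 1 b)))))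
        (smul (qnum ((a : ℤ) - b)) (id [a + 1, b + 1])))
  -- the thin square switch on strands of thickness `(1, b + 1)`; edges of thickness `0` are erased
  | square_left (b : ℕ+) : Rel (X := [1, b + 1]) (Y := [1, b + 1])
      (ms 1 (b + 1))
      (add
        (comp (tensor (id [1]) (split 1 b (b + 1) (_root_.add_comm 1 b)))
          (comp (tensor (ms 1 1) (id [b]) :)
            (tensor (id [1]) (merge 1 b (b + 1) (_root_.add_comm 1 b)))))
        (smul (qnum (-(b : ℤ))) (id [1, b + 1])))
  -- the thin square switch on strands of thickness `(a + 1, 1)`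
  | square_right (a : ℕ+) : Rel (X := [a + 1, 1]) (Y := [a + 1, 1])
      (comp (tensor (split a 1 (a + 1) rfl) (id [1]))
        (comp (tensor (id [a]) (ms 1 1) :) (tensor (merge a 1 (a + 1) rfl) (id [1]))))
      (add (ms (a + 1) 1) (smul (qnum a) (id [a + 1, 1])))
  -- the thin square switch on strands of thickness `(a + 1, 0)` and `(0, b + 1)`; diagrams with an
  -- edge of negative thickness are zero
  | digon_right (a : ℕ+) :
      Rel (comp (split a 1 (a + 1) rfl) (merge a 1 (a + 1) rfl))
        (smul (qnum ((a : ℤ) + 1)) (id [a + 1]))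
  | digon_left (b : ℕ+) :
      Rel (comp (split 1 b (b + 1) (_root_.add_comm 1 b)) (merge 1 b (b + 1) (_root_.add_comm 1 b)))
        (smul (qnum ((b : ℤ) + 1)) (id [b + 1]))

/-- Formal morphisms up to the relations. -/
def setoid (X Y : List ℕ+) : Setoid (Pre X Y) := ⟨Rel, Rel.refl, Rel.symm, Rel.trans⟩

end Pre

end AWeb

/-- The strict monoidal `ℂ(q)`-linear category of webs generated by merges and splits, before
passing to the additive closure. Its objects are the words in positive integers. -/
structure AWeb where
  /-- the word -/
  word : List ℕ+

namespace AWeb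

instance instCategory : Category AWeb where
  Hom X Y := Quotient (Pre.setoid X.word Y.word)
  id X := Quotient.mk _ (.id X.word)
  comp {X Y Z} := Quotient.map₂ (sa := Pre.setoid _ _) (sb := Pre.setoid _ _)
    (sc := Pre.setoid X.word Z.word) Pre.comp fun _ _ h _ _ h' => .comp_congr h h'
  id_comp := by rintro X Y ⟨f⟩; exact Quotient.sound (.id_comp f)
  comp_id := by rintro X Y ⟨f⟩; exact Quotient.sound (.comp_id f)
  assoc := by rintro W X Y Z ⟨f⟩ ⟨g⟩ ⟨h⟩; exact Quotient.sound (.comp_assoc f g h)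


/-- The web represented by a formal expression. -/
def of {X Y : List ℕ+} (f : Pre X Y) : AWeb.mk X ⟶ AWeb.mk Y := Quotient.mk _ f

instance instHomAdd (X Y : AWeb) : Add (X ⟶ Y) where
  add := Quotient.map₂ (sa := Pre.setoid _ _) (sb := Pre.setoid _ _)
    (sc := Pre.setoid X.word Y.word) Pre.add fun _ _ h _ _ h' => .add_congr h h'

instance instHomZero (X Y : AWeb) : Zero (X ⟶ Y) where
  zero := Quotient.mk _ .zero

instance instHomSMul (X Y : AWeb) : SMul Kq (X ⟶ Y) where
  smul k := Quotient.map (sa := Pre.setoid _ _) (sb := Pre.setoid X.word Y.word) (Pre.smul k)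
    fun _ _ h => .smul_congr _ h

instance instHomNeg (X Y : AWeb) : Neg (X ⟶ Y) where
  neg f := (-1 : Kq) • f

instance instHomAddCommGroup (X Y : AWeb) : AddCommGroup (X ⟶ Y) where
  nsmul := nsmulRec
  zsmul := zsmulRec
  add_assoc := by rintro ⟨f⟩ ⟨g⟩ ⟨h⟩; exact Quotient.sound (.add_assoc f g h)
  add_comm := by rintro ⟨f⟩ ⟨g⟩; exact Quotient.sound (.add_comm f g)
  zero_add := by rintro ⟨f⟩; exact Quotient.sound (.zero_add f)
  add_zero := by rintro ⟨f⟩; exact Quotient.sound (.trans (.add_comm _ _) (.zero_add f))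
  neg_add_cancel := by
    rintro ⟨f⟩
    refine Quotient.sound (.trans (.add_congr (.refl _) (.symm (.one_smul f))) ?_)
    refine .trans (.symm (.add_smul _ _ f)) ?_
    rw [neg_add_cancel]
    exact .zero_smul f

instance instPreadditive : Preadditive AWeb where
  add_comp := by rintro X Y Z ⟨f⟩ ⟨f'⟩ ⟨g⟩; exact Quotient.sound (.add_comp f f' g)
  comp_add := by rintro X Y Z ⟨f⟩ ⟨g⟩ ⟨g'⟩; exact Quotient.sound (.comp_add f g g')

instance instLinear : Linear Kq AWeb where
  homModule X Y :=
    { one_smul := by rintro ⟨f⟩; exact Quotient.sound (.one_smul f)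
      mul_smul := by rintro k l ⟨f⟩; exact Quotient.sound (.mul_smul k l f)
      smul_zero := by
        intro k
        refine Quotient.sound (.trans (.smul_congr k (.symm (.zero_smul .zero))) ?_)
        refine .trans (.symm (.mul_smul k 0 _)) ?_
        rw [mul_zero]
        exact .zero_smul _
      smul_add := by rintro k ⟨f⟩ ⟨g⟩; exact Quotient.sound (.smul_add k f g)
      add_smul := by rintro k l ⟨f⟩; exact Quotient.sound (.add_smul k l f)
      zero_smul := by rintro ⟨f⟩; exact Quotient.sound (.zero_smul f) }
  smul_comp := by rintro X Y Z k ⟨f⟩ ⟨g⟩; exact Quotient.sound (.smul_comp k f g)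
  comp_smul := by rintro X Y Z ⟨f⟩ k ⟨g⟩; exact Quotient.sound (.comp_smul k f g)

/-- The horizontal juxtaposition of webs. -/
def juxt {X Y X' Y' : AWeb} (f : X ⟶ Y) (g : X' ⟶ Y') :
    AWeb.mk (X.word ++ X'.word) ⟶ AWeb.mk (Y.word ++ Y'.word) :=
  Quotient.map₂ (sa := Pre.setoid X.word Y.word) (sb := Pre.setoid X'.word Y'.word)
    (sc := Pre.setoid (X.word ++ X'.word) (Y.word ++ Y'.word)) Pre.tensor
    (fun _ _ h _ _ h' => .tensor_congr h h') f g

lemma juxt_comp {X Y Z X' Y' Z' : AWeb} (f : X ⟶ Y) (g : Y ⟶ Z) (f' : X' ⟶ Y') (g' : Y' ⟶ Z') :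
    juxt (f ≫ g) (f' ≫ g') = juxt f f' ≫ juxt g g' := by
  obtain ⟨f⟩ := f; obtain ⟨g⟩ := g; obtain ⟨f'⟩ := f'; obtain ⟨g'⟩ := g'
  exact Quotient.sound (.interchange f g f' g')

lemma juxt_id (X Y : AWeb) : juxt (𝟙 X) (𝟙 Y) = 𝟙 _ := Quotient.sound (.tensor_id X.word Y.word)

lemma of_eqHom {X Y : List ℕ+} (h : X = Y) : of (.eqHom h) = eqToHom (congrArg AWeb.mk h) := by
  subst h; rfl

/-- Morphisms that are identities up to an equality of words. -/
def IsEqToHom {X Y : AWeb} (f : X ⟶ Y) : Prop := ∃ h : X = Y, f = eqToHom h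

lemma IsEqToHom.comp {X Y Z : AWeb} {f : X ⟶ Y} {g : Y ⟶ Z} (hf : IsEqToHom f)
    (hg : IsEqToHom g) : IsEqToHom (f ≫ g) := by
  obtain ⟨rfl, rfl⟩ := hf; obtain ⟨rfl, rfl⟩ := hg
  exact ⟨rfl, by simp⟩

lemma IsEqToHom.juxt {X Y X' Y' : AWeb} {f : X ⟶ Y} {g : X' ⟶ Y'} (hf : IsEqToHom f)
    (hg : IsEqToHom g) : IsEqToHom (juxt f g) := by
  obtain ⟨rfl, rfl⟩ := hf; obtain ⟨rfl, rfl⟩ := hg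
  exact ⟨rfl, juxt_id _ _⟩

lemma IsEqToHom.eq {X Y : AWeb} {f g : X ⟶ Y} (hf : IsEqToHom f) (hg : IsEqToHom g) : f = g := by
  obtain ⟨_, rfl⟩ := hf; obtain ⟨_, rfl⟩ := hg
  rfl

lemma juxt_assoc {X Y X' Y' X'' Y'' : AWeb} (f : X ⟶ Y) (g : X' ⟶ Y') (h : X'' ⟶ Y'') :
    juxt (juxt f g) h = eqToHom (congrArg AWeb.mk (List.append_assoc _ _ _)) ≫
      juxt f (juxt g h) ≫ eqToHom (congrArg AWeb.mk (List.append_assoc _ _ _).symm) := by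
  obtain ⟨f⟩ := f; obtain ⟨g⟩ := g; obtain ⟨h⟩ := h
  rw [← of_eqHom (List.append_assoc _ _ _), ← of_eqHom (List.append_assoc _ _ _).symm]
  exact Quotient.sound (.tensor_assoc f g h)

lemma unit_juxt {X Y : AWeb} (f : X ⟶ Y) : juxt (𝟙 (AWeb.mk [])) f = f := by
  obtain ⟨f⟩ := f
  exact Quotient.sound (.unit_tensor f)

lemma juxt_unit {X Y : AWeb} (f : X ⟶ Y) : juxt f (𝟙 (AWeb.mk [])) =
    eqToHom (congrArg AWeb.mk (List.append_nil _)) ≫ f ≫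
      eqToHom (congrArg AWeb.mk (List.append_nil _).symm) := by
  obtain ⟨f⟩ := f
  rw [← of_eqHom (List.append_nil _), ← of_eqHom (List.append_nil _).symm]
  exact Quotient.sound (.tensor_unit f)

instance instMonoidalCategoryStruct : MonoidalCategoryStruct AWeb where
  tensorObj X Y := ⟨X.word ++ Y.word⟩
  tensorHom := juxt
  whiskerLeft X _ _ f := juxt (𝟙 X) f
  whiskerRight f X := juxt f (𝟙 X)
  tensorUnit := ⟨[]⟩
  associator X Y Z := eqToIso (congrArg AWeb.mk (List.append_assoc X.word Y.word Z.word))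
  leftUnitor X := Iso.refl X
  rightUnitor X := eqToIso (congrArg AWeb.mk (List.append_nil X.word))

lemma isEqToHom_associator (X Y Z : AWeb) : IsEqToHom (α_ X Y Z).hom :=
  ⟨congrArg AWeb.mk (List.append_assoc X.word Y.word Z.word), rfl⟩

lemma isEqToHom_rightUnitor (X : AWeb) : IsEqToHom (ρ_ X).hom :=
  ⟨congrArg AWeb.mk (List.append_nil X.word), rfl⟩

lemma isEqToHom_id (X : AWeb) : IsEqToHom (𝟙 X) := ⟨rfl, rfl⟩

instance instMonoidalCategory : MonoidalCategory AWeb := MonoidalCategory.ofTensorHom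
  (id_tensorHom_id := juxt_id)
  (id_tensorHom := fun _ _ _ _ => rfl)
  (tensorHom_id := fun _ _ => rfl)
  (tensorHom_comp_tensorHom := fun f g f' g' => (juxt_comp f f' g g').symm)
  (associator_naturality := fun f g h => by
    change juxt (juxt f g) h ≫ (eqToIso _).hom = (eqToIso _).hom ≫ juxt f (juxt g h)
    rw [juxt_assoc]
    simp)
  (leftUnitor_naturality := fun f => by
    change juxt (𝟙 (AWeb.mk [])) f ≫ 𝟙 _ = 𝟙 _ ≫ f
    rw [unit_juxt, Category.comp_id, Category.id_comp])
  (rightUnitor_naturality := fun f => by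
    change juxt f (𝟙 (AWeb.mk [])) ≫ (eqToIso _).hom = (eqToIso _).hom ≫ f
    rw [juxt_unit]
    simp)
  (pentagon := fun _ _ _ _ => IsEqToHom.eq
    (.comp (.juxt (isEqToHom_associator _ _ _) (isEqToHom_id _))
      (.comp (isEqToHom_associator _ _ _) (.juxt (isEqToHom_id _) (isEqToHom_associator _ _ _))))
    (.comp (isEqToHom_associator _ _ _) (isEqToHom_associator _ _ _)))
  (triangle := fun _ _ => IsEqToHom.eq
    (.comp (isEqToHom_associator _ _ _) (.juxt (isEqToHom_id _) (isEqToHom_id _)))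
    (.juxt (isEqToHom_rightUnitor _) (isEqToHom_id _)))

instance instBiadditiveAction : BiadditiveAction AWeb AWeb where
  add_left := by
    rintro X Y ⟨f⟩ ⟨g⟩ Z
    exact Quotient.sound (Pre.Rel.add_tensor f g (.id Z.word))
  add_right := by
    rintro Z X Y ⟨f⟩ ⟨g⟩
    exact Quotient.sound (Pre.Rel.tensor_add (.id Z.word) f g)

end AWeb

namespace AddClosure

section Reindex
variable {D : Type*} [Category.{0} D] [Preadditive D]

open Classical in
/-- The matrix with exactly one entry `φ i` in row `i`, placed in column `e i`. -/
def single {M N : Mat_ D} (e : M.ι → N.ι) (φ : ∀ i, M.X i ⟶ N.X (e i)) : M ⟶ N :=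
  fun i j => if h : e i = j then φ i ≫ eqToHom (congrArg N.X h) else 0

lemma single_comp_apply {M N K : Mat_ D} (e : M.ι → N.ι) (φ : ∀ i, M.X i ⟶ N.X (e i))
    (g : N ⟶ K) (i : M.ι) (k : K.ι) : (single e φ ≫ g) i k = φ i ≫ g (e i) k := by
  classical
  rw [Mat_.comp_apply, Finset.sum_eq_single (e i)]
  · simp [single]
  · intro j _ hj
    simp [single, hj.symm]
  · simp

lemma single_apply_self {M N : Mat_ D} (e : M.ι → N.ι) (φ : ∀ i, M.X i ⟶ N.X (e i)) (i : M.ι) :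
    single e φ i (e i) = φ i := by
  simp [single]

lemma comp_single_apply {M N K : Mat_ D} (f : M ⟶ N) (e : N.ι ≃ K.ι)
    (φ : ∀ i, N.X i ⟶ K.X (e i)) (i : M.ι) (j : N.ι) :
    (f ≫ single e φ) i (e j) = f i j ≫ φ j := by
  classical
  rw [Mat_.comp_apply, Finset.sum_eq_single j]
  · simp [single]
  · intro k _ hk
    simp [single, hk]
  · simp

lemma hom_ext_equiv {M N : Mat_ D} {ι : Type} (e : ι ≃ N.ι) {f g : M ⟶ N}
    (h : ∀ i j, f i (e j) = g i (e j)) : f = g := by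
  ext i j
  obtain ⟨j, rfl⟩ := e.surjective j
  exact h i j

lemma single_comp_single {M N K : Mat_ D} (e : M.ι → N.ι) (φ : ∀ i, M.X i ⟶ N.X (e i))
    (e' : N.ι → K.ι) (ψ : ∀ i, N.X i ⟶ K.X (e' i)) :
    single e φ ≫ single e' ψ = single (fun i => e' (e i)) (fun i => φ i ≫ ψ (e i)) := by
  ext i k
  rw [single_comp_apply]
  by_cases h : e' (e i) = k <;> simp [single, h]

lemma single_id (M : Mat_ D) : single (M := M) (N := M) (fun i => i) (fun i => 𝟙 (M.X i)) = 𝟙 M := by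
  ext i j
  by_cases h : i = j
  · subst h; simp [single]
  · simp [single, h]

/-- The isomorphism of formal direct sums given by a bijection of the index sets and isomorphisms
of the summands. -/
def reindex {M N : Mat_ D} (e : M.ι ≃ N.ι) (φ : ∀ i, M.X i ≅ N.X (e i)) : M ≅ N where
  hom := single e fun i => (φ i).hom
  inv := single e.symm fun j =>
    eqToHom (congrArg N.X (e.apply_symm_apply j).symm) ≫ (φ (e.symm j)).inv
  hom_inv_id := by
    ext i j
    rw [single_comp_apply]
    by_cases h : i = j
    · subst h
      have key : ∀ k (hk : k = i) (p : N.X (e i) = N.X (e k)) (q : M.X k = M.X i),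
          (φ i).hom ≫ (eqToHom p ≫ (φ k).inv) ≫ eqToHom q = 𝟙 _ := by
        rintro k rfl p q
        simp
      simp only [single, Equiv.symm_apply_apply, dite_true, Mat_.id_apply_self]
      exact key _ (by simp) _ _
    · simp [single, h]
  inv_hom_id := by
    ext i j
    rw [single_comp_apply]
    by_cases h : i = j
    · subst h
      simp [single]
    · simp [single, h]

end Reindex

section Act
variable {C D : Type*} [Category.{0} C] [Category.{0} D] [Preadditive C] [Preadditive D]
  [MonoidalCategory C] [MonoidalLeftAction C D]

/-- `(⨁ X_i) ⊙ (⨁ Y_j) = ⨁ (X_i ⊙ Y_j)`. -/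
def actObj (M : Mat_ C) (N : Mat_ D) : Mat_ D := ⟨M.ι × N.ι, fun p => M.X p.1 ⊙ₗ N.X p.2⟩

/-- The Kronecker product of matrices of morphisms. -/
def actHom {M M' : Mat_ C} {N N' : Mat_ D} (f : M ⟶ M') (g : N ⟶ N') :
    actObj M N ⟶ actObj M' N' := fun p r => f p.1 r.1 ⊙ₗₘ g p.2 r.2

variable [BiadditiveAction C D]

lemma zero_actionHom {c c' : C} {d d' : D} (g : d ⟶ d') : (0 : c ⟶ c') ⊙ₗₘ g = 0 := by
  have h := BiadditiveAction.add_left (0 : c ⟶ c') 0 d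
  rw [add_zero, left_eq_add] at h
  rw [MonoidalLeftAction.actionHom_def, h, Limits.zero_comp]

lemma actionHom_zero {c c' : C} {d d' : D} (f : c ⟶ c') : f ⊙ₗₘ (0 : d ⟶ d') = 0 := by
  have h := BiadditiveAction.add_right c' (0 : d ⟶ d') 0
  rw [add_zero, left_eq_add] at h
  rw [MonoidalLeftAction.actionHom_def, h, Limits.comp_zero]

lemma add_actionHom {c c' : C} {d d' : D} (f f' : c ⟶ c') (g : d ⟶ d') :
    (f + f') ⊙ₗₘ g = f ⊙ₗₘ g + f' ⊙ₗₘ g := by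
  simp [MonoidalLeftAction.actionHom_def, BiadditiveAction.add_left]

lemma actionHom_add {c c' : C} {d d' : D} (f : c ⟶ c') (g g' : d ⟶ d') :
    f ⊙ₗₘ (g + g') = f ⊙ₗₘ g + f ⊙ₗₘ g' := by
  simp [MonoidalLeftAction.actionHom_def, BiadditiveAction.add_right]

lemma sum_actionHom {ι : Type*} (s : Finset ι) {c c' : C} {d d' : D} (f : ι → (c ⟶ c'))
    (g : d ⟶ d') : (∑ i ∈ s, f i) ⊙ₗₘ g = ∑ i ∈ s, f i ⊙ₗₘ g :=
  map_sum (AddMonoidHom.mk' (fun f : c ⟶ c' => f ⊙ₗₘ g) fun f f' =>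
    add_actionHom f f' g) f s

lemma actionHom_sum {ι : Type*} (s : Finset ι) {c c' : C} {d d' : D} (f : c ⟶ c')
    (g : ι → (d ⟶ d')) : f ⊙ₗₘ (∑ i ∈ s, g i) = ∑ i ∈ s, f ⊙ₗₘ g i :=
  map_sum (AddMonoidHom.mk' (fun g : d ⟶ d' => f ⊙ₗₘ g) fun g g' =>
    actionHom_add f g g') g s

lemma actHom_single {M M' : Mat_ C} {N N' : Mat_ D}
    (e : M.ι → M'.ι) (φ : ∀ i, M.X i ⟶ M'.X (e i))
    (e' : N.ι → N'.ι) (ψ : ∀ i, N.X i ⟶ N'.X (e' i)) :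
    actHom (single e φ) (single e' ψ) =
      single (M := actObj M N) (N := actObj M' N') (fun p => (e p.1, e' p.2))
        (fun p => φ p.1 ⊙ₗₘ ψ p.2) := by
  ext ⟨i, j⟩ ⟨k, l⟩
  by_cases h : e i = k
  · by_cases h' : e' j = l
    · subst h h'
      simp [actHom, single, actObj]
    · simp only [actHom, single, h', dite_false, actionHom_zero]
      refine Eq.symm (dif_neg ?_)
      exact fun hh => h' (congrArg Prod.snd (show (e i, e' j) = (k, l) from hh))
  · simp only [actHom, single, h, dite_false, zero_actionHom]
    refine Eq.symm (dif_neg ?_)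
    exact fun hh => h (congrArg Prod.fst (show (e i, e' j) = (k, l) from hh))

lemma actHom_id (M : Mat_ C) (N : Mat_ D) : actHom (𝟙 M) (𝟙 N) = 𝟙 (actObj M N) := by
  rw [← single_id M, ← single_id N, actHom_single, ← single_id]
  congr 1
  funext p
  simp
  rfl

lemma actHom_comp {M M' M'' : Mat_ C} {N N' N'' : Mat_ D} (f : M ⟶ M') (f' : M' ⟶ M'')
    (g : N ⟶ N') (g' : N' ⟶ N'') :
    actHom (f ≫ f') (g ≫ g') = actHom f g ≫ actHom f' g' := by
  ext p r
  rw [Mat_.comp_apply]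
  change (_ ⊙ₗₘ _) = ∑ s : M'.ι × N'.ι, (f p.1 s.1 ⊙ₗₘ g p.2 s.2) ≫ (f' s.1 r.1 ⊙ₗₘ g' s.2 r.2)
  rw [Mat_.comp_apply, Mat_.comp_apply, sum_actionHom, Fintype.sum_prod_type]
  simp only [actionHom_sum, MonoidalLeftAction.actionHom_comp]

/-- `(L ⊗ M) ⊙ N ≅ L ⊙ (M ⊙ N)` for formal direct sums. -/
def actAssoc [BiadditiveAction C C] (L M : Mat_ C) (N : Mat_ D) :
    actObj (actObj L M) N ≅ actObj L (actObj M N) :=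
  reindex (M := actObj (actObj L M) N) (N := actObj L (actObj M N))
    (Equiv.prodAssoc L.ι M.ι N.ι) fun p => αₗ (L.X p.1.1) (M.X p.1.2) (N.X p.2)

/-- The one-term sum on the unit object. -/
def unitObj (C : Type*) [Category.{0} C] [Preadditive C] [MonoidalCategory C] : Mat_ C :=
  ⟨PUnit, fun _ => 𝟙_ C⟩

/-- `𝟙 ⊙ N ≅ N` for formal direct sums. -/
def actUnit (N : Mat_ D) : actObj (unitObj C) N ≅ N :=
  reindex (M := actObj (unitObj C) N) (N := N) (Equiv.punitProd N.ι) fun p => λₗ (N.X p.2)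

end Act

section Monoidal
variable {C D : Type*} [Category.{0} C] [Preadditive C] [MonoidalCategory C]
  [Category.{0} D] [Preadditive D] [MonoidalLeftAction C D]
  [BiadditiveAction C C] [BiadditiveAction C D]

lemma actAssoc_naturality {L L' M M' : Mat_ C} {N N' : Mat_ D}
    (f : L ⟶ L') (g : M ⟶ M') (h : N ⟶ N') :
    actHom (actHom f g) h ≫ (actAssoc L' M' N').hom =
      (actAssoc L M N).hom ≫ actHom f (actHom g h) := by
  refine hom_ext_equiv (N := actObj L' (actObj M' N')) (Equiv.prodAssoc L'.ι M'.ι N'.ι) ?_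
  rintro ⟨⟨i, j⟩, k⟩ ⟨⟨i', j'⟩, k'⟩
  erw [comp_single_apply, single_comp_apply]
  exact MonoidalLeftAction.actionAssocIso_hom_naturality (f i i') (g j j') (h k k')

lemma actUnit_naturality {N N' : Mat_ D} (g : N ⟶ N') :
    (actUnit (C := C) N).hom ≫ g = actHom (𝟙 (unitObj C)) g ≫ (actUnit N').hom := by
  refine hom_ext_equiv (Equiv.punitProd N'.ι) ?_
  rintro ⟨⟨⟩, j⟩ ⟨⟨⟩, j'⟩
  erw [comp_single_apply, single_comp_apply]
  have e : (𝟙 (unitObj C) : unitObj C ⟶ unitObj C) PUnit.unit PUnit.unit = 𝟙 (𝟙_ C) :=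
    Mat_.id_apply_self _ _
  have key := MonoidalLeftAction.actionUnitIso_hom_naturality (C := C) (g j j')
  rw [← MonoidalLeftAction.id_actionHom] at key
  simp only [actHom]
  rw [e]
  exact key

lemma actAssoc_pentagon (K L M : Mat_ C) (N : Mat_ D) :
    actHom (actAssoc K L M).hom (𝟙 N) ≫ (actAssoc K (actObj L M) N).hom ≫
      actHom (𝟙 K) (actAssoc L M N).hom =
    (actAssoc (actObj K L) M N).hom ≫ (actAssoc K L (actObj M N)).hom := by
  simp only [actAssoc, reindex]
  rw [← single_id K, ← single_id N, actHom_single, actHom_single]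
  erw [single_comp_single, single_comp_single, single_comp_single]
  congr 1
  funext p
  have := MonoidalLeftAction.associator_actionHom (K.X p.1.1.1) (L.X p.1.1.2) (M.X p.1.2) (N.X p.2)
  simp only [MonoidalLeftAction.actionHom_id, MonoidalLeftAction.id_actionHom]
  exact this

instance instMonoidalCategoryStruct : MonoidalCategoryStruct (Mat_ C) where
  tensorObj := actObj
  tensorHom := actHom
  whiskerLeft M _ _ f := actHom (𝟙 M) f
  whiskerRight f M := actHom f (𝟙 M)
  tensorUnit := unitObj C
  associator := actAssoc
  leftUnitor := actUnit
  rightUnitor M := reindex (M := actObj M (unitObj C)) (N := M) (Equiv.prodPUnit M.ι)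
    fun p => ρ_ (M.X p.1)

lemma rightUnitor_naturality {M N : Mat_ C} (f : M ⟶ N) :
    actHom f (𝟙 (unitObj C)) ≫ (ρ_ N).hom = (ρ_ M).hom ≫ f := by
  refine hom_ext_equiv (Equiv.prodPUnit N.ι) ?_
  rintro ⟨i, ⟨⟩⟩ ⟨j, ⟨⟩⟩
  erw [comp_single_apply, single_comp_apply]
  have e : (𝟙 (unitObj C) : unitObj C ⟶ unitObj C) PUnit.unit PUnit.unit = 𝟙 (𝟙_ C) :=
    Mat_.id_apply_self _ _
  have key := MonoidalCategory.rightUnitor_naturality (f i j)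
  rw [← MonoidalCategory.tensorHom_id] at key
  simp only [actHom]
  rw [e]
  exact key

lemma act_triangle (L : Mat_ C) (N : Mat_ D) :
    (actAssoc L (𝟙_ (Mat_ C)) N).hom ≫ actHom (𝟙 L) (actUnit N).hom =
      actHom (ρ_ L).hom (𝟙 N) := by
  simp only [actAssoc, actUnit, reindex, MonoidalCategoryStruct.rightUnitor]
  rw [← single_id L, ← single_id N, actHom_single, actHom_single]
  erw [single_comp_single]
  congr 1
  funext p
  have := MonoidalLeftAction.rightUnitor_actionHom (L.X p.1.1) (N.X p.2)
  simp only [MonoidalLeftAction.actionHom_id, MonoidalLeftAction.id_actionHom]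
  exact this.symm

lemma act_leftUnitor (L : Mat_ C) (N : Mat_ D) :
    actHom (λ_ L).hom (𝟙 N) = (actAssoc (𝟙_ (Mat_ C)) L N).hom ≫ (actUnit (actObj L N)).hom := by
  simp only [actAssoc, actUnit, reindex, MonoidalCategoryStruct.leftUnitor]
  rw [← single_id N, actHom_single]
  erw [single_comp_single]
  congr 1
  funext p
  have := MonoidalLeftAction.leftUnitor_actionHom (L.X p.1.2) (N.X p.2)
  simp only [MonoidalLeftAction.actionHom_id]
  exact this

instance instMonoidalCategory : MonoidalCategory (Mat_ C) := MonoidalCategory.ofTensorHom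
  (id_tensorHom_id := actHom_id)
  (id_tensorHom := fun _ _ _ _ => rfl)
  (tensorHom_id := fun _ _ => rfl)
  (tensorHom_comp_tensorHom := fun f g f' g' => (actHom_comp f f' g g').symm)
  (associator_naturality := actAssoc_naturality)
  (leftUnitor_naturality := fun g => (actUnit_naturality g).symm)
  (rightUnitor_naturality := rightUnitor_naturality)
  (pentagon := actAssoc_pentagon)
  (triangle := act_triangle)

instance instMonoidalLeftAction : MonoidalLeftAction (Mat_ C) (Mat_ D) where
  actionObj := actObj
  actionHom := actHom
  actionHomLeft f N := actHom f (𝟙 N)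
  actionHomRight M _ _ g := actHom (𝟙 M) g
  actionAssocIso := actAssoc
  actionUnitIso := actUnit
  actionHom_def f g := by rw [← actHom_comp, Category.comp_id, Category.id_comp]
  actionHomRight_id := actHom_id
  id_actionHomLeft := actHom_id
  actionHom_comp := actHom_comp
  actionAssocIso_hom_naturality := actAssoc_naturality
  actionUnitIso_hom_naturality := actUnit_naturality
  whiskerLeft_actionHomLeft c c' c'' f d := by
    have := actAssoc_naturality (𝟙 c) f (𝟙 d)
    rw [← Category.assoc, Iso.eq_comp_inv]
    exact this
  whiskerRight_actionHomLeft c f d := by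
    have := actAssoc_naturality f (𝟙 c) (𝟙 d)
    rw [← Category.assoc, Iso.eq_comp_inv, ← actHom_id]
    exact this
  associator_actionHom := actAssoc_pentagon
  leftUnitor_actionHom := act_leftUnitor
  rightUnitor_actionHom c d := (act_triangle c d).symm

instance instBiadditiveAction : BiadditiveAction (Mat_ C) (Mat_ D) where
  add_left f g d := by
    ext p r
    exact add_actionHom (f p.1 r.1) (g p.1 r.1) _
  add_right d _ _ f g := by
    ext p r
    exact actionHom_add _ (f p.2 r.2) (g p.2 r.2)

/-- `X ↦ X` as a one-term sum is compatible with the actions. -/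
def embAct (X : C) (Y : D) :
    (Mat_.embedding C).obj X ⊙ₗ (Mat_.embedding D).obj Y ≅ (Mat_.embedding D).obj (X ⊙ₗ Y) :=
  reindex (M := actObj ((Mat_.embedding C).obj X) ((Mat_.embedding D).obj Y))
    (N := (Mat_.embedding D).obj (X ⊙ₗ Y)) (Equiv.punitProd PUnit) fun _ => Iso.refl _

lemma embAct_naturality {X X' : C} {Y Y' : D} (f : X ⟶ X') (g : Y ⟶ Y') :
    actHom ((Mat_.embedding C).map f) ((Mat_.embedding D).map g) ≫ (embAct X' Y').hom =
      (embAct X Y).hom ≫ (Mat_.embedding D).map (f ⊙ₗₘ g) := by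
  refine hom_ext_equiv (Equiv.punitProd PUnit) ?_
  rintro ⟨⟨⟩, ⟨⟩⟩ ⟨⟨⟩, ⟨⟩⟩
  erw [comp_single_apply, single_comp_apply]
  exact (Category.comp_id _).trans (Category.id_comp _).symm

lemma embAct_assoc (X Y : C) (Z : D) :
    actHom (embAct X Y).hom (𝟙 ((Mat_.embedding D).obj Z)) ≫ (embAct (X ⊗ Y) Z).hom ≫
        (Mat_.embedding D).map (αₗ X Y Z).hom =
      (actAssoc _ _ _).hom ≫ actHom (𝟙 ((Mat_.embedding C).obj X)) (embAct Y Z).hom ≫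
        (embAct X (Y ⊙ₗ Z)).hom := by
  simp only [embAct, actAssoc, reindex]
  rw [← single_id ((Mat_.embedding C).obj X), ← single_id ((Mat_.embedding D).obj Z),
    actHom_single, actHom_single]
  refine funext fun p => funext fun r => ?_
  erw [single_comp_apply, single_comp_apply, single_comp_apply, single_comp_apply]
  obtain ⟨⟨⟨⟩, ⟨⟩⟩, ⟨⟩⟩ := p
  obtain ⟨⟩ := r
  refine Eq.trans (b := (αₗ X Y Z).hom) ?_ ?_
  · change (𝟙 (X ⊗ Y) ⊙ₗₘ 𝟙 Z) ≫ 𝟙 _ ≫ (αₗ X Y Z).hom = _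
    simp
  · refine Eq.symm (Eq.trans (congrArg (fun t => (αₗ X Y Z).hom ≫ (𝟙 X ⊙ₗₘ 𝟙 (Y ⊙ₗ Z)) ≫ t)
      (single_apply_self (M := actObj ((Mat_.embedding C).obj X)
        ((Mat_.embedding D).obj (Y ⊙ₗ Z))) (N := (Mat_.embedding D).obj (X ⊙ₗ Y ⊙ₗ Z))
        (Equiv.punitProd PUnit) (fun _ => 𝟙 (X ⊙ₗ Y ⊙ₗ Z)) (PUnit.unit, PUnit.unit))) ?_)
    exact (congrArg ((αₗ X Y Z).hom ≫ ·) (Category.comp_id _)).trans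
      ((congrArg ((αₗ X Y Z).hom ≫ ·) ((MonoidalLeftAction.actionHom_id _ _).trans
        (MonoidalLeftAction.id_actionHomLeft _ _))).trans (Category.comp_id _))

/-- The inclusion of a monoidal category into its additive closure is monoidal. -/
instance embeddingMonoidal : (Mat_.embedding C).Monoidal :=
  Functor.CoreMonoidal.toMonoidal
    { εIso := Iso.refl _
      μIso := fun X Y => embAct (C := C) (D := C) X Y
      μIso_hom_natural_left := fun f Y => by
        have := embAct_naturality (D := C) f (𝟙 Y)
        rw [CategoryTheory.Functor.map_id, MonoidalLeftAction.actionHom_id] at this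
        exact this
      μIso_hom_natural_right := fun X f => by
        have := embAct_naturality (D := C) (𝟙 X) f
        rw [CategoryTheory.Functor.map_id, MonoidalLeftAction.id_actionHom] at this
        exact this
      associativity := fun X Y Z => embAct_assoc X Y Z
      left_unitality := fun X => by
        change (actUnit _).hom = actHom (𝟙 _) (𝟙 _) ≫ (embAct (𝟙_ C) X).hom ≫ _
        rw [actHom_id, Category.id_comp]
        refine hom_ext_equiv (N := (Mat_.embedding C).obj X) (Equiv.punitProd PUnit) ?_
        rintro ⟨⟨⟩, ⟨⟩⟩ ⟨⟨⟩, ⟨⟩⟩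
        erw [single_comp_apply]
        exact (single_apply_self (M := actObj (unitObj C) ((Mat_.embedding C).obj X))
          (N := (Mat_.embedding C).obj X) (Equiv.punitProd PUnit)
          (fun _ => (λ_ X).hom) (PUnit.unit, PUnit.unit)).trans (Category.id_comp _).symm
      right_unitality := fun X => by
        change _ = actHom (𝟙 _) (𝟙 _) ≫ (embAct X (𝟙_ C)).hom ≫ _
        rw [actHom_id, Category.id_comp]
        refine hom_ext_equiv (N := (Mat_.embedding C).obj X) (Equiv.punitProd PUnit) ?_
        rintro ⟨⟨⟩, ⟨⟩⟩ ⟨⟨⟩, ⟨⟩⟩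
        erw [single_comp_apply]
        exact (single_apply_self (M := actObj ((Mat_.embedding C).obj X) (unitObj C))
          (N := (Mat_.embedding C).obj X) (Equiv.prodPUnit PUnit)
          (fun _ => (ρ_ X).hom) (PUnit.unit, PUnit.unit)).trans (Category.id_comp _).symm }

end Monoidal

section LinearMat
variable (K : Type*) [Field K] {D : Type*} [Category.{0} D] [Preadditive D] [Linear K D]

instance instLinear : Linear K (Mat_ D) where
  homModule M N := inferInstanceAs (Module K (∀ i j, M.X i ⟶ N.X j))
  smul_comp L M N a f g := by
    ext i j
    change ∑ k, (a • f i k) ≫ g k j = a • ∑ k, f i k ≫ g k j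
    simp [Finset.smul_sum]
  comp_smul L M N f a g := by
    ext i j
    change ∑ k, f i k ≫ (a • g k j) = a • ∑ k, f i k ≫ g k j
    simp [Finset.smul_sum]

end LinearMat
end AddClosure

section ModWeb
variable {C : Type} [Category.{0} C] [Preadditive C] [Linear Kq C] [MonoidalCategory C]

/-- Formal expressions for morphisms of the free left module category over `C` on one object `∅`
and on generating morphisms `Gen X Y` from `X ⊙ ∅` to `Y ⊙ ∅`. An object `X : C` stands for
`X ⊙ ∅`. -/
inductive ModPre (Gen : C → C → Type) : C → C → Type
  /-- `f ⊙ id_∅` -/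
  | of {X Y : C} (f : X ⟶ Y) : ModPre Gen X Y
  | gen {X Y : C} (g : Gen X Y) : ModPre Gen X Y
  /-- `id_X ⊙ f` -/
  | whisk (X : C) {Y Z : C} (f : ModPre Gen Y Z) : ModPre Gen (X ⊗ Y) (X ⊗ Z)
  | comp {X Y Z : C} (f : ModPre Gen X Y) (g : ModPre Gen Y Z) : ModPre Gen X Z
  | zero {X Y : C} : ModPre Gen X Y
  | add {X Y : C} (f g : ModPre Gen X Y) : ModPre Gen X Y
  | smul {X Y : C} (k : Kq) (f : ModPre Gen X Y) : ModPre Gen X Y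

variable (C) in
/-- Generating morphisms and relations for a left module category over `C` with one generating
object. -/
structure ModPresentation where
  /-- the generating morphisms `X ⊙ ∅ → Y ⊙ ∅` -/
  Gen : C → C → Type
  /-- the relations -/
  Rel : ∀ {X Y : C}, ModPre Gen X Y → ModPre Gen X Y → Prop

namespace ModPre

/-- The left ideal congruence generated by the relations of a presentation, together with the axioms
of a linear left module category. -/
inductive Rel (P : ModPresentation C) : ∀ {X Y : C}, ModPre P.Gen X Y → ModPre P.Gen X Y → Prop
  | rel {X Y} {f g : ModPre P.Gen X Y} : P.Rel f g → Rel P f g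
  | refl {X Y} (f : ModPre P.Gen X Y) : Rel P f f
  | symm {X Y} {f g : ModPre P.Gen X Y} : Rel P f g → Rel P g f
  | trans {X Y} {f g h : ModPre P.Gen X Y} : Rel P f g → Rel P g h → Rel P f h
  | comp_congr {X Y Z} {f f' : ModPre P.Gen X Y} {g g' : ModPre P.Gen Y Z} :
      Rel P f f' → Rel P g g' → Rel P (comp f g) (comp f' g')
  | whisk_congr (X) {Y Z} {f f' : ModPre P.Gen Y Z} :
      Rel P f f' → Rel P (whisk X f) (whisk X f')
  | add_congr {X Y} {f f' g g' : ModPre P.Gen X Y} :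
      Rel P f f' → Rel P g g' → Rel P (add f g) (add f' g')
  | smul_congr {X Y} (k : Kq) {f f' : ModPre P.Gen X Y} :
      Rel P f f' → Rel P (smul k f) (smul k f')
  -- category
  | id_comp {X Y} (f : ModPre P.Gen X Y) : Rel P (comp (of (𝟙 X)) f) f
  | comp_id {X Y} (f : ModPre P.Gen X Y) : Rel P (comp f (of (𝟙 Y))) f
  | comp_assoc {W X Y Z} (f : ModPre P.Gen W X) (g : ModPre P.Gen X Y) (h : ModPre P.Gen Y Z) :
      Rel P (comp (comp f g) h) (comp f (comp g h))
  -- vector space structure on morphisms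
  | add_assoc {X Y} (f g h : ModPre P.Gen X Y) : Rel P (add (add f g) h) (add f (add g h))
  | add_comm {X Y} (f g : ModPre P.Gen X Y) : Rel P (add f g) (add g f)
  | zero_add {X Y} (f : ModPre P.Gen X Y) : Rel P (add zero f) f
  | zero_smul {X Y} (f : ModPre P.Gen X Y) : Rel P (smul 0 f) zero
  | one_smul {X Y} (f : ModPre P.Gen X Y) : Rel P (smul 1 f) f
  | mul_smul {X Y} (k l : Kq) (f : ModPre P.Gen X Y) :
      Rel P (smul (k * l) f) (smul k (smul l f))
  | add_smul {X Y} (k l : Kq) (f : ModPre P.Gen X Y) :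
      Rel P (smul (k + l) f) (add (smul k f) (smul l f))
  | smul_add {X Y} (k : Kq) (f g : ModPre P.Gen X Y) :
      Rel P (smul k (add f g)) (add (smul k f) (smul k g))
  -- bilinearity of composition
  | add_comp {X Y Z} (f f' : ModPre P.Gen X Y) (g : ModPre P.Gen Y Z) :
      Rel P (comp (add f f') g) (add (comp f g) (comp f' g))
  | comp_add {X Y Z} (f : ModPre P.Gen X Y) (g g' : ModPre P.Gen Y Z) :
      Rel P (comp f (add g g')) (add (comp f g) (comp f g'))
  | smul_comp {X Y Z} (k : Kq) (f : ModPre P.Gen X Y) (g : ModPre P.Gen Y Z) :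
      Rel P (comp (smul k f) g) (smul k (comp f g))
  | comp_smul {X Y Z} (k : Kq) (f : ModPre P.Gen X Y) (g : ModPre P.Gen Y Z) :
      Rel P (comp f (smul k g)) (smul k (comp f g))
  -- `f ↦ f ⊙ id_∅` is a linear functor
  | of_comp {X Y Z : C} (f : X ⟶ Y) (g : Y ⟶ Z) : Rel P (of (f ≫ g)) (comp (of f) (of g))
  | of_add {X Y : C} (f g : X ⟶ Y) : Rel P (of (f + g)) (add (of f) (of g))
  | of_smul {X Y : C} (k : Kq) (f : X ⟶ Y) : Rel P (of (k • f)) (smul k (of f))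
  -- bilinear left action of `C`
  | whisk_of (X : C) {Y Z : C} (f : Y ⟶ Z) : Rel P (whisk X (of f)) (of (X ◁ f))
  | whisk_comp (W : C) {X Y Z} (f : ModPre P.Gen X Y) (g : ModPre P.Gen Y Z) :
      Rel P (whisk W (comp f g)) (comp (whisk W f) (whisk W g))
  | whisk_add (W : C) {X Y} (f g : ModPre P.Gen X Y) :
      Rel P (whisk W (add f g)) (add (whisk W f) (whisk W g))
  | whisk_smul (W : C) {X Y} (k : Kq) (f : ModPre P.Gen X Y) :
      Rel P (whisk W (smul k f)) (smul k (whisk W f))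
  | exchange {W X : C} {Y Z} (f : W ⟶ X) (g : ModPre P.Gen Y Z) :
      Rel P (comp (of (f ▷ Y)) (whisk X g)) (comp (whisk W g) (of (f ▷ Z)))
  | unit_whisk {X Y} (f : ModPre P.Gen X Y) :
      Rel P (comp (whisk (𝟙_ C) f) (of (λ_ Y).hom)) (comp (of (λ_ X).hom) f)
  | tensor_whisk (W X : C) {Y Z} (f : ModPre P.Gen Y Z) :
      Rel P (comp (whisk (W ⊗ X) f) (of (α_ W X Z).hom))
        (comp (of (α_ W X Y).hom) (whisk W (whisk X f)))

/-- Formal morphisms up to the relations. -/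
def setoid (P : ModPresentation C) (X Y : C) : Setoid (ModPre P.Gen X Y) :=
  ⟨Rel P, Rel.refl, Rel.symm, Rel.trans⟩

end ModPre

/-- The left `C`-module category generated by one object `∅` and a presentation `P` (before passing
to the additive closure). Its objects are `X ⊙ ∅` for `X : C`. -/
structure ModWeb (P : ModPresentation C) where
  /-- the object `X` of `X ⊙ ∅` -/
  obj : C

namespace ModWeb
variable {P : ModPresentation C}

instance instCategory : Category (ModWeb P) where
  Hom X Y := Quotient (ModPre.setoid P X.obj Y.obj)
  id X := Quotient.mk _ (.of (𝟙 X.obj))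
  comp {X Y Z} := Quotient.map₂ (sa := ModPre.setoid _ _ _) (sb := ModPre.setoid _ _ _)
    (sc := ModPre.setoid P X.obj Z.obj) ModPre.comp fun _ _ h _ _ h' => .comp_congr h h'
  id_comp := by rintro X Y ⟨f⟩; exact Quotient.sound (.id_comp f)
  comp_id := by rintro X Y ⟨f⟩; exact Quotient.sound (.comp_id f)
  assoc := by rintro W X Y Z ⟨f⟩ ⟨g⟩ ⟨h⟩; exact Quotient.sound (.comp_assoc f g h)

/-- The morphism represented by a formal expression. -/
def mkHom {X Y : C} (f : ModPre P.Gen X Y) : ModWeb.mk (P := P) X ⟶ ModWeb.mk Y := Quotient.mk _ f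

instance instHomAdd (X Y : ModWeb P) : Add (X ⟶ Y) where
  add := Quotient.map₂ (sa := ModPre.setoid _ _ _) (sb := ModPre.setoid _ _ _)
    (sc := ModPre.setoid P X.obj Y.obj) ModPre.add fun _ _ h _ _ h' => .add_congr h h'

instance instHomZero (X Y : ModWeb P) : Zero (X ⟶ Y) where
  zero := Quotient.mk _ .zero

instance instHomSMul (X Y : ModWeb P) : SMul Kq (X ⟶ Y) where
  smul k := Quotient.map (sa := ModPre.setoid _ _ _) (sb := ModPre.setoid P X.obj Y.obj)
    (ModPre.smul k) fun _ _ h => .smul_congr _ h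

instance instHomNeg (X Y : ModWeb P) : Neg (X ⟶ Y) where
  neg f := (-1 : Kq) • f

instance instHomAddCommGroup (X Y : ModWeb P) : AddCommGroup (X ⟶ Y) where
  nsmul := nsmulRec
  zsmul := zsmulRec
  add_assoc := by rintro ⟨f⟩ ⟨g⟩ ⟨h⟩; exact Quotient.sound (.add_assoc f g h)
  add_comm := by rintro ⟨f⟩ ⟨g⟩; exact Quotient.sound (.add_comm f g)
  zero_add := by rintro ⟨f⟩; exact Quotient.sound (.zero_add f)
  add_zero := by rintro ⟨f⟩; exact Quotient.sound (.trans (.add_comm _ _) (.zero_add f))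
  neg_add_cancel := by
    rintro ⟨f⟩
    refine Quotient.sound (.trans (.add_congr (.refl _) (.symm (.one_smul f))) ?_)
    refine .trans (.symm (.add_smul _ _ f)) ?_
    rw [neg_add_cancel]
    exact .zero_smul f

instance instPreadditive : Preadditive (ModWeb P) where
  add_comp := by rintro X Y Z ⟨f⟩ ⟨f'⟩ ⟨g⟩; exact Quotient.sound (.add_comp f f' g)
  comp_add := by rintro X Y Z ⟨f⟩ ⟨g⟩ ⟨g'⟩; exact Quotient.sound (.comp_add f g g')

instance instLinear : Linear Kq (ModWeb P) where
  homModule X Y :=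
    { one_smul := by rintro ⟨f⟩; exact Quotient.sound (.one_smul f)
      mul_smul := by rintro k l ⟨f⟩; exact Quotient.sound (.mul_smul k l f)
      smul_zero := by
        intro k
        refine Quotient.sound (.trans (.smul_congr k (.symm (.zero_smul .zero))) ?_)
        refine .trans (.symm (.mul_smul k 0 _)) ?_
        rw [mul_zero]
        exact .zero_smul _
      smul_add := by rintro k ⟨f⟩ ⟨g⟩; exact Quotient.sound (.smul_add k f g)
      add_smul := by rintro k l ⟨f⟩; exact Quotient.sound (.add_smul k l f)
      zero_smul := by rintro ⟨f⟩; exact Quotient.sound (.zero_smul f) }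
  smul_comp := by rintro X Y Z k ⟨f⟩ ⟨g⟩; exact Quotient.sound (.smul_comp k f g)
  comp_smul := by rintro X Y Z ⟨f⟩ k ⟨g⟩; exact Quotient.sound (.comp_smul k f g)

/-- `f ⊙ id_∅`. -/
def inc {X Y : C} (f : X ⟶ Y) : ModWeb.mk (P := P) X ⟶ ModWeb.mk Y := mkHom (.of f)

lemma inc_id (X : C) : inc (P := P) (𝟙 X) = 𝟙 _ := rfl

lemma inc_comp {X Y Z : C} (f : X ⟶ Y) (g : Y ⟶ Z) : inc (P := P) (f ≫ g) = inc f ≫ inc g :=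
  Quotient.sound (.of_comp f g)

/-- An isomorphism `f ⊙ id_∅`. -/
def incIso {X Y : C} (f : X ≅ Y) : ModWeb.mk (P := P) X ≅ ModWeb.mk Y where
  hom := inc f.hom
  inv := inc f.inv
  hom_inv_id := by rw [← inc_comp, f.hom_inv_id, inc_id]
  inv_hom_id := by rw [← inc_comp, f.inv_hom_id, inc_id]

/-- `id_W ⊙ f`. -/
def whisk (W : C) {X Y : ModWeb P} (f : X ⟶ Y) : ModWeb.mk (P := P) (W ⊗ X.obj) ⟶ ModWeb.mk (W ⊗ Y.obj) :=
  Quotient.map (sa := ModPre.setoid P X.obj Y.obj) (sb := ModPre.setoid P (W ⊗ X.obj) (W ⊗ Y.obj))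
    (ModPre.whisk W) (fun _ _ h => .whisk_congr W h) f

lemma whisk_comp (W : C) {X Y Z : ModWeb P} (f : X ⟶ Y) (g : Y ⟶ Z) :
    whisk W (f ≫ g) = whisk W f ≫ whisk W g := by
  obtain ⟨f⟩ := f; obtain ⟨g⟩ := g
  exact Quotient.sound (.whisk_comp W f g)

lemma whisk_inc (W : C) {X Y : C} (f : X ⟶ Y) :
    whisk W (inc (P := P) f) = inc (P := P) (W ◁ f) := Quotient.sound (.whisk_of W f)

lemma whisk_id (W : C) (X : ModWeb P) : whisk W (𝟙 X) = 𝟙 _ := by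
  refine (whisk_inc W (𝟙 X.obj)).trans ?_
  rw [MonoidalCategory.whiskerLeft_id]; rfl

lemma exchange {W W' : C} {X Y : ModWeb P} (f : W ⟶ W') (g : X ⟶ Y) :
    inc (P := P) (f ▷ X.obj) ≫ whisk W' g = whisk W g ≫ inc (P := P) (f ▷ Y.obj) := by
  obtain ⟨g⟩ := g
  exact Quotient.sound (.exchange f g)

lemma unit_whisk {X Y : ModWeb P} (f : X ⟶ Y) :
    whisk (𝟙_ C) f ≫ inc (P := P) (λ_ Y.obj).hom = inc (P := P) (λ_ X.obj).hom ≫ f := by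
  obtain ⟨f⟩ := f
  exact Quotient.sound (.unit_whisk f)

lemma tensor_whisk (W W' : C) {X Y : ModWeb P} (f : X ⟶ Y) :
    whisk (W ⊗ W') f ≫ inc (P := P) (α_ W W' Y.obj).hom =
      inc (P := P) (α_ W W' X.obj).hom ≫ whisk W (whisk W' f) := by
  obtain ⟨f⟩ := f
  exact Quotient.sound (.tensor_whisk W W' f)

lemma whisk_add (W : C) {X Y : ModWeb P} (f g : X ⟶ Y) :
    whisk W (f + g) = whisk W f + whisk W g := by
  obtain ⟨f⟩ := f; obtain ⟨g⟩ := g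
  exact Quotient.sound (.whisk_add W f g)

lemma inc_add {X Y : C} (f g : X ⟶ Y) :
    inc (P := P) (f + g) = inc (P := P) f + inc (P := P) g := Quotient.sound (.of_add f g)

instance instMonoidalLeftActionStruct : MonoidalLeftActionStruct C (ModWeb P) where
  actionObj W X := ⟨W ⊗ X.obj⟩
  actionHomLeft f X := inc (P := P) (f ▷ X.obj)
  actionHomRight W _ _ f := whisk W f
  actionAssocIso W W' X := incIso (α_ W W' X.obj)
  actionUnitIso X := incIso (λ_ X.obj)

instance instMonoidalLeftAction : MonoidalLeftAction C (ModWeb P) where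
  actionHom_def _ _ := rfl
  actionHomRight_id := whisk_id
  id_actionHomLeft W X := by
    change inc (P := P) (𝟙 W ▷ X.obj) = _
    rw [id_whiskerRight]; rfl
  actionHom_comp {W W' W'' X X' X''} f f' g g' := by
    change inc (P := P) ((f ≫ f') ▷ X.obj) ≫ whisk W'' (g ≫ g') =
      (inc (P := P) (f ▷ X.obj) ≫ whisk W' g) ≫ inc (P := P) (f' ▷ X'.obj) ≫ whisk W'' g'
    rw [comp_whiskerRight, inc_comp, whisk_comp, Category.assoc, Category.assoc,
      ← Category.assoc (whisk W' g), ← exchange, Category.assoc]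
  actionAssocIso_hom_naturality {W₁ W₂ W₃ W₄ X₁ X₂} f g h := by
    change (inc (P := P) ((f ⊗ₘ g) ▷ X₁.obj) ≫ whisk (W₂ ⊗ W₄) h) ≫ inc (P := P) (α_ W₂ W₄ X₂.obj).hom =
      inc (P := P) (α_ W₁ W₃ X₁.obj).hom ≫ inc (P := P) (f ▷ (W₃ ⊗ X₁.obj)) ≫
        whisk W₂ (inc (P := P) (g ▷ X₁.obj) ≫ whisk W₄ h)
    rw [Category.assoc, tensor_whisk, whisk_comp, whisk_inc]
    simp only [← Category.assoc, ← inc_comp]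
    congr 2
    simp [MonoidalCategory.tensorHom_def]
  actionUnitIso_hom_naturality f := (unit_whisk f).symm
  whiskerLeft_actionHomLeft W W' W'' f X := by
    change inc (P := P) ((W ◁ f) ▷ X.obj) = inc (P := P) (α_ W W' X.obj).hom ≫
      whisk W (inc (P := P) (f ▷ X.obj)) ≫ inc (P := P) (α_ W W'' X.obj).inv
    rw [whisk_inc, ← inc_comp, ← inc_comp]
    congr 1
    simp
  whiskerRight_actionHomLeft {W W'} W'' f X := by
    change inc (P := P) ((f ▷ W'') ▷ X.obj) = inc (P := P) (α_ W W'' X.obj).hom ≫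
      inc (P := P) (f ▷ (W'' ⊗ X.obj)) ≫ inc (P := P) (α_ W' W'' X.obj).inv
    rw [← inc_comp, ← inc_comp]
    congr 1
    simp
  associator_actionHom W₁ W₂ W₃ X := by
    change inc (P := P) ((α_ W₁ W₂ W₃).hom ▷ X.obj) ≫ inc (P := P) (α_ W₁ (W₂ ⊗ W₃) X.obj).hom ≫
      whisk W₁ (inc (P := P) (α_ W₂ W₃ X.obj).hom) =
      inc (P := P) (α_ (W₁ ⊗ W₂) W₃ X.obj).hom ≫ inc (P := P) (α_ W₁ W₂ (W₃ ⊗ X.obj)).hom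
    rw [whisk_inc, ← inc_comp, ← inc_comp, ← inc_comp, pentagon]
  leftUnitor_actionHom W X := by
    change inc (P := P) ((λ_ W).hom ▷ X.obj) =
      inc (P := P) (α_ (𝟙_ C) W X.obj).hom ≫ inc (P := P) (λ_ (W ⊗ X.obj)).hom
    rw [← inc_comp]
    congr 1
    simp
  rightUnitor_actionHom W X := by
    change inc (P := P) ((ρ_ W).hom ▷ X.obj) =
      inc (P := P) (α_ W (𝟙_ C) X.obj).hom ≫ whisk W (inc (P := P) (λ_ X.obj).hom)
    rw [whisk_inc, ← inc_comp, triangle]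

instance instBiadditiveAction [BiadditiveAction C C] : BiadditiveAction C (ModWeb P) where
  add_left f g X := by
    change inc (P := P) ((f + g) ▷ X.obj) = inc (P := P) (f ▷ X.obj) + inc (P := P) (g ▷ X.obj)
    rw [← inc_add]
    exact congrArg _ (BiadditiveAction.add_left (D := C) f g X.obj)
  add_right W _ _ f g := whisk_add W f g

end ModWeb
end ModWeb

namespace AWeb.Pre

/-- The crossing `-q⁻¹ id + ms` of two strands of thickness one. -/
def overCross : Pre [1, 1] [1, 1] := add (smul (-q⁻¹) (id [1, 1])) (ms 1 1)

/-- The inverse crossing `-q id + ms` of two strands of thickness one. -/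
def underCross : Pre [1, 1] [1, 1] := add (smul (-q) (id [1, 1])) (ms 1 1)

/-- A web on two thin strands applied to the first two of three thin strands. -/
def on₁₂ (f : Pre [1, 1] [1, 1]) : Pre [1, 1, 1] [1, 1, 1] := tensor f (id [1])

/-- A web on two thin strands applied to the first pair of adjacent strands among four. -/
def pos₁ (f : Pre [1, 1] [1, 1]) : Pre [1, 1, 1, 1] [1, 1, 1, 1] := tensor f (id [1, 1])

/-- A web on two thin strands applied to the middle pair of adjacent strands among four. -/
def pos₂ (f : Pre [1, 1] [1, 1]) : Pre [1, 1, 1, 1] [1, 1, 1, 1] :=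
  tensor (id [1]) (tensor f (id [1]))

/-- A web on two thin strands applied to the last pair of adjacent strands among four. -/
def pos₃ (f : Pre [1, 1] [1, 1]) : Pre [1, 1, 1, 1] [1, 1, 1, 1] := tensor (id [1, 1]) f

/-- Two webs on two thin strands, side by side. -/
def pos₁₃ (f g : Pre [1, 1] [1, 1]) : Pre [1, 1, 1, 1] [1, 1, 1, 1] := tensor f g

/-- The merge of two strands of thickness one. -/
def merge₁₁ : Pre [1, 1] [2] := merge 1 1 2 rfl

/-- The split into two strands of thickness one. -/
def split₁₁ : Pre [2] [1, 1] := split 1 1 2 rfl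

end AWeb.Pre

section WebPresentations
open ModPre
open AWeb.Pre (ms pos₁ pos₂ pos₃ pos₁₃ on₁₂ overCross underCross merge₁₁ split₁₁)

/-- The object of the category of webs given by a word. -/
abbrev wd (X : List ℕ+) : AWeb := ⟨X⟩

/-- An `A`-web acting on `∅`. -/
abbrev web {Gen : AWeb → AWeb → Type} {X Y : List ℕ+} (f : AWeb.Pre X Y) :
    ModPre Gen (wd X) (wd Y) := of (AWeb.of f)

/-- The merge-split sliding relations for morphisms `cup : ∅ → 1 ⊗ 1` and `cap : 1 ⊗ 1 → ∅`. -/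
inductive SlideRel {Gen : AWeb → AWeb → Type} (cup : ModPre Gen (wd []) (wd [1, 1]))
    (cap : ModPre Gen (wd [1, 1]) (wd [])) :
    ∀ {X Y : AWeb}, ModPre Gen X Y → ModPre Gen X Y → Prop
  | cap : SlideRel cup cap
      (comp (web (pos₁ (ms 1 1))) (comp (web (pos₂ (ms 1 1))) (comp (X := wd [1, 1, 1, 1]) (whisk (wd [1, 1]) cap) cap)))
      (comp (web (pos₃ (ms 1 1))) (comp (web (pos₂ (ms 1 1))) (comp (X := wd [1, 1, 1, 1]) (whisk (wd [1, 1]) cap) cap)))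
  | cup : SlideRel cup cap
      (comp (comp (Z := wd [1, 1, 1, 1]) cup (whisk (wd [1, 1]) cup)) (comp (web (pos₂ (ms 1 1))) (web (pos₁ (ms 1 1)))))
      (comp (comp (Z := wd [1, 1, 1, 1]) cup (whisk (wd [1, 1]) cup)) (comp (web (pos₂ (ms 1 1))) (web (pos₃ (ms 1 1)))))

/-- The generators of the cup-web category. -/
inductive CupGen : AWeb → AWeb → Type
  | cup : CupGen (wd []) (wd [1, 1])
  | cap : CupGen (wd [1, 1]) (wd [])

/-- The cup `∅ → 1 ⊗ 1`, as a formal expression. -/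
abbrev cup₀ : ModPre CupGen (wd []) (wd [1, 1]) := gen .cup

/-- The cap `1 ⊗ 1 → ∅`, as a formal expression. -/
abbrev cap₀ : ModPre CupGen (wd [1, 1]) (wd []) := gen .cap

/-- The relations of the cup-web category with parameter `z`. -/
inductive CupRel (z : Kq) : ∀ {X Y : AWeb}, ModPre CupGen X Y → ModPre CupGen X Y → Prop
  | circle : CupRel z (comp cup₀ cap₀) (smul (zqnum 1 z 0) (of (𝟙 (wd []))))
  | bubble : CupRel z
      (comp (X := wd [1]) (whisk (wd [1]) cup₀) (comp (X := wd [1, 1, 1]) (Z := wd [1])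
        (web (on₁₂ (ms 1 1))) (whisk (wd [1]) cap₀)))
      (smul (zqnum 1 z (-1)) (of (𝟙 (wd [1]))))
  | lasso : CupRel z
      (comp (X := wd [1, 1]) (whisk (wd [1, 1]) cup₀)
        (comp (X := wd [1, 1, 1, 1]) (Z := wd [1, 1]) (web (pos₂ underCross))
          (comp (web (pos₁₃ (ms 1 1) (ms 1 1)))
            (comp (web (pos₂ overCross)) (whisk (wd [1, 1]) cap₀)))))
      (add (comp cap₀ cup₀) (smul (zqnum 1 z (-2)) (of (𝟙 (wd [1, 1])))))
  | lollipop_cup : CupRel z (comp cup₀ (web merge₁₁)) zero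
  | lollipop_cap : CupRel z (comp (web split₁₁) cap₀) zero
  | slide {X Y : AWeb} {f g : ModPre CupGen X Y} : SlideRel cup₀ cap₀ f g → CupRel z f g

/-- The presentation of the cup-web category with parameter `z`. -/
def cupPresentation (z : Kq) : ModPresentation AWeb := ⟨CupGen, CupRel z⟩

/-- The generators of the dot-web category. -/
inductive DotGen : AWeb → AWeb → Type
  | startDot : DotGen (wd []) (wd [2])
  | endDot : DotGen (wd [2]) (wd [])

/-- The start dot `∅ → 2`, as a formal expression. -/
abbrev startDot₀ : ModPre DotGen (wd []) (wd [2]) := gen .startDot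

/-- The end dot `2 → ∅`, as a formal expression. -/
abbrev endDot₀ : ModPre DotGen (wd [2]) (wd []) := gen .endDot

/-- The relations of the dot-web category with parameter `z`. -/
inductive DotRel (z : Kq) : ∀ {X Y : AWeb}, ModPre DotGen X Y → ModPre DotGen X Y → Prop
  | barbell : DotRel z (comp startDot₀ endDot₀) (smul (zqnum 2 z 0) (of (𝟙 (wd []))))
  | thin_K : DotRel z
      (comp (X := wd [1]) (Y := wd [1, 2]) (Z := wd [1]) (whisk (wd [1]) startDot₀)
        (comp (web (ms 1 2)) (whisk (wd [1]) endDot₀)))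
      (smul (zqnum 2 z (-1)) (of (𝟙 (wd [1]))))
  | thick_K : DotRel z
      (comp (X := wd [2]) (Y := wd [2, 2]) (Z := wd [2]) (whisk (wd [2]) startDot₀)
        (comp (web (ms 2 2)) (whisk (wd [2]) endDot₀)))
      (add (comp endDot₀ startDot₀) (smul (zqnum 2 z (-2)) (of (𝟙 (wd [2])))))
  | slide {X Y : AWeb} {f g : ModPre DotGen X Y} :
      SlideRel (comp startDot₀ (web split₁₁)) (comp (web merge₁₁) endDot₀) f g →
        DotRel z f g

/-- The presentation of the dot-web category with parameter `z`. -/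
def dotPresentation (z : Kq) : ModPresentation AWeb := ⟨DotGen, DotRel z⟩

end WebPresentations

section QuantumGroup

/-- Generators `q^h` (`h` in the coweight lattice `ℤⁿ`), `E_i`, `F_i` (`i = 1, …, n - 1`) of the
quantum enveloping algebra of `gl_n`. -/
inductive UqGen (n : ℕ) : Type
  | qh (h : Fin n → ℤ)
  | E (i : Fin (n - 1))
  | F (i : Fin (n - 1))

/-- The index `i`, as an element of `{1, …, n}`. -/
def lo {n : ℕ} (i : Fin (n - 1)) : Fin n := ⟨i, by omega⟩

/-- The index `i + 1`, as an element of `{1, …, n}`. -/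
def hi {n : ℕ} (i : Fin (n - 1)) : Fin n := ⟨i + 1, by omega⟩

/-- The coweight `h_i = ε_i - ε_{i+1}`; one has `K_i = q^{h_i}`. -/
def coroot {n : ℕ} (i : Fin (n - 1)) : Fin n → ℤ := Pi.single (lo i) 1 - Pi.single (hi i) 1

/-- The pairing `⟨h, α_i⟩`. -/
def pair {n : ℕ} (h : Fin n → ℤ) (i : Fin (n - 1)) : ℤ := h (lo i) - h (hi i)

namespace UqGen
variable {n : ℕ}

/-- A generator in the free algebra. -/
abbrev fr (x : UqGen n) : FreeAlgebra Kq (UqGen n) := FreeAlgebra.ι Kq x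

/-- The defining relations of the quantum enveloping algebra of `gl_n`. -/
inductive Rel : FreeAlgebra Kq (UqGen n) → FreeAlgebra Kq (UqGen n) → Prop
  | qh_zero : Rel (fr (qh 0)) 1
  | qh_add (h h' : Fin n → ℤ) : Rel (fr (qh (h + h'))) (fr (qh h) * fr (qh h'))
  | qh_E (h : Fin n → ℤ) (i : Fin (n - 1)) :
      Rel (fr (qh h) * fr (E i)) (q ^ pair h i • (fr (E i) * fr (qh h)))
  | qh_F (h : Fin n → ℤ) (i : Fin (n - 1)) :
      Rel (fr (qh h) * fr (F i)) (q ^ (-pair h i) • (fr (F i) * fr (qh h)))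
  | E_F (i : Fin (n - 1)) :
      Rel (fr (E i) * fr (F i)) (fr (F i) * fr (E i) +
        (q - q⁻¹)⁻¹ • (fr (qh (coroot i)) - fr (qh (-coroot i))))
  | E_F_ne (i j : Fin (n - 1)) (h : i ≠ j) : Rel (fr (E i) * fr (F j)) (fr (F j) * fr (E i))
  | serre_E (i j : Fin (n - 1)) (h : (i : ℕ) + 1 = j ∨ (j : ℕ) + 1 = i) :
      Rel (fr (E i) * fr (E i) * fr (E j) + fr (E j) * fr (E i) * fr (E i))
        (qnum 2 • (fr (E i) * fr (E j) * fr (E i)))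
  | serre_F (i j : Fin (n - 1)) (h : (i : ℕ) + 1 = j ∨ (j : ℕ) + 1 = i) :
      Rel (fr (F i) * fr (F i) * fr (F j) + fr (F j) * fr (F i) * fr (F i))
        (qnum 2 • (fr (F i) * fr (F j) * fr (F i)))
  | E_E (i j : Fin (n - 1)) (h : (i : ℕ) + 1 < j) : Rel (fr (E i) * fr (E j)) (fr (E j) * fr (E i))
  | F_F (i j : Fin (n - 1)) (h : (i : ℕ) + 1 < j) : Rel (fr (F i) * fr (F j)) (fr (F j) * fr (F i))

end UqGen

/-- The quantum enveloping algebra `U_q(gl_n)` over `ℂ(q)`. -/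
def Uq (n : ℕ) : Type := RingQuot (UqGen.Rel (n := n))

namespace Uq
variable {n : ℕ}

instance instRing : Ring (Uq n) := inferInstanceAs (Ring (RingQuot UqGen.Rel))
instance instAlgebra : Algebra Kq (Uq n) := inferInstanceAs (Algebra Kq (RingQuot UqGen.Rel))

/-- The generators of `U_q(gl_n)`. -/
def gen (x : UqGen n) : Uq n := RingQuot.mkAlgHom Kq UqGen.Rel (FreeAlgebra.ι Kq x)

/-- The element `q^h`. -/
abbrev qh (h : Fin n → ℤ) : Uq n := gen (.qh h)

/-- The generator `E_i`. -/
abbrev E (i : Fin (n - 1)) : Uq n := gen (.E i)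

/-- The generator `F_i`. -/
abbrev F (i : Fin (n - 1)) : Uq n := gen (.F i)

/-- The universal property of the presentation, on a family of elements satisfying the relations. -/
structure Model (n : ℕ) (A : Type*) [Ring A] [Algebra Kq A] where
  (qh : (Fin n → ℤ) → A)
  (E F : Fin (n - 1) → A)
  qh_zero : qh 0 = 1
  qh_add : ∀ h h', qh (h + h') = qh h * qh h'
  qh_E : ∀ h i, qh h * E i = q ^ pair h i • (E i * qh h)
  qh_F : ∀ h i, qh h * F i = q ^ (-pair h i) • (F i * qh h)
  E_F : ∀ i, E i * F i = F i * E i + (q - q⁻¹)⁻¹ • (qh (coroot i) - qh (-coroot i))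
  E_F_ne : ∀ i j, i ≠ j → E i * F j = F j * E i
  serre_E : ∀ i j : Fin (n - 1), ((i : ℕ) + 1 = j ∨ (j : ℕ) + 1 = i) →
    E i * E i * E j + E j * E i * E i = qnum 2 • (E i * E j * E i)
  serre_F : ∀ i j : Fin (n - 1), ((i : ℕ) + 1 = j ∨ (j : ℕ) + 1 = i) →
    F i * F i * F j + F j * F i * F i = qnum 2 • (F i * F j * F i)
  E_E : ∀ i j : Fin (n - 1), (i : ℕ) + 1 < j → E i * E j = E j * E i
  F_F : ∀ i j : Fin (n - 1), (i : ℕ) + 1 < j → F i * F j = F j * F i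

/-- The tautological family of elements. -/
def tautModel (n : ℕ) : Model n (Uq n) := by
  have key : ∀ {x y}, UqGen.Rel x y → RingQuot.mkAlgHom Kq (UqGen.Rel (n := n)) x =
      RingQuot.mkAlgHom Kq (UqGen.Rel (n := n)) y := fun h => RingQuot.mkAlgHom_rel Kq h
  refine ⟨qh, E, F, ?_, ?_, ?_, ?_, ?_, ?_, ?_, ?_, ?_, ?_⟩
  · exact (key .qh_zero).trans (map_one _)
  · exact fun h h' => (key (.qh_add h h')).trans (map_mul _ _ _)
  · intro h i
    have := key (.qh_E h i)
    rwa [map_smul, map_mul, map_mul] at this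
  · intro h i
    have := key (.qh_F h i)
    rwa [map_smul, map_mul, map_mul] at this
  · intro i
    have := key (.E_F i)
    rwa [map_add, map_smul, map_mul, map_mul, map_sub] at this
  · intro i j h
    have := key (.E_F_ne i j h)
    rwa [map_mul, map_mul] at this
  · intro i j h
    have := key (.serre_E i j h)
    rwa [map_add, map_smul, map_mul, map_mul, map_mul, map_mul, map_mul, map_mul] at this
  · intro i j h
    have := key (.serre_F i j h)
    rwa [map_add, map_smul, map_mul, map_mul, map_mul, map_mul, map_mul, map_mul] at this
  · intro i j h
    have := key (.E_E i j h)
    rwa [map_mul, map_mul] at this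
  · intro i j h
    have := key (.F_F i j h)
    rwa [map_mul, map_mul] at this

/-- The image of a generator under a family of elements. -/
def Model.val {A : Type*} [Ring A] [Algebra Kq A] (M : Model n A) : UqGen n → A
  | .qh h => M.qh h
  | .E i => M.E i
  | .F i => M.F i

/-- The algebra homomorphism with prescribed values on the generators. -/
def lift {A : Type*} [Ring A] [Algebra Kq A] (M : Model n A) : Uq n →ₐ[Kq] A :=
  RingQuot.liftAlgHom Kq ⟨FreeAlgebra.lift Kq M.val, by
    intro x y h
    cases h <;> simp only [map_mul, map_add, map_sub, map_smul, map_one, FreeAlgebra.lift_ι_apply,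
      UqGen.fr, Model.val]
    · exact M.qh_zero
    · exact M.qh_add _ _
    · exact M.qh_E _ _
    · exact M.qh_F _ _
    · exact M.E_F _
    · exact M.E_F_ne _ _ ‹_›
    · exact M.serre_E _ _ ‹_›
    · exact M.serre_F _ _ ‹_›
    · exact M.E_E _ _ ‹_›
    · exact M.F_F _ _ ‹_›⟩

lemma lift_gen {A : Type*} [Ring A] [Algebra Kq A] (M : Model n A) (x : UqGen n) :
    lift M (gen x) = M.val x := by
  unfold lift gen
  erw [RingQuot.liftAlgHom_mkAlgHom_apply]
  exact FreeAlgebra.lift_ι_apply _ _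

lemma algHom_ext {A : Type*} [Ring A] [Algebra Kq A] {f g : Uq n →ₐ[Kq] A}
    (h : ∀ x, f (gen x) = g (gen x)) : f = g := by
  apply RingQuot.ringQuot_ext'
  ext x
  exact h x

/-- The generators generate. -/
lemma induction {P : Uq n → Prop} (scalar : ∀ r : Kq, P (algebraMap Kq (Uq n) r))
    (generator : ∀ x, P (gen x)) (mul : ∀ u v, P u → P v → P (u * v))
    (add : ∀ u v, P u → P v → P (u + v)) (u : Uq n) : P u := by
  have hs : Function.Surjective (RingQuot.mkAlgHom Kq (UqGen.Rel (n := n))) :=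
    RingQuot.mkAlgHom_surjective Kq _
  obtain ⟨x, hx⟩ := hs u
  subst hx
  induction x using FreeAlgebra.induction with
  | grade0 r =>
    have h1 := (RingQuot.mkAlgHom Kq (UqGen.Rel (n := n))).commutes r
    exact h1 ▸ scalar r
  | grade1 x => exact generator x
  | mul x y hx hy =>
    have h1 := map_mul (RingQuot.mkAlgHom Kq (UqGen.Rel (n := n))) x y
    exact h1 ▸ mul _ _ hx hy
  | add x y hx hy =>
    have h1 := map_add (RingQuot.mkAlgHom Kq (UqGen.Rel (n := n))) x y
    exact h1 ▸ add _ _ hx hy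

lemma qh_comm (h h' : Fin n → ℤ) : (qh h * qh h' : Uq n) = qh h' * qh h := by
  have h1 : (qh (h + h') : Uq n) = qh h * qh h' := (tautModel n).qh_add h h'
  have h2 : (qh (h' + h) : Uq n) = qh h' * qh h := (tautModel n).qh_add h' h
  rw [← h1, ← h2, add_comm]

lemma qh_E (h : Fin n → ℤ) (i : Fin (n - 1)) :
    (qh h * E i : Uq n) = q ^ pair h i • (E i * qh h) := (tautModel n).qh_E h i

lemma qh_F (h : Fin n → ℤ) (i : Fin (n - 1)) :
    (qh h * F i : Uq n) = q ^ (-pair h i) • (F i * qh h) := (tautModel n).qh_F h i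

lemma q_ne_zero : q ≠ 0 := RatFunc.X_ne_zero

lemma q_sub_ne_zero : q - q⁻¹ ≠ 0 := by
  have h0 : q ≠ 0 := q_ne_zero
  intro h
  have h2 : (RatFunc.X : RatFunc ℂ) * RatFunc.X = 1 := by
    have h3 : q = q⁻¹ := sub_eq_zero.mp h
    change q * q = 1
    nth_rewrite 1 [h3]
    exact inv_mul_cancel₀ h0
  have h4 : (algebraMap (Polynomial ℂ) (RatFunc ℂ)) (Polynomial.X * Polynomial.X) =
      algebraMap (Polynomial ℂ) (RatFunc ℂ) 1 := by
    rw [map_mul, RatFunc.algebraMap_X, h2, map_one]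
  have h5 := congrArg (Polynomial.eval 0) (RatFunc.algebraMap_injective ℂ h4)
  simp at h5

lemma qnum_two : qnum 2 = q + q⁻¹ := by
  have h0 : q ≠ 0 := q_ne_zero
  have h1 : q - q⁻¹ ≠ 0 := q_sub_ne_zero
  rw [qnum, div_eq_iff h1, zpow_neg, zpow_ofNat]
  field_simp
  ring

lemma pair_coroot (i j : Fin (n - 1)) : pair (coroot i) j =
    if i = j then 2 else if (i : ℕ) + 1 = j ∨ (j : ℕ) + 1 = i then -1 else 0 := by
  simp only [pair, coroot, Pi.sub_apply, Pi.single_apply, lo, hi, Fin.ext_iff]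
  split_ifs <;> omega

lemma pair_neg (h : Fin n → ℤ) (j : Fin (n - 1)) : pair (-h) j = -pair h j := by
  simp [pair]; ring

lemma pair_coroot_symm (i j : Fin (n - 1)) : pair (coroot i) j = pair (coroot j) i := by
  rw [pair_coroot, pair_coroot]
  simp only [eq_comm, or_comm]

/-- The quantum Serre relation is additive on suitably commuting solutions. -/
lemma serre_add {K A : Type*} [Field K] [Ring A] [Algebra K A] {p r : K} (hpr : p * r = 1) {x y z w : A}
    (hxy : x * y = (p * p) • (y * x)) (hxw : x * w = r • (w * x)) (hzy : z * y = r • (y * z))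
    (hx : x * x * z + z * x * x = (p + r) • (x * z * x))
    (hy : y * y * w + w * y * y = (p + r) • (y * w * y)) :
    (x + y) * (x + y) * (z + w) + (z + w) * (x + y) * (x + y) =
      (p + r) • ((x + y) * (z + w) * (x + y)) := by
  have e1 : x * x * w + w * x * x = (p + r) • (x * w * x) := by
    rw [mul_assoc x x w, hxw, mul_smul_comm, ← mul_assoc x w x, hxw]
    simp only [smul_mul_assoc, smul_smul, mul_assoc]
    match_scalars
    linear_combination -hpr
  have e2 : y * y * z + z * y * y = (p + r) • (y * z * y) := by
    rw [mul_assoc y z y, hzy, mul_smul_comm, smul_mul_assoc, mul_assoc y z y, hzy]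
    simp only [mul_smul_comm, smul_smul, mul_assoc]
    match_scalars
    linear_combination -hpr
  have e3 : x * y * z + y * x * z + (z * x * y + z * y * x) =
      (p + r) • (x * z * y + y * z * x) := by
    rw [mul_assoc z x y, hxy, mul_smul_comm, ← mul_assoc z y x, mul_assoc x z y, hzy,
      mul_smul_comm, ← mul_assoc x y z, hxy]
    simp only [smul_mul_assoc, smul_smul, smul_add, mul_assoc]
    match_scalars
    · linear_combination (-1 - p * p - p * r) * hpr
    · linear_combination p * hpr
  have e4 : x * y * w + y * x * w + (w * x * y + w * y * x) =
      (p + r) • (x * w * y + y * w * x) := by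
    rw [hxw, mul_assoc w x y, smul_mul_assoc, mul_assoc w x y, hxy, smul_mul_assoc,
      mul_assoc y x w, hxw]
    simp only [mul_smul_comm, smul_smul, smul_add, mul_assoc]
    match_scalars
    · linear_combination p * hpr
    · linear_combination (-1 - p * p - p * r) * hpr
  have e : (x + y) * (x + y) * (z + w) + (z + w) * (x + y) * (x + y) =
      (x * x * z + z * x * x) + (x * x * w + w * x * x) + (y * y * z + z * y * y) +
      (y * y * w + w * y * y) + (x * y * z + y * x * z + (z * x * y + z * y * x)) +
      (x * y * w + y * x * w + (w * x * y + w * y * x)) := by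
    noncomm_ring
  rw [e, hx, e1, e2, hy, e3, e4]
  simp only [← smul_add]
  congr 1
  noncomm_ring

lemma qh_neg_E (i j : Fin (n - 1)) :
    (qh (-coroot i) * E j : Uq n) = q ^ (-pair (coroot i) j) • (E j * qh (-coroot i)) := by
  rw [qh_E, pair_neg]

lemma qh_neg_F (i j : Fin (n - 1)) :
    (qh (-coroot i) * F j : Uq n) = q ^ pair (coroot i) j • (F j * qh (-coroot i)) := by
  rw [qh_F, pair_neg, neg_neg]

lemma comul_E_comm (i j : Fin (n - 1)) :
    ((E i ⊗ₜ qh (coroot i)) * (1 ⊗ₜ E j) : Uq n ⊗[Kq] Uq n) =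
      q ^ pair (coroot i) j • ((1 ⊗ₜ E j) * (E i ⊗ₜ qh (coroot i))) := by
  simp only [Algebra.TensorProduct.tmul_mul_tmul, mul_one, one_mul, qh_E, TensorProduct.tmul_smul]

lemma comul_F_comm (i j : Fin (n - 1)) :
    ((qh (-coroot i) ⊗ₜ F i) * (F j ⊗ₜ 1) : Uq n ⊗[Kq] Uq n) =
      q ^ pair (coroot i) j • ((F j ⊗ₜ 1) * (qh (-coroot i) ⊗ₜ F i)) := by
  simp only [Algebra.TensorProduct.tmul_mul_tmul, mul_one, one_mul, qh_neg_F,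
    TensorProduct.smul_tmul']

lemma pair_self (i : Fin (n - 1)) : pair (coroot i) i = 2 := by simp [pair_coroot]

lemma pair_adj {i j : Fin (n - 1)} (h : (i : ℕ) + 1 = j ∨ (j : ℕ) + 1 = i) :
    pair (coroot i) j = -1 := by
  have : i ≠ j := by rintro rfl; omega
  rw [pair_coroot, if_neg this, if_pos h]

lemma pair_far {i j : Fin (n - 1)} (h : (i : ℕ) + 1 < j ∨ (j : ℕ) + 1 < i) :
    pair (coroot i) j = 0 := by
  have : i ≠ j := by rintro rfl; omega
  rw [pair_coroot, if_neg this, if_neg (by omega)]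

lemma comm_add {A : Type*} [Ring A] {x y z w : A} (h1 : x * z = z * x) (h2 : x * w = w * x)
    (h3 : y * z = z * y) (h4 : y * w = w * y) : (x + y) * (z + w) = (z + w) * (x + y) := by
  simp only [mul_add, add_mul, h1, h2, h3, h4]
  abel

/-- The comultiplication `Δ(q^h) = q^h ⊗ q^h`, `Δ(E_i) = E_i ⊗ K_i + 1 ⊗ E_i`,
`Δ(F_i) = F_i ⊗ 1 + K_i⁻¹ ⊗ F_i`. -/
def comulModel (n : ℕ) : Model n (Uq n ⊗[Kq] Uq n) where
  qh h := qh h ⊗ₜ qh h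
  E i := E i ⊗ₜ qh (coroot i) + 1 ⊗ₜ E i
  F i := F i ⊗ₜ 1 + qh (-coroot i) ⊗ₜ F i
  qh_zero := by
    rw [show (qh 0 : Uq n) = 1 from (tautModel n).qh_zero]; rfl
  qh_add h h' := by
    rw [show (qh (h + h') : Uq n) = qh h * qh h' from (tautModel n).qh_add h h',
      Algebra.TensorProduct.tmul_mul_tmul]
  qh_E h i := by
    have h1 := qh_E h i
    have h2 : (qh h * qh (coroot i) : Uq n) = qh (coroot i) * qh h := qh_comm _ _
    simp only [mul_add, add_mul, Algebra.TensorProduct.tmul_mul_tmul, h1, h2, mul_one, one_mul,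
      smul_add, TensorProduct.smul_tmul', TensorProduct.tmul_smul]
  qh_F h i := by
    have h1 := qh_F h i
    have h2 : (qh h * qh (-coroot i) : Uq n) = qh (-coroot i) * qh h := qh_comm _ _
    simp only [mul_add, add_mul, Algebra.TensorProduct.tmul_mul_tmul, h1, h2, mul_one, one_mul,
      smul_add, TensorProduct.smul_tmul', TensorProduct.tmul_smul]
  E_F i := by
    have h : (E i * F i : Uq n) = F i * E i + (q - q⁻¹)⁻¹ • (qh (coroot i) - qh (-coroot i)) :=
      (tautModel n).E_F i
    simp only [mul_add, add_mul, Algebra.TensorProduct.tmul_mul_tmul, mul_one, one_mul, h,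
      qh_neg_E, qh_F, TensorProduct.tmul_smul, ← TensorProduct.smul_tmul', TensorProduct.add_tmul,
      TensorProduct.tmul_add, TensorProduct.sub_tmul, TensorProduct.tmul_sub, smul_sub]
    abel
  E_F_ne i j hij := by
    have h : (E i * F j : Uq n) = _ := (tautModel n).E_F_ne i j hij
    simp only [mul_add, add_mul, Algebra.TensorProduct.tmul_mul_tmul, mul_one, one_mul, h,
      qh_neg_E, qh_F, TensorProduct.tmul_smul, TensorProduct.smul_tmul', tautModel,
      pair_coroot_symm i j]
    abel
  serre_E i j hij := by
    have h : (E i * E i * E j + E j * E i * E i : Uq n) = _ := (tautModel n).serre_E i j hij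
    rw [qnum_two] at h ⊢
    have hK := qh_comm (coroot j) (coroot i)
    refine serre_add (mul_inv_cancel₀ q_ne_zero) ?_ ?_ ?_ ?_ ?_
    · rw [comul_E_comm, pair_self, zpow_ofNat, sq]
    · rw [comul_E_comm, pair_adj hij, zpow_neg_one]
    · rw [comul_E_comm, pair_adj hij.symm, zpow_neg_one]
    · have h1 : (qh (coroot j) * qh (coroot i) * qh (coroot i) : Uq n) =
          qh (coroot i) * qh (coroot i) * qh (coroot j) := by
        rw [hK, mul_assoc, hK, mul_assoc]
      have h2 : (qh (coroot i) * qh (coroot j) * qh (coroot i) : Uq n) =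
          qh (coroot i) * qh (coroot i) * qh (coroot j) := by
        rw [mul_assoc, hK, mul_assoc]
      simp only [Algebra.TensorProduct.tmul_mul_tmul]
      rw [h1, h2, ← TensorProduct.add_tmul, h, ← TensorProduct.smul_tmul']
      rfl
    · simp only [Algebra.TensorProduct.tmul_mul_tmul, mul_one]
      rw [← TensorProduct.tmul_add, h, TensorProduct.tmul_smul]
      rfl
  serre_F i j hij := by
    have h : (F i * F i * F j + F j * F i * F i : Uq n) = _ := (tautModel n).serre_F i j hij
    rw [qnum_two] at h ⊢
    have hK := qh_comm (-coroot j) (-coroot i)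
    rw [add_comm (F i ⊗ₜ 1), add_comm (F j ⊗ₜ 1)]
    refine serre_add (mul_inv_cancel₀ q_ne_zero) ?_ ?_ ?_ ?_ ?_
    · rw [comul_F_comm, pair_self, zpow_ofNat, sq]
    · rw [comul_F_comm, pair_adj hij, zpow_neg_one]
    · rw [comul_F_comm, pair_adj hij.symm, zpow_neg_one]
    · have h1 : (qh (-coroot j) * qh (-coroot i) * qh (-coroot i) : Uq n) =
          qh (-coroot i) * qh (-coroot i) * qh (-coroot j) := by
        rw [hK, mul_assoc, hK, mul_assoc]
      have h2 : (qh (-coroot i) * qh (-coroot j) * qh (-coroot i) : Uq n) =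
          qh (-coroot i) * qh (-coroot i) * qh (-coroot j) := by
        rw [mul_assoc, hK, mul_assoc]
      simp only [Algebra.TensorProduct.tmul_mul_tmul]
      rw [h1, h2, ← TensorProduct.tmul_add, h, TensorProduct.tmul_smul]
      rfl
    · simp only [Algebra.TensorProduct.tmul_mul_tmul, mul_one]
      rw [← TensorProduct.add_tmul, h, ← TensorProduct.smul_tmul']
      rfl
  E_E i j hij := by
    have h : (E i * E j : Uq n) = E j * E i := (tautModel n).E_E i j hij
    refine comm_add ?_ ?_ ?_ ?_
    · simp only [Algebra.TensorProduct.tmul_mul_tmul, h, qh_comm (coroot i) (coroot j)]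
    · rw [comul_E_comm, pair_far (.inl hij), zpow_zero, one_smul]
    · rw [comul_E_comm, pair_far (.inr hij), zpow_zero, one_smul]
    · simp only [Algebra.TensorProduct.tmul_mul_tmul, h]
  F_F i j hij := by
    have h : (F i * F j : Uq n) = F j * F i := (tautModel n).F_F i j hij
    refine comm_add ?_ ?_ ?_ ?_
    · simp only [Algebra.TensorProduct.tmul_mul_tmul, h]
    · rw [comul_F_comm, pair_far (.inr hij), zpow_zero, one_smul]
    · rw [comul_F_comm, pair_far (.inl hij), zpow_zero, one_smul]
    · simp only [Algebra.TensorProduct.tmul_mul_tmul, h, qh_comm (-coroot i) (-coroot j)]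

/-- The counit `ε(q^h) = 1`, `ε(E_i) = ε(F_i) = 0`. -/
def counitModel (n : ℕ) : Model n Kq where
  qh _ := 1
  E _ := 0
  F _ := 0
  qh_zero := rfl
  qh_add := by simp
  qh_E := by simp
  qh_F := by simp
  E_F := by simp
  E_F_ne := by simp
  serre_E := by simp
  serre_F := by simp
  E_E := by simp
  F_F := by simp

lemma comul_qh (h : Fin n → ℤ) : lift (comulModel n) (qh h) = qh h ⊗ₜ qh h := lift_gen _ _

lemma comul_E (i : Fin (n - 1)) :
    lift (comulModel n) (E i) = E i ⊗ₜ qh (coroot i) + 1 ⊗ₜ E i := lift_gen _ _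

lemma comul_F (i : Fin (n - 1)) :
    lift (comulModel n) (F i) = F i ⊗ₜ 1 + qh (-coroot i) ⊗ₜ F i := lift_gen _ _

lemma counit_qh (h : Fin n → ℤ) : lift (counitModel n) (qh h) = 1 := lift_gen _ _

lemma counit_E (i : Fin (n - 1)) : lift (counitModel n) (E i) = 0 := lift_gen _ _

lemma counit_F (i : Fin (n - 1)) : lift (counitModel n) (F i) = 0 := lift_gen _ _

/-- The bialgebra structure of `U_q(gl_n)`. -/
instance instBialgebra : Bialgebra Kq (Uq n) :=
  Bialgebra.ofAlgHom (lift (comulModel n)) (lift (counitModel n))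
    (by
      apply algHom_ext
      rintro (h | i | i) <;>
      simp [comul_qh, comul_E, comul_F, TensorProduct.add_tmul, TensorProduct.tmul_add,
        Algebra.TensorProduct.one_def, add_assoc])
    (by
      apply algHom_ext
      rintro (h | i | i) <;>
      simp [comul_qh, comul_E, comul_F, counit_qh, counit_E, counit_F])
    (by
      apply algHom_ext
      rintro (h | i | i) <;>
      simp [comul_qh, comul_E, comul_F, counit_qh, counit_E, counit_F])

end Uq
end QuantumGroup

section Reps

/-- A finite-dimensional representation of an algebra over `ℂ(q)`. -/
structure FinRep (A : Type) [Ring A] [Algebra Kq A] where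
  /-- the underlying vector space -/
  V : Type
  [addCommGroup : AddCommGroup V]
  [module : Module Kq V]
  [finite : FiniteDimensional Kq V]
  /-- the action -/
  ρ : A →ₐ[Kq] Module.End Kq V

namespace FinRep

attribute [instance] addCommGroup module finite

section Category
variable {A : Type} [Ring A] [Algebra Kq A]

/-- An equivariant linear map. -/
@[ext]
structure Hom (X Y : FinRep A) where
  /-- the underlying linear map -/
  lin : X.V →ₗ[Kq] Y.V
  comm : ∀ a, lin ∘ₗ X.ρ a = Y.ρ a ∘ₗ lin

instance instCategory : Category (FinRep A) where
  Hom := Hom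
  id X := ⟨LinearMap.id, fun _ => rfl⟩
  comp f g := ⟨g.lin ∘ₗ f.lin, fun a => by
    rw [LinearMap.comp_assoc, f.comm, ← LinearMap.comp_assoc, g.comm, LinearMap.comp_assoc]⟩

/-- The linear map underlying a morphism. -/
def lin {X Y : FinRep A} (f : X ⟶ Y) : X.V →ₗ[Kq] Y.V := Hom.lin f

lemma lin_comm {X Y : FinRep A} (f : X ⟶ Y) (a : A) : lin f ∘ₗ X.ρ a = Y.ρ a ∘ₗ lin f :=
  Hom.comm f a

@[ext]
lemma hom_ext {X Y : FinRep A} {f g : X ⟶ Y} (h : lin f = lin g) : f = g := Hom.ext h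

@[simp] lemma lin_id (X : FinRep A) : lin (𝟙 X) = LinearMap.id := rfl

@[simp] lemma lin_comp {X Y Z : FinRep A} (f : X ⟶ Y) (g : Y ⟶ Z) :
    lin (f ≫ g) = lin g ∘ₗ lin f := rfl

/-- A morphism from an equivariant linear map. -/
def mkHom {X Y : FinRep A} (f : X.V →ₗ[Kq] Y.V) (h : ∀ a, f ∘ₗ X.ρ a = Y.ρ a ∘ₗ f) : X ⟶ Y :=
  Hom.mk f h

@[simp] lemma lin_mkHom {X Y : FinRep A} (f : X.V →ₗ[Kq] Y.V) (h) : lin (mkHom f h) = f := rfl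

/-- An isomorphism from an equivariant linear equivalence. -/
def mkIso {X Y : FinRep A} (f : X.V ≃ₗ[Kq] Y.V)
    (h : ∀ a, f.toLinearMap ∘ₗ X.ρ a = Y.ρ a ∘ₗ f.toLinearMap) : X ≅ Y where
  hom := mkHom f.toLinearMap h
  inv := mkHom f.symm.toLinearMap fun a => by
    ext y
    have := congrArg f.symm (LinearMap.congr_fun (h a) (f.symm y))
    simpa using this.symm
  hom_inv_id := by ext; simp
  inv_hom_id := by ext; simp

instance instHomAdd (X Y : FinRep A) : Add (X ⟶ Y) where
  add f g := mkHom (lin f + lin g) fun a => by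
    rw [LinearMap.add_comp, LinearMap.comp_add, lin_comm, lin_comm]

instance instHomZero (X Y : FinRep A) : Zero (X ⟶ Y) where
  zero := mkHom 0 fun a => by rw [LinearMap.zero_comp, LinearMap.comp_zero]

instance instHomSMul (X Y : FinRep A) : SMul Kq (X ⟶ Y) where
  smul k f := mkHom (k • lin f) fun a => by
    rw [LinearMap.smul_comp, LinearMap.comp_smul, lin_comm]

@[simp] lemma lin_add {X Y : FinRep A} (f g : X ⟶ Y) : lin (f + g) = lin f + lin g := rfl

@[simp] lemma lin_zero {X Y : FinRep A} : lin (0 : X ⟶ Y) = 0 := rfl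

@[simp] lemma lin_smul {X Y : FinRep A} (k : Kq) (f : X ⟶ Y) : lin (k • f) = k • lin f := rfl

instance instHomNeg (X Y : FinRep A) : Neg (X ⟶ Y) where
  neg f := (-1 : Kq) • f

instance instHomAddCommGroup (X Y : FinRep A) : AddCommGroup (X ⟶ Y) where
  nsmul := nsmulRec
  zsmul := zsmulRec
  add_assoc f g h := hom_ext (add_assoc _ _ _)
  add_comm f g := hom_ext (add_comm _ _)
  zero_add f := hom_ext (zero_add _)
  add_zero f := hom_ext (add_zero _)
  neg_add_cancel f := hom_ext (by
    change (-1 : Kq) • lin f + lin f = 0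
    rw [neg_one_smul, neg_add_cancel])

instance instPreadditive : Preadditive (FinRep A) where
  add_comp _ _ _ f g h := hom_ext (LinearMap.comp_add _ _ _)
  comp_add _ _ _ f g h := hom_ext (LinearMap.add_comp _ _ _)

instance instLinear : Linear Kq (FinRep A) where
  homModule X Y :=
    { one_smul f := hom_ext (one_smul _ _)
      mul_smul k l f := hom_ext (mul_smul _ _ _)
      smul_zero k := hom_ext (smul_zero _)
      smul_add k f g := hom_ext (smul_add _ _ _)
      add_smul k l f := hom_ext (add_smul _ _ _)
      zero_smul f := hom_ext (zero_smul _ _) }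
  smul_comp _ _ _ k f g := hom_ext (LinearMap.comp_smul _ _ _)
  comp_smul _ _ _ f k g := hom_ext (LinearMap.smul_comp _ _ _)

end Category

end FinRep

/-- A left coaction of a bialgebra `A` on an algebra `B` by an algebra homomorphism. -/
class ComoduleAlgebra (A B : Type) [Ring A] [Bialgebra Kq A] [Ring B] [Algebra Kq B] where
  /-- the coaction -/
  coact : B →ₐ[Kq] A ⊗[Kq] B
  coassoc : (Algebra.TensorProduct.assoc Kq Kq Kq A A B).toAlgHom.comp
    ((Algebra.TensorProduct.map (Bialgebra.comulAlgHom Kq A) (AlgHom.id Kq B)).comp coact) =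
      (Algebra.TensorProduct.map (AlgHom.id Kq A) coact).comp coact
  counit : (Algebra.TensorProduct.lid Kq B).toAlgHom.comp
    ((Algebra.TensorProduct.map (Bialgebra.counitAlgHom Kq A) (AlgHom.id Kq B)).comp coact) =
      AlgHom.id Kq B

instance comoduleAlgebraSelf (A : Type) [Ring A] [Bialgebra Kq A] : ComoduleAlgebra A A where
  coact := Bialgebra.comulAlgHom Kq A
  coassoc := by
    ext a
    exact Coalgebra.coassoc_apply a
  counit := by
    ext a
    have := LinearMap.congr_fun (Coalgebra.rTensor_counit_comp_comul (R := Kq) (A := A)) a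
    exact (congrArg (TensorProduct.lid Kq A) this).trans (by simp)

namespace FinRep
variable {A B : Type} [Ring A] [Bialgebra Kq A] [Ring B] [Algebra Kq B]

/-- The action of `A ⊗ B` on `V ⊗ W`. -/
def extAct (X : FinRep A) (Y : FinRep B) : A ⊗[Kq] B →ₐ[Kq] Module.End Kq (X.V ⊗[Kq] Y.V) :=
  Module.endTensorEndAlgHom.comp (Algebra.TensorProduct.map X.ρ Y.ρ)

lemma extAct_tmul (X : FinRep A) (Y : FinRep B) (a : A) (b : B) :
    extAct X Y (a ⊗ₜ b) = TensorProduct.map (X.ρ a) (Y.ρ b) := rfl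

lemma extAct_natural {X X' : FinRep A} {Y Y' : FinRep B} (f : X ⟶ X') (g : Y ⟶ Y')
    (t : A ⊗[Kq] B) : TensorProduct.map (lin f) (lin g) ∘ₗ extAct X Y t =
      extAct X' Y' t ∘ₗ TensorProduct.map (lin f) (lin g) := by
  induction t using TensorProduct.induction_on with
  | zero => rw [map_zero, map_zero]; exact (LinearMap.comp_zero _).trans (LinearMap.zero_comp _).symm
  | tmul a b =>
    rw [extAct_tmul, extAct_tmul, ← TensorProduct.map_comp, ← TensorProduct.map_comp, lin_comm,
      lin_comm]
  | add s t hs ht =>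
    rw [map_add, map_add]
    exact (LinearMap.comp_add _ _ _).trans ((congrArg₂ _ hs ht).trans (LinearMap.add_comp _ _ _).symm)

variable [ComoduleAlgebra A B]

/-- The representation of `B` on `V ⊗ W`, for a representation `V` of `A` and a representation `W`
of `B`. -/
def act (X : FinRep A) (Y : FinRep B) : FinRep B where
  V := X.V ⊗[Kq] Y.V
  ρ := (extAct X Y).comp ComoduleAlgebra.coact

/-- The tensor product of two equivariant maps. -/
def actHom {X X' : FinRep A} {Y Y' : FinRep B} (f : X ⟶ X') (g : Y ⟶ Y') : act X Y ⟶ act X' Y' :=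
  mkHom (TensorProduct.map (lin f) (lin g)) fun _ => extAct_natural f g _

lemma lin_actHom {X X' : FinRep A} {Y Y' : FinRep B} (f : X ⟶ X') (g : Y ⟶ Y') :
    lin (actHom f g) = TensorProduct.map (lin f) (lin g) := rfl

lemma actHom_id (X : FinRep A) (Y : FinRep B) : actHom (𝟙 X) (𝟙 Y) = 𝟙 (act X Y) :=
  hom_ext TensorProduct.map_id

lemma actHom_comp {X X' X'' : FinRep A} {Y Y' Y'' : FinRep B} (f : X ⟶ X') (f' : X' ⟶ X'')
    (g : Y ⟶ Y') (g' : Y' ⟶ Y'') : actHom (f ≫ f') (g ≫ g') = actHom f g ≫ actHom f' g' :=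
  hom_ext (TensorProduct.map_comp _ _ _ _)

lemma assoc_end {V W U : Type} [AddCommGroup V] [Module Kq V] [AddCommGroup W] [Module Kq W]
    [AddCommGroup U] [Module Kq U] (f : A →ₐ[Kq] Module.End Kq V) (g : A →ₐ[Kq] Module.End Kq W)
    (h : B →ₐ[Kq] Module.End Kq U) (s : (A ⊗[Kq] A) ⊗[Kq] B) :
    (TensorProduct.assoc Kq V W U).toLinearMap ∘ₗ
      Module.endTensorEndAlgHom (S := Kq) (Algebra.TensorProduct.map
        (Module.endTensorEndAlgHom.comp (Algebra.TensorProduct.map f g)) h s) =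
      Module.endTensorEndAlgHom (S := Kq) (Algebra.TensorProduct.map f
        (Module.endTensorEndAlgHom.comp (Algebra.TensorProduct.map g h))
        (Algebra.TensorProduct.assoc Kq Kq Kq A A B s)) ∘ₗ
        (TensorProduct.assoc Kq V W U).toLinearMap := by
  induction s using TensorProduct.induction_on with
  | zero => simp only [map_zero, LinearMap.comp_zero, LinearMap.zero_comp]
  | tmul t b =>
    induction t using TensorProduct.induction_on with
    | zero => simp only [TensorProduct.zero_tmul, map_zero, LinearMap.comp_zero, LinearMap.zero_comp]
    | tmul a a' =>
      ext v w u
      rfl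
    | add t t' ht ht' =>
      simp only [TensorProduct.add_tmul, map_add, LinearMap.comp_add, LinearMap.add_comp, ht, ht']
  | add t t' ht ht' => simp only [map_add, LinearMap.comp_add, LinearMap.add_comp, ht, ht']

/-- `(X ⊗ Y) ⊗ Z ≅ X ⊗ (Y ⊗ Z)`. -/
def actAssoc (X Y : FinRep A) (Z : FinRep B) : act (act X Y) Z ≅ act X (act Y Z) :=
  mkIso (X := act (act X Y) Z) (Y := act X (act Y Z)) (TensorProduct.assoc Kq X.V Y.V Z.V) (by
    intro b
    have h1 : (act (act X Y) Z).ρ b = Module.endTensorEndAlgHom (S := Kq)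
        (Algebra.TensorProduct.map (extAct X Y) Z.ρ (Algebra.TensorProduct.map
          (Bialgebra.comulAlgHom Kq A) (AlgHom.id Kq B) (ComoduleAlgebra.coact b))) := by
      change Module.endTensorEndAlgHom (S := Kq) (Algebra.TensorProduct.map
        ((extAct X Y).comp (Bialgebra.comulAlgHom Kq A)) (Z.ρ.comp (AlgHom.id Kq B)) _) = _
      rw [Algebra.TensorProduct.map_comp]
      rfl
    have h2 : (act X (act Y Z)).ρ b = Module.endTensorEndAlgHom (S := Kq)
        (Algebra.TensorProduct.map X.ρ (extAct Y Z) (Algebra.TensorProduct.map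
          (AlgHom.id Kq A) ComoduleAlgebra.coact (ComoduleAlgebra.coact b))) := by
      change Module.endTensorEndAlgHom (S := Kq) (Algebra.TensorProduct.map
        (X.ρ.comp (AlgHom.id Kq A)) ((extAct Y Z).comp ComoduleAlgebra.coact) _) = _
      rw [Algebra.TensorProduct.map_comp]
      rfl
    have h3 := AlgHom.congr_fun (ComoduleAlgebra.coassoc (A := A) (B := B)) b
    rw [h1, h2]
    refine (assoc_end X.ρ Y.ρ Z.ρ _).trans ?_
    exact congrArg (fun t => Module.endTensorEndAlgHom (S := Kq)
        (Algebra.TensorProduct.map X.ρ (extAct Y Z) t) ∘ₗ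
          (TensorProduct.assoc Kq X.V Y.V Z.V).toLinearMap) h3)

/-- The trivial representation. -/
def triv (A : Type) [Ring A] [Bialgebra Kq A] : FinRep A where
  V := Kq
  ρ := (Algebra.lmul Kq Kq).comp (Bialgebra.counitAlgHom Kq A)

lemma lid_end (Y : FinRep B) (t : A ⊗[Kq] B) :
    (TensorProduct.lid Kq Y.V).toLinearMap ∘ₗ extAct (triv A) Y t =
      Y.ρ (Algebra.TensorProduct.lid Kq B (Algebra.TensorProduct.map
        (Bialgebra.counitAlgHom Kq A) (AlgHom.id Kq B) t)) ∘ₗ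
          (TensorProduct.lid Kq Y.V).toLinearMap := by
  induction t using TensorProduct.induction_on with
  | zero =>
    simp only [map_zero]
    exact (LinearMap.comp_zero _).trans (LinearMap.zero_comp _).symm
  | tmul a b =>
    refine TensorProduct.ext' fun (k : Kq) y => ?_
    change (Coalgebra.counit (R := Kq) a * k) • Y.ρ b y =
      Y.ρ (Coalgebra.counit (R := Kq) a • b) (k • y)
    rw [map_smul, map_smul, LinearMap.smul_apply, smul_smul, mul_comm]
  | add t t' ht ht' =>
    simp only [map_add]
    exact (LinearMap.comp_add _ _ _).trans
      ((congrArg₂ _ ht ht').trans (LinearMap.add_comp _ _ _).symm)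

lemma rid_end (X : FinRep A) (t : A ⊗[Kq] A) :
    (TensorProduct.rid Kq X.V).toLinearMap ∘ₗ extAct X (triv A) t =
      X.ρ (Algebra.TensorProduct.rid Kq Kq A (Algebra.TensorProduct.map
        (AlgHom.id Kq A) (Bialgebra.counitAlgHom Kq A) t)) ∘ₗ
          (TensorProduct.rid Kq X.V).toLinearMap := by
  induction t using TensorProduct.induction_on with
  | zero =>
    simp only [map_zero]
    exact (LinearMap.comp_zero _).trans (LinearMap.zero_comp _).symm
  | tmul a b =>
    refine TensorProduct.ext' fun x (k : Kq) => ?_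
    change (Coalgebra.counit (R := Kq) b * k) • X.ρ a x =
      X.ρ (Coalgebra.counit (R := Kq) b • a) (k • x)
    rw [map_smul, map_smul, LinearMap.smul_apply, smul_smul, mul_comm]
  | add t t' ht ht' =>
    simp only [map_add]
    exact (LinearMap.comp_add _ _ _).trans
      ((congrArg₂ _ ht ht').trans (LinearMap.add_comp _ _ _).symm)

/-- `ℂ(q) ⊗ Y ≅ Y`. -/
def actUnit (Y : FinRep B) : act (triv A) Y ≅ Y :=
  mkIso (X := act (triv A) Y) (Y := Y) (TensorProduct.lid Kq Y.V) (by
    intro b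
    refine (lid_end Y (ComoduleAlgebra.coact b)).trans ?_
    have h := AlgHom.congr_fun (ComoduleAlgebra.counit (A := A) (B := B)) b
    exact congrArg (fun t => Y.ρ t ∘ₗ (TensorProduct.lid Kq Y.V).toLinearMap) h)

/-- `X ⊗ ℂ(q) ≅ X`. -/
def rightUnit (X : FinRep A) : act X (triv A) ≅ X :=
  mkIso (X := act X (triv A)) (Y := X) (TensorProduct.rid Kq X.V) (by
    intro b
    refine (rid_end X (ComoduleAlgebra.coact b)).trans ?_
    have h := LinearMap.congr_fun (Coalgebra.lTensor_counit_comp_comul (R := Kq) (A := A)) b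
    have h' := congrArg (TensorProduct.rid Kq A) h
    exact congrArg (fun t => X.ρ t ∘ₗ (TensorProduct.rid Kq X.V).toLinearMap)
      (h'.trans (by simp)))

instance instMonoidalCategoryStruct : MonoidalCategoryStruct (FinRep A) where
  tensorObj := act
  tensorHom := actHom
  whiskerLeft X _ _ f := actHom (𝟙 X) f
  whiskerRight f X := actHom f (𝟙 X)
  tensorUnit := triv A
  associator := actAssoc
  leftUnitor := actUnit
  rightUnitor := rightUnit

lemma actAssoc_naturality {X X' Y Y' : FinRep A} {Z Z' : FinRep B} (f : X ⟶ X') (g : Y ⟶ Y')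
    (h : Z ⟶ Z') : actHom (actHom f g) h ≫ (actAssoc X' Y' Z').hom =
      (actAssoc X Y Z).hom ≫ actHom f (actHom g h) :=
  hom_ext (TensorProduct.ext_threefold fun _ _ _ => rfl)

lemma actUnit_naturality {Y Y' : FinRep B} (g : Y ⟶ Y') :
    actHom (𝟙 (triv A)) g ≫ (actUnit Y').hom = (actUnit Y).hom ≫ g :=
  hom_ext (TensorProduct.ext' fun (k : Kq) y => (map_smul (lin g) k y).symm)

lemma act_pentagon (W X Y : FinRep A) (Z : FinRep B) :
    actHom (actAssoc W X Y).hom (𝟙 Z) ≫ (actAssoc W (act X Y) Z).hom ≫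
      actHom (𝟙 W) (actAssoc X Y Z).hom =
    (actAssoc (act W X) Y Z).hom ≫ (actAssoc W X (act Y Z)).hom :=
  hom_ext (TensorProduct.ext_fourfold fun _ _ _ _ => rfl)

lemma act_triangle (X : FinRep A) (Y : FinRep B) :
    (actAssoc X (triv A) Y).hom ≫ actHom (𝟙 X) (actUnit Y).hom = actHom (rightUnit X).hom (𝟙 Y) :=
  hom_ext (TensorProduct.ext_threefold fun x (k : Kq) y => TensorProduct.tmul_smul k x y)

lemma act_leftUnitor (X : FinRep A) (Y : FinRep B) :
    actHom (actUnit X).hom (𝟙 Y) = (actAssoc (triv A) X Y).hom ≫ (actUnit (act X Y)).hom :=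
  hom_ext (TensorProduct.ext_threefold fun (k : Kq) x y => TensorProduct.smul_tmul' k x y)

instance instMonoidalCategory : MonoidalCategory (FinRep A) := MonoidalCategory.ofTensorHom
  (id_tensorHom_id := actHom_id)
  (id_tensorHom := fun _ _ _ _ => rfl)
  (tensorHom_id := fun _ _ => rfl)
  (tensorHom_comp_tensorHom := fun f g f' g' => (actHom_comp f f' g g').symm)
  (associator_naturality := actAssoc_naturality)
  (leftUnitor_naturality := actUnit_naturality)
  (rightUnitor_naturality := fun f =>
    hom_ext (TensorProduct.ext' fun x (k : Kq) => (map_smul (lin f) k x).symm))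
  (pentagon := act_pentagon)
  (triangle := act_triangle)

instance instMonoidalLeftAction : MonoidalLeftAction (FinRep A) (FinRep B) where
  actionObj := act
  actionHom := actHom
  actionHomLeft f Y := actHom f (𝟙 Y)
  actionHomRight X _ _ g := actHom (𝟙 X) g
  actionAssocIso := actAssoc
  actionUnitIso := actUnit
  actionHom_def f g := by rw [← actHom_comp, Category.comp_id, Category.id_comp]
  actionHomRight_id := actHom_id
  id_actionHomLeft := actHom_id
  actionHom_comp := actHom_comp
  actionAssocIso_hom_naturality := actAssoc_naturality
  actionUnitIso_hom_naturality g := (actUnit_naturality g).symm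
  whiskerLeft_actionHomLeft c c' c'' f d := by
    have := actAssoc_naturality (𝟙 c) f (𝟙 d)
    rw [← Category.assoc, Iso.eq_comp_inv]
    exact this
  whiskerRight_actionHomLeft c f d := by
    have := actAssoc_naturality f (𝟙 c) (𝟙 d)
    rw [← Category.assoc, Iso.eq_comp_inv, ← actHom_id]
    exact this
  associator_actionHom := act_pentagon
  leftUnitor_actionHom := act_leftUnitor
  rightUnitor_actionHom c d := (act_triangle c d).symm

end FinRep
end Reps

section Coideal

namespace CoidealSubalgebra
variable {A : Type} [Ring A] [Bialgebra Kq A] (S : Subalgebra Kq A)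

/-- The map `A ⊗ S → A ⊗ A`. -/
abbrev incl : A ⊗[Kq] S →ₐ[Kq] A ⊗[Kq] A := Algebra.TensorProduct.map (AlgHom.id Kq A) S.val

lemma lTensor_injective {M N P : Type} [AddCommGroup M] [Module Kq M] [AddCommGroup N] [Module Kq N]
    [AddCommGroup P] [Module Kq P] (f : N →ₗ[Kq] P) (hf : Function.Injective f) :
    Function.Injective (TensorProduct.map (LinearMap.id : M →ₗ[Kq] M) f) :=
  Module.Flat.lTensor_preserves_injective_linearMap f hf

lemma incl_injective : Function.Injective (incl S) :=
  lTensor_injective S.val.toLinearMap Subtype.val_injective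

variable (h : ∀ s ∈ S, Coalgebra.comul (R := Kq) s ∈ (incl S).range)

/-- The restriction of the comultiplication to a left coideal subalgebra `S`, as a map
`S → A ⊗ S`. -/
def coact : S →ₐ[Kq] A ⊗[Kq] S :=
  ((AlgEquiv.ofInjective (incl S) (incl_injective S)).symm.toAlgHom).comp
    (((Bialgebra.comulAlgHom Kq A).comp S.val).codRestrict (incl S).range fun s => h s s.2)

lemma incl_coact (s : S) : incl S (coact S h s) = Coalgebra.comul (R := Kq) (s : A) := by
  have := congrArg Subtype.val ((AlgEquiv.ofInjective (incl S) (incl_injective S)).apply_symm_apply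
    ⟨Coalgebra.comul (R := Kq) (s : A), h s s.2⟩)
  exact this

/-- A left coideal subalgebra is a left comodule algebra. -/
@[reducible]
def comoduleAlgebra : ComoduleAlgebra A S where
  coact := coact S h
  coassoc := by
    apply AlgHom.ext
    intro s
    apply lTensor_injective (M := A) (incl S).toLinearMap (incl_injective S)
    have h1 : ∀ t : A ⊗[Kq] S, TensorProduct.map (LinearMap.id : A →ₗ[Kq] A) (incl S).toLinearMap
        (Algebra.TensorProduct.assoc Kq Kq Kq A A S (Algebra.TensorProduct.map
          (Bialgebra.comulAlgHom Kq A) (AlgHom.id Kq S) t)) =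
        Algebra.TensorProduct.assoc Kq Kq Kq A A A (Algebra.TensorProduct.map
          (Bialgebra.comulAlgHom Kq A) (AlgHom.id Kq A) (incl S t)) := by
      intro t
      induction t using TensorProduct.induction_on with
      | zero => simp only [map_zero]
      | tmul a s =>
        have h3 : ∀ u : A ⊗[Kq] A, TensorProduct.map (LinearMap.id : A →ₗ[Kq] A)
            (incl S).toLinearMap (TensorProduct.assoc Kq A A S (u ⊗ₜ s)) =
            TensorProduct.assoc Kq A A A (u ⊗ₜ (s : A)) := by
          intro u
          induction u using TensorProduct.induction_on with
          | zero => simp only [TensorProduct.zero_tmul, map_zero]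
          | tmul b c => rfl
          | add u u' hu hu' => simp only [TensorProduct.add_tmul, map_add, hu, hu']
        exact h3 (Coalgebra.comul (R := Kq) a)
      | add t t' ht ht' => simp only [map_add, ht, ht']
    have h2 : ∀ t : A ⊗[Kq] S, TensorProduct.map (LinearMap.id : A →ₗ[Kq] A) (incl S).toLinearMap
        (Algebra.TensorProduct.map (AlgHom.id Kq A) (coact S h) t) =
        Algebra.TensorProduct.map (AlgHom.id Kq A) (Bialgebra.comulAlgHom Kq A) (incl S t) := by
      intro t
      induction t using TensorProduct.induction_on with
      | zero => simp only [map_zero]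
      | tmul a s => exact congrArg (fun x => a ⊗ₜ[Kq] x) (incl_coact S h s)
      | add t t' ht ht' => simp only [map_add, ht, ht']
    refine (h1 (coact S h s)).trans (Eq.trans ?_ (h2 (coact S h s)).symm)
    rw [incl_coact]
    exact Coalgebra.coassoc_apply (R := Kq) (s : A)
  counit := by
    apply AlgHom.ext
    intro s
    apply Subtype.val_injective
    have h1 : ∀ t : A ⊗[Kq] S, (Algebra.TensorProduct.lid Kq S (Algebra.TensorProduct.map
          (Bialgebra.counitAlgHom Kq A) (AlgHom.id Kq S) t) : A) =
        Algebra.TensorProduct.lid Kq A (Algebra.TensorProduct.map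
          (Bialgebra.counitAlgHom Kq A) (AlgHom.id Kq A) (incl S t)) := by
      intro t
      induction t using TensorProduct.induction_on with
      | zero => simp only [map_zero]; rfl
      | tmul a s => rfl
      | add t t' ht ht' => simp only [map_add, ← ht, ← ht']; rfl
    refine (h1 (coact S h s)).trans ?_
    rw [incl_coact]
    exact AlgHom.congr_fun (ComoduleAlgebra.counit (A := A) (B := A)) (s : A)

end CoidealSubalgebra

/-- The element `B_i = F_i - K_i⁻¹ E_i` of `U_q(gl_n)`. -/
def soGen {n : ℕ} (i : Fin (n - 1)) : Uq n := Uq.F i - Uq.qh (-coroot i) * Uq.E i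

/-- The coideal subalgebra `U'_q(so_n)` of `U_q(gl_n)`. -/
def soCoideal (n : ℕ) : Subalgebra Kq (Uq n) := Algebra.adjoin Kq (Set.range soGen)

lemma soGen_mem {n : ℕ} (i : Fin (n - 1)) : soGen i ∈ soCoideal n :=
  Algebra.subset_adjoin ⟨i, rfl⟩

/-- `Δ(B_i) = B_i ⊗ 1 + K_i⁻¹ ⊗ B_i`. -/
lemma comul_soGen {n : ℕ} (i : Fin (n - 1)) : Coalgebra.comul (R := Kq) (soGen i) =
    soGen i ⊗ₜ[Kq] 1 + Uq.qh (-coroot i) ⊗ₜ[Kq] soGen i := by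
  change Uq.lift (Uq.comulModel n) (soGen i) = _
  have h : (Uq.qh (-coroot i) * Uq.qh (coroot i) : Uq n) = 1 := by
    have h1 := (Uq.tautModel n).qh_add (-coroot i) (coroot i)
    rw [neg_add_cancel, (Uq.tautModel n).qh_zero] at h1
    exact h1.symm
  simp only [soGen, map_sub, map_mul, Uq.comul_F, Uq.comul_qh, Uq.comul_E, mul_add,
    Algebra.TensorProduct.tmul_mul_tmul, mul_one, h, TensorProduct.sub_tmul, TensorProduct.tmul_sub]
  abel

lemma comul_mem_range {n : ℕ} (s : Uq n) (hs : s ∈ soCoideal n) :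
    Coalgebra.comul (R := Kq) s ∈ (CoidealSubalgebra.incl (soCoideal n)).range := by
  have key : soCoideal n ≤ (CoidealSubalgebra.incl (soCoideal n)).range.comap
      (Bialgebra.comulAlgHom Kq (Uq n)) := by
    refine Algebra.adjoin_le ?_
    rintro _ ⟨i, rfl⟩
    refine ⟨soGen i ⊗ₜ 1 + Uq.qh (-coroot i) ⊗ₜ ⟨soGen i, soGen_mem i⟩, ?_⟩
    exact (comul_soGen i).symm
  exact key hs

instance comoduleAlgebraSoCoideal (n : ℕ) : ComoduleAlgebra (Uq n) (soCoideal n) :=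
  CoidealSubalgebra.comoduleAlgebra (soCoideal n) comul_mem_range

/-- The restriction of a representation of `U_q(gl_n)` to `U'_q(so_n)`. -/
def Res {n : ℕ} (X : FinRep (Uq n)) : FinRep (soCoideal n) where
  V := X.V
  ρ := X.ρ.comp (soCoideal n).val

end Coideal

section SubRep
variable {A : Type} [Ring A] [Algebra Kq A]

/-- A subrepresentation. -/
structure SubRep (X : FinRep A) where
  /-- the underlying subspace -/
  carrier : Submodule Kq X.V
  invariant : ∀ a, ∀ v ∈ carrier, X.ρ a v ∈ carrier

namespace SubRep
variable {X Y : FinRep A}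

/-- A subrepresentation as a representation. -/
def toRep (W : SubRep X) : FinRep A where
  V := W.carrier
  ρ := AlgHom.ofLinearMap
    { toFun := fun a => (X.ρ a).restrict (W.invariant a)
      map_add' := fun a b => by ext; simp
      map_smul' := fun k a => by ext; simp }
    (by ext; simp) (fun a b => by ext; simp)

/-- The inclusion of a subrepresentation. -/
def incl (W : SubRep X) : W.toRep ⟶ X := FinRep.mkHom W.carrier.subtype fun _ => rfl

/-- The quotient by a subrepresentation. -/
def quot (W : SubRep X) : FinRep A where
  V := X.V ⧸ W.carrier
  ρ := AlgHom.ofLinearMap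
    { toFun := fun a => W.carrier.mapQ W.carrier (X.ρ a) (W.invariant a)
      map_add' := fun a b => by ext; simp
      map_smul' := fun k a => by ext; simp }
    (by ext; simp) (fun a b => by ext; simp)

/-- The projection to the quotient by a subrepresentation. -/
def proj (W : SubRep X) : X ⟶ W.quot := FinRep.mkHom W.carrier.mkQ fun _ => rfl

/-- The image of an equivariant map. -/
def image (f : X ⟶ Y) : SubRep Y where
  carrier := LinearMap.range (FinRep.lin f)
  invariant := by
    rintro a _ ⟨v, rfl⟩
    exact ⟨X.ρ a v, LinearMap.congr_fun (FinRep.lin_comm f a) v⟩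

/-- The zero subrepresentation. -/
def bot (X : FinRep A) : SubRep X where
  carrier := ⊥
  invariant := by
    rintro a v hv
    rw [Submodule.mem_bot] at hv
    simp [hv]

/-- The sum of two subrepresentations. -/
def sup (W W' : SubRep X) : SubRep X where
  carrier := W.carrier ⊔ W'.carrier
  invariant := by
    intro a v hv
    obtain ⟨w, hw, w', hw', rfl⟩ := Submodule.mem_sup.mp hv
    rw [map_add]
    exact Submodule.add_mem_sup (W.invariant a w hw) (W'.invariant a w' hw')

end SubRep
end SubRep

section Powers
variable {n : ℕ}

lemma lo_ne_hi (i : Fin (n - 1)) : lo i ≠ hi i := by simp [lo, hi, Fin.ext_iff]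

lemma diagonal_mul_single (d : Fin n → Kq) (i j : Fin n) :
    Matrix.diagonal d * Matrix.single i j 1 = d i • Matrix.single i j 1 := by
  ext a b
  rw [Matrix.diagonal_mul, Matrix.smul_apply, Matrix.single_apply]
  split_ifs with h
  · rw [h.1, smul_eq_mul]
  · simp

lemma single_mul_diagonal (d : Fin n → Kq) (i j : Fin n) :
    Matrix.single i j 1 * Matrix.diagonal d = d j • Matrix.single i j 1 := by
  ext a b
  rw [Matrix.mul_diagonal, Matrix.smul_apply, Matrix.single_apply]
  split_ifs with h
  · rw [h.2, smul_eq_mul, mul_comm]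
  · simp

/-- The vector representation in terms of matrices: `q^h v_j = q^{h_j} v_j`,
`E_i v_{i+1} = v_i`, `F_i v_i = v_{i+1}`, and `E_i`, `F_i` vanish on all other basis vectors. -/
def vecModel (n : ℕ) : Uq.Model n (Matrix (Fin n) (Fin n) Kq) where
  qh h := Matrix.diagonal fun j => q ^ h j
  E i := Matrix.single (lo i) (hi i) 1
  F i := Matrix.single (hi i) (lo i) 1
  qh_zero := by simp
  qh_add h h' := by
    rw [Matrix.diagonal_mul_diagonal]
    congr 1
    funext j
    exact zpow_add₀ Uq.q_ne_zero _ _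
  qh_E h i := by
    rw [diagonal_mul_single, single_mul_diagonal, smul_smul, pair, ← zpow_add₀ Uq.q_ne_zero,
      sub_add_cancel]
  qh_F h i := by
    rw [diagonal_mul_single, single_mul_diagonal, smul_smul, pair, ← zpow_add₀ Uq.q_ne_zero,
      neg_sub, sub_add_cancel]
  E_F i := by
    have h1 : q - q⁻¹ ≠ 0 := Uq.q_sub_ne_zero
    have h2 := lo_ne_hi i
    rw [Matrix.single_mul_single_same, Matrix.single_mul_single_same, Matrix.diagonal_sub]
    ext a b
    by_cases hab : a = b
    · subst hab
      by_cases ha : a = lo i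
      · subst ha
        simp [coroot, h2, h2.symm, h1]
      · by_cases ha' : a = hi i
        · subst ha'
          have h3 : (q - q⁻¹)⁻¹ * (q⁻¹ - q) = -1 := by
            rw [← neg_sub q, mul_neg, inv_mul_cancel₀ h1]
          simp [coroot, h2, h2.symm, h3]
        · simp [coroot, ha, ha', Ne.symm ha, Ne.symm ha']
    · rw [Matrix.single_apply_of_ne _ _ _ _ _ (by rintro ⟨rfl, h⟩; exact hab h)]
      simp [Matrix.diagonal_apply_ne _ hab,
        Matrix.single_apply_of_ne _ _ _ _ _ (show ¬ (hi i = a ∧ hi i = b) by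
          rintro ⟨rfl, h⟩; exact hab h)]
  E_F_ne i j hij := by
    have h1 : hi i ≠ hi j := by simpa [hi, Fin.ext_iff] using hij
    have h2 : lo j ≠ lo i := by simpa [lo, Fin.ext_iff, eq_comm] using hij
    rw [Matrix.single_mul_single_of_ne _ _ _ _ h1, Matrix.single_mul_single_of_ne _ _ _ _ h2]
  serre_E i j hij := by
    have h1 : hi i ≠ lo i := by simp [hi, lo, Fin.ext_iff]
    have h2 : hi i ≠ lo j ∨ hi j ≠ lo i := by simp [hi, lo, Fin.ext_iff]; omega
    have h3 : (Matrix.single (lo i) (hi i) 1 : Matrix (Fin n) (Fin n) Kq) *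
        Matrix.single (lo i) (hi i) 1 = 0 := Matrix.single_mul_single_of_ne _ _ _ _ h1 _
    rw [h3, mul_assoc, mul_assoc, h3, zero_mul, mul_zero, add_zero]
    rcases h2 with h2 | h2
    · rw [← mul_assoc, Matrix.single_mul_single_of_ne _ _ _ _ h2, zero_mul, smul_zero]
    · rw [Matrix.single_mul_single_of_ne _ _ _ _ h2, mul_zero, smul_zero]
  serre_F i j hij := by
    have h1 : lo i ≠ hi i := by simp [hi, lo, Fin.ext_iff]
    have h2 : lo i ≠ hi j ∨ lo j ≠ hi i := by simp [hi, lo, Fin.ext_iff]; omega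
    have h3 : (Matrix.single (hi i) (lo i) 1 : Matrix (Fin n) (Fin n) Kq) *
        Matrix.single (hi i) (lo i) 1 = 0 := Matrix.single_mul_single_of_ne _ _ _ _ h1 _
    rw [h3, mul_assoc, mul_assoc, h3, zero_mul, mul_zero, add_zero]
    rcases h2 with h2 | h2
    · rw [← mul_assoc, Matrix.single_mul_single_of_ne _ _ _ _ h2, zero_mul, smul_zero]
    · rw [Matrix.single_mul_single_of_ne _ _ _ _ h2, mul_zero, smul_zero]
  E_E i j hij := by
    have h1 : hi i ≠ lo j := by simp [hi, lo, Fin.ext_iff]; omega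
    have h2 : hi j ≠ lo i := by simp [hi, lo, Fin.ext_iff]; omega
    rw [Matrix.single_mul_single_of_ne _ _ _ _ h1, Matrix.single_mul_single_of_ne _ _ _ _ h2]
  F_F i j hij := by
    have h1 : lo i ≠ hi j := by simp [hi, lo, Fin.ext_iff]; omega
    have h2 : lo j ≠ hi i := by simp [hi, lo, Fin.ext_iff]; omega
    rw [Matrix.single_mul_single_of_ne _ _ _ _ h1, Matrix.single_mul_single_of_ne _ _ _ _ h2]

/-- The vector representation `V` of `U_q(gl_n)`. -/
def vecRep (n : ℕ) : FinRep (Uq n) where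
  V := Fin n → Kq
  ρ := (Matrix.toLinAlgEquiv' : Matrix (Fin n) (Fin n) Kq ≃ₐ[Kq] _).toAlgHom.comp
    (Uq.lift (vecModel n))

/-- The standard basis vector `v_i` of `V`. -/
def vecBasis (i : Fin n) : (vecRep n).V := Pi.single i 1

lemma qh_vecBasis (h : Fin n → ℤ) (j : Fin n) :
    (vecRep n).ρ (Uq.qh h) (vecBasis j) = q ^ h j • vecBasis j := by
  refine (LinearMap.congr_fun (congrArg Matrix.toLinAlgEquiv' (Uq.lift_gen (vecModel n) (.qh h)))
    (Pi.single j 1)).trans ?_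
  rw [Matrix.toLinAlgEquiv'_apply, Matrix.mulVec_single_one]
  funext a
  by_cases ha : a = j
  · subst ha
    simp only [Uq.Model.val, vecModel, Matrix.col_apply, Matrix.diagonal_apply_eq]
    exact (by simp : q ^ h a = (q ^ h a • (Pi.single a 1 : Fin n → Kq)) a)
  · simp only [Uq.Model.val, vecModel, Matrix.col_apply, Matrix.diagonal_apply_ne _ ha]
    exact (by simp [ha] : (0 : Kq) = (q ^ h j • (Pi.single j 1 : Fin n → Kq)) a)

lemma E_vecBasis (i : Fin (n - 1)) (j : Fin n) :
    (vecRep n).ρ (Uq.E i) (vecBasis j) = if j = hi i then vecBasis (lo i) else 0 := by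
  refine (LinearMap.congr_fun (congrArg Matrix.toLinAlgEquiv' (Uq.lift_gen (vecModel n) (.E i)))
    (Pi.single j 1)).trans ?_
  rw [Matrix.toLinAlgEquiv'_apply, Matrix.mulVec_single_one]
  funext a
  by_cases hj : j = hi i
  · simp [Uq.Model.val, vecModel, vecBasis, hj, Matrix.single_apply, Pi.single_apply, eq_comm]
  · simp [Uq.Model.val, vecModel, hj, Ne.symm hj]
    rfl

lemma F_vecBasis (i : Fin (n - 1)) (j : Fin n) :
    (vecRep n).ρ (Uq.F i) (vecBasis j) = if j = lo i then vecBasis (hi i) else 0 := by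
  refine (LinearMap.congr_fun (congrArg Matrix.toLinAlgEquiv' (Uq.lift_gen (vecModel n) (.F i)))
    (Pi.single j 1)).trans ?_
  rw [Matrix.toLinAlgEquiv'_apply, Matrix.mulVec_single_one]
  funext a
  by_cases hj : j = lo i
  · simp [Uq.Model.val, vecModel, vecBasis, hj, Matrix.single_apply, Pi.single_apply, eq_comm]
  · simp [Uq.Model.val, vecModel, hj, Ne.symm hj]
    rfl

/-- The vector `v_i ⊗ v_j`. -/
def vecBasis₂ (i j : Fin n) : (vecRep n ⊗ vecRep n : FinRep (Uq n)).V :=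
  vecBasis i ⊗ₜ[Kq] vecBasis j

lemma qh_vecBasis₂ (h : Fin n → ℤ) (i j : Fin n) :
    (vecRep n ⊗ vecRep n : FinRep (Uq n)).ρ (Uq.qh h) (vecBasis₂ i j) =
      q ^ (h i + h j) • vecBasis₂ i j := by
  have h1 : (vecRep n ⊗ vecRep n : FinRep (Uq n)).ρ (Uq.qh h) =
      FinRep.extAct (vecRep n) (vecRep n) (Uq.qh h ⊗ₜ Uq.qh h) :=
    congrArg (FinRep.extAct (vecRep n) (vecRep n)) (Uq.comul_qh h)
  rw [h1]
  refine (congrArg₂ (fun v w => v ⊗ₜ[Kq] w) (qh_vecBasis h i) (qh_vecBasis h j)).trans ?_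
  rw [TensorProduct.smul_tmul_smul, zpow_add₀ Uq.q_ne_zero]
  rfl

lemma E_vecBasis₂ (k : Fin (n - 1)) (i j : Fin n) :
    (vecRep n ⊗ vecRep n : FinRep (Uq n)).ρ (Uq.E k) (vecBasis₂ i j) =
      (if i = hi k then q ^ coroot k j • vecBasis₂ (lo k) j else 0) +
        if j = hi k then vecBasis₂ i (lo k) else 0 := by
  have h1 : (vecRep n ⊗ vecRep n : FinRep (Uq n)).ρ (Uq.E k) =
      FinRep.extAct (vecRep n) (vecRep n) (Uq.E k ⊗ₜ Uq.qh (coroot k)) +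
        FinRep.extAct (vecRep n) (vecRep n) (1 ⊗ₜ Uq.E k) :=
    (congrArg (FinRep.extAct (vecRep n) (vecRep n)) (Uq.comul_E k)).trans (map_add _ _ _)
  rw [h1]
  have h2 : FinRep.extAct (vecRep n) (vecRep n) (Uq.E k ⊗ₜ Uq.qh (coroot k)) (vecBasis₂ i j) =
      if i = hi k then q ^ coroot k j • vecBasis₂ (lo k) j else 0 := by
    refine (congrArg₂ (fun v w => v ⊗ₜ[Kq] w) (E_vecBasis k i) (qh_vecBasis _ j)).trans ?_
    split_ifs
    · exact TensorProduct.tmul_smul _ _ _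
    · exact TensorProduct.zero_tmul _ _
  have h3 : FinRep.extAct (vecRep n) (vecRep n) (1 ⊗ₜ Uq.E k) (vecBasis₂ i j) =
      if j = hi k then vecBasis₂ i (lo k) else 0 := by
    have h4 : (vecRep n).ρ 1 (vecBasis i) = vecBasis i := by rw [map_one]; rfl
    refine (congrArg₂ (fun v w => v ⊗ₜ[Kq] w) h4 (E_vecBasis k j)).trans ?_
    split_ifs
    · rfl
    · exact TensorProduct.tmul_zero _ _
  exact congrArg₂ (fun v w => v + w) h2 h3

lemma F_vecBasis₂ (k : Fin (n - 1)) (i j : Fin n) :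
    (vecRep n ⊗ vecRep n : FinRep (Uq n)).ρ (Uq.F k) (vecBasis₂ i j) =
      (if i = lo k then vecBasis₂ (hi k) j else 0) +
        if j = lo k then q ^ (-coroot k i) • vecBasis₂ i (hi k) else 0 := by
  have h1 : (vecRep n ⊗ vecRep n : FinRep (Uq n)).ρ (Uq.F k) =
      FinRep.extAct (vecRep n) (vecRep n) (Uq.F k ⊗ₜ 1) +
        FinRep.extAct (vecRep n) (vecRep n) (Uq.qh (-coroot k) ⊗ₜ Uq.F k) :=
    (congrArg (FinRep.extAct (vecRep n) (vecRep n)) (Uq.comul_F k)).trans (map_add _ _ _)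
  rw [h1]
  have h2 : FinRep.extAct (vecRep n) (vecRep n) (Uq.F k ⊗ₜ 1) (vecBasis₂ i j) =
      if i = lo k then vecBasis₂ (hi k) j else 0 := by
    have h4 : (vecRep n).ρ 1 (vecBasis j) = vecBasis j := by rw [map_one]; rfl
    refine (congrArg₂ (fun v w => v ⊗ₜ[Kq] w) (F_vecBasis k i) h4).trans ?_
    split_ifs
    · rfl
    · exact TensorProduct.zero_tmul _ _
  have h3 : FinRep.extAct (vecRep n) (vecRep n) (Uq.qh (-coroot k) ⊗ₜ Uq.F k) (vecBasis₂ i j) =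
      if j = lo k then q ^ (-coroot k i) • vecBasis₂ i (hi k) else 0 := by
    refine (congrArg₂ (fun v w => v ⊗ₜ[Kq] w) (qh_vecBasis _ i) (F_vecBasis k j)).trans ?_
    split_ifs
    · exact (TensorProduct.smul_tmul' _ _ _).symm
    · exact TensorProduct.tmul_zero _ _
  exact congrArg₂ (fun v w => v + w) h2 h3

/-- A subspace that is invariant under the generators is a subrepresentation. -/
def SubRep.ofGen {X : FinRep (Uq n)} (s : Set X.V)
    (h : ∀ g, ∀ v ∈ s, X.ρ (Uq.gen g) v ∈ Submodule.span Kq s) : SubRep X where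
  carrier := Submodule.span Kq s
  invariant := by
    intro u
    induction u using Uq.induction with
    | scalar r =>
      intro v hv
      rw [AlgHom.commutes]
      exact Submodule.smul_mem _ r hv
    | generator g =>
      intro v hv
      induction hv using Submodule.span_induction with
      | mem v hv => exact h g v hv
      | zero => rw [map_zero]; exact Submodule.zero_mem _
      | add v w _ _ hv hw => rw [map_add]; exact Submodule.add_mem _ hv hw
      | smul k v _ hv => rw [map_smul]; exact Submodule.smul_mem _ k hv
    | mul x y hx hy =>
      intro v hv
      rw [map_mul]
      exact hx _ (hy v hv)
    | add x y hx hy =>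
      intro v hv
      rw [map_add]
      exact Submodule.add_mem _ (hx v hv) (hy v hv)

/-- The two kinds of quantum powers. -/
inductive Kind : Type
  | ext
  | sym

namespace Kind

/-- The spanning vectors of the quadratic relations: `v_i ⊗ v_i` and `q⁻¹ v_i ⊗ v_j + v_j ⊗ v_i`,
`i < j`, in the exterior case, `q v_i ⊗ v_j - v_j ⊗ v_i`, `i < j`, in the symmetric case. -/
inductive IsRel (n : ℕ) : Kind → (vecRep n ⊗ vecRep n : FinRep (Uq n)).V → Prop
  | ext_diag (i : Fin n) : IsRel n ext (vecBasis₂ i i)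
  | ext_lt (i j : Fin n) (h : i < j) : IsRel n ext (q⁻¹ • vecBasis₂ i j + vecBasis₂ j i)
  | sym_lt (i j : Fin n) (h : i < j) : IsRel n sym (q • vecBasis₂ i j - vecBasis₂ j i)

lemma coroot_lo (k : Fin (n - 1)) : coroot k (lo k) = 1 := by simp [coroot, lo_ne_hi k]

lemma coroot_hi (k : Fin (n - 1)) : coroot k (hi k) = -1 := by
  simp [coroot, (lo_ne_hi k).symm]

lemma coroot_of_ne {k : Fin (n - 1)} {j : Fin n} (h : j ≠ lo k) (h' : j ≠ hi k) :
    coroot k j = 0 := by simp [coroot, h, h']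

lemma isRel_invariant (k : Kind) (g : UqGen n) (v : (vecRep n ⊗ vecRep n : FinRep (Uq n)).V)
    (hv : IsRel n k v) : (vecRep n ⊗ vecRep n : FinRep (Uq n)).ρ (Uq.gen g) v ∈
      Submodule.span Kq {v | IsRel n k v} := by
  have hmem : ∀ {w}, IsRel n k w → w ∈ Submodule.span Kq {v | IsRel n k v} :=
    fun h => Submodule.subset_span h
  have hlt : ∀ k : Fin (n - 1), lo k < hi k := fun k => by simp [lo, hi, Fin.lt_def]
  have hi_eq : ∀ k : Fin (n - 1), (hi k : ℕ) = (lo k : ℕ) + 1 := fun k => rfl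
  rcases g with h | l | l
  · cases hv with
    | ext_diag i =>
      rw [qh_vecBasis₂]
      exact Submodule.smul_mem _ _ (hmem (.ext_diag i))
    | ext_lt i j hij =>
      rw [map_add, map_smul, qh_vecBasis₂, qh_vecBasis₂, add_comm (h j), smul_comm, ← smul_add]
      exact Submodule.smul_mem _ _ (hmem (.ext_lt i j hij))
    | sym_lt i j hij =>
      rw [map_sub, map_smul, qh_vecBasis₂, qh_vecBasis₂, add_comm (h j), smul_comm, ← smul_sub]
      exact Submodule.smul_mem _ _ (hmem (.sym_lt i j hij))
  · cases hv with
    | ext_diag i =>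
      rw [E_vecBasis₂]
      by_cases h1 : i = hi l
      · subst h1
        have := hmem (.ext_lt _ _ (hlt l))
        simpa [coroot_hi, coroot_lo, add_comm] using this
      · simp [h1]
    | ext_lt i j hij =>
      rw [map_add, map_smul, E_vecBasis₂, E_vecBasis₂]
      by_cases h1 : i = hi l
      · subst h1
        by_cases h0 : j = lo l
        · subst h0
          exact absurd hij (not_lt.mpr (hlt l).le)
        · have h2 : j ≠ hi l := hij.ne'
          have h3 : lo l < j := by
            have := hi_eq l
            rw [Fin.lt_def] at hij ⊢
            rw [Fin.ext_iff] at h0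
            omega
          have := hmem (.ext_lt _ _ h3)
          have hc : coroot l j = 0 := coroot_of_ne (by assumption) (by assumption)
          simpa [h2, hc] using this
      · by_cases h2 : j = hi l
        · subst h2
          by_cases h0 : i = lo l
          · subst h0
            rw [if_neg h1, if_pos rfl, if_pos rfl, if_neg h1, zero_add, add_zero, coroot_lo,
              ← add_smul]
            exact Submodule.smul_mem _ _ (hmem (.ext_diag _))
          · have h3 : i < lo l := by
              have := hi_eq l
              rw [Fin.lt_def] at hij ⊢
              rw [Fin.ext_iff] at h0
              omega
            have := hmem (.ext_lt _ _ h3)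
            have hc : coroot l i = 0 := coroot_of_ne (by assumption) (by assumption)
            simpa [h1, hc] using this
        · simp [h1, h2]
    | sym_lt i j hij =>
      rw [map_sub, map_smul, E_vecBasis₂, E_vecBasis₂]
      by_cases h1 : i = hi l
      · subst h1
        by_cases h0 : j = lo l
        · subst h0
          exact absurd hij (not_lt.mpr (hlt l).le)
        · have h2 : j ≠ hi l := hij.ne'
          have h3 : lo l < j := by
            have := hi_eq l
            rw [Fin.lt_def] at hij ⊢
            rw [Fin.ext_iff] at h0
            omega
          have := hmem (.sym_lt _ _ h3)
          have hc : coroot l j = 0 := coroot_of_ne (by assumption) (by assumption)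
          simpa [h2, hc] using this
      · by_cases h2 : j = hi l
        · subst h2
          by_cases h0 : i = lo l
          · subst h0
            rw [if_neg h1, if_pos rfl, if_pos rfl, if_neg h1, zero_add, add_zero, coroot_lo,
              zpow_one, sub_self]
            exact Submodule.zero_mem _
          · have h3 : i < lo l := by
              have := hi_eq l
              rw [Fin.lt_def] at hij ⊢
              rw [Fin.ext_iff] at h0
              omega
            have := hmem (.sym_lt _ _ h3)
            have hc : coroot l i = 0 := coroot_of_ne (by assumption) (by assumption)
            simpa [h1, hc] using this
        · simp [h1, h2]
  · cases hv with
    | ext_diag i =>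
      rw [F_vecBasis₂]
      by_cases h1 : i = lo l
      · subst h1
        have := hmem (.ext_lt _ _ (hlt l))
        simpa [coroot_hi, coroot_lo, add_comm] using this
      · simp [h1]
    | ext_lt i j hij =>
      rw [map_add, map_smul, F_vecBasis₂, F_vecBasis₂]
      by_cases h1 : i = lo l
      · subst h1
        by_cases h0 : j = hi l
        · subst h0
          have h1 := (lo_ne_hi l).symm
          rw [if_pos rfl, if_neg h1, if_neg h1, if_pos rfl, zero_add, add_zero, coroot_hi,
            ← add_smul]
          exact Submodule.smul_mem _ _ (hmem (.ext_diag _))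
        · have h2 : j ≠ lo l := hij.ne'
          have h3 : hi l < j := by
            have := hi_eq l
            rw [Fin.lt_def] at hij ⊢
            rw [Fin.ext_iff] at h0
            omega
          have := hmem (.ext_lt _ _ h3)
          have hc : coroot l j = 0 := coroot_of_ne (by assumption) (by assumption)
          simpa [h2, hc] using this
      · by_cases h2 : j = lo l
        · subst h2
          by_cases h0 : i = hi l
          · subst h0
            exact absurd hij (not_lt.mpr (hlt l).le)
          · have h3 : i < hi l := by
              have := hi_eq l
              rw [Fin.lt_def] at hij ⊢
              rw [Fin.ext_iff] at h0
              omega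
            have := hmem (.ext_lt _ _ h3)
            have hc : coroot l i = 0 := coroot_of_ne (by assumption) (by assumption)
            simpa [h1, hc] using this
        · simp [h1, h2]
    | sym_lt i j hij =>
      rw [map_sub, map_smul, F_vecBasis₂, F_vecBasis₂]
      by_cases h1 : i = lo l
      · subst h1
        by_cases h0 : j = hi l
        · subst h0
          have h1 := (lo_ne_hi l).symm
          rw [if_pos rfl, if_neg h1, if_neg h1, if_pos rfl, zero_add, add_zero, coroot_hi,
            neg_neg, zpow_one, sub_self]
          exact Submodule.zero_mem _
        · have h2 : j ≠ lo l := hij.ne'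
          have h3 : hi l < j := by
            have := hi_eq l
            rw [Fin.lt_def] at hij ⊢
            rw [Fin.ext_iff] at h0
            omega
          have := hmem (.sym_lt _ _ h3)
          have hc : coroot l j = 0 := coroot_of_ne (by assumption) (by assumption)
          simpa [h2, hc] using this
      · by_cases h2 : j = lo l
        · subst h2
          by_cases h0 : i = hi l
          · subst h0
            exact absurd hij (not_lt.mpr (hlt l).le)
          · have h3 : i < hi l := by
              have := hi_eq l
              rw [Fin.lt_def] at hij ⊢
              rw [Fin.ext_iff] at h0
              omega
            have := hmem (.sym_lt _ _ h3)
            have hc : coroot l i = 0 := coroot_of_ne (by assumption) (by assumption)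
            simpa [h1, hc] using this
        · simp [h1, h2]

/-- The subrepresentation of `V ⊗ V` of quadratic relations. -/
def quadRel (n : ℕ) (k : Kind) : SubRep (vecRep n ⊗ vecRep n : FinRep (Uq n)) :=
  SubRep.ofGen {v | IsRel n k v} (isRel_invariant k)

end Kind

/-- The tensor power of the vector representation. -/
def tensorPow (n : ℕ) : ℕ → FinRep (Uq n)
  | 0 => 𝟙_ _
  | a + 1 => vecRep n ⊗ tensorPow n a

/-- The degree `a` part of the two-sided ideal of the tensor algebra generated by a subspace `R` of
`V ⊗ V`; it is zero in degrees `0` and `1`, and in degree `a + 2` it is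
`V ⊗ I_{a+1} + R ⊗ V^{⊗ a}`. -/
def idealPart (R : SubRep (vecRep n ⊗ vecRep n : FinRep (Uq n))) : ∀ a, SubRep (tensorPow n a)
  | 0 => .bot _
  | 1 => .bot _
  | a + 2 => .sup (.image (vecRep n ◁ (idealPart R (a + 1)).incl))
      (.image (R.incl ▷ tensorPow n a ≫ (α_ (vecRep n) (vecRep n) (tensorPow n a)).hom))

/-- The tensor `v_{f(1)} ⊗ ⋯ ⊗ v_{f(a)}`. -/
def tensorVec : ∀ {a : ℕ} (_ : Fin a → Fin n), (tensorPow n a).V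
  | 0, _ => (1 : Kq)
  | _ + 1, f => vecBasis (f 0) ⊗ₜ[Kq] tensorVec (Fin.tail f)

namespace Kind

/-- The `a`-th quantum exterior power `Λ^a V` or symmetric power `S^a V` of the vector
representation. -/
def pow (k : Kind) (n a : ℕ) : FinRep (Uq n) := (idealPart (k.quadRel n) a).quot

/-- The class of `v_{f(1)} ⊗ ⋯ ⊗ v_{f(a)}` in the quantum power. -/
def vec (k : Kind) {a : ℕ} (f : Fin a → Fin n) : (k.pow n a).V :=
  FinRep.lin (idealPart (k.quadRel n) a).proj (tensorVec f)

/-- The index sequences of the standard basis: strictly increasing in the exterior case, weakly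
increasing in the symmetric case. -/
def Increasing {a : ℕ} (f : Fin a → Fin n) : Kind → Prop
  | ext => StrictMono f
  | sym => Monotone f

/-- The coefficient in the comultiplication of `v_{f(1)} ⋯ v_{f(c)}` of the term belonging to the
decomposition of `{1, …, c}` into the ranges of the increasing maps `s` and `t`. -/
def splitCoeff {a b c : ℕ} (f : Fin c → Fin n) (s : Fin a ↪o Fin c) (t : Fin b ↪o Fin c) :
    Kind → Kq
  | ext => q ^ Nat.card {p : Fin a × Fin b // s p.1 < t p.2} *
      (-1) ^ Nat.card {p : Fin a × Fin b // t p.2 < s p.1}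
  | sym => (q ^ Nat.card {p : Fin a × Fin b // s p.1 < t p.2})⁻¹ *
      q ^ Nat.card {p : Fin a × Fin b // t p.2 < s p.1 ∧ f (s p.1) = f (t p.2)}

/-- The multiplication `v_{f} ⊗ v_{g} ↦ v_{f, g}` of the quantum exterior or symmetric algebra in
degrees `a + b = c`. -/
def IsMul (k : Kind) (n : ℕ) {a b c : ℕ} (h : a + b = c)
    (φ : (k.pow n a ⊗ k.pow n b : FinRep (Uq n)) ⟶ k.pow n c) : Prop :=
  ∀ (f : Fin a → Fin n) (g : Fin b → Fin n),
    FinRep.lin φ (k.vec f ⊗ₜ[Kq] k.vec g) = k.vec (Fin.append f g ∘ Fin.cast h.symm)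

/-- The comultiplication of the quantum exterior or symmetric algebra in degrees `a + b = c`: the
basis vector `v_{f(1)} ⋯ v_{f(c)}` is sent to the sum, over all ways to write `{1, …, c}` as a
disjoint union of the ranges of two increasing maps `s` and `t`, of the vectors
`v_{f ∘ s} ⊗ v_{f ∘ t}` with the coefficients above. -/
def IsComul (k : Kind) (n : ℕ) (a b c : ℕ)
    (φ : k.pow n c ⟶ (k.pow n a ⊗ k.pow n b : FinRep (Uq n))) : Prop :=
  ∀ f : Fin c → Fin n, Increasing f k →
    FinRep.lin φ (k.vec f) = ∑ s : Fin a ↪o Fin c, ∑ t : Fin b ↪o Fin c,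
      if ∀ x y, s x ≠ t y then splitCoeff f s t k • (k.vec (f ∘ s) ⊗ₜ[Kq] k.vec (f ∘ t)) else 0

end Kind
end Powers

section ModuleFunctor
universe v₁ v₂ v₃ v₄ u₁ u₂ u₃ u₄
variable {C : Type u₁} [Category.{v₁} C] [MonoidalCategory C]
  {C' : Type u₂} [Category.{v₂} C'] [MonoidalCategory C']
  {D : Type u₃} [Category.{v₃} D] [MonoidalLeftAction C D]
  {D' : Type u₄} [Category.{v₄} D'] [MonoidalLeftAction C' D']

/-- A functor `G : D ⥤ D'` of left module categories over a monoidal functor `F : C ⥤ C'`: natural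
isomorphisms `F(X) ⊙ G(Y) ≅ G(X ⊙ Y)` compatible with the associativity and unit isomorphisms. -/
structure ModuleFunctor (F : C ⥤ C') [F.Monoidal] (G : D ⥤ D') where
  /-- `F(X) ⊙ G(Y) ≅ G(X ⊙ Y)` -/
  actIso : ∀ (X : C) (Y : D), F.obj X ⊙ₗ G.obj Y ≅ G.obj (X ⊙ₗ Y)
  natural : ∀ {X X' : C} {Y Y' : D} (f : X ⟶ X') (g : Y ⟶ Y'),
    (F.map f ⊙ₗₘ G.map g) ≫ (actIso X' Y').hom = (actIso X Y).hom ≫ G.map (f ⊙ₗₘ g)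
  assoc : ∀ (X Y : C) (Z : D),
    (Functor.LaxMonoidal.μ F X Y ⊵ₗ G.obj Z) ≫ (actIso (X ⊗ Y) Z).hom ≫ G.map (αₗ X Y Z).hom =
      (αₗ (F.obj X) (F.obj Y) (G.obj Z)).hom ≫ (F.obj X ⊴ₗ (actIso Y Z).hom) ≫
        (actIso X (Y ⊙ₗ Z)).hom
  unit : ∀ Y : D,
    (Functor.LaxMonoidal.ε F ⊵ₗ G.obj Y) ≫ (actIso (𝟙_ C) Y).hom ≫ G.map (λₗ Y).hom =
      (λₗ (G.obj Y)).hom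

end ModuleFunctor

section Functors
open Functor.LaxMonoidal Functor.OplaxMonoidal

/-- The additive closure of the category of webs. -/
abbrev AWebAdd : Type 1 := Mat_ AWeb

/-- The inclusion of webs into the additive closure. -/
abbrev webEmb : AWeb ⥤ AWebAdd := Mat_.embedding AWeb

/-- The generating object `a` of the category of webs. -/
abbrev strand (a : ℕ+) : AWeb := ⟨[a]⟩

/-- The merge `a ⊗ b → c`, `c = a + b`. -/
def mergeWeb (a b c : ℕ+) (h : a + b = c) : strand a ⊗ strand b ⟶ strand c :=
  AWeb.of (.merge a b c h)

/-- The split `c → a ⊗ b`, `c = a + b`. -/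
def splitWeb (a b c : ℕ+) (h : a + b = c) : strand c ⟶ strand a ⊗ strand b :=
  AWeb.of (.split a b c h)

/-- The type `A` presentation functor: a `ℂ(q)`-linear monoidal functor from the category of webs to
the category of finite-dimensional representations of `U_q(gl_n)` that sends `a` to the `a`-th
quantum exterior (or symmetric) power and merges and splits to multiplication and
comultiplication. -/
structure GammaA (k : Kind) (n : ℕ) where
  /-- the functor -/
  functor : AWebAdd ⥤ FinRep (Uq n)
  [additive : functor.Additive]
  [linear : functor.Linear Kq]
  [monoidal : functor.Monoidal]
  /-- the identification of the image of the object `a` -/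
  objIso : ∀ a : ℕ+, functor.obj (webEmb.obj (strand a)) ≅ k.pow n a
  map_merge : ∀ (a b c : ℕ+) (h : a + b = c), k.IsMul n (congrArg PNat.val h)
    (((objIso a).inv ⊗ₘ (objIso b).inv) ≫ μ (webEmb ⋙ functor) (strand a) (strand b) ≫
      functor.map (webEmb.map (mergeWeb a b c h)) ≫ (objIso c).hom)
  map_split : ∀ (a b c : ℕ+) (h : a + b = c), k.IsComul n a b c
    ((objIso c).inv ≫ functor.map (webEmb.map (splitWeb a b c h)) ≫
      δ (webEmb ⋙ functor) (strand a) (strand b) ≫ ((objIso a).hom ⊗ₘ (objIso b).hom))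

namespace GammaA
variable {k : Kind} {n : ℕ}

attribute [instance] additive linear monoidal

/-- The vector in the image of the object `a` that corresponds to `v_{f(1)} ⋯ v_{f(a)}`. -/
def vec (Γ : GammaA k n) (a : ℕ+) (f : Fin a → Fin n) :
    (Γ.functor.obj (webEmb.obj (strand a))).V :=
  FinRep.lin (Γ.objIso a).inv (k.vec f)

/-- The vector in the image of `1 ⊗ 1` that corresponds to `v_i ⊗ v_j`. -/
def vec₂ (Γ : GammaA k n) (i j : Fin n) : (Γ.functor.obj (webEmb.obj (strand 1 ⊗ strand 1))).V :=
  FinRep.lin (μ (webEmb ⋙ Γ.functor) (strand 1) (strand 1))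
    (Γ.vec 1 (fun _ => i) ⊗ₜ[Kq] Γ.vec 1 (fun _ => j))

end GammaA

/-- The inclusion into the additive closure. -/
abbrev modEmb (P : ModPresentation AWeb) : ModWeb P ⥤ Mat_ (ModWeb P) := Mat_.embedding (ModWeb P)

/-- A `ℂ(q)`-linear functor from the additive closure of a left module category over webs, generated
by the object `∅`, to representations of `U'_q(so_n)`, which is a functor of module
categories over the type `A` presentation functor and sends `∅` to the trivial representation. -/
structure GammaMod {k : Kind} {n : ℕ} (Γ : GammaA k n) (P : ModPresentation AWeb) where
  /-- the functor -/
  functor : Mat_ (ModWeb P) ⥤ FinRep (soCoideal n)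
  [additive : functor.Additive]
  [linear : functor.Linear Kq]
  /-- the compatibility with the actions -/
  action : ModuleFunctor Γ.functor functor
  /-- the identification of the image of the object `∅` -/
  unitIso : functor.obj ((modEmb P).obj ⟨𝟙_ AWeb⟩) ≅ Res (𝟙_ (FinRep (Uq n)))

namespace GammaMod
variable {k : Kind} {n : ℕ} {Γ : GammaA k n} {P : ModPresentation AWeb}

attribute [instance] additive linear

/-- The image of the object `X`, identified with the image of `X` under the type `A` functor. -/
def objIso (G : GammaMod Γ P) (X : AWeb) :
    Γ.functor.obj (webEmb.obj X) ⊙ₗ Res (𝟙_ (FinRep (Uq n))) ≅ G.functor.obj ((modEmb P).obj ⟨X⟩) :=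
  { hom := Γ.functor.obj (webEmb.obj X) ⊴ₗ G.unitIso.inv
    inv := Γ.functor.obj (webEmb.obj X) ⊴ₗ G.unitIso.hom } ≪≫ G.action.actIso _ _ ≪≫
    G.functor.mapIso (AddClosure.embAct (C := AWeb) (D := ModWeb P) X ⟨𝟙_ AWeb⟩ ≪≫
      (modEmb P).mapIso (ModWeb.incIso (ρ_ X)))

/-- The vector in the image of `X` that corresponds to a vector in the image of `X` under the type
`A` functor. -/
def ofA (G : GammaMod Γ P) (X : AWeb) (v : (Γ.functor.obj (webEmb.obj X)).V) :
    (G.functor.obj ((modEmb P).obj ⟨X⟩)).V :=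
  FinRep.lin (G.objIso X).hom (v ⊗ₜ[Kq] (1 : Kq))

/-- The image of a morphism `∅ → X`, as the image of the vector `1`. -/
def valueOn₁ (G : GammaMod Γ P) {X : AWeb} (f : ModWeb.mk (P := P) (𝟙_ AWeb) ⟶ ⟨X⟩) :
    (G.functor.obj ((modEmb P).obj ⟨X⟩)).V :=
  FinRep.lin (G.unitIso.inv ≫ G.functor.map ((modEmb P).map f)) (1 : Kq)

/-- The image of a morphism `X → ∅`, as a scalar-valued function. -/
def value (G : GammaMod Γ P) {X : AWeb} (f : ModWeb.mk (P := P) X ⟶ ⟨𝟙_ AWeb⟩)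
    (v : (G.functor.obj ((modEmb P).obj ⟨X⟩)).V) : Kq :=
  FinRep.lin (G.functor.map ((modEmb P).map f) ≫ G.unitIso.hom) v

end GammaMod

/-- The cup `∅ → 1 ⊗ 1`. -/
def cupWeb (z : Kq) :
    ModWeb.mk (P := cupPresentation z) (𝟙_ AWeb) ⟶ ModWeb.mk (strand 1 ⊗ strand 1) :=
  ModWeb.mkHom (P := cupPresentation z) cup₀

/-- The cap `1 ⊗ 1 → ∅`. -/
def capWeb (z : Kq) :
    ModWeb.mk (P := cupPresentation z) (strand 1 ⊗ strand 1) ⟶ ModWeb.mk (𝟙_ AWeb) :=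
  ModWeb.mkHom (P := cupPresentation z) cap₀

/-- The start dot `∅ → 2`. -/
def startDotWeb (z : Kq) :
    ModWeb.mk (P := dotPresentation z) (𝟙_ AWeb) ⟶ ModWeb.mk (strand 2) :=
  ModWeb.mkHom (P := dotPresentation z) startDot₀

/-- The end dot `2 → ∅`. -/
def endDotWeb (z : Kq) :
    ModWeb.mk (P := dotPresentation z) (strand 2) ⟶ ModWeb.mk (𝟙_ AWeb) :=
  ModWeb.mkHom (P := dotPresentation z) endDot₀

/-- The number `q^{n + 1 - 2i}` for `i ∈ {1, …, n}` (which is `i + 1` for `i : Fin n`). -/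
def capCoeff {n : ℕ} (i : Fin n) : Kq := q ^ ((n : ℤ) + 1 - 2 * ((i : ℤ) + 1))

/-- The exterior presentation functor for `U'_q(so_n)`, from the cup-web category at `z = q^n`: it
sends `a` to the exterior power `Λ^a V`, extends the given type `A` functor, and sends the cup to
`1 ↦ ∑ v_i ⊗ v_i` and the cap to `v_i ⊗ v_i ↦ q^{n+1-2i}`, `v_i ⊗ v_j ↦ 0` for `i ≠ j`. -/
structure GammaExt {n : ℕ} (Γ : GammaA .ext n) extends GammaMod Γ (cupPresentation (q ^ n)) where
  obj_strand : ∀ a : ℕ+,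
    Nonempty (functor.obj ((modEmb _).obj ⟨strand a⟩) ≅ Res (Kind.ext.pow n a))
  map_cup : toGammaMod.valueOn₁ (cupWeb (q ^ n)) = toGammaMod.ofA _ (∑ i, Γ.vec₂ i i)
  map_cap : ∀ i j, toGammaMod.value (capWeb (q ^ n)) (toGammaMod.ofA _ (Γ.vec₂ i j)) =
    if i = j then capCoeff i else 0

/-- The symmetric presentation functor for `U'_q(so_n)`, from the dot-web category at `z = -q^{-n}`:
it sends `a` to the symmetric power `S^a V`, extends the given type `A` functor, and sends the
start dot to `1 ↦ (1/[2]) ∑ v_i v_i` and the end dot to `v_i v_i ↦ q^{n+1-2i}`, `v_i v_j ↦ 0` for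
`i < j`. -/
structure GammaSym {n : ℕ} (Γ : GammaA .sym n) extends
    GammaMod Γ (dotPresentation (-(q ^ n)⁻¹)) where
  obj_strand : ∀ a : ℕ+,
    Nonempty (functor.obj ((modEmb _).obj ⟨strand a⟩) ≅ Res (Kind.sym.pow n a))
  map_startDot : toGammaMod.valueOn₁ (startDotWeb (-(q ^ n)⁻¹)) =
    (qnum 2)⁻¹ • toGammaMod.ofA _ (∑ i, Γ.vec 2 ![i, i])
  map_endDot : ∀ i j, i ≤ j → toGammaMod.value (endDotWeb (-(q ^ n)⁻¹))
    (toGammaMod.ofA _ (Γ.vec 2 ![i, j])) = if i = j then capCoeff i else 0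

end Functors

open Limits

namespace FinRep
section
variable {A : Type} [Ring A] [Algebra Kq A]

/-- The direct sum of finitely many representations. -/
def pi {J : Type} [Fintype J] (X : J → FinRep A) : FinRep A where
  V := ∀ j, (X j).V
  ρ := AlgHom.ofLinearMap
    { toFun := fun a => LinearMap.pi fun j => (X j).ρ a ∘ₗ LinearMap.proj j
      map_add' := fun a b => by ext; simp
      map_smul' := fun k a => by ext; simp }
    (by ext; simp) (fun a b => by ext; simp)

/-- The projection to a direct summand. -/
def piProj {J : Type} [Fintype J] (X : J → FinRep A) (j : J) : pi X ⟶ X j :=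
  mkHom (X := pi X) (LinearMap.proj j) fun _ => rfl

/-- The inclusion of a direct summand. -/
def piIncl {J : Type} [Fintype J] [DecidableEq J] (X : J → FinRep A) (j : J) : X j ⟶ pi X :=
  mkHom (Y := pi X) (LinearMap.single Kq (fun j => (X j).V) j) fun a => by
    refine LinearMap.ext fun v => funext fun i => ?_
    change (Pi.single j ((X j).ρ a v) : ∀ j, (X j).V) i =
      (X i).ρ a ((Pi.single j v : ∀ j, (X j).V) i)
    by_cases h : i = j
    · subst h; simp
    · simp [h]

lemma lin_sum {X Y : FinRep A} {J : Type*} (s : Finset J) (f : J → (X ⟶ Y)) :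
    lin (∑ j ∈ s, f j) = ∑ j ∈ s, lin (f j) :=
  map_sum (AddMonoidHom.mk' (lin : (X ⟶ Y) → _) lin_add) f s

instance hasFiniteBiproducts : HasFiniteBiproducts (FinRep A) where
  out n :=
    { has_biproduct := fun f => hasBiproduct_of_total
        { pt := pi f
          π := piProj f
          ι := piIncl f
          ι_π := by
            intro i j
            split_ifs with h
            · subst h
              refine hom_ext (LinearMap.ext fun v => ?_)
              exact Pi.single_eq_same (M := fun j => (f j).V) i v
            · refine hom_ext (LinearMap.ext fun v => ?_)
              exact Pi.single_eq_of_ne (M := fun j => (f j).V) (i := i) (i' := j) (Ne.symm h) v }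
        (by
          refine hom_ext ?_
          rw [lin_sum]
          refine LinearMap.ext fun v => ?_
          rw [LinearMap.sum_apply]
          exact Finset.univ_sum_single (M := fun j => (f j).V) v) }

end

section
variable {A : Type} [Ring A] [Bialgebra Kq A]

instance monoidalPreadditive : MonoidalPreadditive (FinRep A) where
  whiskerLeft_zero := hom_ext (TensorProduct.map_zero_right _)
  zero_whiskerRight := hom_ext (TensorProduct.map_zero_left _)
  whiskerLeft_add _ _ := hom_ext (TensorProduct.map_add_right _ _ _)
  add_whiskerRight _ _ := hom_ext (TensorProduct.map_add_left _ _ _)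

instance monoidalLinear : MonoidalLinear Kq (FinRep A) where
  whiskerLeft_smul _ _ _ r _ := hom_ext (TensorProduct.map_smul_right r _ _)
  smul_whiskerRight r _ _ _ _ := hom_ext (TensorProduct.map_smul_left r _ _)

end
end FinRep

namespace AddClosure

section Summands
variable {C : Type*} [Category.{0} C] [Preadditive C]

/-- The inclusion of a summand of a formal direct sum. -/
def inj (M : Mat_ C) (i : M.ι) : (Mat_.embedding C).obj (M.X i) ⟶ M :=
  single (M := (Mat_.embedding C).obj (M.X i)) (fun _ => i) fun _ => 𝟙 (M.X i)

open Classical in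
/-- The projection to a summand of a formal direct sum. -/
def prj (M : Mat_ C) (i : M.ι) : M ⟶ (Mat_.embedding C).obj (M.X i) :=
  fun j _ => if h : j = i then eqToHom (congrArg M.X h) else 0

lemma sum_apply {ι : Type*} (s : Finset ι) {M N : Mat_ C} (f : ι → (M ⟶ N)) (i : M.ι) (j : N.ι) :
    (∑ k ∈ s, f k) i j = ∑ k ∈ s, f k i j :=
  map_sum (AddMonoidHom.mk' (fun f : M ⟶ N => f i j) fun _ _ => rfl) f s

lemma inj_comp_apply {M N : Mat_ C} (f : M ⟶ N) (i : M.ι) (j : N.ι) (u) :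
    (inj M i ≫ f) u j = f i j := by
  unfold inj
  erw [single_comp_apply]
  exact Category.id_comp _

lemma comp_prj_apply {M N : Mat_ C} (f : M ⟶ N) (i : M.ι) (j : N.ι) (u) :
    (f ≫ prj N j) i u = f i j := by
  rw [Mat_.comp_apply, Finset.sum_eq_single j]
  · simp only [prj, dite_true]
    exact Category.comp_id _
  · intro k _ hk
    simp [prj, hk]
  · simp

lemma inj_comp_prj {M N : Mat_ C} (f : M ⟶ N) (i : M.ι) (j : N.ι) :
    inj M i ≫ f ≫ prj N j = (Mat_.embedding C).map (f i j) := by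
  ext u v
  rw [inj_comp_apply, comp_prj_apply]
  rfl

lemma inj_prj_self (M : Mat_ C) (i : M.ι) : inj M i ≫ prj M i = 𝟙 _ := by
  have := inj_comp_prj (𝟙 M) i i
  rwa [Category.id_comp, Mat_.id_apply_self, CategoryTheory.Functor.map_id] at this

lemma inj_prj_ne (M : Mat_ C) {i j : M.ι} (h : i ≠ j) : inj M i ≫ prj M j = 0 := by
  have := inj_comp_prj (𝟙 M) i j
  rwa [Category.id_comp, Mat_.id_apply_of_ne _ _ _ h, Functor.map_zero] at this

lemma sum_prj_inj (M : Mat_ C) : ∑ i, prj M i ≫ inj M i = 𝟙 M := by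
  classical
  ext j k
  rw [sum_apply, Finset.sum_eq_single k]
  · rw [Mat_.comp_apply]
    simp only [prj, inj, single, Mat_.id_apply, dite_true, eqToHom_refl]
    refine (Fintype.sum_unique (ι := PUnit) _).trans ?_
    exact (congrArg _ (Category.comp_id _)).trans (Category.comp_id _)
  · intro i _ hi
    rw [Mat_.comp_apply]
    simp [inj, single, hi]
  · simp

end Summands

section Ext
variable {C D : Type*} [Category.{0} C] [Preadditive C] [Category* D] [Preadditive D]

/-- Additive functors on the additive closure that agree on the one-term sums are isomorphic. -/
def natIsoExt {F G : Mat_ C ⥤ D} [F.Additive] [G.Additive]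
    (α : Mat_.embedding C ⋙ F ≅ Mat_.embedding C ⋙ G) : F ≅ G := by
  classical
  have key : ∀ {F G : Mat_ C ⥤ D} [F.Additive] [G.Additive]
      (α : Mat_.embedding C ⋙ F ≅ Mat_.embedding C ⋙ G) (M : Mat_ C),
      (∑ i, F.map (prj M i) ≫ α.hom.app (M.X i) ≫ G.map (inj M i)) ≫
        (∑ i, G.map (prj M i) ≫ α.inv.app (M.X i) ≫ F.map (inj M i)) = 𝟙 _ := by
    intro F G _ _ α M
    rw [← F.map_id, ← sum_prj_inj M, F.map_sum, Preadditive.sum_comp]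
    refine Finset.sum_congr rfl fun i _ => ?_
    rw [Preadditive.comp_sum, Finset.sum_eq_single i]
    · have h : G.map (inj M i) ≫ G.map (prj M i) = 𝟙 _ := by
        rw [← G.map_comp, inj_prj_self, G.map_id]
      simp only [Category.assoc, reassoc_of% h, F.map_comp]
      congr 1
      have := α.hom_inv_id_app_assoc (M.X i) (F.map (inj M i))
      exact this
    · intro j _ hj
      have h : G.map (inj M i) ≫ G.map (prj M j) = 0 := by
        rw [← G.map_comp, inj_prj_ne M hj.symm, G.map_zero]
      simp only [Category.assoc, reassoc_of% h, zero_comp, comp_zero]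
    · simp
  exact NatIso.ofComponents (fun M =>
    { hom := ∑ i, F.map (prj M i) ≫ α.hom.app (M.X i) ≫ G.map (inj M i)
      inv := ∑ i, G.map (prj M i) ≫ α.inv.app (M.X i) ≫ F.map (inj M i)
      hom_inv_id := key α M
      inv_hom_id := key α.symm M }) (by
    intro M N f
    dsimp only
    rw [Preadditive.comp_sum, Preadditive.sum_comp]
    have h1 : ∀ j, F.map f ≫ F.map (prj N j) =
        ∑ i, F.map (prj M i) ≫ F.map ((Mat_.embedding C).map (f i j)) := by
      intro j
      rw [← F.map_comp, ← Category.id_comp (f ≫ prj N j), ← sum_prj_inj M, Preadditive.sum_comp,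
        F.map_sum]
      simp only [Category.assoc, inj_comp_prj, F.map_comp]
    have h2 : ∀ i, G.map (inj M i) ≫ G.map f =
        ∑ j, G.map ((Mat_.embedding C).map (f i j)) ≫ G.map (inj N j) := by
      intro i
      rw [← G.map_comp, ← Category.comp_id (inj M i ≫ f), ← sum_prj_inj N, Preadditive.comp_sum,
        G.map_sum]
      simp only [Category.assoc, ← inj_comp_prj, G.map_comp]
    simp only [← Category.assoc (F.map f), h1, Preadditive.sum_comp]
    simp only [Category.assoc, h2, Preadditive.comp_sum]
    rw [Finset.sum_comm]
    refine Finset.sum_congr rfl fun i _ => Finset.sum_congr rfl fun j _ => ?_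
    congr 1
    exact α.hom.naturality_assoc (f i j) (G.map (inj N j)))

end Ext

section Lift
variable {C D : Type*} [Category.{0} C] [Preadditive C] [Category* D] [Preadditive D]
  [HasFiniteBiproducts D] (F : C ⥤ D) [F.Additive]

/-- The extension of an additive functor to the additive closure. -/
def lift : Mat_ C ⥤ D where
  obj M := ⨁ fun i => F.obj (M.X i)
  map f := biproduct.matrix fun i j => F.map (f i j)
  map_id M := by
    classical
    ext i j
    by_cases h : j = i
    · subst h; simp
    · simp [h, biproduct.ι_π_ne _ h]
  map_comp f g := by
    ext i j
    simp only [biproduct.matrix_π, biproduct.ι_desc, Mat_.comp_apply, Functor.map_sum,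
      Functor.map_comp, biproduct.ι_matrix_assoc, Category.assoc, biproduct.lift_desc]

/-- The inclusion of a summand. -/
def liftι (M : Mat_ C) (i : M.ι) : F.obj (M.X i) ⟶ (lift F).obj M :=
  biproduct.ι (fun i => F.obj (M.X i)) i

/-- The projection to a summand. -/
def liftπ (M : Mat_ C) (i : M.ι) : (lift F).obj M ⟶ F.obj (M.X i) :=
  biproduct.π (fun i => F.obj (M.X i)) i

lemma liftι_π_self (M : Mat_ C) (i : M.ι) : liftι F M i ≫ liftπ F M i = 𝟙 _ :=
  biproduct.ι_π_self _ _

lemma liftι_π_ne (M : Mat_ C) {i j : M.ι} (h : i ≠ j) : liftι F M i ≫ liftπ F M j = 0 :=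
  biproduct.ι_π_ne _ h

lemma lift_total (M : Mat_ C) : ∑ i, liftπ F M i ≫ liftι F M i = 𝟙 _ :=
  biproduct.total

lemma liftι_map {M N : Mat_ C} (f : M ⟶ N) (i : M.ι) :
    liftι F M i ≫ (lift F).map f = ∑ j, F.map (f i j) ≫ liftι F N j := by
  rw [← Category.comp_id ((lift F).map f), ← lift_total F N, Preadditive.comp_sum,
    Preadditive.comp_sum]
  refine Finset.sum_congr rfl fun j _ => ?_
  simp only [← Category.assoc]
  congr 1
  simp [lift, liftι, liftπ]

lemma liftι_map_single {M N : Mat_ C} (e : M.ι → N.ι) (φ : ∀ i, M.X i ⟶ N.X (e i)) (i : M.ι) :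
    liftι F M i ≫ (lift F).map (single e φ) = F.map (φ i) ≫ liftι F N (e i) := by
  rw [liftι_map, Finset.sum_eq_single (e i)]
  · rw [single_apply_self]
  · intro j _ hj
    simp [single, hj.symm]
  · simp

lemma lift_hom_ext {M : Mat_ C} {Z : D} {f g : (lift F).obj M ⟶ Z}
    (h : ∀ i, liftι F M i ≫ f = liftι F M i ≫ g) : f = g :=
  biproduct.hom_ext' _ _ h

instance lift_additive : (lift F).Additive where
  map_add {M N f g} := by
    refine lift_hom_ext F fun i => ?_
    simp only [Preadditive.comp_add, liftι_map, Mat_.add_apply, Functor.map_add,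
      Preadditive.add_comp, Finset.sum_add_distrib]

instance lift_linear [Linear Kq C] [Linear Kq D] [F.Linear Kq] : (lift F).Linear Kq where
  map_smul {M N} f r := by
    refine lift_hom_ext F fun i => ?_
    have h : ∀ j, (r • f) i j = r • f i j := fun j => rfl
    simp only [Linear.comp_smul, liftι_map, h, Functor.map_smul, Linear.smul_comp,
      Finset.smul_sum]

/-- The value of the extension on a one-term sum. -/
def liftEmb (X : C) : (lift F).obj ((Mat_.embedding C).obj X) ≅ F.obj X where
  hom := liftπ F ((Mat_.embedding C).obj X) PUnit.unit
  inv := liftι F ((Mat_.embedding C).obj X) PUnit.unit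
  hom_inv_id := by
    exact (Fintype.sum_unique (ι := PUnit) fun i => liftπ F ((Mat_.embedding C).obj X) i ≫
      liftι F ((Mat_.embedding C).obj X) i).symm.trans (lift_total F _)
  inv_hom_id := liftι_π_self F _ _

lemma liftEmb_naturality {X Y : C} (f : X ⟶ Y) :
    (liftEmb F X).inv ≫ (lift F).map ((Mat_.embedding C).map f) = F.map f ≫ (liftEmb F Y).inv := by
  refine (liftι_map F ((Mat_.embedding C).map f) PUnit.unit).trans ?_
  exact Fintype.sum_unique (ι := PUnit) _

end Lift

end AddClosure

namespace AddClosure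
section LiftMonoidal
open Functor.LaxMonoidal Functor.OplaxMonoidal Limits
variable {C D : Type*} [Category.{0} C] [Preadditive C] [MonoidalCategory C] [BiadditiveAction C C]
  [Category* D] [Preadditive D] [MonoidalCategory D] [MonoidalPreadditive D]
  [HasFiniteBiproducts D] (F : C ⥤ D) [F.Additive] [F.Monoidal]

lemma lift_hom_ext₂ {M N : Mat_ C} {Z : D} {f g : (lift F).obj M ⊗ (lift F).obj N ⟶ Z}
    (h : ∀ i j, (liftι F M i ⊗ₘ liftι F N j) ≫ f = (liftι F M i ⊗ₘ liftι F N j) ≫ g) : f = g := by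
  refine rightDistributor_ext_left fun i => leftDistributor_ext_left fun j => ?_
  have := h i j
  rw [tensorHom_def', Category.assoc, Category.assoc] at this
  exact this

lemma lift_hom_ext₃ {M N K : Mat_ C} {Z : D}
    {f g : ((lift F).obj M ⊗ (lift F).obj N) ⊗ (lift F).obj K ⟶ Z}
    (h : ∀ i j k, ((liftι F M i ⊗ₘ liftι F N j) ⊗ₘ liftι F K k) ≫ f =
      ((liftι F M i ⊗ₘ liftι F N j) ⊗ₘ liftι F K k) ≫ g) : f = g := by
  have key : ∀ f : ((lift F).obj M ⊗ (lift F).obj N) ⊗ (lift F).obj K ⟶ Z,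
      f = ((𝟙 ((lift F).obj M) ⊗ₘ 𝟙 ((lift F).obj N)) ⊗ₘ 𝟙 ((lift F).obj K)) ≫ f := by simp
  rw [key f, key g, ← lift_total F M, ← lift_total F N, ← lift_total F K]
  simp only [sum_tensor, tensor_sum, Preadditive.sum_comp, ← tensorHom_comp_tensorHom,
    Category.assoc, h]

/-- The inclusion of a summand of a tensor product. -/
def liftι₂ (M N : Mat_ C) (i : M.ι) (j : N.ι) :
    F.obj (M.X i ⊗ N.X j) ⟶ (lift F).obj (M ⊗ N) := liftι F (M ⊗ N) (i, j)

/-- The projection to a summand of a tensor product. -/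
def liftπ₂ (M N : Mat_ C) (i : M.ι) (j : N.ι) :
    (lift F).obj (M ⊗ N) ⟶ F.obj (M.X i ⊗ N.X j) := liftπ F (M ⊗ N) (i, j)

lemma liftι₂_π₂_self (M N : Mat_ C) (i : M.ι) (j : N.ι) :
    liftι₂ F M N i j ≫ liftπ₂ F M N i j = 𝟙 _ := liftι_π_self F (M ⊗ N) (i, j)

lemma liftι₂_π₂_ne (M N : Mat_ C) {i i' : M.ι} {j j' : N.ι} (h : (i, j) ≠ (i', j')) :
    liftι₂ F M N i j ≫ liftπ₂ F M N i' j' = 0 := liftι_π_ne F (M ⊗ N) h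

lemma lift_hom_ext₂' {M N : Mat_ C} {Z : D} {f g : (lift F).obj (M ⊗ N) ⟶ Z}
    (h : ∀ i j, liftι₂ F M N i j ≫ f = liftι₂ F M N i j ≫ g) : f = g :=
  lift_hom_ext F fun p => h p.1 p.2

lemma liftι₂_map {M M' N N' : Mat_ C} (f : M ⟶ M') (g : N ⟶ N') (i : M.ι) (j : N.ι) :
    liftι₂ F M N i j ≫ (lift F).map (f ⊗ₘ g) =
      ∑ i', ∑ j', F.map (f i i' ⊗ₘ g j j') ≫ liftι₂ F M' N' i' j' :=
  (liftι_map F (f ⊗ₘ g : M ⊗ N ⟶ M' ⊗ N') (i, j)).trans (Fintype.sum_prod_type _)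

/-- The tensorator of the extension of a monoidal functor to the additive closure. -/
def liftμHom (M N : Mat_ C) : (lift F).obj M ⊗ (lift F).obj N ⟶ (lift F).obj (M ⊗ N) :=
  ∑ i, ∑ j, (liftπ F M i ⊗ₘ liftπ F N j) ≫ μ F (M.X i) (N.X j) ≫ liftι₂ F M N i j

/-- The inverse of the tensorator. -/
def liftμInv (M N : Mat_ C) : (lift F).obj (M ⊗ N) ⟶ (lift F).obj M ⊗ (lift F).obj N :=
  ∑ i, ∑ j, liftπ₂ F M N i j ≫ δ F (M.X i) (N.X j) ≫ (liftι F M i ⊗ₘ liftι F N j)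

lemma ι_liftμHom (M N : Mat_ C) (i : M.ι) (j : N.ι) :
    (liftι F M i ⊗ₘ liftι F N j) ≫ liftμHom F M N = μ F (M.X i) (N.X j) ≫ liftι₂ F M N i j := by
  simp only [liftμHom, Preadditive.comp_sum]
  rw [Finset.sum_eq_single i, Finset.sum_eq_single j]
  · rw [tensorHom_comp_tensorHom_assoc, liftι_π_self, liftι_π_self, id_tensorHom_id,
      Category.id_comp]
  · intro j' _ h
    rw [tensorHom_comp_tensorHom_assoc, liftι_π_ne F N h.symm, MonoidalCategory.tensorHom_def,
      MonoidalPreadditive.whiskerLeft_zero, comp_zero, zero_comp]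
  · simp
  · intro i' _ h
    refine Finset.sum_eq_zero fun j' _ => ?_
    rw [tensorHom_comp_tensorHom_assoc, liftι_π_ne F M h.symm, MonoidalCategory.tensorHom_def,
      MonoidalPreadditive.zero_whiskerRight, zero_comp, zero_comp]
  · simp

lemma ι_liftμInv (M N : Mat_ C) (i : M.ι) (j : N.ι) :
    liftι₂ F M N i j ≫ liftμInv F M N =
      δ F (M.X i) (N.X j) ≫ (liftι F M i ⊗ₘ liftι F N j) := by
  simp only [liftμInv, Preadditive.comp_sum]
  rw [Finset.sum_eq_single i, Finset.sum_eq_single j]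
  · rw [← Category.assoc, liftι₂_π₂_self, Category.id_comp]
  · intro j' _ h
    rw [← Category.assoc, liftι₂_π₂_ne F M N (fun e => h (congrArg Prod.snd e).symm), zero_comp]
  · simp
  · intro i' _ h
    refine Finset.sum_eq_zero fun j' _ => ?_
    rw [← Category.assoc, liftι₂_π₂_ne F M N (fun e => h (congrArg Prod.fst e).symm), zero_comp]
  · simp

/-- The tensorator as an isomorphism. -/
def liftμ (M N : Mat_ C) : (lift F).obj M ⊗ (lift F).obj N ≅ (lift F).obj (M ⊗ N) where
  hom := liftμHom F M N
  inv := liftμInv F M N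
  hom_inv_id := lift_hom_ext₂ F fun i j => by
    rw [reassoc_of% ι_liftμHom F, ι_liftμInv, Functor.Monoidal.μ_δ_assoc, Category.comp_id]
  inv_hom_id := lift_hom_ext₂' F fun i j => by
    rw [reassoc_of% ι_liftμInv F, ι_liftμHom, Functor.Monoidal.δ_μ_assoc, Category.comp_id]

lemma ι_liftμ (M N : Mat_ C) (i : M.ι) (j : N.ι) :
    (liftι F M i ⊗ₘ liftι F N j) ≫ (liftμ F M N).hom =
      μ F (M.X i) (N.X j) ≫ liftι₂ F M N i j := ι_liftμHom F M N i j

lemma liftμ_naturality {M M' N N' : Mat_ C} (f : M ⟶ M') (g : N ⟶ N') :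
    ((lift F).map f ⊗ₘ (lift F).map g) ≫ (liftμ F M' N').hom =
      (liftμ F M N).hom ≫ (lift F).map (f ⊗ₘ g) := by
  refine lift_hom_ext₂ F fun i j => ?_
  rw [tensorHom_comp_tensorHom_assoc, reassoc_of% ι_liftμ F, liftι_map, liftι_map, liftι₂_map, sum_tensor,
    Preadditive.comp_sum]
  simp only [tensor_sum, Preadditive.sum_comp, Preadditive.comp_sum, ← tensorHom_comp_tensorHom,
    Category.assoc, ι_liftμ]
  refine Finset.sum_congr rfl fun i' _ => Finset.sum_congr rfl fun j' _ => ?_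
  exact μ_natural_assoc F _ _ _

/-- The inclusion of a summand of a threefold tensor product. -/
def liftι₃ (M N K : Mat_ C) (i : M.ι) (j : N.ι) (k : K.ι) :
    F.obj ((M.X i ⊗ N.X j) ⊗ K.X k) ⟶ (lift F).obj ((M ⊗ N) ⊗ K) :=
  liftι F ((M ⊗ N) ⊗ K) ((i, j), k)

/-- The inclusion of a summand of a threefold tensor product. -/
def liftι₃' (M N K : Mat_ C) (i : M.ι) (j : N.ι) (k : K.ι) :
    F.obj (M.X i ⊗ N.X j ⊗ K.X k) ⟶ (lift F).obj (M ⊗ N ⊗ K) :=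
  liftι F (M ⊗ N ⊗ K) (i, j, k)

lemma liftι_assoc (M N K : Mat_ C) (i : M.ι) (j : N.ι) (k : K.ι) :
    liftι₃ F M N K i j k ≫ (lift F).map (α_ M N K).hom =
      F.map (α_ (M.X i) (N.X j) (K.X k)).hom ≫ liftι₃' F M N K i j k :=
  liftι_map_single F (M := (M ⊗ N) ⊗ K) (N := M ⊗ N ⊗ K) (Equiv.prodAssoc M.ι N.ι K.ι)
    (fun p => (α_ (M.X p.1.1) (N.X p.1.2) (K.X p.2)).hom) ((i, j), k)

lemma ι_liftμ₃ (M N K : Mat_ C) (i : M.ι) (j : N.ι) (k : K.ι) :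
    (liftι₂ F M N i j ⊗ₘ liftι F K k) ≫ (liftμ F (M ⊗ N) K).hom =
      μ F (M.X i ⊗ N.X j) (K.X k) ≫ liftι₃ F M N K i j k :=
  ι_liftμ F (M ⊗ N) K (i, j) k

lemma ι_liftμ₃' (M N K : Mat_ C) (i : M.ι) (j : N.ι) (k : K.ι) :
    (liftι F M i ⊗ₘ liftι₂ F N K j k) ≫ (liftμ F M (N ⊗ K)).hom =
      μ F (M.X i) (N.X j ⊗ K.X k) ≫ liftι₃' F M N K i j k :=
  ι_liftμ F M (N ⊗ K) i (j, k)

lemma lift_associativity (M N K : Mat_ C) :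
    (liftμ F M N).hom ▷ (lift F).obj K ≫ (liftμ F (M ⊗ N) K).hom ≫ (lift F).map (α_ M N K).hom =
      (α_ _ _ _).hom ≫ (lift F).obj M ◁ (liftμ F N K).hom ≫ (liftμ F M (N ⊗ K)).hom := by
  refine lift_hom_ext₃ F fun i j k => ?_
  have h3 : ((liftι F M i ⊗ₘ liftι F N j) ⊗ₘ liftι F K k) ≫ (liftμ F M N).hom ▷ (lift F).obj K =
      μ F (M.X i) (N.X j) ▷ F.obj (K.X k) ≫ (liftι₂ F M N i j ⊗ₘ liftι F K k) := by
    rw [← tensorHom_id, tensorHom_comp_tensorHom, ι_liftμ, Category.comp_id, ← tensorHom_id,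
      tensorHom_comp_tensorHom, Category.id_comp]
  have h4 : (liftι F M i ⊗ₘ liftι F N j ⊗ₘ liftι F K k) ≫ (lift F).obj M ◁ (liftμ F N K).hom =
      F.obj (M.X i) ◁ μ F (N.X j) (K.X k) ≫ (liftι F M i ⊗ₘ liftι₂ F N K j k) := by
    rw [← id_tensorHom, tensorHom_comp_tensorHom, ι_liftμ, Category.comp_id, ← id_tensorHom,
      tensorHom_comp_tensorHom, Category.id_comp]
  have h5 := Functor.LaxMonoidal.associativity F (M.X i) (N.X j) (K.X k)
  rw [reassoc_of% h3, reassoc_of% ι_liftμ₃ F, liftι_assoc, associator_naturality_assoc, reassoc_of% h4,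
    ι_liftμ₃']
  simp only [← Category.assoc] at h5 ⊢
  rw [h5]

/-- The inclusion of the unit object into the one-term sum. -/
def liftιUnit : F.obj (𝟙_ C) ⟶ (lift F).obj (𝟙_ (Mat_ C)) := liftι F (𝟙_ (Mat_ C)) PUnit.unit

/-- The inclusion of the unit object into the one-term sum, as an isomorphism. -/
def liftUnit : F.obj (𝟙_ C) ≅ (lift F).obj (𝟙_ (Mat_ C)) := (liftEmb F (𝟙_ C)).symm

/-- The inclusion of a summand of a tensor product with the unit object. -/
def liftιLeft (M : Mat_ C) (i : M.ι) : F.obj (𝟙_ C ⊗ M.X i) ⟶ (lift F).obj (𝟙_ (Mat_ C) ⊗ M) :=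
  liftι F (𝟙_ (Mat_ C) ⊗ M) (PUnit.unit, i)

/-- The inclusion of a summand of a tensor product with the unit object. -/
def liftιRight (M : Mat_ C) (i : M.ι) : F.obj (M.X i ⊗ 𝟙_ C) ⟶ (lift F).obj (M ⊗ 𝟙_ (Mat_ C)) :=
  liftι F (M ⊗ 𝟙_ (Mat_ C)) (i, PUnit.unit)

lemma lift_left_unitality (M : Mat_ C) :
    (λ_ ((lift F).obj M)).hom = (ε F ≫ liftιUnit F) ▷ (lift F).obj M ≫
      (liftμ F (𝟙_ (Mat_ C)) M).hom ≫ (lift F).map (λ_ M).hom := by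
  refine (cancel_epi (λ_ _).inv).mp (lift_hom_ext F fun i => ?_)
  have h1 : (liftιUnit F ⊗ₘ liftι F M i) ≫ (liftμ F (𝟙_ (Mat_ C)) M).hom =
      μ F (𝟙_ C) (M.X i) ≫ liftιLeft F M i := ι_liftμ F _ _ _ _
  have h2 : liftιLeft F M i ≫ (lift F).map (λ_ M).hom = F.map (λ_ (M.X i)).hom ≫ liftι F M i :=
    liftι_map_single F (M := 𝟙_ (Mat_ C) ⊗ M) (N := M) (Equiv.punitProd M.ι)
      (fun p => (λ_ (M.X p.2)).hom) (PUnit.unit, i)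
  rw [Iso.inv_hom_id, Category.comp_id, leftUnitor_inv_naturality_assoc,
    ← tensorHom_id, ← id_tensorHom, tensorHom_comp_tensorHom_assoc, Category.id_comp,
    Category.comp_id, ← Category.id_comp (liftι F M i), ← tensorHom_comp_tensorHom,
    Category.assoc, reassoc_of% h1, h2, tensorHom_id]
  have := Functor.LaxMonoidal.left_unitality F (M.X i)
  rw [← Category.assoc (μ F _ _), ← Category.assoc (ε F ▷ _), ← this,
    Iso.inv_hom_id_assoc, Category.id_comp]

lemma lift_right_unitality (M : Mat_ C) :
    (ρ_ ((lift F).obj M)).hom = (lift F).obj M ◁ (ε F ≫ liftιUnit F) ≫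
      (liftμ F M (𝟙_ (Mat_ C))).hom ≫ (lift F).map (ρ_ M).hom := by
  refine (cancel_epi (ρ_ _).inv).mp (lift_hom_ext F fun i => ?_)
  have h1 : (liftι F M i ⊗ₘ liftιUnit F) ≫ (liftμ F M (𝟙_ (Mat_ C))).hom =
      μ F (M.X i) (𝟙_ C) ≫ liftιRight F M i := ι_liftμ F _ _ _ _
  have h2 : liftιRight F M i ≫ (lift F).map (ρ_ M).hom = F.map (ρ_ (M.X i)).hom ≫ liftι F M i :=
    liftι_map_single F (M := M ⊗ 𝟙_ (Mat_ C)) (N := M) (Equiv.prodPUnit M.ι)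
      (fun p => (ρ_ (M.X p.1)).hom) (i, PUnit.unit)
  rw [Iso.inv_hom_id, Category.comp_id, rightUnitor_inv_naturality_assoc,
    ← tensorHom_id, ← id_tensorHom, tensorHom_comp_tensorHom_assoc, Category.id_comp,
    Category.comp_id, ← Category.id_comp (liftι F M i), ← tensorHom_comp_tensorHom,
    Category.assoc, reassoc_of% h1, h2, id_tensorHom]
  have := Functor.LaxMonoidal.right_unitality F (M.X i)
  rw [← Category.assoc (μ F _ _), ← Category.assoc (_ ◁ ε F), ← this,
    Iso.inv_hom_id_assoc, Category.id_comp]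

instance liftMonoidal : (lift F).Monoidal :=
  Functor.CoreMonoidal.toMonoidal
    { εIso := Functor.Monoidal.εIso F ≪≫ liftUnit F
      μIso := liftμ F
      μIso_hom_natural_left := fun f Y => by
        have := liftμ_naturality F f (𝟙 Y)
        rwa [CategoryTheory.Functor.map_id, tensorHom_id, tensorHom_id] at this
      μIso_hom_natural_right := fun X f => by
        have := liftμ_naturality F (𝟙 X) f
        rwa [CategoryTheory.Functor.map_id, id_tensorHom, id_tensorHom] at this
      associativity := lift_associativity F
      left_unitality := lift_left_unitality F
      right_unitality := lift_right_unitality F }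

lemma lift_μ_emb (X Y : C) :
    ((liftEmb F X).inv ⊗ₘ (liftEmb F Y).inv) ≫ μ (Mat_.embedding C ⋙ lift F) X Y =
      μ F X Y ≫ (liftEmb F (X ⊗ Y)).inv := by
  have h1 : ((liftEmb F X).inv ⊗ₘ (liftEmb F Y).inv) ≫
      (liftμ F ((Mat_.embedding C).obj X) ((Mat_.embedding C).obj Y)).hom =
        μ F X Y ≫ liftι₂ F ((Mat_.embedding C).obj X) ((Mat_.embedding C).obj Y)
          PUnit.unit PUnit.unit := ι_liftμ F _ _ _ _
  have h2 : (liftι₂ F ((Mat_.embedding C).obj X) ((Mat_.embedding C).obj Y)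
      PUnit.unit PUnit.unit : F.obj (X ⊗ Y) ⟶ _) ≫
        (lift F).map (embAct (C := C) (D := C) X Y).hom =
        F.map (𝟙 (X ⊗ Y)) ≫ (liftEmb F (X ⊗ Y)).inv :=
    liftι_map_single F (M := (Mat_.embedding C).obj X ⊗ (Mat_.embedding C).obj Y)
      (N := (Mat_.embedding C).obj (X ⊗ Y)) (Equiv.punitProd PUnit)
      (fun _ => 𝟙 (X ⊗ Y)) (PUnit.unit, PUnit.unit)
  rw [CategoryTheory.Functor.map_id] at h2
  rw [Functor.LaxMonoidal.comp_μ]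
  refine ((Category.assoc _ _ _).symm.trans (congrArg (· ≫ (lift F).map
    (embAct (C := C) (D := C) X Y).hom) h1)).trans ((Category.assoc _ _ _).trans ?_)
  exact congrArg (μ F X Y ≫ ·) (h2.trans (Category.id_comp _))

end LiftMonoidal
end AddClosure

/-- Objects and morphisms of a linear monoidal category that satisfy the web relations. -/
structure WebData (D : Type*) [Category* D] [Preadditive D] [Linear Kq D] [MonoidalCategory D] where
  /-- the image of the strand `a` -/
  obj : ℕ+ → D
  /-- the image of a merge -/
  merge : ∀ a b c : ℕ+, a + b = c → (obj a ⊗ obj b ⟶ obj c)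
  /-- the image of a split -/
  split : ∀ a b c : ℕ+, a + b = c → (obj c ⟶ obj a ⊗ obj b)
  merge_assoc : ∀ (a b c ab bc abc : ℕ+) (h₁ : a + b = ab) (h₂ : ab + c = abc) (h₃ : b + c = bc)
    (h₄ : a + bc = abc), merge a b ab h₁ ▷ obj c ≫ merge ab c abc h₂ =
      (α_ _ _ _).hom ≫ obj a ◁ merge b c bc h₃ ≫ merge a bc abc h₄
  split_coassoc : ∀ (a b c ab bc abc : ℕ+) (h₁ : a + b = ab) (h₂ : ab + c = abc) (h₃ : b + c = bc)
    (h₄ : a + bc = abc), split ab c abc h₂ ≫ split a b ab h₁ ▷ obj c =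
      split a bc abc h₄ ≫ obj a ◁ split b c bc h₃ ≫ (α_ _ _ _).inv
  square : ∀ a b : ℕ+,
    split a 1 (a + 1) rfl ▷ obj (b + 1) ≫ (α_ _ _ _).hom ≫
      obj a ◁ (merge 1 (b + 1) _ rfl ≫ split 1 (b + 1) _ rfl) ≫ (α_ _ _ _).inv ≫
        merge a 1 (a + 1) rfl ▷ obj (b + 1) =
    obj (a + 1) ◁ split 1 b (b + 1) (add_comm 1 b) ≫ (α_ _ _ _).inv ≫
      (merge (a + 1) 1 _ rfl ≫ split (a + 1) 1 _ rfl) ▷ obj b ≫ (α_ _ _ _).hom ≫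
        obj (a + 1) ◁ merge 1 b (b + 1) (add_comm 1 b) + qnum ((a : ℤ) - b) • 𝟙 _
  square_left : ∀ b : ℕ+, merge 1 (b + 1) _ rfl ≫ split 1 (b + 1) _ rfl =
    obj 1 ◁ split 1 b (b + 1) (add_comm 1 b) ≫ (α_ _ _ _).inv ≫
      (merge 1 1 _ rfl ≫ split 1 1 _ rfl) ▷ obj b ≫ (α_ _ _ _).hom ≫
        obj 1 ◁ merge 1 b (b + 1) (add_comm 1 b) + qnum (-(b : ℤ)) • 𝟙 _
  square_right : ∀ a : ℕ+,
    split a 1 (a + 1) rfl ▷ obj 1 ≫ (α_ _ _ _).hom ≫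
      obj a ◁ (merge 1 1 _ rfl ≫ split 1 1 _ rfl) ≫ (α_ _ _ _).inv ≫
        merge a 1 (a + 1) rfl ▷ obj 1 =
    merge (a + 1) 1 _ rfl ≫ split (a + 1) 1 _ rfl + qnum a • 𝟙 _
  digon_right : ∀ a : ℕ+, split a 1 (a + 1) rfl ≫ merge a 1 (a + 1) rfl =
    qnum ((a : ℤ) + 1) • 𝟙 _
  digon_left : ∀ b : ℕ+, split 1 b (b + 1) (add_comm 1 b) ≫ merge 1 b (b + 1) (add_comm 1 b) =
    qnum ((b : ℤ) + 1) • 𝟙 _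

namespace WebData
variable {D : Type*} [Category* D] [Preadditive D] [Linear Kq D] [MonoidalCategory D]
  (W : WebData D)

/-- The image of a word. -/
def word : List ℕ+ → D
  | [] => 𝟙_ D
  | a :: X => W.obj a ⊗ word X

/-- The compatibility with concatenation of words. -/
def wordμ : ∀ X Y : List ℕ+, W.word X ⊗ W.word Y ≅ W.word (X ++ Y)
  | [], Y => λ_ (W.word Y)
  | a :: X, Y => α_ (W.obj a) (W.word X) (W.word Y) ≪≫ whiskerLeftIso (W.obj a) (wordμ X Y)

lemma eqToHom_cons (a : ℕ+) {X Y : List ℕ+} (h : X = Y)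
    (h' : W.word (a :: X) = W.word (a :: Y)) :
    eqToHom h' = W.obj a ◁ eqToHom (congrArg W.word h) := by
  subst h
  exact (whiskerLeft_id _ _).symm

lemma cons_assoc_aux (A : D) {X Y Z XY YZ XYZ XYZ' : D} (u : X ⊗ Y ⟶ XY) (v : XY ⊗ Z ⟶ XYZ)
    (e : XYZ ⟶ XYZ') (u' : Y ⊗ Z ⟶ YZ) (v' : X ⊗ YZ ⟶ XYZ')
    (h : u ▷ Z ≫ v ≫ e = (α_ X Y Z).hom ≫ X ◁ u' ≫ v') :
    ((α_ A X Y).hom ≫ A ◁ u) ▷ Z ≫ ((α_ A XY Z).hom ≫ A ◁ v) ≫ A ◁ e =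
      (α_ (A ⊗ X) Y Z).hom ≫ (A ⊗ X) ◁ u' ≫ (α_ A X YZ).hom ≫ A ◁ v' := by
  have h' := congrArg (fun t => (α_ A X Y).hom ▷ Z ≫ (α_ A (X ⊗ Y) Z).hom ≫ A ◁ t) h
  simp only [whiskerLeft_comp] at h'
  simp only [comp_whiskerRight, Category.assoc, associator_naturality_middle_assoc, h']
  simp

lemma cons_nil_aux (A : D) {X Y : D} (u : X ⊗ 𝟙_ D ⟶ Y) (e : Y ⟶ X)
    (h : u ≫ e = (ρ_ X).hom) : ((α_ A X (𝟙_ D)).hom ≫ A ◁ u) ≫ A ◁ e = (ρ_ (A ⊗ X)).hom := by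
  rw [Category.assoc, ← whiskerLeft_comp, h]
  simp

lemma wordμ_assoc : ∀ X Y Z : List ℕ+,
    (W.wordμ X Y).hom ▷ W.word Z ≫ (W.wordμ (X ++ Y) Z).hom ≫
      eqToHom (congrArg W.word (List.append_assoc X Y Z)) =
    (α_ _ _ _).hom ≫ W.word X ◁ (W.wordμ Y Z).hom ≫ (W.wordμ X (Y ++ Z)).hom
  | [], Y, Z => by
    simp [wordμ, word]
  | a :: X, Y, Z => by
    have ih := wordμ_assoc X Y Z
    refine Eq.trans (congrArg (fun t => (W.wordμ (a :: X) Y).hom ▷ W.word Z ≫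
      (W.wordμ (a :: (X ++ Y)) Z).hom ≫ t) (eqToHom_cons W a (List.append_assoc X Y Z) _)) ?_
    exact cons_assoc_aux (W.obj a) _ _ _ _ _ ih

lemma wordμ_nil : ∀ X : List ℕ+, (W.wordμ X []).hom ≫
    eqToHom (congrArg W.word (List.append_nil X)) = (ρ_ (W.word X)).hom
  | [] => by simp [wordμ, word, unitors_equal]
  | a :: X => by
    have ih := wordμ_nil X
    refine Eq.trans (congrArg (fun t => (W.wordμ (a :: X) []).hom ≫ t)
      (eqToHom_cons W a (List.append_nil X) _)) ?_
    exact cons_nil_aux (W.obj a) _ _ ih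

/-- The value on a one-letter word. -/
def word₁ (a : ℕ+) : W.word [a] ≅ W.obj a := ρ_ (W.obj a)

/-- The value on a two-letter word. -/
def word₂ (a b : ℕ+) : W.word [a, b] ≅ W.obj a ⊗ W.obj b :=
  whiskerLeftIso (W.obj a) (ρ_ (W.obj b))

/-- The value on a three-letter word. -/
def word₃ (a b c : ℕ+) : W.word [a, b, c] ≅ W.obj a ⊗ W.obj b ⊗ W.obj c :=
  whiskerLeftIso (W.obj a) (whiskerLeftIso (W.obj b) (ρ_ (W.obj c)))

/-- The value on formal expressions for webs. -/
def eval : ∀ {X Y : List ℕ+}, AWeb.Pre X Y → (W.word X ⟶ W.word Y)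
  | _, _, .id X => 𝟙 (W.word X)
  | _, _, .comp f g => eval f ≫ eval g
  | _, _, .tensor f g => (W.wordμ _ _).inv ≫ (eval f ⊗ₘ eval g) ≫ (W.wordμ _ _).hom
  | _, _, .merge a b c h => (W.word₂ a b).hom ≫ W.merge a b c h ≫ (W.word₁ c).inv
  | _, _, .split a b c h => (W.word₁ c).hom ≫ W.split a b c h ≫ (W.word₂ a b).inv
  | _, _, .zero => 0
  | _, _, .add f g => eval f + eval g
  | _, _, .smul k f => k • eval f

lemma eval_eqHom {X Y : List ℕ+} (h : X = Y) :
    W.eval (.eqHom h) = eqToHom (congrArg W.word h) := by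
  subst h; rfl

section Aux
variable {A B C E F : D}

lemma aux_tensor_id₂₁ (f' : A ⊗ B ⟶ E) (C : D) :
    (α_ A (B ⊗ 𝟙_ D) (C ⊗ 𝟙_ D) ≪≫ whiskerLeftIso A (α_ B (𝟙_ D) (C ⊗ 𝟙_ D) ≪≫
      whiskerLeftIso B (λ_ (C ⊗ 𝟙_ D)))).inv ≫
      ((A ◁ (ρ_ B).hom ≫ f' ≫ (ρ_ E).inv) ⊗ₘ 𝟙 (C ⊗ 𝟙_ D)) ≫
      (α_ E (𝟙_ D) (C ⊗ 𝟙_ D) ≪≫ whiskerLeftIso E (λ_ (C ⊗ 𝟙_ D))).hom =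
    A ◁ B ◁ (ρ_ C).hom ≫ (α_ A B C).inv ≫ f' ▷ C ≫ E ◁ (ρ_ C).inv := by
  simp only [Iso.trans_inv, Iso.trans_hom, whiskerLeftIso_inv, whiskerLeftIso_hom]
  monoidal

lemma aux_tensor_id₁₂ (f' : E ⟶ A ⊗ B) (C : D) :
    (α_ E (𝟙_ D) (C ⊗ 𝟙_ D) ≪≫ whiskerLeftIso E (λ_ (C ⊗ 𝟙_ D))).inv ≫
      (((ρ_ E).hom ≫ f' ≫ A ◁ (ρ_ B).inv) ⊗ₘ 𝟙 (C ⊗ 𝟙_ D)) ≫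
      (α_ A (B ⊗ 𝟙_ D) (C ⊗ 𝟙_ D) ≪≫ whiskerLeftIso A (α_ B (𝟙_ D) (C ⊗ 𝟙_ D) ≪≫
        whiskerLeftIso B (λ_ (C ⊗ 𝟙_ D)))).hom =
    E ◁ (ρ_ C).hom ≫ f' ▷ C ≫ (α_ A B C).hom ≫ A ◁ B ◁ (ρ_ C).inv := by
  simp only [Iso.trans_inv, Iso.trans_hom, whiskerLeftIso_inv, whiskerLeftIso_hom]
  monoidal

lemma aux_tensor_id₂₂ (f' : A ⊗ B ⟶ E ⊗ F) (C : D) :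
    (α_ A (B ⊗ 𝟙_ D) (C ⊗ 𝟙_ D) ≪≫ whiskerLeftIso A (α_ B (𝟙_ D) (C ⊗ 𝟙_ D) ≪≫
      whiskerLeftIso B (λ_ (C ⊗ 𝟙_ D)))).inv ≫
      ((A ◁ (ρ_ B).hom ≫ f' ≫ E ◁ (ρ_ F).inv) ⊗ₘ 𝟙 (C ⊗ 𝟙_ D)) ≫
      (α_ E (F ⊗ 𝟙_ D) (C ⊗ 𝟙_ D) ≪≫ whiskerLeftIso E (α_ F (𝟙_ D) (C ⊗ 𝟙_ D) ≪≫
        whiskerLeftIso F (λ_ (C ⊗ 𝟙_ D)))).hom =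
    A ◁ B ◁ (ρ_ C).hom ≫ (α_ A B C).inv ≫ f' ▷ C ≫ (α_ E F C).hom ≫ E ◁ F ◁ (ρ_ C).inv := by
  simp only [Iso.trans_inv, Iso.trans_hom, whiskerLeftIso_inv, whiskerLeftIso_hom]
  monoidal

lemma aux_id_tensor {M N : D} (f' : M ⟶ N) (C : D) :
    (α_ C (𝟙_ D) M ≪≫ whiskerLeftIso C (λ_ M)).inv ≫ (𝟙 (C ⊗ 𝟙_ D) ⊗ₘ f') ≫
      (α_ C (𝟙_ D) N ≪≫ whiskerLeftIso C (λ_ N)).hom = C ◁ f' := by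
  simp only [Iso.trans_inv, Iso.trans_hom, whiskerLeftIso_inv, whiskerLeftIso_hom]
  monoidal

end Aux

section Whisker
variable {W}

lemma eval_tensor_eq {X Y X' Y' : List ℕ+} {f : AWeb.Pre X Y} {g : AWeb.Pre X' Y'}
    {f' : W.word X ⟶ W.word Y} (h : W.eval f = f') : W.eval (.tensor f g) =
      (W.wordμ _ _).inv ≫ (f' ⊗ₘ W.eval g) ≫ (W.wordμ _ _).hom := by
  subst h; rfl

lemma eval_id_tensor {Y Y' : List ℕ+} {f : AWeb.Pre Y Y'} {f' : W.word Y ⟶ W.word Y'}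
    (h : W.eval f = f') (c : ℕ+) : W.eval (.tensor (.id [c]) f) = W.obj c ◁ f' := by
  subst h; exact aux_id_tensor _ _

lemma eval_tensor_id₂₁ {a b d : ℕ+} {f : AWeb.Pre [a, b] [d]} {f' : W.obj a ⊗ W.obj b ⟶ W.obj d}
    (h : W.eval f = (W.word₂ a b).hom ≫ f' ≫ (W.word₁ d).inv) (c : ℕ+) :
    W.eval (.tensor f (.id [c])) = (W.word₃ a b c).hom ≫ (α_ _ _ _).inv ≫ f' ▷ W.obj c ≫
      (W.word₂ d c).inv :=
  (eval_tensor_eq h).trans (aux_tensor_id₂₁ _ _)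

lemma eval_tensor_id₁₂ {a b d : ℕ+} {f : AWeb.Pre [d] [a, b]} {f' : W.obj d ⟶ W.obj a ⊗ W.obj b}
    (h : W.eval f = (W.word₁ d).hom ≫ f' ≫ (W.word₂ a b).inv) (c : ℕ+) :
    W.eval (.tensor f (.id [c])) = (W.word₂ d c).hom ≫ f' ▷ W.obj c ≫ (α_ _ _ _).hom ≫
      (W.word₃ a b c).inv :=
  (eval_tensor_eq h).trans (aux_tensor_id₁₂ _ _)

lemma eval_tensor_id₂₂ {a b d e : ℕ+} {f : AWeb.Pre [a, b] [d, e]}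
    {f' : W.obj a ⊗ W.obj b ⟶ W.obj d ⊗ W.obj e}
    (h : W.eval f = (W.word₂ a b).hom ≫ f' ≫ (W.word₂ d e).inv) (c : ℕ+) :
    W.eval (.tensor f (.id [c])) = (W.word₃ a b c).hom ≫ (α_ _ _ _).inv ≫ f' ▷ W.obj c ≫
      (α_ _ _ _).hom ≫ (W.word₃ d e c).inv :=
  (eval_tensor_eq h).trans (aux_tensor_id₂₂ _ _)

lemma eval_id_tensor₂₁ {a b d : ℕ+} {f : AWeb.Pre [a, b] [d]} {f' : W.obj a ⊗ W.obj b ⟶ W.obj d}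
    (h : W.eval f = (W.word₂ a b).hom ≫ f' ≫ (W.word₁ d).inv) (c : ℕ+) :
    W.eval (.tensor (.id [c]) f) = (W.word₃ c a b).hom ≫ W.obj c ◁ f' ≫ (W.word₂ c d).inv := by
  refine (eval_id_tensor h c).trans ?_
  rw [whiskerLeft_comp, whiskerLeft_comp]
  rfl

lemma eval_id_tensor₁₂ {a b d : ℕ+} {f : AWeb.Pre [d] [a, b]} {f' : W.obj d ⟶ W.obj a ⊗ W.obj b}
    (h : W.eval f = (W.word₁ d).hom ≫ f' ≫ (W.word₂ a b).inv) (c : ℕ+) :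
    W.eval (.tensor (.id [c]) f) = (W.word₂ c d).hom ≫ W.obj c ◁ f' ≫ (W.word₃ c a b).inv := by
  refine (eval_id_tensor h c).trans ?_
  rw [whiskerLeft_comp, whiskerLeft_comp]
  rfl

lemma eval_id_tensor₂₂ {a b d e : ℕ+} {f : AWeb.Pre [a, b] [d, e]}
    {f' : W.obj a ⊗ W.obj b ⟶ W.obj d ⊗ W.obj e}
    (h : W.eval f = (W.word₂ a b).hom ≫ f' ≫ (W.word₂ d e).inv) (c : ℕ+) :
    W.eval (.tensor (.id [c]) f) = (W.word₃ c a b).hom ≫ W.obj c ◁ f' ≫ (W.word₃ c d e).inv := by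
  refine (eval_id_tensor h c).trans ?_
  rw [whiskerLeft_comp, whiskerLeft_comp]
  rfl

end Whisker

lemma eval_comp {X Y Z : List ℕ+} (f : AWeb.Pre X Y) (g : AWeb.Pre Y Z) :
    W.eval (.comp f g) = W.eval f ≫ W.eval g := rfl

lemma eval_add {X Y : List ℕ+} (f g : AWeb.Pre X Y) :
    W.eval (.add f g) = W.eval f + W.eval g := rfl

lemma eval_smul {X Y : List ℕ+} (k : Kq) (f : AWeb.Pre X Y) :
    W.eval (.smul k f) = k • W.eval f := rfl

lemma eval_id (X : List ℕ+) : W.eval (.id X) = 𝟙 (W.word X) := rfl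

lemma eval_merge (a b c : ℕ+) (h : a + b = c) :
    W.eval (.merge a b c h) = (W.word₂ a b).hom ≫ W.merge a b c h ≫ (W.word₁ c).inv := rfl

lemma eval_split (a b c : ℕ+) (h : a + b = c) :
    W.eval (.split a b c h) = (W.word₁ c).hom ≫ W.split a b c h ≫ (W.word₂ a b).inv := rfl

lemma eval_ms (a b : ℕ+) : W.eval (.ms a b) =
    (W.word₂ a b).hom ≫ (W.merge a b _ rfl ≫ W.split a b _ rfl) ≫ (W.word₂ a b).inv := by
  simp [AWeb.Pre.ms, eval]

variable [MonoidalPreadditive D] [MonoidalLinear Kq D]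

lemma eval_rel {X Y : List ℕ+} {f g : AWeb.Pre X Y} (h : AWeb.Pre.Rel f g) :
    W.eval f = W.eval g := by
  induction h with
  | refl => rfl
  | symm _ ih => exact ih.symm
  | trans _ _ ih ih' => exact ih.trans ih'
  | comp_congr _ _ ih ih' => simp only [eval, ih, ih']
  | tensor_congr _ _ ih ih' => simp only [eval, ih, ih']
  | add_congr _ _ ih ih' => simp only [eval, ih, ih']
  | smul_congr k _ ih => simp only [eval, ih]
  | id_comp => simp only [eval, Category.id_comp]
  | comp_id => simp only [eval, Category.comp_id]
  | comp_assoc => simp only [eval, Category.assoc]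
  | add_assoc => simp only [eval, add_assoc]
  | add_comm => simp only [eval, add_comm]
  | zero_add => simp only [eval, zero_add]
  | zero_smul => simp only [eval, zero_smul]
  | one_smul => simp only [eval, one_smul]
  | mul_smul => simp only [eval, mul_smul]
  | add_smul => simp only [eval, add_smul]
  | smul_add => simp only [eval, smul_add]
  | add_comp => simp only [eval, Preadditive.add_comp]
  | comp_add => simp only [eval, Preadditive.comp_add]
  | smul_comp => simp only [eval, Linear.smul_comp]
  | comp_smul => simp only [eval, Linear.comp_smul]
  | add_tensor =>
    simp only [eval, MonoidalPreadditive.add_tensor, Preadditive.add_comp, Preadditive.comp_add]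
  | tensor_add =>
    simp only [eval, MonoidalPreadditive.tensor_add, Preadditive.add_comp, Preadditive.comp_add]
  | smul_tensor =>
    simp only [eval, MonoidalCategory.tensorHom_def, MonoidalLinear.smul_whiskerRight,
      Linear.smul_comp, Linear.comp_smul]
  | tensor_smul =>
    simp only [eval, MonoidalCategory.tensorHom_def, MonoidalLinear.whiskerLeft_smul,
      Linear.smul_comp, Linear.comp_smul]
  | tensor_id => simp [eval]
  | interchange => simp [eval]
  | unit_tensor f => simp [eval, wordμ, word]
  | @tensor_unit X Y f =>
    simp only [eval, eval_eqHom]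
    rw [Iso.inv_comp_eq, ← cancel_mono (eqToHom (congrArg W.word (List.append_nil Y)))]
    simp only [Category.assoc, eqToHom_trans, eqToHom_refl, Category.comp_id, wordμ_nil]
    rw [← Category.assoc (W.wordμ X []).hom, wordμ_nil]
    simp [word]
  | @tensor_assoc X Y X' Y' X'' Y'' f g h =>
    simp only [eval, eval_eqHom]
    rw [Iso.inv_comp_eq, ← cancel_mono (eqToHom (congrArg W.word (List.append_assoc Y Y' Y'')))]
    simp only [Category.assoc, eqToHom_trans, eqToHom_refl, Category.comp_id]
    rw [← cancel_epi ((W.wordμ X X').hom ▷ W.word X'')]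
    have h1 := W.wordμ_assoc X X' X''
    have h2 := W.wordμ_assoc Y Y' Y''
    rw [reassoc_of% h1, Iso.hom_inv_id_assoc]
    have h3 : (W.wordμ X X').hom ▷ W.word X'' ≫
        ((W.wordμ X X').inv ≫ (W.eval f ⊗ₘ W.eval g) ≫ (W.wordμ Y Y').hom ⊗ₘ W.eval h) =
        ((W.eval f ⊗ₘ W.eval g) ⊗ₘ W.eval h) ≫ (W.wordμ Y Y').hom ▷ W.word Y'' := by
      rw [← tensorHom_id, ← tensorHom_id, tensorHom_comp_tensorHom, tensorHom_comp_tensorHom,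
        Category.id_comp, Category.comp_id, Iso.hom_inv_id_assoc]
    have h4 : W.word X ◁ (W.wordμ X' X'').hom ≫
        (W.eval f ⊗ₘ (W.wordμ X' X'').inv ≫ (W.eval g ⊗ₘ W.eval h) ≫ (W.wordμ Y' Y'').hom) =
        (W.eval f ⊗ₘ W.eval g ⊗ₘ W.eval h) ≫ W.word Y ◁ (W.wordμ Y' Y'').hom := by
      rw [← id_tensorHom, ← id_tensorHom, tensorHom_comp_tensorHom, tensorHom_comp_tensorHom,
        Category.id_comp, Category.comp_id, Iso.hom_inv_id_assoc]
    rw [reassoc_of% h3, h2, reassoc_of% h4, associator_naturality_assoc]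
  | merge_assoc a b c ab bc abc h₁ h₂ h₃ h₄ =>
    rw [eval, eval, eval_tensor_id₂₁ (W.eval_merge a b ab h₁),
      eval_id_tensor₂₁ (W.eval_merge b c bc h₃), eval_merge, eval_merge]
    have := W.merge_assoc a b c ab bc abc h₁ h₂ h₃ h₄
    simp only [Category.assoc, Iso.inv_hom_id_assoc]
    rw [reassoc_of% this, Iso.inv_hom_id_assoc]
  | split_coassoc a b c ab bc abc h₁ h₂ h₃ h₄ =>
    rw [eval, eval, eval_tensor_id₁₂ (W.eval_split a b ab h₁),
      eval_id_tensor₁₂ (W.eval_split b c bc h₃), eval_split, eval_split]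
    have := W.split_coassoc a b c ab bc abc h₁ h₂ h₃ h₄
    simp only [Category.assoc, Iso.inv_hom_id_assoc]
    rw [reassoc_of% this, Iso.inv_hom_id_assoc]
  | square a b =>
    simp only [eval_comp, eval_add, eval_smul, eval_id]
    rw [eval_tensor_id₁₂ (W.eval_split a 1 _ rfl), eval_id_tensor₂₂ (W.eval_ms 1 (b + 1)),
      eval_tensor_id₂₁ (W.eval_merge a 1 _ rfl),
      eval_id_tensor₁₂ (W.eval_split 1 b _ (_root_.add_comm 1 b)),
      eval_tensor_id₂₂ (W.eval_ms (a + 1) 1),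
      eval_id_tensor₂₁ (W.eval_merge 1 b _ (_root_.add_comm 1 b))]
    have := W.square a b
    rw [← cancel_epi (W.word₂ (a + 1) (b + 1)).inv, ← cancel_mono (W.word₂ (a + 1) (b + 1)).hom]
    simpa using this
  | square_left b =>
    simp only [eval_comp, eval_add, eval_smul, eval_id]
    rw [eval_id_tensor₁₂ (W.eval_split 1 b _ (_root_.add_comm 1 b)),
      eval_tensor_id₂₂ (W.eval_ms 1 1),
      eval_id_tensor₂₁ (W.eval_merge 1 b _ (_root_.add_comm 1 b)), eval_ms]
    have := W.square_left b
    rw [← cancel_epi (W.word₂ 1 (b + 1)).inv, ← cancel_mono (W.word₂ 1 (b + 1)).hom]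
    simpa using this
  | square_right a =>
    simp only [eval_comp, eval_add, eval_smul, eval_id]
    rw [eval_tensor_id₁₂ (W.eval_split a 1 _ rfl), eval_id_tensor₂₂ (W.eval_ms 1 1),
      eval_tensor_id₂₁ (W.eval_merge a 1 _ rfl), eval_ms]
    have := W.square_right a
    rw [← cancel_epi (W.word₂ (a + 1) 1).inv, ← cancel_mono (W.word₂ (a + 1) 1).hom]
    simpa using this
  | digon_right a =>
    simp only [eval_comp, eval_smul, eval_id, eval_split, eval_merge]
    have := W.digon_right a
    rw [← cancel_epi (W.word₁ (a + 1)).inv, ← cancel_mono (W.word₁ (a + 1)).hom]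
    simpa using this
  | digon_left b =>
    simp only [eval_comp, eval_smul, eval_id, eval_split, eval_merge]
    have := W.digon_left b
    rw [← cancel_epi (W.word₁ (b + 1)).inv, ← cancel_mono (W.word₁ (b + 1)).hom]
    simpa using this

/-- The functor on webs. -/
def functor : AWeb ⥤ D where
  obj X := W.word X.word
  map {X Y} f := Quotient.lift (s := AWeb.Pre.setoid X.word Y.word) W.eval
    (fun _ _ h => W.eval_rel h) f
  map_id _ := rfl
  map_comp := by rintro X Y Z ⟨f⟩ ⟨g⟩; rfl

instance : W.functor.Additive where
  map_add := by rintro X Y ⟨f⟩ ⟨g⟩; rfl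

instance : W.functor.Linear Kq where
  map_smul := by rintro X Y ⟨f⟩ k; rfl

instance functorMonoidal : W.functor.Monoidal :=
  Functor.CoreMonoidal.toMonoidal
    { εIso := Iso.refl _
      μIso := fun X Y => W.wordμ X.word Y.word
      μIso_hom_natural_left := by
        rintro X Y ⟨f⟩ Z
        change W.eval f ▷ W.word Z.word ≫ _ =
          _ ≫ (W.wordμ _ _).inv ≫ (W.eval f ⊗ₘ 𝟙 (W.word Z.word)) ≫ (W.wordμ _ _).hom
        rw [Iso.hom_inv_id_assoc, tensorHom_id]
      μIso_hom_natural_right := by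
        rintro X Y Z ⟨f⟩
        change W.word Z.word ◁ W.eval f ≫ _ =
          _ ≫ (W.wordμ _ _).inv ≫ (𝟙 (W.word Z.word) ⊗ₘ W.eval f) ≫ (W.wordμ _ _).hom
        rw [Iso.hom_inv_id_assoc, id_tensorHom]
      associativity := fun X Y Z => by
        have h := W.wordμ_assoc X.word Y.word Z.word
        have h' : W.functor.map (α_ X Y Z).hom =
            eqToHom (congrArg W.word (List.append_assoc X.word Y.word Z.word)) := by
          exact eqToHom_map W.functor
            (congrArg AWeb.mk (List.append_assoc X.word Y.word Z.word))
        rw [h']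
        exact h
      left_unitality := fun X => by
        change (λ_ (W.word X.word)).hom = 𝟙 (𝟙_ D) ▷ _ ≫ (λ_ (W.word X.word)).hom ≫ 𝟙 _
        simp
      right_unitality := fun X => by
        have h := W.wordμ_nil X.word
        have h' : W.functor.map (ρ_ X).hom =
            eqToHom (congrArg W.word (List.append_nil X.word)) := by
          exact eqToHom_map W.functor (congrArg AWeb.mk (List.append_nil X.word))
        rw [h']
        exact h.symm.trans ((Category.id_comp _).symm.trans
          (congrArg (fun t => t ≫ _) (whiskerLeft_id _ _).symm)) }

end WebData

/-! ### Occupation numbers -/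

section Occupation
variable {n : ℕ}

/-- The occupation number function of a single letter. -/
abbrev unitOcc (i : Fin n) : Fin n → ℕ := Pi.single i 1

/-- The number of letters smaller than `i`. -/
def below (m : Fin n → ℕ) (i : Fin n) : ℕ := ∑ k ∈ Finset.Iio i, m k

/-- The number of letters larger than `i`. -/
def above (m : Fin n → ℕ) (i : Fin n) : ℕ := ∑ k ∈ Finset.Ioi i, m k

/-- The number of letters. -/
def deg (m : Fin n → ℕ) : ℕ := ∑ k, m k

/-- The number of pairs of a letter of `m` and a larger letter of `p`. -/
def cross (m p : Fin n → ℕ) : ℕ := ∑ j, below m j * p j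

lemma below_add (m p : Fin n → ℕ) (i : Fin n) : below (m + p) i = below m i + below p i :=
  Finset.sum_add_distrib

lemma above_add (m p : Fin n → ℕ) (i : Fin n) : above (m + p) i = above m i + above p i :=
  Finset.sum_add_distrib

lemma deg_add (m p : Fin n → ℕ) : deg (m + p) = deg m + deg p := Finset.sum_add_distrib

@[simp] lemma deg_zero : deg (0 : Fin n → ℕ) = 0 := by simp [deg]

@[simp] lemma below_zero (i : Fin n) : below (0 : Fin n → ℕ) i = 0 := by simp [below]

@[simp] lemma above_zero (i : Fin n) : above (0 : Fin n → ℕ) i = 0 := by simp [above]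

lemma deg_unitOcc (i : Fin n) : deg (unitOcc i) = 1 := by simp [deg]

lemma below_unitOcc (j i : Fin n) : below (unitOcc j) i = if j < i then 1 else 0 := by
  simp [below, Pi.single_apply]

lemma above_unitOcc (j i : Fin n) : above (unitOcc j) i = if i < j then 1 else 0 := by
  simp [above, Pi.single_apply]

lemma deg_eq_zero {m : Fin n → ℕ} : deg m = 0 ↔ m = 0 := by
  simp [deg, funext_iff]

lemma below_eq_zero {m : Fin n → ℕ} {i : Fin n} (h : ∀ k < i, m k = 0) : below m i = 0 :=
  Finset.sum_eq_zero fun k hk => h k (Finset.mem_Iio.mp hk)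

lemma deg_eq (m : Fin n → ℕ) (i : Fin n) : deg m = below m i + m i + above m i := by
  have h : (Finset.univ : Finset (Fin n)) = Finset.Iio i ∪ {i} ∪ Finset.Ioi i := by
    ext k
    simp only [Finset.mem_univ, Finset.mem_union, Finset.mem_Iio, Finset.mem_singleton,
      Finset.mem_Ioi, true_iff]
    exact (lt_trichotomy k i).elim (fun h => .inl (.inl h))
      (fun h => h.elim (fun h => .inl (.inr h)) .inr)
  rw [deg, h, Finset.sum_union, Finset.sum_union, Finset.sum_singleton]
  · rfl
  · simp
  · rw [Finset.disjoint_left]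
    intro k hk
    simp only [Finset.mem_union, Finset.mem_Iio, Finset.mem_singleton, Finset.mem_Ioi] at hk ⊢
    exact fun h => hk.elim (fun h' => lt_asymm h h') fun h' => h.ne' h'

lemma cross_add_left (m m' p : Fin n → ℕ) : cross (m + m') p = cross m p + cross m' p := by
  simp [cross, below_add, add_mul, Finset.sum_add_distrib]

lemma cross_add_right (m p p' : Fin n → ℕ) : cross m (p + p') = cross m p + cross m p' := by
  simp [cross, mul_add, Finset.sum_add_distrib]

@[simp] lemma cross_zero_right (p : Fin n → ℕ) : cross p 0 = 0 := by simp [cross]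

lemma cross_unitOcc_right (m : Fin n → ℕ) (i : Fin n) : cross m (unitOcc i) = below m i := by
  simp [cross, Pi.single_apply]

lemma cross_unitOcc_left (m : Fin n → ℕ) (i : Fin n) : cross (unitOcc i) m = above m i := by
  simp only [cross, below_unitOcc, above, ite_mul, one_mul, zero_mul, Finset.sum_ite,
    Finset.sum_const_zero, add_zero]
  congr 1
  ext k
  simp

lemma exists_lowest {m : Fin n → ℕ} (h : m ≠ 0) :
    ∃ (j : Fin n) (m' : Fin n → ℕ), m = m' + unitOcc j ∧ ∀ k < j, m' k = 0 := by
  have hne : (Finset.univ.filter fun j => m j ≠ 0).Nonempty := by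
    by_contra hh
    rw [Finset.not_nonempty_iff_eq_empty, Finset.filter_eq_empty_iff] at hh
    exact h (funext fun k => not_not.mp (hh (Finset.mem_univ k)))
  set j := Finset.min' _ hne with hj
  have hjm : m j ≠ 0 := (Finset.mem_filter.mp (Finset.min'_mem _ hne)).2
  refine ⟨j, m - unitOcc j, (tsub_add_cancel_of_le ?_).symm, fun k hk => ?_⟩
  · intro k
    by_cases hk : k = j
    · subst hk; simpa [Nat.one_le_iff_ne_zero] using hjm
    · simp [Pi.single_apply, hk]
  · have : m k = 0 := by
      by_contra hh
      exact absurd (Finset.min'_le _ k (Finset.mem_filter.mpr ⟨Finset.mem_univ _, hh⟩))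
        (not_le.mpr hk)
    simp [this]

/-- Induction on occupation numbers, adding a letter that is at most the smallest one. -/
lemma occ_induction {P : ∀ _ : ℕ, (Fin n → ℕ) → Prop} (zero : P 0 0)
    (add : ∀ (c : ℕ) (m : Fin n → ℕ) (j : Fin n), deg m = c → (∀ k < j, m k = 0) → P c m →
      P (c + 1) (m + unitOcc j)) (c : ℕ) (m : Fin n → ℕ) (hm : deg m = c) : P c m := by
  induction c generalizing m with
  | zero => rw [deg_eq_zero.mp hm]; exact zero
  | succ c ih =>
    have h : m ≠ 0 := by
      rintro rfl
      simp at hm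
    obtain ⟨j, m', rfl, hj⟩ := exists_lowest h
    rw [deg_add, deg_unitOcc] at hm
    have hm' : deg m' = c := by omega
    exact add c m' j hm' hj (ih m' hm')

end Occupation

namespace Kind
variable {n : ℕ}

/-- The constant in `v_j v_i = s v_i v_j` for `i < j`. -/
def s : Kind → Kq
  | ext => -q⁻¹
  | sym => q

/-- The sign `-1` (exterior) or `1` (symmetric). -/
def b : Kind → Kq
  | ext => -1
  | sym => 1

/-- The scalar `q` (exterior) or `q⁻¹` (symmetric). -/
def r : Kind → Kq
  | ext => q
  | sym => q⁻¹

/-- The occupation numbers of the standard basis vectors. -/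
def Valid (k : Kind) (m : Fin n → ℕ) : Prop := k = ext → ∀ i, m i ≤ 1

lemma s_ne_zero (k : Kind) : k.s ≠ 0 := by
  cases k
  · exact neg_ne_zero.mpr (inv_ne_zero Uq.q_ne_zero)
  · exact Uq.q_ne_zero

lemma r_ne_zero (k : Kind) : k.r ≠ 0 := by
  cases k
  · exact Uq.q_ne_zero
  · exact inv_ne_zero Uq.q_ne_zero

lemma s_mul_r (k : Kind) : k.s * k.r = k.b := by
  have := Uq.q_ne_zero
  cases k <;> simp [s, r, b, this]

lemma b_sq (k : Kind) : k.b * k.b = 1 := by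
  cases k <;> simp [b]

lemma Valid.mono {k : Kind} {m m' : Fin n → ℕ} (h : k.Valid m) (h' : m' ≤ m) : k.Valid m' :=
  fun hk i => (h' i).trans (h hk i)

lemma valid_zero (k : Kind) : k.Valid (0 : Fin n → ℕ) := fun _ _ => zero_le_one

lemma valid_unitOcc (k : Kind) (i : Fin n) : k.Valid (unitOcc i) := fun _ j => by
  by_cases h : j = i <;> simp [Pi.single_apply, h]

/-! ### Left multiplication by a letter -/

lemma _root_.SubRep.mem_sup_left {A : Type} [Ring A] [Algebra Kq A] {X : FinRep A}
    {W W' : SubRep X} {v : X.V} (h : v ∈ W.carrier) : v ∈ (W.sup W').carrier :=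
  Submodule.mem_sup_left h

lemma tmul_mem_idealPart (k : Kind) {a : ℕ} (v : (vecRep n).V) {x : (tensorPow n a).V}
    (hx : x ∈ (idealPart (k.quadRel n) a).carrier) :
    (v ⊗ₜ[Kq] x : (tensorPow n (a + 1)).V) ∈ (idealPart (k.quadRel n) (a + 1)).carrier := by
  cases a with
  | zero =>
    have hx' : x = 0 := (Submodule.mem_bot _).mp hx
    rw [hx', TensorProduct.tmul_zero]
    exact Submodule.zero_mem _
  | succ a =>
    exact SubRep.mem_sup_left (X := tensorPow n (a + 2))
      (LinearMap.mem_range_self (FinRep.lin (vecRep n ◁ (idealPart (k.quadRel n) (a + 1)).incl))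
        (TensorProduct.tmul Kq v (⟨x, hx⟩ : (idealPart (k.quadRel n) (a + 1)).carrier)))

/-- Left multiplication by vectors, as a bilinear map. -/
def lmul (k : Kind) (n a : ℕ) : (vecRep n).V →ₗ[Kq] (k.pow n a).V →ₗ[Kq] (k.pow n (a + 1)).V :=
  ((idealPart (k.quadRel n) a).carrier.liftQ
    (LinearMap.flip (LinearMap.compr₂ (TensorProduct.mk Kq (vecRep n).V (tensorPow n a).V)
      (idealPart (k.quadRel n) (a + 1)).carrier.mkQ)) (by
      intro x hx
      rw [LinearMap.mem_ker]
      ext1 v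
      exact (Submodule.Quotient.mk_eq_zero _).mpr (tmul_mem_idealPart k v hx))).flip

lemma proj_surjective {A : Type} [Ring A] [Algebra Kq A] {X : FinRep A} (W : SubRep X) :
    Function.Surjective (FinRep.lin W.proj) := Submodule.mkQ_surjective _

/-- Descending equivariance along a surjective equivariant map. -/
lemma _root_.FinRep.comm_of_surjective {A : Type} [Ring A] [Algebra Kq A] {X Y Z : FinRep A} (e : X ⟶ Y)
    (he : Function.Surjective (FinRep.lin e)) (g : X ⟶ Z) (f : Y.V →ₗ[Kq] Z.V)
    (h : ∀ x, f (FinRep.lin e x) = FinRep.lin g x) (a : A) : f ∘ₗ Y.ρ a = Z.ρ a ∘ₗ f := by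
  ext y
  obtain ⟨x, rfl⟩ := he y
  have h1 := LinearMap.congr_fun (FinRep.lin_comm e a) x
  have h2 := LinearMap.congr_fun (FinRep.lin_comm g a) x
  simp only [LinearMap.comp_apply] at h1 h2 ⊢
  rw [← h1, h, h2, h]

/-- Left multiplication by vectors. -/
def lmulHom (k : Kind) (n a : ℕ) : (vecRep n ⊗ k.pow n a : FinRep (Uq n)) ⟶ k.pow n (a + 1) :=
  FinRep.mkHom (X := (vecRep n ⊗ k.pow n a : FinRep (Uq n))) (TensorProduct.lift (k.lmul n a))
    (FinRep.comm_of_surjective (vecRep n ◁ (idealPart (k.quadRel n) a).proj)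
      (TensorProduct.map_surjective Function.surjective_id (proj_surjective _))
      (idealPart (k.quadRel n) (a + 1)).proj _ fun x => by
        refine LinearMap.congr_fun (f := TensorProduct.lift (k.lmul n a) ∘ₗ
          TensorProduct.map LinearMap.id (FinRep.lin (idealPart (k.quadRel n) a).proj))
          (g := FinRep.lin (idealPart (k.quadRel n) (a + 1)).proj) ?_ x
        exact TensorProduct.ext' fun v x => rfl)

lemma lmulHom_tmul (k : Kind) {a : ℕ} (v : (vecRep n).V) (x : (k.pow n a).V) :
    FinRep.lin (k.lmulHom n a) (v ⊗ₜ[Kq] x) = k.lmul n a v x := rfl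

lemma lmulHom_surjective (k : Kind) (a : ℕ) :
    Function.Surjective (FinRep.lin (k.lmulHom n a)) := by
  intro y
  obtain ⟨x, rfl⟩ := proj_surjective _ y
  refine ⟨TensorProduct.map LinearMap.id (FinRep.lin (idealPart (k.quadRel n) a).proj) x, ?_⟩
  refine LinearMap.congr_fun (f := TensorProduct.lift (k.lmul n a) ∘ₗ
    TensorProduct.map LinearMap.id (FinRep.lin (idealPart (k.quadRel n) a).proj))
    (g := FinRep.lin (idealPart (k.quadRel n) (a + 1)).proj) ?_ x
  exact TensorProduct.ext' fun v x => rfl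

/-- Left multiplication by a letter. -/
def lm (k : Kind) {a : ℕ} (i : Fin n) : (k.pow n a).V →ₗ[Kq] (k.pow n (a + 1)).V :=
  k.lmul n a (vecBasis i)

lemma vec_succ (k : Kind) {a : ℕ} (f : Fin (a + 1) → Fin n) :
    k.vec f = k.lm (f 0) (k.vec (Fin.tail f)) := rfl

/-- Left multiplication of a tensor by elements of `V ⊗ V`. -/
def lmul₂ {a : ℕ} (x : (tensorPow n a).V) :
    (vecRep n ⊗ vecRep n : FinRep (Uq n)).V →ₗ[Kq] (tensorPow n (a + 2)).V :=
  (TensorProduct.assoc Kq (vecRep n).V (vecRep n).V (tensorPow n a).V).toLinearMap ∘ₗ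
    (TensorProduct.mk Kq ((vecRep n).V ⊗[Kq] (vecRep n).V) (tensorPow n a).V).flip x

lemma isRel_mul_eq_zero (k : Kind) {a : ℕ} {v : (vecRep n ⊗ vecRep n : FinRep (Uq n)).V}
    (hv : IsRel n k v) (x : (tensorPow n a).V) :
    FinRep.lin (idealPart (k.quadRel n) (a + 2)).proj (lmul₂ x v) = 0 := by
  refine (Submodule.Quotient.mk_eq_zero _).mpr (Submodule.mem_sup_right ?_)
  exact (show _ ∈ LinearMap.range (FinRep.lin ((k.quadRel n).incl ▷ tensorPow n a ≫
      (α_ (vecRep n) (vecRep n) (tensorPow n a)).hom)) from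
    ⟨(⟨v, Submodule.subset_span hv⟩ : (k.quadRel n).carrier) ⊗ₜ[Kq] x, rfl⟩)

lemma lm_lm {k : Kind} {a : ℕ} {i j : Fin n} (h : j < i) (x : (k.pow n a).V) :
    k.lm i (k.lm j x) = k.s • k.lm j (k.lm i x) := by
  obtain ⟨x, rfl⟩ := proj_surjective _ x
  cases k with
  | ext =>
    have := isRel_mul_eq_zero ext (IsRel.ext_lt j i h) x
    rw [map_add, map_add, map_smul, map_smul] at this
    rw [s, neg_smul]
    exact eq_neg_of_add_eq_zero_right this
  | sym =>
    have := isRel_mul_eq_zero sym (IsRel.sym_lt j i h) x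
    rw [map_sub, map_sub, map_smul, map_smul] at this
    exact (sub_eq_zero.mp this).symm

lemma lm_lm_self {a : ℕ} (i : Fin n) (x : (ext.pow n a).V) : ext.lm i (ext.lm i x) = 0 := by
  obtain ⟨x, rfl⟩ := proj_surjective _ x
  exact isRel_mul_eq_zero ext (IsRel.ext_diag i) x

lemma lmul_hom_ext {a : ℕ} {k : Kind} {M : Type*} [AddCommGroup M] [Module Kq M]
    {f g : (k.pow n (a + 1)).V →ₗ[Kq] M} (h : ∀ i x, f (k.lm i x) = g (k.lm i x)) : f = g := by
  ext y
  obtain ⟨t, rfl⟩ := lmulHom_surjective k a y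
  refine LinearMap.congr_fun (f := f ∘ₗ FinRep.lin (k.lmulHom n a))
    (g := g ∘ₗ FinRep.lin (k.lmulHom n a)) ?_ t
  refine TensorProduct.ext (LinearMap.pi_ext' fun i => LinearMap.ext_ring (LinearMap.ext fun x => ?_))
  exact h i x

/-! ### The standard basis vectors -/

open Classical in
/-- The ordered monomial with the given occupation numbers; it is zero if the degree is wrong. -/
def ev (k : Kind) : ∀ (c : ℕ) (_ : Fin n → ℕ), (k.pow n c).V
  | 0, m => if m = 0 then k.vec Fin.elim0 else 0
  | c + 1, m => ∑ j, if m j ≠ 0 ∧ ∀ i < j, m i = 0 then k.lm j (ev k c (m - unitOcc j)) else 0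

lemma ev_zero (k : Kind) : k.ev 0 (0 : Fin n → ℕ) = k.vec Fin.elim0 := by simp [ev]

lemma ev_add_lowest (k : Kind) (c : ℕ) (m : Fin n → ℕ) (j : Fin n) (h : ∀ i < j, m i = 0) :
    k.ev (c + 1) (m + unitOcc j) = k.lm j (k.ev c m) := by
  rw [ev, Finset.sum_eq_single j]
  · rw [if_pos, add_tsub_cancel_right]
    refine ⟨by simp, fun i hi => ?_⟩
    simp [h i hi, hi.ne]
  · intro i _ hij
    rw [if_neg]
    rintro ⟨h1, h2⟩
    rcases lt_or_gt_of_ne hij with hlt | hlt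
    · exact h1 (by simp [h i hlt, hij])
    · simpa using h2 j hlt
  · simp

lemma ev_of_deg_ne (k : Kind) (c : ℕ) (m : Fin n → ℕ) (h : deg m ≠ c) : k.ev c m = 0 := by
  induction c generalizing m with
  | zero =>
    rw [ev, if_neg]
    rintro rfl
    simp at h
  | succ c ih =>
    by_cases hm : m = 0
    · subst hm
      simp [ev]
    · obtain ⟨j, m', rfl, hj⟩ := exists_lowest hm
      rw [ev_add_lowest k c m' j hj, ih, map_zero]
      rw [deg_add, deg_unitOcc] at h
      omega

lemma lm_ev (k : Kind) (c : ℕ) (m : Fin n → ℕ) (i : Fin n) :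
    k.lm i (k.ev c m) = k.s ^ below m i • k.ev (c + 1) (m + unitOcc i) := by
  by_cases hm : deg m = c
  swap
  · rw [ev_of_deg_ne k c m hm, ev_of_deg_ne k (c + 1), map_zero, smul_zero]
    rw [deg_add, deg_unitOcc]
    omega
  refine occ_induction (P := fun c m => k.lm i (k.ev c m) =
    k.s ^ below m i • k.ev (c + 1) (m + unitOcc i)) ?_ ?_ c m hm
  · rw [ev_add_lowest k 0 0 i fun _ _ => rfl]
    simp
  · intro c m j _ hj ih
    rcases lt_or_ge j i with hji | hij
    · rw [ev_add_lowest k c m j hj, lm_lm hji, ih, map_smul, smul_smul, below_add, below_unitOcc,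
        if_pos hji, pow_succ', ← ev_add_lowest k (c + 1) _ j, add_right_comm m (unitOcc j)]
      intro l hl
      simp [hj l hl, (hl.trans hji).ne]
    · have h0 : ∀ l < i, (m + unitOcc j) l = 0 := fun l hl => by
        simp [hj l (hl.trans_le hij), (hl.trans_le hij).ne]
      rw [below_eq_zero h0, pow_zero, one_smul, ev_add_lowest k (c + 1) _ i h0]

lemma ev_of_not_valid (k : Kind) (c : ℕ) (m : Fin n → ℕ) (h : ¬ k.Valid m) : k.ev c m = 0 := by
  simp only [Valid, not_forall, not_le] at h
  obtain ⟨rfl, i, hi⟩ := h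
  by_cases hm : deg m = c
  swap
  · exact ev_of_deg_ne _ c m hm
  obtain ⟨m', rfl⟩ : ∃ m', m = m' + unitOcc i + unitOcc i := by
    refine ⟨m - unitOcc i - unitOcc i, ?_⟩
    funext l
    by_cases hl : l = i
    · subst hl
      simp only [Pi.add_apply, Pi.sub_apply, Pi.single_eq_same]
      omega
    · simp [hl]
  rw [deg_add, deg_add, deg_unitOcc] at hm
  subst hm
  have h1 := lm_lm_self i (ext.ev (deg m') m')
  rw [lm_ev, map_smul, lm_ev, smul_smul] at h1
  exact (smul_eq_zero.mp h1).resolve_left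
    (mul_ne_zero (pow_ne_zero _ (s_ne_zero _)) (pow_ne_zero _ (s_ne_zero _)))

/-- The occupation numbers of a sequence of letters. -/
def cnt {c : ℕ} (f : Fin c → Fin n) : Fin n → ℕ := ∑ x, unitOcc (f x)

lemma cnt_succ {c : ℕ} (f : Fin (c + 1) → Fin n) : cnt f = cnt (Fin.tail f) + unitOcc (f 0) := by
  rw [cnt, Fin.sum_univ_succ, add_comm]
  rfl

lemma deg_cnt {c : ℕ} (f : Fin c → Fin n) : deg (cnt f) = c := by
  induction c with
  | zero => simp [cnt]
  | succ c ih => rw [cnt_succ, deg_add, ih, deg_unitOcc]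

lemma cnt_apply_eq_zero {c : ℕ} {f : Fin c → Fin n} {k : Fin n} (h : ∀ x, f x ≠ k) :
    cnt f k = 0 := by
  rw [cnt, Finset.sum_apply]
  exact Finset.sum_eq_zero fun x _ => by simp [(h x).symm]

lemma vec_of_monotone (k : Kind) {c : ℕ} {f : Fin c → Fin n} (hf : Monotone f) :
    k.vec f = k.ev c (cnt f) := by
  induction c with
  | zero =>
    rw [show cnt f = 0 by simp [cnt], ev_zero]
    congr 1
    exact Subsingleton.elim _ _
  | succ c ih =>
    have h : Monotone (Fin.tail f) := hf.comp fun x y h => Fin.succ_le_succ_iff.mpr h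
    rw [vec_succ, ih h, cnt_succ, ev_add_lowest]
    intro i hi
    exact cnt_apply_eq_zero fun x hx => absurd (hf (Fin.zero_le x.succ))
      (not_le.mpr (by rw [← hx] at hi; exact hi))

lemma hom_ext {k : Kind} {c : ℕ} {M : Type*} [AddCommGroup M] [Module Kq M]
    {f g : (k.pow n c).V →ₗ[Kq] M}
    (h : ∀ m, k.Valid m → deg m = c → f (k.ev c m) = g (k.ev c m)) : f = g := by
  have h' : ∀ m, f (k.ev c m) = g (k.ev c m) := fun m => by
    by_cases hm : k.Valid m ∧ deg m = c
    · exact h m hm.1 hm.2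
    · rw [not_and_or] at hm
      rcases hm with hm | hm
      · rw [ev_of_not_valid k c m hm, map_zero, map_zero]
      · rw [ev_of_deg_ne k c m hm, map_zero, map_zero]
  clear h
  induction c with
  | zero =>
    have hs : Function.Surjective (FinRep.lin (idealPart (k.quadRel n) 0).proj) :=
      proj_surjective _
    ext y
    obtain ⟨x, rfl⟩ := hs y
    have h0 := h' 0
    rw [ev_zero] at h0
    refine LinearMap.congr_fun (f := f ∘ₗ FinRep.lin (idealPart (k.quadRel n) 0).proj)
      (g := g ∘ₗ FinRep.lin (idealPart (k.quadRel n) 0).proj) ?_ x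
    exact LinearMap.ext_ring h0
  | succ c ih =>
    refine lmul_hom_ext fun i x => ?_
    have := @ih (f ∘ₗ k.lm i) (g ∘ₗ k.lm i) fun m => by
      simp only [LinearMap.comp_apply, lm_ev, map_smul, h']
    exact LinearMap.congr_fun this x

/-! ### Coordinates -/

open Classical in
/-- Left multiplication by a letter in coordinates. -/
def coordMul (k : Kind) (i : Fin n) : ((Fin n → ℕ) →₀ Kq) →ₗ[Kq] ((Fin n → ℕ) →₀ Kq) :=
  Finsupp.linearCombination Kq fun m =>
    if k.Valid (m + unitOcc i) then Finsupp.single (m + unitOcc i) (k.s ^ below m i) else 0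

open Classical in
lemma coordMul_single (k : Kind) (i : Fin n) (m : Fin n → ℕ) (c : Kq) :
    k.coordMul i (Finsupp.single m c) = if k.Valid (m + unitOcc i) then
      Finsupp.single (m + unitOcc i) (c * k.s ^ below m i) else 0 := by
  rw [coordMul, Finsupp.linearCombination_single]
  split_ifs <;> simp

lemma coordMul_coordMul (k : Kind) {i j : Fin n} (h : j < i) (x : (Fin n → ℕ) →₀ Kq) :
    k.coordMul i (k.coordMul j x) = k.s • k.coordMul j (k.coordMul i x) := by
  classical
  refine LinearMap.congr_fun (f := k.coordMul i ∘ₗ k.coordMul j)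
    (g := k.s • (k.coordMul j ∘ₗ k.coordMul i)) ?_ x
  refine Finsupp.lhom_ext fun m c => ?_
  simp only [LinearMap.comp_apply, LinearMap.smul_apply, coordMul_single]
  by_cases hv : k.Valid (m + unitOcc j + unitOcc i)
  · have h1 : k.Valid (m + unitOcc j) := hv.mono le_self_add
    have h2 : k.Valid (m + unitOcc i) := hv.mono (by rw [add_right_comm]; exact le_self_add)
    have hv' : k.Valid (m + unitOcc i + unitOcc j) := by rwa [add_right_comm]
    rw [if_pos h1, if_pos h2, coordMul_single, coordMul_single, if_pos hv, if_pos hv',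
      Finsupp.smul_single, add_right_comm, below_add, below_add, below_unitOcc, below_unitOcc,
      if_pos h, if_neg h.not_gt]
    congr 1
    simp only [smul_eq_mul]
    ring
  · have hv' : ¬ k.Valid (m + unitOcc i + unitOcc j) := by rwa [add_right_comm]
    have h1 : ∀ c, k.coordMul i (if k.Valid (m + unitOcc j) then
        Finsupp.single (m + unitOcc j) c else 0) = 0 := fun c => by
      split_ifs
      · rw [coordMul_single, if_neg hv]
      · exact map_zero _
    have h2 : ∀ c, k.coordMul j (if k.Valid (m + unitOcc i) then
        Finsupp.single (m + unitOcc i) c else 0) = 0 := fun c => by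
      split_ifs
      · rw [coordMul_single, if_neg hv']
      · exact map_zero _
    rw [h1, h2, smul_zero]

lemma coordMul_self (i : Fin n) (x : (Fin n → ℕ) →₀ Kq) :
    ext.coordMul i (ext.coordMul i x) = 0 := by
  classical
  refine LinearMap.congr_fun (f := ext.coordMul i ∘ₗ ext.coordMul i) (g := 0) ?_ x
  refine Finsupp.lhom_ext fun m c => ?_
  simp only [LinearMap.comp_apply, LinearMap.zero_apply, coordMul_single]
  split_ifs
  · rw [coordMul_single, if_neg]
    intro hh
    have := hh rfl i
    simp at this
  · exact map_zero _

/-- Left multiplication by a vector in coordinates. -/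
def coordMulVec (k : Kind) (n : ℕ) :
    (vecRep n).V →ₗ[Kq] ((Fin n → ℕ) →₀ Kq) →ₗ[Kq] ((Fin n → ℕ) →₀ Kq) :=
  Fintype.linearCombination Kq k.coordMul

lemma coordMulVec_vecBasis (k : Kind) (i : Fin n) :
    k.coordMulVec n (vecBasis i) = k.coordMul i := by
  refine (Fintype.linearCombination_apply_single Kq (v := k.coordMul) i 1).trans ?_
  rw [one_smul]

/-- The coordinates of a tensor. -/
def tensorCoord (k : Kind) (n : ℕ) : ∀ a, (tensorPow n a).V →ₗ[Kq] ((Fin n → ℕ) →₀ Kq)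
  | 0 => LinearMap.toSpanSingleton Kq _ (Finsupp.single 0 1)
  | a + 1 => TensorProduct.lift (LinearMap.compl₂ (k.coordMulVec n) (tensorCoord k n a))

lemma tensorCoord_rel (k : Kind) {a : ℕ} (x : (tensorPow n a).V) :
    (k.quadRel n).carrier ≤ LinearMap.ker (k.tensorCoord n (a + 2) ∘ₗ lmul₂ x) := by
  refine Submodule.span_le.mpr fun v hv => ?_
  have key : ∀ i j, (k.tensorCoord n (a + 2) ∘ₗ lmul₂ x) (vecBasis₂ i j) =
      k.coordMul i (k.coordMul j (k.tensorCoord n a x)) := fun i j => by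
    rw [← coordMulVec_vecBasis, ← coordMulVec_vecBasis]
    rfl
  rw [SetLike.mem_coe, LinearMap.mem_ker]
  cases hv with
  | ext_diag i => rw [key, coordMul_self]
  | ext_lt i j h =>
    rw [map_add, map_smul, key, key, coordMul_coordMul _ h, ← add_smul, s, add_neg_cancel,
      zero_smul]
  | sym_lt i j h =>
    rw [map_sub, map_smul, key, key, coordMul_coordMul _ h, ← sub_smul, s, sub_self, zero_smul]

lemma tensorCoord_idealPart (k : Kind) (n : ℕ) : ∀ a,
    (idealPart (k.quadRel n) a).carrier ≤ LinearMap.ker (k.tensorCoord n a)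
  | 0 => bot_le
  | 1 => bot_le
  | a + 2 => by
    refine sup_le ?_ ?_
    · rintro _ ⟨t, rfl⟩
      refine LinearMap.congr_fun (f := k.tensorCoord n (a + 2) ∘ₗ
        TensorProduct.map LinearMap.id (idealPart (k.quadRel n) (a + 1)).carrier.subtype)
        (g := 0) ?_ t
      refine TensorProduct.ext' fun v x => ?_
      have hx := tensorCoord_idealPart k n (a + 1) x.2
      rw [LinearMap.mem_ker] at hx
      exact (congrArg (k.coordMulVec n v) hx).trans (map_zero _)
    · rintro _ ⟨t, rfl⟩
      refine LinearMap.congr_fun (f := k.tensorCoord n (a + 2) ∘ₗ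
        (TensorProduct.assoc Kq (vecRep n).V (vecRep n).V (tensorPow n a).V).toLinearMap ∘ₗ
        TensorProduct.map (k.quadRel n).carrier.subtype LinearMap.id) (g := 0) ?_ t
      refine TensorProduct.ext' fun v x => ?_
      exact tensorCoord_rel k x v.2

/-- The coordinates of an element of a quantum power. -/
def coord (k : Kind) (n a : ℕ) : (k.pow n a).V →ₗ[Kq] ((Fin n → ℕ) →₀ Kq) :=
  (idealPart (k.quadRel n) a).carrier.liftQ (k.tensorCoord n a) (tensorCoord_idealPart k n a)

lemma coord_lm (k : Kind) {a : ℕ} (i : Fin n) (x : (k.pow n a).V) :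
    k.coord n (a + 1) (k.lm i x) = k.coordMul i (k.coord n a x) := by
  obtain ⟨x, rfl⟩ := proj_surjective _ x
  rw [← coordMulVec_vecBasis]
  rfl

lemma coord_ev (k : Kind) (c : ℕ) (m : Fin n → ℕ) (hv : k.Valid m) (hm : deg m = c) :
    k.coord n c (k.ev c m) = Finsupp.single m 1 := by
  revert hv
  refine occ_induction (P := fun c m => k.Valid m → k.coord n c (k.ev c m) = Finsupp.single m 1)
    ?_ ?_ c m hm
  · intro _
    rw [ev_zero]
    exact one_smul Kq _
  · intro c m j _ hj ih hv
    rw [ev_add_lowest k c m j hj, coord_lm, ih (hv.mono le_self_add), coordMul_single, if_pos hv,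
      below_eq_zero hj, pow_zero, mul_one]

/-- The linear map with prescribed values on the standard basis vectors. -/
def mkLin (k : Kind) (a : ℕ) {M : Type*} [AddCommGroup M] [Module Kq M] (G : (Fin n → ℕ) → M) :
    (k.pow n a).V →ₗ[Kq] M :=
  Finsupp.linearCombination Kq G ∘ₗ k.coord n a

lemma mkLin_ev (k : Kind) {a : ℕ} {M : Type*} [AddCommGroup M] [Module Kq M]
    (G : (Fin n → ℕ) → M) {m : Fin n → ℕ} (hv : k.Valid m) (hm : deg m = a) :
    k.mkLin a G (k.ev a m) = G m := by
  rw [mkLin, LinearMap.comp_apply, coord_ev k a m hv hm, Finsupp.linearCombination_single, one_smul]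

end Kind

@[simp] lemma unitOcc_self {n : ℕ} (i : Fin n) : unitOcc i i = 1 := Pi.single_eq_same _ _

lemma unitOcc_of_ne {n : ℕ} {i j : Fin n} (h : j ≠ i) : unitOcc i j = 0 := Pi.single_eq_of_ne h _

/-! ### Quantum integers -/

lemma qnum_zero : qnum 0 = 0 := by simp [qnum]

lemma qnum_one : qnum 1 = 1 := by
  rw [qnum, zpow_one, zpow_neg, zpow_one, div_self Uq.q_sub_ne_zero]

lemma qnum_neg (a : ℤ) : qnum (-a) = -qnum a := by
  rw [qnum, qnum, neg_neg, ← neg_div, neg_sub]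

lemma qnum_add (a b : ℤ) : qnum (a + b) = q ^ b * qnum a + q ^ (-a) * qnum b := by
  have h := Uq.q_ne_zero
  simp only [qnum, mul_div_assoc', ← add_div, mul_sub, ← zpow_add₀ h]
  congr 1
  rw [show -a + b = b + -a by ring, show -a + -b = -(a + b) by ring, add_comm a b]
  ring

lemma qnum_add_one (a : ℤ) : qnum (a + 1) = q * qnum a + q ^ (-a) := by
  rw [qnum_add, qnum_one, zpow_one, mul_one]

lemma qnum_add_one' (a : ℤ) : qnum (a + 1) = q⁻¹ * qnum a + q ^ a := by
  rw [add_comm, qnum_add, qnum_one, zpow_neg, zpow_one, mul_one, add_comm]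

lemma q_pow_ne_one {k : ℕ} (hk : k ≠ 0) : q ^ k ≠ 1 := by
  intro h
  have h4 : (algebraMap (Polynomial ℂ) (RatFunc ℂ)) (Polynomial.X ^ k) =
      algebraMap (Polynomial ℂ) (RatFunc ℂ) 1 := by
    rw [map_pow, RatFunc.algebraMap_X, map_one]
    exact h
  have h5 := congrArg (Polynomial.eval 0) (RatFunc.algebraMap_injective ℂ h4)
  simp [hk] at h5

lemma qnum_succ_ne_zero (k : ℕ) : qnum ((k : ℤ) + 1) ≠ 0 := by
  have h := Uq.q_ne_zero
  refine div_ne_zero ?_ Uq.q_sub_ne_zero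
  intro h'
  rw [sub_eq_zero, zpow_neg] at h'
  have h1 : q ^ ((k : ℤ) + 1) = q ^ (k + 1) := by exact_mod_cast zpow_natCast q (k + 1)
  rw [h1] at h'
  have h2 := mul_inv_cancel₀ (pow_ne_zero (k + 1) h)
  rw [← h', ← pow_add] at h2
  exact q_pow_ne_one (by omega) h2

lemma qnum_natCast_ne_zero {k : ℕ} (hk : k ≠ 0) : qnum (k : ℤ) ≠ 0 := by
  obtain ⟨k, rfl⟩ := Nat.exists_eq_succ_of_ne_zero hk
  exact_mod_cast qnum_succ_ne_zero k

namespace FinRep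
variable {n : ℕ} (X Y : FinRep (Uq n))

lemma ρ_qh_tmul (h : Fin n → ℤ) (x : X.V) (y : Y.V) :
    (X ⊗ Y).ρ (Uq.qh h) (x ⊗ₜ[Kq] y) = X.ρ (Uq.qh h) x ⊗ₜ[Kq] Y.ρ (Uq.qh h) y :=
  LinearMap.congr_fun (congrArg (FinRep.extAct X Y) (Uq.comul_qh h)) (x ⊗ₜ[Kq] y)

lemma ρ_E_tmul (i : Fin (n - 1)) (x : X.V) (y : Y.V) :
    (X ⊗ Y).ρ (Uq.E i) (x ⊗ₜ[Kq] y) =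
      X.ρ (Uq.E i) x ⊗ₜ[Kq] Y.ρ (Uq.qh (coroot i)) y + x ⊗ₜ[Kq] Y.ρ (Uq.E i) y := by
  refine (LinearMap.congr_fun (congrArg (FinRep.extAct X Y) (Uq.comul_E i)) (x ⊗ₜ[Kq] y)).trans ?_
  rw [map_add, LinearMap.add_apply, extAct_tmul, extAct_tmul, map_one]
  rfl

lemma ρ_F_tmul (i : Fin (n - 1)) (x : X.V) (y : Y.V) :
    (X ⊗ Y).ρ (Uq.F i) (x ⊗ₜ[Kq] y) =
      X.ρ (Uq.F i) x ⊗ₜ[Kq] y + X.ρ (Uq.qh (-coroot i)) x ⊗ₜ[Kq] Y.ρ (Uq.F i) y := by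
  refine (LinearMap.congr_fun (congrArg (FinRep.extAct X Y) (Uq.comul_F i)) (x ⊗ₜ[Kq] y)).trans ?_
  rw [map_add, LinearMap.add_apply, extAct_tmul, extAct_tmul, map_one]
  rfl

variable {X Y}

/-- Equivariance may be checked on generators. -/
lemma comm_of_gen (f : X.V →ₗ[Kq] Y.V)
    (h : ∀ g, f ∘ₗ X.ρ (Uq.gen g) = Y.ρ (Uq.gen g) ∘ₗ f) (u : Uq n) :
    f ∘ₗ X.ρ u = Y.ρ u ∘ₗ f := by
  induction u using Uq.induction with
  | scalar r =>
    rw [AlgHom.commutes, AlgHom.commutes]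
    ext x
    simp
  | generator g => exact h g
  | mul u v hu hv =>
    rw [map_mul, map_mul, Module.End.mul_eq_comp, Module.End.mul_eq_comp, ← LinearMap.comp_assoc,
      hu, LinearMap.comp_assoc, hv, LinearMap.comp_assoc]
  | add u v hu hv => rw [map_add, map_add, LinearMap.comp_add, LinearMap.add_comp, hu, hv]

end FinRep

namespace Kind
variable {n : ℕ}

/-! ### Multiplication -/

lemma tensor_hom_ext {k l : Kind} {a b : ℕ} {M : Type*} [AddCommGroup M] [Module Kq M]
    {f g : (k.pow n a).V ⊗[Kq] (l.pow n b).V →ₗ[Kq] M}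
    (h : ∀ x y, k.Valid x → deg x = a → l.Valid y → deg y = b →
      f (k.ev a x ⊗ₜ l.ev b y) = g (k.ev a x ⊗ₜ l.ev b y)) : f = g :=
  TensorProduct.ext (hom_ext fun x hx hx' => hom_ext fun y hy hy' => h x y hx hx' hy hy')

/-- The multiplication of the quantum powers, as a linear map. -/
def mulLin (k : Kind) (n a b c : ℕ) : (k.pow n a).V ⊗[Kq] (k.pow n b).V →ₗ[Kq] (k.pow n c).V :=
  TensorProduct.lift (k.mkLin a fun x => k.mkLin b fun y => k.s ^ cross y x • k.ev c (x + y))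

lemma mulLin_ev (k : Kind) {a b c : ℕ} {x y : Fin n → ℕ} (hx : deg x = a) (hy : deg y = b) :
    k.mulLin n a b c (k.ev a x ⊗ₜ k.ev b y) = k.s ^ cross y x • k.ev c (x + y) := by
  by_cases h : k.Valid x
  · by_cases h' : k.Valid y
    · rw [mulLin, TensorProduct.lift.tmul, mkLin_ev k _ h hx, mkLin_ev k _ h' hy]
    · rw [ev_of_not_valid k b y h', TensorProduct.tmul_zero, map_zero,
        ev_of_not_valid k c _ fun hh => h' (hh.mono le_add_self), smul_zero]
  · rw [ev_of_not_valid k a x h, TensorProduct.zero_tmul, map_zero,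
      ev_of_not_valid k c _ fun hh => h (hh.mono le_self_add), smul_zero]

lemma mulLin_lm (k : Kind) {a b c : ℕ} (i : Fin n) (x : (k.pow n a).V) (y : (k.pow n b).V) :
    k.mulLin n (a + 1) b (c + 1) (k.lm i x ⊗ₜ y) = k.lm i (k.mulLin n a b c (x ⊗ₜ y)) := by
  refine LinearMap.congr_fun (f := k.mulLin n (a + 1) b (c + 1) ∘ₗ
    TensorProduct.map (k.lm i) LinearMap.id) (g := k.lm i ∘ₗ k.mulLin n a b c)
    (tensor_hom_ext fun x y _ hx' _ hy' => ?_) (x ⊗ₜ y)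
  rw [LinearMap.comp_apply, LinearMap.comp_apply, TensorProduct.map_tmul, lm_ev,
    ← TensorProduct.smul_tmul', map_smul, LinearMap.id_apply, mulLin_ev k hx' hy',
    mulLin_ev k (by rw [deg_add, deg_unitOcc, hx']) hy', map_smul, lm_ev, smul_smul, smul_smul,
    add_right_comm, ← pow_add, ← pow_add, cross_add_right, cross_unitOcc_right, below_add]
  congr 2
  omega

lemma mulLin_one (k : Kind) {b : ℕ} (y : (k.pow n b).V) :
    k.mulLin n 0 b b (k.ev 0 0 ⊗ₜ y) = y := by
  refine LinearMap.congr_fun (f := k.mulLin n 0 b b ∘ₗ TensorProduct.mk Kq _ _ (k.ev 0 0))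
    (g := LinearMap.id) (hom_ext fun y _ hy' => ?_) y
  rw [LinearMap.comp_apply, TensorProduct.mk_apply, mulLin_ev k deg_zero hy']
  simp

lemma mulLin_vec (k : Kind) {a b c : ℕ} (h : a + b = c) (f : Fin a → Fin n) (g : Fin b → Fin n) :
    k.mulLin n a b c (k.vec f ⊗ₜ k.vec g) = k.vec (Fin.append f g ∘ Fin.cast h.symm) := by
  induction a generalizing c with
  | zero =>
    obtain rfl : b = c := by omega
    rw [show k.vec f = k.ev 0 0 by rw [ev_zero]; congr 1; exact Subsingleton.elim _ _, mulLin_one]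
    congr 1
    funext x
    rw [Function.comp_apply]
    have : Fin.cast h.symm x = Fin.natAdd 0 x := by ext; simp
    rw [this, Fin.append_right]
  | succ a ih =>
    obtain ⟨c, rfl⟩ : ∃ c', c = c' + 1 := ⟨a + b, by omega⟩
    have h' : a + b = c := by omega
    rw [vec_succ, mulLin_lm, ih h', vec_succ]
    have h0 : Fin.append f g (Fin.cast h.symm 0) = f 0 := by
      have : Fin.cast h.symm 0 = Fin.castAdd b (0 : Fin (a + 1)) := by ext; simp
      rw [this, Fin.append_left]
    have ht : Fin.tail (Fin.append f g ∘ Fin.cast h.symm) =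
        Fin.append (Fin.tail f) g ∘ Fin.cast h'.symm := by
      funext x
      obtain ⟨x, rfl⟩ := (finCongr h').surjective x
      refine Fin.addCases (fun x => ?_) (fun x => ?_) x
      · have : Fin.cast h.symm (finCongr h' (Fin.castAdd b x)).succ = Fin.castAdd b x.succ := by
          ext; simp
        rw [Fin.tail, Function.comp_apply, this, Fin.append_left]
        exact (Fin.append_left (Fin.tail f) g x).symm
      · have : Fin.cast h.symm (finCongr h' (Fin.natAdd a x)).succ = Fin.natAdd (a + 1) x := by
          ext; simp; omega
        rw [Fin.tail, Function.comp_apply, this, Fin.append_right]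
        exact (Fin.append_right (Fin.tail f) g x).symm
    rw [Function.comp_apply, h0, ht]

lemma mulLin_comm (k : Kind) {a b c : ℕ} (h : a + b = c) (u : Uq n) :
    k.mulLin n a b c ∘ₗ (k.pow n a ⊗ k.pow n b : FinRep (Uq n)).ρ u =
      (k.pow n c).ρ u ∘ₗ k.mulLin n a b c := by
  induction a generalizing c u with
  | zero =>
    obtain rfl : b = c := by omega
    refine FinRep.comm_of_surjective (Y := (k.pow n 0 ⊗ k.pow n b : FinRep (Uq n)))
      ((idealPart (k.quadRel n) 0).proj ▷ k.pow n b)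
      (TensorProduct.map_surjective (proj_surjective _) Function.surjective_id)
      (λ_ (k.pow n b)).hom _ (fun t => ?_) u
    refine LinearMap.congr_fun (f := k.mulLin n 0 b b ∘ₗ
      TensorProduct.map (FinRep.lin (idealPart (k.quadRel n) 0).proj) LinearMap.id)
      (g := (TensorProduct.lid Kq (k.pow n b).V).toLinearMap) ?_ t
    refine TensorProduct.ext (LinearMap.ext_ring (LinearMap.ext fun y => ?_))
    have h1 := k.mulLin_one y
    rw [ev_zero] at h1
    exact h1.trans (one_smul Kq y).symm
  | succ a ih =>
    obtain ⟨c, rfl⟩ : ∃ c', c = c' + 1 := ⟨a + b, by omega⟩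
    have h' : a + b = c := by omega
    let φ : (k.pow n a ⊗ k.pow n b : FinRep (Uq n)) ⟶ k.pow n c :=
      FinRep.mkHom (X := (k.pow n a ⊗ k.pow n b : FinRep (Uq n))) (k.mulLin n a b c) (ih h')
    refine FinRep.comm_of_surjective (Y := (k.pow n (a + 1) ⊗ k.pow n b : FinRep (Uq n)))
      (k.lmulHom n a ▷ k.pow n b)
      (TensorProduct.map_surjective (lmulHom_surjective k a) Function.surjective_id)
      ((α_ _ _ _).hom ≫ vecRep n ◁ φ ≫ k.lmulHom n c) _ (fun t => ?_) u
    refine LinearMap.congr_fun (f := k.mulLin n (a + 1) b (c + 1) ∘ₗ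
      TensorProduct.map (FinRep.lin (k.lmulHom n a)) LinearMap.id)
      (g := FinRep.lin ((α_ _ _ _).hom ≫ vecRep n ◁ φ ≫ k.lmulHom n c)) ?_ t
    refine TensorProduct.ext (TensorProduct.ext (LinearMap.pi_ext' fun i =>
      LinearMap.ext_ring (LinearMap.ext fun x => LinearMap.ext fun y => ?_)))
    exact mulLin_lm k i x y

/-- The multiplication of the quantum powers. -/
def mulHom (k : Kind) (n : ℕ) {a b c : ℕ} (h : a + b = c) :
    (k.pow n a ⊗ k.pow n b : FinRep (Uq n)) ⟶ k.pow n c :=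
  FinRep.mkHom (X := (k.pow n a ⊗ k.pow n b : FinRep (Uq n))) (k.mulLin n a b c) (k.mulLin_comm h)

lemma isMul_mulHom (k : Kind) {a b c : ℕ} (h : a + b = c) : k.IsMul n h (k.mulHom n h) :=
  fun f g => k.mulLin_vec h f g

lemma mulLin_assoc (k : Kind) {a b c ab bc abc : ℕ} (h₁ : a + b = ab) (h₃ : b + c = bc)
    (x : (k.pow n a).V) (y : (k.pow n b).V) (z : (k.pow n c).V) :
    k.mulLin n ab c abc (k.mulLin n a b ab (x ⊗ₜ y) ⊗ₜ z) =
      k.mulLin n a bc abc (x ⊗ₜ k.mulLin n b c bc (y ⊗ₜ z)) := by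
  have key : k.mulLin n ab c abc ∘ₗ TensorProduct.map (k.mulLin n a b ab) LinearMap.id =
      k.mulLin n a bc abc ∘ₗ TensorProduct.map LinearMap.id (k.mulLin n b c bc) ∘ₗ
        (TensorProduct.assoc Kq _ _ _).toLinearMap := by
    refine TensorProduct.ext (tensor_hom_ext fun x y _ hx _ hy => hom_ext fun z _ hz => ?_)
    have hxy : deg (x + y) = ab := by rw [deg_add, hx, hy, h₁]
    have hyz : deg (y + z) = bc := by rw [deg_add, hy, hz, h₃]
    change k.mulLin n ab c abc (k.mulLin n a b ab (k.ev a x ⊗ₜ k.ev b y) ⊗ₜ k.ev c z) =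
      k.mulLin n a bc abc (k.ev a x ⊗ₜ k.mulLin n b c bc (k.ev b y ⊗ₜ k.ev c z))
    rw [mulLin_ev k hx hy, mulLin_ev k hy hz, ← TensorProduct.smul_tmul', TensorProduct.tmul_smul,
      map_smul, map_smul, mulLin_ev k hxy hz, mulLin_ev k hx hyz, smul_smul, smul_smul, add_assoc,
      ← pow_add, ← pow_add, cross_add_left, cross_add_right]
    congr 2
    omega
  exact LinearMap.congr_fun key ((x ⊗ₜ y) ⊗ₜ z)

/-! ### The action on the standard basis -/

lemma ρ_qh_lm (k : Kind) {a : ℕ} (h : Fin n → ℤ) (j : Fin n) (x : (k.pow n a).V) :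
    (k.pow n (a + 1)).ρ (Uq.qh h) (k.lm j x) = q ^ h j • k.lm j ((k.pow n a).ρ (Uq.qh h) x) := by
  have h1 := LinearMap.congr_fun (FinRep.lin_comm (k.lmulHom n a) (Uq.qh h)) (vecBasis j ⊗ₜ[Kq] x)
  refine h1.symm.trans ?_
  refine (congrArg (FinRep.lin (k.lmulHom n a)) (FinRep.ρ_qh_tmul _ _ h _ _)).trans ?_
  rw [qh_vecBasis, lmulHom_tmul, map_smul]
  rfl

lemma ρ_E_lm (k : Kind) {a : ℕ} (i : Fin (n - 1)) (j : Fin n) (x : (k.pow n a).V) :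
    (k.pow n (a + 1)).ρ (Uq.E i) (k.lm j x) =
      (if j = hi i then k.lm (lo i) ((k.pow n a).ρ (Uq.qh (coroot i)) x) else 0) +
        k.lm j ((k.pow n a).ρ (Uq.E i) x) := by
  have h1 := LinearMap.congr_fun (FinRep.lin_comm (k.lmulHom n a) (Uq.E i)) (vecBasis j ⊗ₜ[Kq] x)
  refine h1.symm.trans ?_
  refine (congrArg (FinRep.lin (k.lmulHom n a)) (FinRep.ρ_E_tmul _ _ i _ _)).trans ?_
  refine (map_add (FinRep.lin (k.lmulHom n a)) _ _).trans ?_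
  rw [E_vecBasis, lmulHom_tmul, lmulHom_tmul]
  split_ifs with hj
  · rfl
  · rw [map_zero, LinearMap.zero_apply]
    rfl

lemma ρ_F_lm (k : Kind) {a : ℕ} (i : Fin (n - 1)) (j : Fin n) (x : (k.pow n a).V) :
    (k.pow n (a + 1)).ρ (Uq.F i) (k.lm j x) =
      (if j = lo i then k.lm (hi i) x else 0) +
        q ^ (-coroot i j) • k.lm j ((k.pow n a).ρ (Uq.F i) x) := by
  have h1 := LinearMap.congr_fun (FinRep.lin_comm (k.lmulHom n a) (Uq.F i)) (vecBasis j ⊗ₜ[Kq] x)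
  refine h1.symm.trans ?_
  refine (congrArg (FinRep.lin (k.lmulHom n a)) (FinRep.ρ_F_tmul _ _ i _ _)).trans ?_
  refine (map_add (FinRep.lin (k.lmulHom n a)) _ _).trans ?_
  rw [F_vecBasis, lmulHom_tmul, lmulHom_tmul, qh_vecBasis]
  congr 1
  · split_ifs with hj
    · rfl
    · rw [map_zero, LinearMap.zero_apply]
  · rw [map_smul]
    rfl

lemma ρ_one_vec (k : Kind) (u : Uq n) :
    (k.pow n 0).ρ u (k.ev 0 0) = Coalgebra.counit (R := Kq) u • k.ev 0 0 := by
  rw [ev_zero]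
  have h1 := LinearMap.congr_fun (FinRep.lin_comm (idealPart (k.quadRel n) 0).proj u) (1 : Kq)
  refine h1.symm.trans ?_
  refine Eq.trans ?_ (map_smul (FinRep.lin (idealPart (k.quadRel n) 0).proj) _ (1 : Kq))
  rfl

/-- The weight of a standard basis vector. -/
def weight (h : Fin n → ℤ) (m : Fin n → ℕ) : ℤ := ∑ i, h i * m i

lemma weight_add (h : Fin n → ℤ) (m p : Fin n → ℕ) :
    weight h (m + p) = weight h m + weight h p := by
  simp [weight, mul_add, Finset.sum_add_distrib]

lemma weight_unitOcc (h : Fin n → ℤ) (i : Fin n) : weight h (unitOcc i) = h i := by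
  simp [weight, Pi.single_apply]

lemma weight_coroot (i : Fin (n - 1)) (m : Fin n → ℕ) :
    weight (coroot i) m = m (lo i) - m (hi i) := by
  simp [weight, coroot, sub_mul, Pi.single_apply, Finset.sum_sub_distrib]

lemma weight_neg_coroot (i : Fin (n - 1)) (m : Fin n → ℕ) :
    weight (-coroot i) m = m (hi i) - m (lo i) := by
  simp [weight, coroot, sub_mul, Pi.single_apply, Finset.sum_sub_distrib]

lemma ρ_qh_ev (k : Kind) (c : ℕ) (h : Fin n → ℤ) (m : Fin n → ℕ) :
    (k.pow n c).ρ (Uq.qh h) (k.ev c m) = q ^ weight h m • k.ev c m := by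
  by_cases hm : deg m = c
  swap
  · rw [ev_of_deg_ne k c m hm, map_zero, smul_zero]
  refine occ_induction (P := fun c m => (k.pow n c).ρ (Uq.qh h) (k.ev c m) =
    q ^ weight h m • k.ev c m) ?_ ?_ c m hm
  · rw [ρ_one_vec]
    change Uq.lift (Uq.counitModel n) (Uq.qh h) • _ = _
    rw [Uq.counit_qh]
    simp [weight]
  · intro c m j _ hj ih
    rw [ev_add_lowest k c m j hj, ρ_qh_lm, ih, map_smul, smul_smul, ← zpow_add₀ Uq.q_ne_zero,
      weight_add, weight_unitOcc, add_comm (h j)]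

lemma lo_lt_hi (i : Fin (n - 1)) : lo i < hi i := Nat.lt_succ_self _

lemma le_lo_of_lt_hi {i : Fin (n - 1)} {j : Fin n} (h : j < hi i) : j ≤ lo i := Nat.le_of_lt_succ h

lemma below_hi (m : Fin n → ℕ) (i : Fin (n - 1)) : below m (hi i) = below m (lo i) + m (lo i) := by
  have : Finset.Iio (hi i) = insert (lo i) (Finset.Iio (lo i)) := by
    ext k
    simp only [Finset.mem_Iio, Finset.mem_insert]
    exact ⟨fun h => (le_lo_of_lt_hi h).eq_or_lt, fun h => h.elim (fun h => h ▸ lo_lt_hi i)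
      fun h => h.trans (lo_lt_hi i)⟩
  rw [below, this, Finset.sum_insert (by simp), add_comm]
  rfl

/-- Replacing a letter `i` by a letter `j`. -/
def move (m : Fin n → ℕ) (i j : Fin n) : Fin n → ℕ := m - unitOcc i + unitOcc j

lemma move_add (m : Fin n → ℕ) (i j : Fin n) : move (m + unitOcc i) i j = m + unitOcc j := by
  rw [move, add_tsub_cancel_right]

lemma exists_eq_add_unitOcc {m : Fin n → ℕ} {i : Fin n} (h : m i ≠ 0) :
    ∃ m', m = m' + unitOcc i := by
  refine ⟨m - unitOcc i, (tsub_add_cancel_of_le fun k => ?_).symm⟩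
  by_cases hk : k = i
  · subst hk; simpa [Nat.one_le_iff_ne_zero] using h
  · simp [hk]

lemma ρ_E_ev (k : Kind) (c : ℕ) (i : Fin (n - 1)) (m : Fin n → ℕ) (hv : k.Valid m) :
    (k.pow n c).ρ (Uq.E i) (k.ev c m) = qnum (m (hi i)) • k.ev c (move m (hi i) (lo i)) := by
  by_cases hm : deg m = c
  swap
  · rw [ev_of_deg_ne k c m hm, map_zero]
    by_cases h0 : m (hi i) = 0
    · rw [h0, Nat.cast_zero, qnum_zero, zero_smul]
    · obtain ⟨m', rfl⟩ := exists_eq_add_unitOcc h0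
      rw [move_add, ev_of_deg_ne, smul_zero]
      rw [deg_add, deg_unitOcc] at hm ⊢
      exact hm
  revert hv
  refine occ_induction (P := fun c m => k.Valid m → (k.pow n c).ρ (Uq.E i) (k.ev c m) =
    qnum (m (hi i)) • k.ev c (move m (hi i) (lo i))) ?_ ?_ c m hm
  · intro _
    rw [ρ_one_vec]
    change Uq.lift (Uq.counitModel n) (Uq.E i) • _ = _
    rw [Uq.counit_E, zero_smul, Pi.zero_apply, Nat.cast_zero, qnum_zero, zero_smul]
  · intro c m j _ hj ih hv
    rw [ev_add_lowest k c m j hj, ρ_E_lm, ih (hv.mono le_self_add), map_smul]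
    by_cases hjh : j = hi i
    · subst hjh
      have hlo : m (lo i) = 0 := hj _ (lo_lt_hi i)
      have hb : below m (lo i) = 0 := below_eq_zero fun l hl => hj l (hl.trans (lo_lt_hi i))
      rw [if_pos rfl, ρ_qh_ev, map_smul, lm_ev, hb, pow_zero, one_smul, weight_coroot, hlo,
        move_add]
      rw [Nat.cast_zero, zero_sub, Pi.add_apply, unitOcc_self]
      by_cases h0 : m (hi i) = 0
      · rw [h0]
        simp [qnum_zero, qnum_one]
      · have hk : k = sym := by
          cases k
          · exact absurd (hv rfl (hi i)) (by simp; omega)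
          · rfl
        subst hk
        obtain ⟨m', rfl⟩ := exists_eq_add_unitOcc h0
        rw [move_add, lm_ev, below_add, below_unitOcc, if_pos (lo_lt_hi i)]
        rw [below_add, below_unitOcc, if_neg (lo_lt_hi i).not_gt] at hb
        rw [Pi.add_apply, unitOcc_of_ne (lo_ne_hi i), add_zero] at hlo
        rw [below_hi, show below m' (lo i) = 0 by omega, hlo, zero_add, zero_add, pow_one, smul_smul,
          add_right_comm, ← add_smul, Nat.cast_add _ 1, Nat.cast_one, qnum_add_one, s]
        congr 1
        ring
    · rw [if_neg hjh, zero_add, Pi.add_apply, unitOcc_of_ne (Ne.symm hjh), add_zero]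
      by_cases h0 : m (hi i) = 0
      · rw [h0, Nat.cast_zero, qnum_zero, zero_smul, zero_smul]
      · have hjl : j ≤ lo i := le_lo_of_lt_hi
          (lt_of_le_of_ne (not_lt.mp fun h => h0 (hj _ h)) hjh)
        obtain ⟨m', rfl⟩ := exists_eq_add_unitOcc h0
        rw [add_right_comm, move_add, move_add, add_right_comm, ev_add_lowest]
        intro l hl
        have := hj l hl
        rw [Pi.add_apply, Nat.add_eq_zero_iff] at this
        simp [this.1, (hl.trans_le hjl).ne]

lemma ρ_F_ev (k : Kind) (c : ℕ) (i : Fin (n - 1)) (m : Fin n → ℕ) (hv : k.Valid m) :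
    (k.pow n c).ρ (Uq.F i) (k.ev c m) = qnum (m (lo i)) • k.ev c (move m (lo i) (hi i)) := by
  by_cases hm : deg m = c
  swap
  · rw [ev_of_deg_ne k c m hm, map_zero]
    by_cases h0 : m (lo i) = 0
    · rw [h0, Nat.cast_zero, qnum_zero, zero_smul]
    · obtain ⟨m', rfl⟩ := exists_eq_add_unitOcc h0
      rw [move_add, ev_of_deg_ne, smul_zero]
      rw [deg_add, deg_unitOcc] at hm ⊢
      exact hm
  revert hv
  refine occ_induction (P := fun c m => k.Valid m → (k.pow n c).ρ (Uq.F i) (k.ev c m) =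
    qnum (m (lo i)) • k.ev c (move m (lo i) (hi i))) ?_ ?_ c m hm
  · intro _
    rw [ρ_one_vec]
    change Uq.lift (Uq.counitModel n) (Uq.F i) • _ = _
    rw [Uq.counit_F, zero_smul, Pi.zero_apply, Nat.cast_zero, qnum_zero, zero_smul]
  · intro c m j _ hj ih hv
    rw [ev_add_lowest k c m j hj, ρ_F_lm, ih (hv.mono le_self_add), map_smul]
    by_cases hjl : j = lo i
    · subst hjl
      rw [if_pos rfl, lm_ev, below_hi, below_eq_zero hj, zero_add, coroot_lo, move_add,
        Pi.add_apply, unitOcc_self]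
      by_cases h0 : m (lo i) = 0
      · rw [h0]
        simp [qnum_zero, qnum_one]
      · have hk : k = sym := by
          cases k
          · exact absurd (hv rfl (lo i)) (by simp; omega)
          · rfl
        subst hk
        obtain ⟨m', rfl⟩ := exists_eq_add_unitOcc h0
        rw [move_add, lm_ev, below_add, below_unitOcc, if_neg (lo_lt_hi i).not_gt]
        have hb := below_eq_zero hj
        rw [below_add] at hb
        rw [show below m' (lo i) = 0 by omega, add_zero, pow_zero, one_smul, smul_smul,
          add_right_comm, ← add_smul, Nat.cast_add _ 1, Nat.cast_one, qnum_add_one', s, zpow_neg,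
          zpow_one, zpow_natCast]
        congr 1
        ring
    · rw [if_neg hjl, zero_add, Pi.add_apply, unitOcc_of_ne (Ne.symm hjl), add_zero]
      by_cases h0 : m (lo i) = 0
      · rw [h0, Nat.cast_zero, qnum_zero, zero_smul, zero_smul, smul_zero]
      · have hjl' : j < lo i := lt_of_le_of_ne (not_lt.mp fun h => h0 (hj _ h)) hjl
        obtain ⟨m', rfl⟩ := exists_eq_add_unitOcc h0
        rw [coroot_of_ne hjl (hjl'.trans (lo_lt_hi i)).ne, neg_zero, zpow_zero, one_smul,
          add_right_comm, move_add, move_add, add_right_comm, ev_add_lowest]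
        intro l hl
        have := hj l hl
        rw [Pi.add_apply, Nat.add_eq_zero_iff] at this
        simp [this.1, (hl.trans (hjl'.trans (lo_lt_hi i))).ne]

end Kind

/-! ### Tensor products of bilinear forms -/

section TensorForm
variable {V W : Type*} [AddCommGroup V] [Module Kq V] [AddCommGroup W] [Module Kq W]

/-- The tensor product of two bilinear forms. -/
def tensorForm (B : V →ₗ[Kq] V →ₗ[Kq] Kq) (B' : W →ₗ[Kq] W →ₗ[Kq] Kq) :
    V ⊗[Kq] W →ₗ[Kq] V ⊗[Kq] W →ₗ[Kq] Kq :=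
  TensorProduct.dualDistrib Kq V W ∘ₗ TensorProduct.map B B'

lemma tensorForm_tmul (B : V →ₗ[Kq] V →ₗ[Kq] Kq) (B' : W →ₗ[Kq] W →ₗ[Kq] Kq) (v v' : V) (w w' : W) :
    tensorForm B B' (v ⊗ₜ w) (v' ⊗ₜ w') = B v v' * B' w w' := rfl

lemma tensorForm_injective [FiniteDimensional Kq V] [FiniteDimensional Kq W]
    {B : V →ₗ[Kq] V →ₗ[Kq] Kq} {B' : W →ₗ[Kq] W →ₗ[Kq] Kq} (hB : Function.Injective B)
    (hB' : Function.Injective B') : Function.Injective (tensorForm B B') := by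
  have h := (TensorProduct.dualDistribEquiv Kq V W).injective
  exact h.comp (TensorProduct.map_injective_of_flat_flat _ _ hB hB')

end TensorForm

lemma Uq.qh_mul_neg {n : ℕ} (h : Fin n → ℤ) : (Uq.qh h * Uq.qh (-h) : Uq n) = 1 := by
  have h1 := (Uq.tautModel n).qh_add h (-h)
  rw [add_neg_cancel, (Uq.tautModel n).qh_zero] at h1
  exact h1.symm

/-- The adjoint of a generator with respect to a contravariant form. -/
def UqGen.adj {n : ℕ} : UqGen n → Uq n
  | .qh h => Uq.qh h
  | .E i => q • (Uq.qh (coroot i) * Uq.F i)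
  | .F i => q⁻¹ • (Uq.E i * Uq.qh (-coroot i))

/-- A bilinear form for which the generators have the prescribed adjoints. -/
def FinRep.IsContravariant {n : ℕ} {X : FinRep (Uq n)} (B : X.V →ₗ[Kq] X.V →ₗ[Kq] Kq) : Prop :=
  ∀ (g : UqGen n) (x y : X.V), B (X.ρ (Uq.gen g) x) y = B x (X.ρ g.adj y)

namespace FinRep
variable {n : ℕ} {X Y : FinRep (Uq n)}

lemma ρ_qh_neg (h : Fin n → ℤ) (x : X.V) : X.ρ (Uq.qh h) (X.ρ (Uq.qh (-h)) x) = x := by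
  rw [← Module.End.mul_apply, ← map_mul, Uq.qh_mul_neg, map_one, Module.End.one_apply]

lemma ρ_qh_neg' (h : Fin n → ℤ) (x : X.V) : X.ρ (Uq.qh (-h)) (X.ρ (Uq.qh h) x) = x := by
  have := ρ_qh_neg (X := X) (-h) x
  rwa [neg_neg] at this

lemma ρ_adj_E (i : Fin (n - 1)) (x : X.V) :
    X.ρ (UqGen.E i).adj x = q • X.ρ (Uq.qh (coroot i)) (X.ρ (Uq.F i) x) := by
  rw [UqGen.adj, map_smul, map_mul, LinearMap.smul_apply, Module.End.mul_apply]

lemma ρ_adj_F (i : Fin (n - 1)) (x : X.V) :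
    X.ρ (UqGen.F i).adj x = q⁻¹ • X.ρ (Uq.E i) (X.ρ (Uq.qh (-coroot i)) x) := by
  rw [UqGen.adj, map_smul, map_mul, LinearMap.smul_apply, Module.End.mul_apply]

lemma ρ_adj_tmul_E (i : Fin (n - 1)) (x : X.V) (y : Y.V) :
    (X ⊗ Y).ρ (UqGen.E i).adj (x ⊗ₜ[Kq] y) =
      X.ρ (UqGen.E i).adj x ⊗ₜ[Kq] Y.ρ (Uq.qh (coroot i)) y + x ⊗ₜ[Kq] Y.ρ (UqGen.E i).adj y := by
  rw [ρ_adj_E (X := X), ρ_adj_E (X := Y)]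
  refine (ρ_adj_E (X := X ⊗ Y) i _).trans ?_
  rw [ρ_F_tmul]
  refine (congrArg (fun t => q • t) (map_add ((X ⊗ Y).ρ (Uq.qh (coroot i))) _ _)).trans ?_
  rw [ρ_qh_tmul, ρ_qh_tmul, ρ_qh_neg, ← TensorProduct.smul_tmul', TensorProduct.tmul_smul]
  exact smul_add _ _ _

lemma ρ_adj_tmul_F (i : Fin (n - 1)) (x : X.V) (y : Y.V) :
    (X ⊗ Y).ρ (UqGen.F i).adj (x ⊗ₜ[Kq] y) =
      X.ρ (UqGen.F i).adj x ⊗ₜ[Kq] y + X.ρ (Uq.qh (-coroot i)) x ⊗ₜ[Kq] Y.ρ (UqGen.F i).adj y := by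
  rw [ρ_adj_F (X := X), ρ_adj_F (X := Y)]
  refine (ρ_adj_F (X := X ⊗ Y) i _).trans ?_
  rw [ρ_qh_tmul, ρ_E_tmul, ρ_qh_neg, ← TensorProduct.smul_tmul', TensorProduct.tmul_smul]
  exact smul_add _ _ _

lemma IsContravariant.tensor {B : X.V →ₗ[Kq] X.V →ₗ[Kq] Kq} {B' : Y.V →ₗ[Kq] Y.V →ₗ[Kq] Kq}
    (hB : IsContravariant B) (hB' : IsContravariant B') :
    IsContravariant (X := X ⊗ Y) (tensorForm B B') := by
  intro g s t
  refine LinearMap.congr_fun₂ (f := (tensorForm B B') ∘ₗ (X ⊗ Y).ρ (Uq.gen g))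
    (g := LinearMap.compl₂ (tensorForm B B') ((X ⊗ Y).ρ g.adj)) ?_ s t
  refine TensorProduct.ext' fun x y => TensorProduct.ext' fun x' y' => ?_
  change tensorForm B B' ((X ⊗ Y).ρ (Uq.gen g) (x ⊗ₜ[Kq] y)) (x' ⊗ₜ[Kq] y') =
    tensorForm B B' (x ⊗ₜ[Kq] y) ((X ⊗ Y).ρ g.adj (x' ⊗ₜ[Kq] y'))
  have hK : ∀ h x y, B (X.ρ (Uq.qh h) x) y = B x (X.ρ (Uq.qh h) y) := fun h => hB (.qh h)
  have hK' : ∀ h x y, B' (Y.ρ (Uq.qh h) x) y = B' x (Y.ρ (Uq.qh h) y) := fun h => hB' (.qh h)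
  rcases g with h | i | i
  · rw [ρ_qh_tmul, tensorForm_tmul, hK, hK']
    refine Eq.symm ((congrArg (tensorForm B B' (x ⊗ₜ y)) (ρ_qh_tmul X Y h x' y')).trans ?_)
    rw [tensorForm_tmul]
  · rw [ρ_E_tmul, ρ_adj_tmul_E, map_add, map_add, LinearMap.add_apply, tensorForm_tmul,
      tensorForm_tmul, tensorForm_tmul, tensorForm_tmul, hK', ← hB, ← hB']
  · rw [ρ_F_tmul, ρ_adj_tmul_F, map_add, map_add, LinearMap.add_apply, tensorForm_tmul,
      tensorForm_tmul, tensorForm_tmul, tensorForm_tmul, hK, ← hB, ← hB']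

end FinRep

namespace Kind
variable {n : ℕ}

/-! ### The contravariant form -/

/-- The square norm of a power of a letter. -/
def norm₁ (a : ℕ) : Kq := ∏ j ∈ Finset.range a, qnum ((j : ℤ) + 1) * q ^ j

/-- The square norm of a standard basis vector. -/
def norm (m : Fin n → ℕ) : Kq := ∏ i, norm₁ (m i)

lemma norm₁_ne_zero (a : ℕ) : norm₁ a ≠ 0 :=
  Finset.prod_ne_zero_iff.mpr fun j _ =>
    mul_ne_zero (qnum_succ_ne_zero j) (pow_ne_zero _ Uq.q_ne_zero)

lemma norm_ne_zero (m : Fin n → ℕ) : norm m ≠ 0 :=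
  Finset.prod_ne_zero_iff.mpr fun _ _ => norm₁_ne_zero _

lemma norm₁_succ (a : ℕ) : norm₁ (a + 1) = norm₁ a * (qnum ((a : ℤ) + 1) * q ^ a) :=
  Finset.prod_range_succ _ _

lemma norm_zero : norm (0 : Fin n → ℕ) = 1 := by simp [norm, norm₁]

lemma norm_add_unitOcc (m : Fin n → ℕ) (i : Fin n) :
    norm (m + unitOcc i) = norm m * (qnum ((m i : ℤ) + 1) * q ^ m i) := by
  rw [norm, norm, ← Finset.mul_prod_erase _ _ (Finset.mem_univ i),
    ← Finset.mul_prod_erase (a := i) (f := fun j => norm₁ (m j)) _ (Finset.mem_univ i),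
    Pi.add_apply, unitOcc_self, norm₁_succ]
  rw [Finset.prod_congr rfl (g := fun j => norm₁ (m j))]
  · ring
  · intro j hj
    rw [Pi.add_apply, unitOcc_of_ne (Finset.ne_of_mem_erase hj), add_zero]

lemma norm_unitOcc (i : Fin n) : norm (unitOcc i) = 1 := by
  have := norm_add_unitOcc 0 i
  simpa [norm_zero, qnum_one] using this

/-- The contravariant form on a quantum power. -/
def form (k : Kind) (n c : ℕ) : (k.pow n c).V →ₗ[Kq] (k.pow n c).V →ₗ[Kq] Kq :=
  k.mkLin c fun m => norm m • (Finsupp.lapply m ∘ₗ k.coord n c)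

lemma form_ev_left (k : Kind) {c : ℕ} {m : Fin n → ℕ} (hv : k.Valid m) (hm : deg m = c)
    (w : (k.pow n c).V) : k.form n c (k.ev c m) w = norm m * k.coord n c w m := by
  rw [form, mkLin_ev k _ hv hm]
  rfl

lemma coord_ev_apply (k : Kind) {c : ℕ} {m : Fin n → ℕ} (hv : k.Valid m) (hm : deg m = c)
    (p : Fin n → ℕ) : k.coord n c (k.ev c p) m = if p = m then 1 else 0 := by
  by_cases hp : k.Valid p ∧ deg p = c
  · rw [coord_ev k c p hp.1 hp.2, Finsupp.single_apply]
  · rw [if_neg, show k.ev c p = 0 from ?_, map_zero, Finsupp.zero_apply]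
    · rw [not_and_or] at hp
      rcases hp with hp | hp
      · exact ev_of_not_valid k c p hp
      · exact ev_of_deg_ne k c p hp
    · rintro rfl
      exact hp ⟨hv, hm⟩

lemma form_ev_ev (k : Kind) {c : ℕ} {m : Fin n → ℕ} (hv : k.Valid m) (hm : deg m = c)
    (p : Fin n → ℕ) : k.form n c (k.ev c m) (k.ev c p) = if p = m then norm m else 0 := by
  rw [form_ev_left k hv hm, coord_ev_apply k hv hm, mul_ite, mul_one, mul_zero]

lemma form_symm (k : Kind) {c : ℕ} (x y : (k.pow n c).V) :
    k.form n c x y = k.form n c y x := by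
  refine LinearMap.congr_fun₂ (f := k.form n c) (g := (k.form n c).flip)
    (hom_ext fun m hv hm => hom_ext fun p hv' hp => ?_) x y
  rw [LinearMap.flip_apply, form_ev_ev k hv hm, form_ev_ev k hv' hp]
  by_cases h : p = m
  · rw [h]
  · rw [if_neg h, if_neg (Ne.symm h)]

lemma form_ev_ev' (k : Kind) {c : ℕ} {m : Fin n → ℕ} (hv : k.Valid m) (hm : deg m = c)
    (p : Fin n → ℕ) : k.form n c (k.ev c p) (k.ev c m) = if p = m then norm m else 0 := by
  rw [form_symm, form_ev_ev k hv hm]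

lemma eq_sum_coord (k : Kind) {c : ℕ} (x : (k.pow n c).V) :
    Finsupp.linearCombination Kq (k.ev c) (k.coord n c x) = x := by
  refine LinearMap.congr_fun (f := Finsupp.linearCombination Kq (k.ev c) ∘ₗ k.coord n c)
    (g := LinearMap.id) (hom_ext fun m hv hm => ?_) x
  rw [LinearMap.comp_apply, coord_ev k c m hv hm, Finsupp.linearCombination_single, one_smul]
  rfl

lemma form_injective (k : Kind) (n c : ℕ) : Function.Injective (k.form n c) := by
  rw [injective_iff_map_eq_zero]
  intro x hx
  rw [← eq_sum_coord k x, Finsupp.linearCombination_apply, Finsupp.sum]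
  refine Finset.sum_eq_zero fun m _ => ?_
  by_cases hm : k.Valid m ∧ deg m = c
  · have h1 := form_symm k (k.ev c m) x
    rw [hx, LinearMap.zero_apply, form_ev_left k hm.1 hm.2] at h1
    rw [(mul_eq_zero.mp h1).resolve_left (norm_ne_zero m), zero_smul]
  · rw [not_and_or] at hm
    rcases hm with hm | hm
    · rw [ev_of_not_valid k c m hm, smul_zero]
    · rw [ev_of_deg_ne k c m hm, smul_zero]

lemma form_contravariant (k : Kind) (n c : ℕ) :
    FinRep.IsContravariant (X := k.pow n c) (k.form n c) := by
  have hK : ∀ h x y, k.form n c ((k.pow n c).ρ (Uq.qh h) x) y =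
      k.form n c x ((k.pow n c).ρ (Uq.qh h) y) := by
    intro h x y
    refine LinearMap.congr_fun₂ (f := (k.form n c) ∘ₗ (k.pow n c).ρ (Uq.qh h))
      (g := LinearMap.compl₂ (k.form n c) ((k.pow n c).ρ (Uq.qh h)))
      (hom_ext fun m hv hm => hom_ext fun p hv' hp => ?_) x y
    rw [LinearMap.comp_apply, LinearMap.compl₂_apply, ρ_qh_ev, ρ_qh_ev, map_smul, map_smul,
      LinearMap.smul_apply, form_ev_ev k hv hm]
    by_cases h : p = m
    · rw [h]
    · simp [h]
  have hE : ∀ i x y, k.form n c ((k.pow n c).ρ (Uq.E i) x) y =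
      k.form n c x (q • (k.pow n c).ρ (Uq.qh (coroot i)) ((k.pow n c).ρ (Uq.F i) y)) := by
    intro i x y
    refine LinearMap.congr_fun₂ (f := (k.form n c) ∘ₗ (k.pow n c).ρ (Uq.E i))
      (g := LinearMap.compl₂ (k.form n c)
        (q • ((k.pow n c).ρ (Uq.qh (coroot i)) ∘ₗ (k.pow n c).ρ (Uq.F i))))
      (hom_ext fun m hv hm => hom_ext fun p hv' hp => ?_) x y
    rw [LinearMap.comp_apply, LinearMap.compl₂_apply, LinearMap.smul_apply, LinearMap.comp_apply,
      ρ_E_ev k c i m hv, ρ_F_ev k c i p hv', map_smul (k.form n c), LinearMap.smul_apply,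
      form_ev_ev' k hv' hp, map_smul ((k.pow n c).ρ (Uq.qh (coroot i))), ρ_qh_ev, map_smul,
      map_smul, map_smul, form_ev_ev k hv hm]
    simp only [smul_eq_mul]
    by_cases h0 : m (hi i) = 0
    · rw [h0, Nat.cast_zero, qnum_zero, zero_mul]
      by_cases h1 : p (lo i) = 0
      · rw [h1, Nat.cast_zero, qnum_zero]
        simp
      · obtain ⟨p', rfl⟩ := exists_eq_add_unitOcc h1
        rw [move_add, if_neg]
        · simp
        · intro h2
          have := congrFun h2 (hi i)
          rw [h0] at this
          simp at this
    · obtain ⟨m', rfl⟩ := exists_eq_add_unitOcc h0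
      rw [move_add]
      by_cases h1 : p (lo i) = 0
      · rw [h1, Nat.cast_zero, qnum_zero, if_neg]
        · simp
        · rintro rfl
          simp at h1
      · obtain ⟨p', rfl⟩ := exists_eq_add_unitOcc h1
        rw [move_add]
        by_cases h2 : m' = p'
        · subst h2
          have hlo := lo_ne_hi i
          have hq := Uq.q_ne_zero
          rw [if_pos rfl, if_pos rfl, weight_coroot, norm_add_unitOcc, norm_add_unitOcc]
          simp only [Pi.add_apply, unitOcc_self, unitOcc_of_ne hlo, Nat.cast_add, Nat.cast_one, add_zero]
          rw [zpow_sub₀ hq, zpow_add₀ hq, zpow_natCast, zpow_natCast, zpow_one]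
          field_simp
        · have h3 : m' + unitOcc (lo i) ≠ p' + unitOcc (lo i) := fun h => h2 (add_right_cancel h)
          have h4 : p' + unitOcc (hi i) ≠ m' + unitOcc (hi i) :=
            fun h => h2 (add_right_cancel h).symm
          rw [if_neg h3, if_neg h4]
          simp
  rintro (h | i | i) x y
  · exact hK h x y
  · rw [FinRep.ρ_adj_E]
    exact hE i x y
  · rw [FinRep.ρ_adj_F, form_symm k x, map_smul, LinearMap.smul_apply, hE, hK, map_smul,
      FinRep.ρ_qh_neg', map_smul, smul_eq_mul, smul_eq_mul, ← mul_assoc,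
      inv_mul_cancel₀ Uq.q_ne_zero, one_mul, form_symm k y]

/-! ### Comultiplication -/

/-- The coefficient of the comultiplication. -/
def comulCoeff (k : Kind) (x y : Fin n → ℕ) : Kq :=
  k.r ^ (deg x * deg y) * k.s ^ cross y x * norm (x + y) / (norm x * norm y)

/-- The comultiplication of the quantum powers, as a linear map. -/
def comulLin (k : Kind) (n a b c : ℕ) : (k.pow n c).V →ₗ[Kq] (k.pow n a).V ⊗[Kq] (k.pow n b).V :=
  k.mkLin c fun m => ∑ y ∈ Finset.Iic m, k.comulCoeff (m - y) y • (k.ev a (m - y) ⊗ₜ k.ev b y)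

lemma tensorForm_comulLin (k : Kind) {a b c : ℕ} (z : (k.pow n c).V)
    (t : (k.pow n a).V ⊗[Kq] (k.pow n b).V) :
    tensorForm (k.form n a) (k.form n b) (k.comulLin n a b c z) t =
      k.r ^ (a * b) * k.form n c z (k.mulLin n a b c t) := by
  refine LinearMap.congr_fun₂ (f := tensorForm (k.form n a) (k.form n b) ∘ₗ k.comulLin n a b c)
    (g := k.r ^ (a * b) • LinearMap.compl₂ (k.form n c) (k.mulLin n a b c))
    (hom_ext fun m hv hm => tensor_hom_ext fun x y hx hdx hy hdy => ?_) z t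
  rw [LinearMap.comp_apply, comulLin, mkLin_ev k _ hv hm, LinearMap.smul_apply,
    LinearMap.smul_apply, LinearMap.compl₂_apply, mulLin_ev k hdx hdy, map_smul,
    form_ev_ev k hv hm, map_sum, LinearMap.sum_apply]
  simp only [map_smul, LinearMap.smul_apply, tensorForm_tmul, form_ev_ev' k hx hdx,
    form_ev_ev' k hy hdy, smul_eq_mul]
  by_cases hm' : x + y = m
  · subst hm'
    rw [Finset.sum_eq_single y]
    · rw [add_tsub_cancel_right, if_pos rfl, if_pos rfl, if_pos rfl, comulCoeff, hdx, hdy]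
      have h1 := norm_ne_zero x
      have h2 := norm_ne_zero y
      field_simp
    · intro y' _ hy'
      rw [if_neg hy', mul_zero, mul_zero]
    · intro hh
      exact absurd (Finset.mem_Iic.mpr le_add_self) hh
  · rw [if_neg hm', mul_zero, mul_zero]
    refine Finset.sum_eq_zero fun y' hy' => ?_
    by_cases h1 : y' = y
    · subst h1
      rw [if_neg, zero_mul, mul_zero]
      rintro rfl
      exact hm' (tsub_add_cancel_of_le (Finset.mem_Iic.mp hy'))
    · rw [if_neg h1, mul_zero, mul_zero]

lemma form₂_injective (k : Kind) (n a b : ℕ) :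
    Function.Injective (tensorForm (k.form n a) (k.form n b)) :=
  tensorForm_injective (k.form_injective n a) (k.form_injective n b)

lemma comulLin_comm (k : Kind) {a b c : ℕ} (h : a + b = c) (u : Uq n) :
    k.comulLin n a b c ∘ₗ (k.pow n c).ρ u =
      (k.pow n a ⊗ k.pow n b : FinRep (Uq n)).ρ u ∘ₗ k.comulLin n a b c := by
  refine FinRep.comm_of_gen (Y := (k.pow n a ⊗ k.pow n b : FinRep (Uq n))) _ (fun g => ?_) u
  refine LinearMap.ext fun z => k.form₂_injective n a b (LinearMap.ext fun t => ?_)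
  have h1 := LinearMap.congr_fun (k.mulLin_comm h (n := n) g.adj) t
  have h2 := (k.form_contravariant n a).tensor (k.form_contravariant n b) g
    (k.comulLin n a b c z) t
  refine Eq.trans ?_ h2.symm
  change tensorForm (k.form n a) (k.form n b) (k.comulLin n a b c ((k.pow n c).ρ (Uq.gen g) z)) t = _
  rw [tensorForm_comulLin k, k.form_contravariant n c]
  refine Eq.trans ?_ (tensorForm_comulLin k z _).symm
  exact congrArg (fun s => k.r ^ (a * b) * k.form n c z s) h1.symm

/-- The comultiplication of the quantum powers. -/
def comulHom (k : Kind) (n : ℕ) {a b c : ℕ} (h : a + b = c) :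
    k.pow n c ⟶ (k.pow n a ⊗ k.pow n b : FinRep (Uq n)) :=
  FinRep.mkHom (Y := (k.pow n a ⊗ k.pow n b : FinRep (Uq n))) (k.comulLin n a b c)
    (k.comulLin_comm h)

lemma comulLin_coassoc (k : Kind) {a b c ab bc abc : ℕ} (h₁ : a + b = ab) (h₃ : b + c = bc) (z : (k.pow n abc).V) :
    TensorProduct.assoc Kq _ _ _
      (TensorProduct.map (k.comulLin n a b ab) LinearMap.id (k.comulLin n ab c abc z)) =
        TensorProduct.map LinearMap.id (k.comulLin n b c bc) (k.comulLin n a bc abc z) := by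
  have key₁ : ∀ (t : (k.pow n ab).V ⊗[Kq] (k.pow n c).V) x y w,
      tensorForm (k.form n a) (tensorForm (k.form n b) (k.form n c)) (TensorProduct.assoc Kq _ _ _
        (TensorProduct.map (k.comulLin n a b ab) LinearMap.id t)) (x ⊗ₜ (y ⊗ₜ w)) =
      k.r ^ (a * b) * tensorForm (k.form n ab) (k.form n c) t
        (k.mulLin n a b ab (x ⊗ₜ y) ⊗ₜ w) := by
    intro t x y w
    have h0 : ∀ (p : (k.pow n a).V ⊗[Kq] (k.pow n b).V) (u : (k.pow n c).V),
        tensorForm (k.form n a) (tensorForm (k.form n b) (k.form n c)) (TensorProduct.assoc Kq _ _ _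
          (p ⊗ₜ u)) (x ⊗ₜ (y ⊗ₜ w)) =
        tensorForm (k.form n a) (k.form n b) p (x ⊗ₜ y) * k.form n c u w := by
      intro p u
      induction p using TensorProduct.induction_on with
      | zero => simp
      | tmul p p' => rw [TensorProduct.assoc_tmul]; simp only [tensorForm_tmul]; ring
      | add p p' hp hp' =>
        rw [TensorProduct.add_tmul, map_add, map_add, map_add, LinearMap.add_apply,
          LinearMap.add_apply, hp, hp', add_mul]
    induction t using TensorProduct.induction_on with
    | zero => simp
    | tmul t u =>
      rw [TensorProduct.map_tmul, h0, tensorForm_comulLin k, tensorForm_tmul, LinearMap.id_apply,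
        mul_assoc]
    | add t t' ht ht' =>
      rw [map_add, map_add, map_add, map_add, LinearMap.add_apply, LinearMap.add_apply, ht, ht',
        mul_add]
  have key₂ : ∀ (t : (k.pow n a).V ⊗[Kq] (k.pow n bc).V) x y w,
      tensorForm (k.form n a) (tensorForm (k.form n b) (k.form n c))
        (TensorProduct.map LinearMap.id (k.comulLin n b c bc) t) (x ⊗ₜ (y ⊗ₜ w)) =
      k.r ^ (b * c) * tensorForm (k.form n a) (k.form n bc) t
        (x ⊗ₜ k.mulLin n b c bc (y ⊗ₜ w)) := by
    intro t x y w
    induction t using TensorProduct.induction_on with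
    | zero => simp
    | tmul t u =>
      rw [TensorProduct.map_tmul, tensorForm_tmul, tensorForm_comulLin k, tensorForm_tmul,
        LinearMap.id_apply]
      ring
    | add t t' ht ht' =>
      rw [map_add, map_add, map_add, LinearMap.add_apply, LinearMap.add_apply, ht, ht', mul_add]
  refine tensorForm_injective (k.form_injective n a) (k.form₂_injective n b c) ?_
  refine TensorProduct.ext (LinearMap.ext fun x => TensorProduct.ext'  fun y w => ?_)
  change tensorForm (k.form n a) (tensorForm (k.form n b) (k.form n c)) _ (x ⊗ₜ (y ⊗ₜ w)) =
    tensorForm (k.form n a) (tensorForm (k.form n b) (k.form n c)) _ (x ⊗ₜ (y ⊗ₜ w))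
  rw [key₁, key₂, tensorForm_comulLin k, tensorForm_comulLin k, mulLin_assoc k h₁ h₃,
    ← mul_assoc, ← mul_assoc, ← pow_add, ← pow_add]
  congr 2
  rw [← h₁, ← h₃]
  ring

end Kind

/-! ### Telescoping sums of quantum integers -/

/-- The contribution of `k` to the difference of the sums below and above `i`. -/
def skewTerm {n : ℕ} (h : Fin n → ℤ) (i k : Fin n) : ℤ :=
  if k < i then h k else if i < k then -h k else 0

/-- The sum of the values below `i` minus the sum of the values above `i`. -/
def skew {n : ℕ} (h : Fin n → ℤ) (i : Fin n) : ℤ := ∑ k, skewTerm h i k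

lemma skew_sub {n : ℕ} (h h' : Fin n → ℤ) (i : Fin n) :
    skew (fun k => h k - h' k) i = skew h i - skew h' i := by
  rw [skew, skew, skew, ← Finset.sum_sub_distrib]
  refine Finset.sum_congr rfl fun k _ => ?_
  unfold skewTerm
  split_ifs <;> ring

lemma sum_skew_qnum {n : ℕ} {e : ℤ} (he : e = 1 ∨ e = -1) (h : Fin n → ℤ) :
    ∑ i, q ^ (e * skew h i) * qnum (h i) = qnum (∑ i, h i) := by
  have hq := Uq.q_ne_zero
  have key : ∀ S : Finset (Fin n), ∑ i ∈ S, q ^ (e * ∑ k ∈ S, skewTerm h i k) * qnum (h i) =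
      qnum (∑ i ∈ S, h i) := by
    intro S
    induction S using Finset.induction_on_max with
    | empty => simp [qnum_zero]
    | insert a S hS ih =>
      have ha : a ∉ S := fun h => lt_irrefl _ (hS a h)
      rw [Finset.sum_insert ha, Finset.sum_insert ha, Finset.sum_insert ha]
      have h1 : ∑ k ∈ S, skewTerm h a k = ∑ k ∈ S, h k :=
        Finset.sum_congr rfl fun k hk => if_pos (hS k hk)
      have h2 : ∑ i ∈ S, q ^ (e * ∑ k ∈ insert a S, skewTerm h i k) * qnum (h i) =
          q ^ (-(e * h a)) * qnum (∑ i ∈ S, h i) := by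
        rw [← ih, Finset.mul_sum]
        refine Finset.sum_congr rfl fun i hi => ?_
        rw [Finset.sum_insert ha, ← mul_assoc, ← zpow_add₀ hq,
          show skewTerm h i a = -h a from (if_neg (hS i hi).not_gt).trans (if_pos (hS i hi))]
        ring_nf
      have h3 : skewTerm h a a = 0 := by simp [skewTerm]
      rw [h1, h2, h3, zero_add]
      rcases he with rfl | rfl
      · rw [add_comm (h a), add_comm (∑ i ∈ S, h i) (h a), qnum_add, one_mul, one_mul]
      · rw [add_comm (h a), qnum_add, neg_one_mul, neg_one_mul, neg_neg]
        ring
  exact key Finset.univ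

namespace Kind
variable {n : ℕ}

lemma skew_natCast (m : Fin n → ℕ) (i : Fin n) :
    skew (fun k => (m k : ℤ)) i = (below m i : ℤ) - above m i := by
  simp only [skew, skewTerm, below, above]
  have h : ∀ k : Fin n, (if k < i then (m k : ℤ) else if i < k then -(m k : ℤ) else 0) =
      (if k < i then (m k : ℤ) else 0) - if i < k then (m k : ℤ) else 0 := by
    intro k
    rcases lt_trichotomy k i with h | h | h
    · simp [h, h.not_gt]
    · simp [h]
    · simp [h, h.not_gt]
  simp only [h, Finset.sum_sub_distrib, ← Finset.sum_filter, Nat.cast_sum, Finset.filter_gt_eq_Iio,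
    Finset.filter_lt_eq_Ioi]

/-! ### Comultiplication with a thin component -/

/-- The exponent of `q` in `r`. -/
def rExp : Kind → ℤ
  | ext => 1
  | sym => -1

lemma r_eq (k : Kind) : k.r = q ^ k.rExp := by cases k <;> simp [r, rExp]

lemma rExp_eq (k : Kind) : k.rExp = 1 ∨ k.rExp = -1 := by cases k <;> simp [rExp]

lemma s_pow_mul_b_pow (k : Kind) (t : ℕ) : k.s ^ t * k.b ^ t = (k.r ^ t)⁻¹ := by
  rw [← mul_pow, ← inv_pow]
  congr 1
  refine eq_inv_of_mul_eq_one_left ?_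
  rw [mul_right_comm, s_mul_r, b_sq]

/-- The quantum integer, restricted to admissible multiplicities. -/
def mult : Kind → ℕ → Kq
  | ext, a => if a = 1 then 1 else 0
  | sym, a => qnum a

lemma mult_zero (k : Kind) : k.mult 0 = 0 := by cases k <;> simp [mult, qnum_zero]

lemma mult_one (k : Kind) : k.mult 1 = 1 := by cases k <;> simp [mult, qnum_one]

lemma mult_of_valid {k : Kind} {m : Fin n → ℕ} (h : k.Valid m) (i : Fin n) :
    k.mult (m i) = qnum (m i) := by
  cases k with
  | ext =>
    have h1 : m i = 0 ∨ m i = 1 := by have := h rfl i; omega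
    rcases h1 with h1 | h1 <;> simp [mult, h1, qnum_zero, qnum_one]
  | sym => rfl

lemma mult_mul_sub {k : Kind} {m p : Fin n → ℕ} (h : k.Valid m) (h' : k.Valid p) (i : Fin n) :
    k.mult (m i) * k.mult (p i + 1) - k.mult (p i) * k.mult (m i + 1) =
      qnum ((m i : ℤ) - p i) := by
  cases k with
  | ext =>
    have h1 : m i = 0 ∨ m i = 1 := by have := h rfl i; omega
    have h2 : p i = 0 ∨ p i = 1 := by have := h' rfl i; omega
    rcases h1 with h1 | h1 <;> rcases h2 with h2 | h2 <;>
      simp [h1, h2, mult, qnum_zero, qnum_one, qnum_neg]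
  | sym =>
    have hq := Uq.q_ne_zero
    simp only [mult, Nat.cast_add, Nat.cast_one]
    rw [qnum_add_one, qnum_add_one, sub_eq_add_neg (m i : ℤ), qnum_add, qnum_neg]
    ring

/-- The coefficients of the comultiplication with thin right component. -/
def thinR (k : Kind) (m : Fin n → ℕ) (i : Fin n) : Kq :=
  k.r ^ below m i * k.b ^ above m i * k.mult (m i)

/-- The coefficients of the comultiplication with thin left component. -/
def thinL (k : Kind) (m : Fin n → ℕ) (i : Fin n) : Kq :=
  k.r ^ above m i * k.b ^ below m i * k.mult (m i)

lemma eq_unitOcc_of_deg {m : Fin n → ℕ} (h : deg m = 1) : ∃ i, m = unitOcc i := by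
  have h0 : m ≠ 0 := by rintro rfl; simp at h
  obtain ⟨j, m', rfl, _⟩ := exists_lowest h0
  refine ⟨j, ?_⟩
  rw [deg_add, deg_unitOcc] at h
  rw [deg_eq_zero.mp (by omega : deg m' = 0), zero_add]

lemma mult_smul_ev (k : Kind) {a c : ℕ} (hc : a + 1 = c) {m : Fin n → ℕ}
    (h : ¬(k.Valid m ∧ deg m = c)) (i : Fin n) : k.mult (m i) • k.ev a (m - unitOcc i) = 0 := by
  by_cases h0 : m i = 0
  · rw [h0, mult_zero, zero_smul]
  obtain ⟨m', rfl⟩ := exists_eq_add_unitOcc h0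
  rw [add_tsub_cancel_right]
  by_cases hd : deg m' = a
  swap
  · rw [ev_of_deg_ne k a m' hd, smul_zero]
  by_cases hv : k.Valid m'
  swap
  · rw [ev_of_not_valid k a m' hv, smul_zero]
  have h2 : ¬k.Valid (m' + unitOcc i) := fun h' => h ⟨h', by rw [deg_add, deg_unitOcc, hd, hc]⟩
  simp only [Valid, not_forall, not_le] at h2
  obtain ⟨hk, j, hj⟩ := h2
  have hj' := hv hk j
  obtain rfl : j = i := by
    by_contra hji
    rw [Pi.add_apply, unitOcc_of_ne hji] at hj
    omega
  subst hk
  rw [mult, if_neg (by omega), zero_smul]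

lemma ev_eq_zero (k : Kind) {c : ℕ} {m : Fin n → ℕ} (h : ¬(k.Valid m ∧ deg m = c)) :
    k.ev c m = 0 := by
  rw [not_and_or] at h
  rcases h with h | h
  · exact ev_of_not_valid k c m h
  · exact ev_of_deg_ne k c m h

lemma thin_norm (k : Kind) {x : Fin n → ℕ} {j : Fin n} (h : k.Valid (x + unitOcc j)) :
    k.r ^ x j * (qnum ((x j : ℤ) + 1) * q ^ x j) = k.mult (x j + 1) := by
  have hq := Uq.q_ne_zero
  cases k with
  | ext =>
    have := h rfl j
    rw [Pi.add_apply, unitOcc_self] at this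
    have hx : x j = 0 := by omega
    simp [hx, mult, qnum_one]
  | sym =>
    simp only [mult, r, Nat.cast_add, Nat.cast_one, inv_pow]
    field_simp

lemma comulLin_thin_right (k : Kind) {a c : ℕ} (hc : a + 1 = c) (m : Fin n → ℕ) :
    k.comulLin n a 1 c (k.ev c m) =
      ∑ i, k.thinR m i • (k.ev a (m - unitOcc i) ⊗ₜ[Kq] k.ev 1 (unitOcc i)) := by
  by_cases hm : k.Valid m ∧ deg m = c
  swap
  · rw [ev_eq_zero k hm, map_zero]
    refine (Finset.sum_eq_zero fun i _ => ?_).symm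
    rw [thinR, mul_smul, TensorProduct.smul_tmul', mult_smul_ev k hc hm, TensorProduct.zero_tmul,
      smul_zero]
  refine k.form₂_injective n a 1 (tensor_hom_ext fun x y hx hdx hy hdy => ?_)
  obtain ⟨j, rfl⟩ := eq_unitOcc_of_deg hdy
  rw [tensorForm_comulLin, mulLin_ev k hdx hdy, map_smul, form_ev_ev k hm.1 hm.2, map_sum,
    LinearMap.sum_apply, cross_unitOcc_left, Finset.sum_eq_single j]
  · rw [map_smul, LinearMap.smul_apply, tensorForm_tmul, form_ev_ev' k hx hdx,
      form_ev_ev k (k.valid_unitOcc j) hdy, if_pos rfl, norm_unitOcc, mul_one, smul_eq_mul,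
      smul_eq_mul]
    by_cases h : x + unitOcc j = m
    · subst h
      rw [add_tsub_cancel_right, if_pos rfl, if_pos rfl, norm_add_unitOcc, thinR, below_add,
        above_add, below_unitOcc, above_unitOcc, if_neg (lt_irrefl j), Pi.add_apply, unitOcc_self,
        add_zero, add_zero, ← k.thin_norm hm.1, mul_one, ← hdx, deg_eq x j, ← s_mul_r, mul_pow,
        pow_add, pow_add]
      ring
    · rw [if_neg h, mul_zero, mul_zero]
      by_cases h0 : m j = 0
      · rw [thinR, h0, mult_zero, mul_zero, zero_mul]
      · obtain ⟨m', rfl⟩ := exists_eq_add_unitOcc h0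
        rw [add_tsub_cancel_right, if_neg, zero_mul, mul_zero]
        rintro rfl
        exact h rfl
  · intro i _ hij
    rw [map_smul, LinearMap.smul_apply, tensorForm_tmul,
      form_ev_ev k (k.valid_unitOcc i) (deg_unitOcc i), if_neg, mul_zero, smul_zero]
    intro h
    have := congrFun h i
    rw [unitOcc_self, unitOcc_of_ne hij] at this
    omega
  · simp

lemma comulLin_thin_left (k : Kind) {b c : ℕ} (hc : b + 1 = c) (m : Fin n → ℕ) :
    k.comulLin n 1 b c (k.ev c m) =
      ∑ i, k.thinL m i • (k.ev 1 (unitOcc i) ⊗ₜ[Kq] k.ev b (m - unitOcc i)) := by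
  by_cases hm : k.Valid m ∧ deg m = c
  swap
  · rw [ev_eq_zero k hm, map_zero]
    refine (Finset.sum_eq_zero fun i _ => ?_).symm
    rw [thinL, mul_smul, ← TensorProduct.tmul_smul, mult_smul_ev k hc hm, TensorProduct.tmul_zero,
      smul_zero]
  refine k.form₂_injective n 1 b (tensor_hom_ext fun y x hy hdy hx hdx => ?_)
  obtain ⟨j, rfl⟩ := eq_unitOcc_of_deg hdy
  rw [tensorForm_comulLin, mulLin_ev k hdy hdx, map_smul, form_ev_ev k hm.1 hm.2, map_sum,
    LinearMap.sum_apply, cross_unitOcc_right, Finset.sum_eq_single j]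
  · rw [map_smul, LinearMap.smul_apply, tensorForm_tmul, form_ev_ev' k hx hdx,
      form_ev_ev k (k.valid_unitOcc j) hdy, if_pos rfl, norm_unitOcc, one_mul, smul_eq_mul,
      smul_eq_mul, add_comm (unitOcc j)]
    by_cases h : x + unitOcc j = m
    · subst h
      rw [add_tsub_cancel_right, if_pos rfl, if_pos rfl, norm_add_unitOcc, thinL, below_add,
        above_add, below_unitOcc, above_unitOcc, if_neg (lt_irrefl j), Pi.add_apply, unitOcc_self,
        add_zero, add_zero, ← k.thin_norm hm.1, one_mul, ← hdx, deg_eq x j, ← s_mul_r, mul_pow,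
        pow_add, pow_add]
      ring
    · rw [if_neg h, mul_zero, mul_zero]
      by_cases h0 : m j = 0
      · rw [thinL, h0, mult_zero, mul_zero, zero_mul]
      · obtain ⟨m', rfl⟩ := exists_eq_add_unitOcc h0
        rw [add_tsub_cancel_right, if_neg, mul_zero, mul_zero]
        rintro rfl
        exact h rfl
  · intro i _ hij
    rw [map_smul, LinearMap.smul_apply, tensorForm_tmul,
      form_ev_ev k (k.valid_unitOcc i) (deg_unitOcc i), if_neg, zero_mul, smul_zero]
    intro h
    have := congrFun h i
    rw [unitOcc_self, unitOcc_of_ne hij] at this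
    omega
  · simp

lemma mulLin_thin_right (k : Kind) {a c : ℕ} (hc : a + 1 = c) (x : Fin n → ℕ) (i : Fin n) :
    k.mulLin n a 1 c (k.ev a x ⊗ₜ k.ev 1 (unitOcc i)) =
      k.s ^ above x i • k.ev c (x + unitOcc i) := by
  by_cases hx : deg x = a
  · rw [mulLin_ev k hx (deg_unitOcc i), cross_unitOcc_left]
  · rw [ev_of_deg_ne k a x hx, TensorProduct.zero_tmul, map_zero, ev_of_deg_ne k c, smul_zero]
    rw [deg_add, deg_unitOcc]
    omega

lemma mulLin_thin_left (k : Kind) {b c : ℕ} (hc : b + 1 = c) (y : Fin n → ℕ) (i : Fin n) :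
    k.mulLin n 1 b c (k.ev 1 (unitOcc i) ⊗ₜ k.ev b y) =
      k.s ^ below y i • k.ev c (y + unitOcc i) := by
  by_cases hy : deg y = b
  · rw [mulLin_ev k (deg_unitOcc i) hy, cross_unitOcc_right, add_comm (unitOcc i)]
  · rw [ev_of_deg_ne k b y hy, TensorProduct.tmul_zero, map_zero, ev_of_deg_ne k c, smul_zero]
    rw [deg_add, deg_unitOcc]
    omega

/-! ### The square switch on basis vectors -/

lemma deg_cast (m : Fin n → ℕ) : ((deg m : ℕ) : ℤ) = ∑ i, (m i : ℤ) := by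
  rw [deg, Nat.cast_sum]

lemma r_pow_ratio (k : Kind) (a b : ℕ) : k.r ^ a * (k.r ^ b)⁻¹ = q ^ (k.rExp * ((a : ℤ) - b)) := by
  have hq := Uq.q_ne_zero
  rw [r_eq, ← zpow_natCast, ← zpow_natCast, ← zpow_mul, ← zpow_mul, ← zpow_neg, ← zpow_add₀ hq]
  congr 1
  ring

lemma sum_mult (k : Kind) {m : Fin n → ℕ} (h : k.Valid m) :
    ∑ i, k.r ^ below m i * (k.r ^ above m i)⁻¹ * k.mult (m i) = qnum (deg m) := by
  rw [deg_cast, ← sum_skew_qnum k.rExp_eq]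
  refine Finset.sum_congr rfl fun i _ => ?_
  rw [mult_of_valid h, r_pow_ratio, skew_natCast]

/-- The common value of the diagonal coefficients. -/
lemma sum_mult_sub (k : Kind) {m p : Fin n → ℕ} (h : k.Valid m) (h' : k.Valid p) :
    ∑ i, k.r ^ below m i * (k.r ^ above m i)⁻¹ * (k.r ^ above p i * (k.r ^ below p i)⁻¹) *
      (k.mult (m i) * k.mult (p i + 1) - k.mult (p i) * k.mult (m i + 1)) =
        qnum ((deg m : ℤ) - deg p) := by
  have hq := Uq.q_ne_zero
  rw [deg_cast, deg_cast, ← Finset.sum_sub_distrib, ← sum_skew_qnum k.rExp_eq]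
  refine Finset.sum_congr rfl fun i _ => ?_
  rw [mult_mul_sub h h', r_pow_ratio, r_pow_ratio, ← zpow_add₀ hq, skew_sub, skew_natCast,
    skew_natCast]
  congr 2
  ring

lemma rung_exchange (k : Kind) {m p : Fin n → ℕ} (hm : k.Valid m) (hp : k.Valid p)
    {M : Type*} [AddCommGroup M] [Module Kq M] (W : (Fin n → ℕ) → (Fin n → ℕ) → M) :
    ∑ i, ∑ j, (k.thinR m i * k.s ^ below p i *
        (k.thinL (p + unitOcc i) j * k.s ^ above (m - unitOcc i) j)) •
        W (m - unitOcc i + unitOcc j) (p + unitOcc i - unitOcc j) =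
      ∑ j, ∑ i, (k.thinL p j * k.s ^ above m j *
        (k.thinR (m + unitOcc j) i * k.s ^ below (p - unitOcc j) i)) •
        W (m + unitOcc j - unitOcc i) (p - unitOcc j + unitOcc i) +
      qnum ((deg m : ℤ) - deg p) • W m p := by
  rw [← sum_mult_sub k hm hp, Finset.sum_smul, Finset.sum_comm (s := Finset.univ)
    (t := Finset.univ) (f := fun j i => (k.thinL p j * k.s ^ above m j *
        (k.thinR (m + unitOcc j) i * k.s ^ below (p - unitOcc j) i)) •
        W (m + unitOcc j - unitOcc i) (p - unitOcc j + unitOcc i)), ← Finset.sum_add_distrib]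
  refine Finset.sum_congr rfl fun i _ => ?_
  rw [← Finset.sum_erase_add _ _ (Finset.mem_univ i), ← Finset.sum_erase_add
    (f := fun j => (k.thinL p j * k.s ^ above m j *
        (k.thinR (m + unitOcc j) i * k.s ^ below (p - unitOcc j) i)) •
        W (m + unitOcc j - unitOcc i) (p - unitOcc j + unitOcc i)) _ (Finset.mem_univ i), add_assoc]
  congr 1
  · refine Finset.sum_congr rfl fun j hj => ?_
    have hji : j ≠ i := Finset.ne_of_mem_erase hj
    by_cases hmi : m i = 0
    · have h1 : k.thinR m i = 0 := by rw [thinR, hmi, mult_zero, mul_zero]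
      have h2 : k.thinR (m + unitOcc j) i = 0 := by
        rw [thinR, Pi.add_apply, unitOcc_of_ne hji.symm, hmi, mult_zero, mul_zero]
      rw [h1, h2, zero_mul, zero_mul, zero_mul, mul_zero, zero_smul, zero_smul]
    by_cases hpj : p j = 0
    · have h1 : k.thinL p j = 0 := by rw [thinL, hpj, mult_zero, mul_zero]
      have h2 : k.thinL (p + unitOcc i) j = 0 := by
        rw [thinL, Pi.add_apply, unitOcc_of_ne hji, hpj, mult_zero, mul_zero]
      rw [h1, h2, zero_mul, zero_mul, zero_mul, mul_zero, zero_smul, zero_smul]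
    obtain ⟨m, rfl⟩ := exists_eq_add_unitOcc hmi
    obtain ⟨p, rfl⟩ := exists_eq_add_unitOcc hpj
    rw [add_tsub_cancel_right, add_tsub_cancel_right, add_right_comm p, add_tsub_cancel_right,
      add_right_comm m, add_tsub_cancel_right]
    congr 1
    simp only [thinR, thinL, below_add, above_add, Pi.add_apply, below_unitOcc, above_unitOcc,
      lt_irrefl, if_false, unitOcc_self, unitOcc_of_ne hji, unitOcc_of_ne hji.symm, add_zero]
    rcases lt_or_gt_of_ne hji with h | h
    · simp only [h, h.not_gt, if_true, if_false, add_zero, pow_succ]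
      ring
    · simp only [h, h.not_gt, if_true, if_false, add_zero, pow_succ]
      ring
  · set C : Kq := k.r ^ below m i * (k.r ^ above m i)⁻¹ * (k.r ^ above p i * (k.r ^ below p i)⁻¹)
    have h1 : (k.thinR m i * k.s ^ below p i *
        (k.thinL (p + unitOcc i) i * k.s ^ above (m - unitOcc i) i)) •
        W (m - unitOcc i + unitOcc i) (p + unitOcc i - unitOcc i) =
        (C * (k.mult (m i) * k.mult (p i + 1))) • W m p := by
      rw [add_tsub_cancel_right]
      by_cases hmi : m i = 0
      · rw [thinR, hmi, mult_zero, mul_zero, zero_mul, zero_mul, zero_mul, mul_zero, zero_smul,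
          zero_smul]
      obtain ⟨m', rfl⟩ := exists_eq_add_unitOcc hmi
      rw [add_tsub_cancel_right]
      congr 1
      simp only [C, thinR, thinL, below_add, above_add, Pi.add_apply, below_unitOcc,
        above_unitOcc, lt_irrefl, if_false, unitOcc_self, add_zero]
      rw [← s_pow_mul_b_pow, ← s_pow_mul_b_pow]
      ring
    have h2 : (k.thinL p i * k.s ^ above m i *
        (k.thinR (m + unitOcc i) i * k.s ^ below (p - unitOcc i) i)) •
        W (m + unitOcc i - unitOcc i) (p - unitOcc i + unitOcc i) =
        (C * (k.mult (p i) * k.mult (m i + 1))) • W m p := by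
      rw [add_tsub_cancel_right]
      by_cases hpi : p i = 0
      · rw [thinL, hpi, mult_zero, mul_zero, zero_mul, zero_mul, zero_mul, mul_zero, zero_smul,
          zero_smul]
      obtain ⟨p', rfl⟩ := exists_eq_add_unitOcc hpi
      rw [add_tsub_cancel_right]
      congr 1
      simp only [C, thinR, thinL, below_add, above_add, Pi.add_apply, below_unitOcc,
        above_unitOcc, lt_irrefl, if_false, unitOcc_self, add_zero]
      rw [← s_pow_mul_b_pow, ← s_pow_mul_b_pow]
      ring
    rw [h1, h2, ← add_smul, mul_sub, add_sub_cancel]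

end Kind

namespace Kind
variable {n : ℕ}

/-- Moving a thin strand from the left factor to the right factor. -/
def rungR (k : Kind) (n a A B B' : ℕ) :
    (k.pow n A).V ⊗[Kq] (k.pow n B).V →ₗ[Kq] (k.pow n a).V ⊗[Kq] (k.pow n B').V :=
  TensorProduct.map LinearMap.id (k.mulLin n 1 B B') ∘ₗ
    (TensorProduct.assoc Kq _ _ _).toLinearMap ∘ₗ
      TensorProduct.map (k.comulLin n a 1 A) LinearMap.id

/-- Moving a thin strand from the right factor to the left factor. -/
def rungL (k : Kind) (n a A B B' : ℕ) :
    (k.pow n a).V ⊗[Kq] (k.pow n B').V →ₗ[Kq] (k.pow n A).V ⊗[Kq] (k.pow n B).V :=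
  TensorProduct.map (k.mulLin n a 1 A) LinearMap.id ∘ₗ
    (TensorProduct.assoc Kq _ _ _).symm.toLinearMap ∘ₗ
      TensorProduct.map LinearMap.id (k.comulLin n 1 B B')

lemma rungR_ev (k : Kind) {a A B B' : ℕ} (hA : a + 1 = A) (hB : B + 1 = B') (m p : Fin n → ℕ) :
    k.rungR n a A B B' (k.ev A m ⊗ₜ k.ev B p) = ∑ i, (k.thinR m i * k.s ^ below p i) •
      (k.ev a (m - unitOcc i) ⊗ₜ[Kq] k.ev B' (p + unitOcc i)) := by
  rw [rungR, LinearMap.comp_apply, LinearMap.comp_apply, TensorProduct.map_tmul,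
    comulLin_thin_right k hA, TensorProduct.sum_tmul, map_sum, map_sum]
  refine Finset.sum_congr rfl fun i _ => ?_
  rw [← TensorProduct.smul_tmul', map_smul, map_smul, LinearEquiv.coe_coe, LinearMap.id_apply,
    TensorProduct.assoc_tmul, TensorProduct.map_tmul, mulLin_thin_left k hB, LinearMap.id_apply,
    TensorProduct.tmul_smul, smul_smul]

lemma rungL_ev (k : Kind) {a A B B' : ℕ} (hA : a + 1 = A) (hB : B + 1 = B') (m p : Fin n → ℕ) :
    k.rungL n a A B B' (k.ev a m ⊗ₜ k.ev B' p) = ∑ j, (k.thinL p j * k.s ^ above m j) •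
      (k.ev A (m + unitOcc j) ⊗ₜ[Kq] k.ev B (p - unitOcc j)) := by
  rw [rungL, LinearMap.comp_apply, LinearMap.comp_apply, TensorProduct.map_tmul,
    comulLin_thin_left k hB, TensorProduct.tmul_sum, map_sum, map_sum]
  refine Finset.sum_congr rfl fun i _ => ?_
  rw [TensorProduct.tmul_smul, map_smul, map_smul, LinearEquiv.coe_coe, LinearMap.id_apply,
    TensorProduct.assoc_symm_tmul, TensorProduct.map_tmul, mulLin_thin_right k hA,
    LinearMap.id_apply, ← TensorProduct.smul_tmul', smul_smul]

lemma rung_square (k : Kind) {a A A' b B B' : ℕ} (hA : a + 1 = A) (hA' : A + 1 = A')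
    (hB : b + 1 = B) (hB' : B + 1 = B') :
    k.rungL n a A B B' ∘ₗ k.rungR n a A B B' =
      k.rungR n A A' b B ∘ₗ k.rungL n A A' b B + qnum ((a : ℤ) - b) • LinearMap.id := by
  refine tensor_hom_ext fun m p hm hdm hp hdp => ?_
  rw [LinearMap.add_apply, LinearMap.comp_apply, LinearMap.comp_apply, rungR_ev k hA hB',
    rungL_ev k hA' hB, map_sum, map_sum, LinearMap.smul_apply, LinearMap.id_apply]
  simp only [map_smul, rungL_ev k hA hB', rungR_ev k hA' hB, Finset.smul_sum, smul_smul]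
  have h := k.rung_exchange hm hp fun x y => k.ev A x ⊗ₜ[Kq] k.ev B y
  rw [hdm, hdp] at h
  refine h.trans ?_
  congr 3
  push_cast [← hA, ← hB]
  ring

lemma thinR_unitOcc_of_ne (k : Kind) {i l : Fin n} (h : i ≠ l) : k.thinR (unitOcc l) i = 0 := by
  rw [thinR, unitOcc_of_ne h, mult_zero, mul_zero]

lemma thinL_unitOcc_of_ne (k : Kind) {i l : Fin n} (h : i ≠ l) : k.thinL (unitOcc l) i = 0 := by
  rw [thinL, unitOcc_of_ne h, mult_zero, mul_zero]

lemma thinR_unitOcc (k : Kind) (l : Fin n) : k.thinR (unitOcc l) l = 1 := by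
  simp [thinR, below_unitOcc, above_unitOcc, mult_one]

lemma thinL_unitOcc (k : Kind) (l : Fin n) : k.thinL (unitOcc l) l = 1 := by
  simp [thinL, below_unitOcc, above_unitOcc, mult_one]

lemma above_zero (i : Fin n) : above (0 : Fin n → ℕ) i = 0 := by simp [above]

lemma below_zero (i : Fin n) : below (0 : Fin n → ℕ) i = 0 := by simp [below]

lemma rung_square_left (k : Kind) {b B B' : ℕ} (hB : b + 1 = B) (hB' : B + 1 = B') :
    k.comulLin n 1 B B' ∘ₗ k.mulLin n 1 B B' =
      k.rungR n 1 2 b B ∘ₗ k.rungL n 1 2 b B + qnum (-(b : ℤ)) • LinearMap.id := by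
  refine tensor_hom_ext fun m p hm hdm hp hdp => ?_
  rw [LinearMap.add_apply, LinearMap.comp_apply, LinearMap.comp_apply,
    rungL_ev k rfl hB, map_sum, LinearMap.smul_apply, LinearMap.id_apply]
  simp only [map_smul, rungR_ev k rfl hB, Finset.smul_sum, smul_smul]
  have h := k.rung_exchange hm hp fun x y => k.ev 1 x ⊗ₜ[Kq] k.ev B y
  obtain ⟨l, rfl⟩ := eq_unitOcc_of_deg hdm
  rw [hdm, hdp, Finset.sum_eq_single l] at h
  · rw [tsub_self, thinR_unitOcc] at h
    simp only [above_zero, zero_add, one_mul, pow_zero, mul_one] at h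
    rw [mulLin_thin_left k hB', map_smul, comulLin_thin_left k hB', Finset.smul_sum]
    simp only [smul_smul]
    refine h.trans ?_
    congr 3
    push_cast [← hB]
    ring
  · intro i _ hi
    refine Finset.sum_eq_zero fun j _ => ?_
    rw [thinR_unitOcc_of_ne k hi, zero_mul, zero_mul, zero_smul]
  · simp

lemma rung_square_right (k : Kind) {a A A' : ℕ} (hA : a + 1 = A) (hA' : A + 1 = A') :
    k.rungL n a A 1 2 ∘ₗ k.rungR n a A 1 2 =
      k.comulLin n A 1 A' ∘ₗ k.mulLin n A 1 A' + qnum (a : ℤ) • LinearMap.id := by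
  refine tensor_hom_ext fun m p hm hdm hp hdp => ?_
  rw [LinearMap.add_apply, LinearMap.comp_apply, LinearMap.comp_apply,
    rungR_ev k hA rfl, map_sum, LinearMap.smul_apply, LinearMap.id_apply]
  simp only [map_smul, rungL_ev k hA rfl, Finset.smul_sum, smul_smul]
  have h := k.rung_exchange hm hp fun x y => k.ev A x ⊗ₜ[Kq] k.ev 1 y
  obtain ⟨l, rfl⟩ := eq_unitOcc_of_deg hdp
  rw [hdm, hdp, Finset.sum_eq_single (f := fun j => ∑ i, (k.thinL (unitOcc l) j * k.s ^ above m j *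
    (k.thinR (m + unitOcc j) i * k.s ^ below (unitOcc l - unitOcc j) i)) •
    (k.ev A (m + unitOcc j - unitOcc i) ⊗ₜ[Kq] k.ev 1 (unitOcc l - unitOcc j + unitOcc i))) l] at h
  · rw [tsub_self, thinL_unitOcc] at h
    simp only [below_zero, zero_add, one_mul, pow_zero, mul_one] at h
    rw [mulLin_thin_right k hA', map_smul, comulLin_thin_right k hA', Finset.smul_sum]
    simp only [smul_smul]
    refine h.trans ?_
    congr 3
    push_cast [← hA]
    ring
  · intro i _ hi
    refine Finset.sum_eq_zero fun j _ => ?_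
    rw [thinL_unitOcc_of_ne k hi, zero_mul, zero_mul, zero_smul]
  · simp

lemma mulLin_comulLin_right (k : Kind) {a A : ℕ} (hA : a + 1 = A) :
    k.mulLin n a 1 A ∘ₗ k.comulLin n a 1 A = qnum ((a : ℤ) + 1) • LinearMap.id := by
  refine hom_ext fun m hm hdm => ?_
  rw [LinearMap.comp_apply, comulLin_thin_right k hA, map_sum, LinearMap.smul_apply,
    LinearMap.id_apply, show (a : ℤ) + 1 = (deg m : ℕ) by rw [hdm, ← hA]; push_cast; rfl,
    ← sum_mult k hm, Finset.sum_smul]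
  refine Finset.sum_congr rfl fun i _ => ?_
  rw [map_smul, mulLin_thin_right k hA, smul_smul]
  by_cases h0 : m i = 0
  · rw [thinR, h0, mult_zero, mul_zero, mul_zero, zero_mul, zero_smul, zero_smul]
  obtain ⟨m', rfl⟩ := exists_eq_add_unitOcc h0
  rw [add_tsub_cancel_right]
  congr 1
  rw [thinR, ← s_pow_mul_b_pow, above_add, above_unitOcc, if_neg (lt_irrefl i), add_zero]
  ring

lemma mulLin_comulLin_left (k : Kind) {b B : ℕ} (hB : b + 1 = B) :
    k.mulLin n 1 b B ∘ₗ k.comulLin n 1 b B = qnum ((b : ℤ) + 1) • LinearMap.id := by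
  refine hom_ext fun m hm hdm => ?_
  have h := k.rung_exchange (valid_zero k) hm fun _ y => k.ev B y
  rw [LinearMap.comp_apply, comulLin_thin_left k hB, map_sum, LinearMap.smul_apply,
    LinearMap.id_apply]
  rw [Finset.sum_eq_zero, deg_zero, hdm, Nat.cast_zero, zero_sub, qnum_neg, neg_smul,
    ← sub_eq_add_neg, eq_comm, sub_eq_zero] at h
  · rw [show (b : ℤ) + 1 = (B : ℕ) by rw [← hB]; push_cast; rfl, ← h]
    refine Finset.sum_congr rfl fun i _ => ?_
    rw [Finset.sum_eq_single i]
    · rw [zero_add, thinR_unitOcc, map_smul, mulLin_thin_left k hB, smul_smul, above_zero,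
        pow_zero, mul_one, one_mul]
    · intro j _ hj
      rw [zero_add, thinR_unitOcc_of_ne k hj, zero_mul, mul_zero, zero_smul]
    · simp
  · intro i _
    refine Finset.sum_eq_zero fun j _ => ?_
    rw [thinR, Pi.zero_apply, mult_zero, mul_zero, zero_mul, zero_mul, zero_smul]

/-- The quantum powers satisfy the web relations. -/
def webData (k : Kind) (n : ℕ) : WebData (FinRep (Uq n)) where
  obj a := k.pow n a
  merge a b c h := k.mulHom n (congrArg PNat.val h)
  split a b c h := k.comulHom n (congrArg PNat.val h)
  merge_assoc a b c ab bc abc h₁ h₂ h₃ h₄ := by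
    refine FinRep.hom_ext (TensorProduct.ext (TensorProduct.ext' fun x y => LinearMap.ext fun z => ?_))
    exact k.mulLin_assoc (congrArg PNat.val h₁) (congrArg PNat.val h₃) x y z
  split_coassoc a b c ab bc abc h₁ h₂ h₃ h₄ := by
    rw [← Category.assoc, Iso.eq_comp_inv]
    exact FinRep.hom_ext (LinearMap.ext fun z =>
      k.comulLin_coassoc (congrArg PNat.val h₁) (congrArg PNat.val h₃) z)
  square a b := by
    rw [MonoidalCategory.whiskerLeft_comp, comp_whiskerRight]
    refine FinRep.hom_ext (Eq.trans (b := k.rungL n a (a + 1) (b + 1) (1 + (b + 1)) ∘ₗ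
      k.rungR n a (a + 1) (b + 1) (1 + (b + 1))) rfl ?_)
    exact k.rung_square rfl rfl rfl (add_comm _ _)
  square_left b := by
    rw [comp_whiskerRight]
    exact FinRep.hom_ext (k.rung_square_left rfl (add_comm _ _))
  square_right a := by
    rw [MonoidalCategory.whiskerLeft_comp]
    exact FinRep.hom_ext (k.rung_square_right rfl rfl)
  digon_right a := FinRep.hom_ext (k.mulLin_comulLin_right rfl)
  digon_left b := FinRep.hom_ext (k.mulLin_comulLin_left rfl)

end Kind

lemma tensorForm_map {V W V₀ W₀ : Type*} [AddCommGroup V] [Module Kq V] [AddCommGroup W]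
    [Module Kq W] [AddCommGroup V₀] [Module Kq V₀] [AddCommGroup W₀] [Module Kq W₀]
    {B : V →ₗ[Kq] V →ₗ[Kq] Kq} {B' : W →ₗ[Kq] W →ₗ[Kq] Kq} {B₀ : V₀ →ₗ[Kq] V₀ →ₗ[Kq] Kq}
    {B₀' : W₀ →ₗ[Kq] W₀ →ₗ[Kq] Kq} {f : V₀ →ₗ[Kq] V} {g : W₀ →ₗ[Kq] W} {v : V} {w : W} {v₀ : V₀}
    {w₀ : W₀} {α β : Kq} (hf : ∀ z, B (f z) v = α * B₀ z v₀) (hg : ∀ z, B' (g z) w = β * B₀' z w₀)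
    (t : V₀ ⊗[Kq] W₀) : tensorForm B B' (TensorProduct.map f g t) (v ⊗ₜ w) =
      α * β * tensorForm B₀ B₀' t (v₀ ⊗ₜ w₀) := by
  induction t using TensorProduct.induction_on with
  | zero => simp
  | tmul x y =>
    rw [TensorProduct.map_tmul, tensorForm_tmul, tensorForm_tmul, hf, hg]
    ring
  | add t t' ht ht' =>
    rw [map_add, map_add, map_add, LinearMap.add_apply, LinearMap.add_apply, ht, ht', mul_add]

namespace Kind
variable {n : ℕ}

/-! ### Recursion for the comultiplication -/

/-- The coefficient that arises when a letter `i` passes a basis vector. -/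
def passCoeff (i : Fin n) (x : Fin n → ℕ) : Kind → Kq
  | ext => (-1) ^ deg x
  | sym => q ^ x i

/-- The diagonal operator with the eigenvalues `passCoeff`. -/
def twist (k : Kind) (a : ℕ) (i : Fin n) : (k.pow n a).V →ₗ[Kq] (k.pow n a).V :=
  k.mkLin a fun x => passCoeff i x k • k.ev a x

lemma twist_ev (k : Kind) {a : ℕ} (i : Fin n) {x : Fin n → ℕ} (hx : deg x = a) :
    k.twist a i (k.ev a x) = passCoeff i x k • k.ev a x := by
  by_cases hv : k.Valid x
  · rw [twist, mkLin_ev k _ hv hx]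
  · rw [ev_of_not_valid k a x hv, map_zero, smul_zero]

lemma form_twist (k : Kind) {a : ℕ} (i : Fin n) {x : Fin n → ℕ} (hv : k.Valid x)
    (hx : deg x = a) (z : (k.pow n a).V) :
    k.form n a (k.twist a i z) (k.ev a x) = passCoeff i x k * k.form n a z (k.ev a x) := by
  refine LinearMap.congr_fun (f := (k.form n a).flip (k.ev a x) ∘ₗ k.twist a i)
    (g := passCoeff i x k • (k.form n a).flip (k.ev a x)) (hom_ext fun m _ hm => ?_) z
  rw [LinearMap.comp_apply, twist_ev k i hm, map_smul, LinearMap.smul_apply, LinearMap.flip_apply,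
    form_ev_ev' k hv hx]
  by_cases h : m = x
  · rw [h]
  · rw [if_neg h, smul_zero, smul_zero]

lemma form_lm (k : Kind) {a : ℕ} (i : Fin n) {x : Fin n → ℕ} (hv : k.Valid (x + unitOcc i))
    (hx : deg x = a) (z : (k.pow n a).V) :
    k.form n (a + 1) (k.lm i z) (k.ev (a + 1) (x + unitOcc i)) =
      k.s ^ below x i * (qnum ((x i : ℤ) + 1) * q ^ x i) * k.form n a z (k.ev a x) := by
  refine LinearMap.congr_fun (f := (k.form n (a + 1)).flip (k.ev (a + 1) (x + unitOcc i)) ∘ₗ k.lm i)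
    (g := (k.s ^ below x i * (qnum ((x i : ℤ) + 1) * q ^ x i)) • (k.form n a).flip (k.ev a x))
    (hom_ext fun m _ hm => ?_) z
  rw [LinearMap.comp_apply, lm_ev, map_smul, LinearMap.smul_apply, LinearMap.flip_apply,
    LinearMap.flip_apply, form_ev_ev' k hv (by rw [deg_add, deg_unitOcc, hx]),
    form_ev_ev' k (hv.mono le_self_add) hx, norm_add_unitOcc]
  by_cases h : m = x
  · rw [h, if_pos rfl, if_pos rfl, smul_eq_mul, smul_eq_mul]
    ring
  · rw [if_neg h, if_neg fun h' => h (add_right_cancel h'), smul_zero, smul_zero]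

lemma form_lm_zero (k : Kind) {a : ℕ} (i : Fin n) {x : Fin n → ℕ} (hv : k.Valid x)
    (hx : deg x = a + 1) (hi : x i = 0) (z : (k.pow n a).V) :
    k.form n (a + 1) (k.lm i z) (k.ev (a + 1) x) = 0 := by
  refine LinearMap.congr_fun (f := (k.form n (a + 1)).flip (k.ev (a + 1) x) ∘ₗ k.lm i)
    (g := 0) (hom_ext fun m _ hm => ?_) z
  rw [LinearMap.comp_apply, lm_ev, map_smul, LinearMap.flip_apply, form_ev_ev' k hv hx, if_neg,
    smul_zero]
  · rfl
  · rintro rfl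
    simp at hi

lemma form₂_comulLin_ev (k : Kind) {a b c : ℕ} {m x y : Fin n → ℕ} (hm : k.Valid m)
    (hdm : deg m = c) (hdx : deg x = a) (hdy : deg y = b) :
    tensorForm (k.form n a) (k.form n b) (k.comulLin n a b c (k.ev c m)) (k.ev a x ⊗ₜ k.ev b y) =
      if x + y = m then k.r ^ (a * b) * k.s ^ cross y x * norm m else 0 := by
  rw [tensorForm_comulLin, mulLin_ev k hdx hdy, map_smul, form_ev_ev k hm hdm, smul_eq_mul,
    mul_ite, mul_zero, mul_ite, mul_zero, mul_assoc]

/-- The part of the comultiplication of `v_i w` in which `v_i` is in the left factor. -/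
def comulLeft (k : Kind) (i : Fin n) (b c : ℕ) (w : (k.pow n c).V) :
    ∀ a, (k.pow n a).V ⊗[Kq] (k.pow n b).V
  | 0 => 0
  | a + 1 => k.r ^ b • TensorProduct.map (k.lm i) LinearMap.id (k.comulLin n a b c w)

/-- The part of the comultiplication of `v_i w` in which `v_i` is in the right factor. -/
def comulRight (k : Kind) (i : Fin n) (a c : ℕ) (w : (k.pow n c).V) :
    ∀ b, (k.pow n a).V ⊗[Kq] (k.pow n b).V
  | 0 => 0
  | b + 1 => TensorProduct.map (k.twist a i) (k.lm i) (k.comulLin n a b c w)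

lemma below_eq_zero_of_le {m x : Fin n → ℕ} {i : Fin n} (hi : ∀ l < i, m l = 0)
    (h : x ≤ m) : below x i = 0 :=
  below_eq_zero fun l hl => Nat.eq_zero_of_le_zero ((h l).trans (hi l hl).le)

lemma form_comulLeft (k : Kind) {a b c : ℕ} {m x y : Fin n → ℕ} {i : Fin n}
    (hm : k.Valid m) (hdm : deg m = c) (hi : ∀ l < i, m l = 0) (hx : k.Valid x) (hy : k.Valid y)
    (hdx : deg x = a) (hdy : deg y = b) (h : x + y = m + unitOcc i) :
    tensorForm (k.form n a) (k.form n b) (k.comulLeft i b c (k.ev c m) a) (k.ev a x ⊗ₜ k.ev b y) =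
      k.r ^ (a * b) * k.s ^ cross y x * norm m * (qnum (x i) * q ^ ((x i : ℤ) - 1)) := by
  by_cases h0 : x i = 0
  · rw [h0, Nat.cast_zero, qnum_zero, zero_mul, mul_zero]
    cases a with
    | zero => rw [comulLeft, map_zero, LinearMap.zero_apply]
    | succ a =>
      rw [comulLeft, map_smul, LinearMap.smul_apply, tensorForm_map (α := 0) (β := 1)
        (v₀ := 0) (B₀ := k.form n a) (fun z => by rw [form_lm_zero k i hx hdx h0, zero_mul])
        (fun z => (one_mul _).symm), zero_mul, zero_mul, smul_zero]
  obtain ⟨x, rfl⟩ := exists_eq_add_unitOcc h0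
  obtain rfl : x + y = m := by
    rw [add_right_comm] at h
    exact add_right_cancel h
  have hbx := below_eq_zero_of_le hi (le_self_add : x ≤ x + y)
  have hby := below_eq_zero_of_le hi (le_add_self : y ≤ x + y)
  cases a with
  | zero => rw [deg_add, deg_unitOcc] at hdx; omega
  | succ a =>
    have hda : deg x = a := by rw [deg_add, deg_unitOcc] at hdx; omega
    rw [comulLeft, map_smul, LinearMap.smul_apply, tensorForm_map (β := 1)
      (fun z => form_lm k i hx hda z) (fun z => (one_mul _).symm), form₂_comulLin_ev k hm hdm hda hdy,
      if_pos rfl, hbx, Pi.add_apply, unitOcc_self, cross_add_right, cross_unitOcc_right, hby,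
      smul_eq_mul]
    push_cast
    rw [add_sub_cancel_right, zpow_natCast]
    ring

lemma form_comulRight (k : Kind) {a b c : ℕ} {m x y : Fin n → ℕ} {i : Fin n}
    (hm : k.Valid m) (hdm : deg m = c) (hi : ∀ l < i, m l = 0) (hx : k.Valid x) (hy : k.Valid y)
    (hdx : deg x = a) (hdy : deg y = b) (h : x + y = m + unitOcc i) :
    tensorForm (k.form n a) (k.form n b) (k.comulRight i a c (k.ev c m) b) (k.ev a x ⊗ₜ k.ev b y) =
      k.r ^ (a * b) * k.s ^ cross y x * norm m * (qnum (y i) * q ^ ((y i : ℤ) - 1) *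
        (passCoeff i x k * (k.r ^ a)⁻¹ * (k.s ^ above x i)⁻¹)) := by
  have hr := pow_ne_zero a k.r_ne_zero
  have hs := pow_ne_zero (above x i) k.s_ne_zero
  by_cases h0 : y i = 0
  · rw [h0, Nat.cast_zero, qnum_zero, zero_mul, zero_mul, mul_zero]
    cases b with
    | zero => rw [comulRight, map_zero, LinearMap.zero_apply]
    | succ b =>
      rw [comulRight, tensorForm_map (β := 0) (w₀ := 0) (B₀' := k.form n b)
        (fun z => form_twist k i hx hdx z)
        (fun z => by rw [form_lm_zero k i hy hdy h0, zero_mul]), mul_zero, zero_mul]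
  obtain ⟨y, rfl⟩ := exists_eq_add_unitOcc h0
  obtain rfl : x + y = m := by
    rw [← add_assoc] at h
    exact add_right_cancel h
  have hby := below_eq_zero_of_le hi (le_add_self : y ≤ x + y)
  cases b with
  | zero => rw [deg_add, deg_unitOcc] at hdy; omega
  | succ b =>
    have hdb : deg y = b := by rw [deg_add, deg_unitOcc] at hdy; omega
    rw [comulRight, tensorForm_map
      (fun z => form_twist k i hx hdx z) (fun z => form_lm k i hy hdb z),
      form₂_comulLin_ev k hm hdm hdx hdb, if_pos rfl, hby, Pi.add_apply, unitOcc_self,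
      cross_add_left, cross_unitOcc_left]
    push_cast
    rw [add_sub_cancel_right, zpow_natCast, pow_add, mul_add, mul_one, pow_add]
    field_simp

lemma pass_pascal (k : Kind) {x y : Fin n → ℕ} {i : Fin n} (hv : k.Valid (x + y))
    (hb : below x i = 0) :
    qnum ((x i : ℤ) + y i) * q ^ ((x i : ℤ) + y i - 1) = qnum (x i) * q ^ ((x i : ℤ) - 1) +
      qnum (y i) * q ^ ((y i : ℤ) - 1) *
        (passCoeff i x k * (k.r ^ deg x)⁻¹ * (k.s ^ above x i)⁻¹) := by
  have hq := Uq.q_ne_zero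
  have hd := deg_eq x i
  rw [hb, zero_add] at hd
  cases k with
  | ext =>
    have hv' : x i + y i ≤ 1 := hv rfl i
    have hp : (-1 : Kq) ^ above x i * (-1) ^ above x i = 1 := by rw [← mul_pow]; simp
    by_cases hx : x i = 0
    · rw [hx, zero_add] at hd
      rw [hx, passCoeff, hd, Nat.cast_zero, zero_add, qnum_zero, zero_mul, zero_add, r, s,
        neg_pow q⁻¹, inv_pow, mul_inv, inv_inv]
      have hne : (-1 : Kq) ^ above x i ≠ 0 := pow_ne_zero _ (by norm_num)
      field_simp
    · have hy : y i = 0 := by omega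
      rw [hy, Nat.cast_zero, add_zero, qnum_zero, zero_mul, zero_mul, add_zero]
  | sym =>
    rw [hd, passCoeff, r, s, add_comm (x i : ℤ), qnum_add, inv_pow, inv_inv, pow_add, zpow_sub₀ hq, zpow_sub₀ hq,
      zpow_sub₀ hq, zpow_add₀ hq, zpow_natCast, zpow_natCast, zpow_neg, zpow_natCast]
    field_simp
    ring

lemma comulLin_add_lowest (k : Kind) {a b c : ℕ} (hab : a + b = c + 1) {m : Fin n → ℕ} {i : Fin n}
    (hv : k.Valid (m + unitOcc i)) (hdm : deg m = c) (hi : ∀ l < i, m l = 0) :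
    k.comulLin n a b (c + 1) (k.ev (c + 1) (m + unitOcc i)) =
      k.comulLeft i b c (k.ev c m) a + k.comulRight i a c (k.ev c m) b := by
  refine k.form₂_injective n a b (tensor_hom_ext fun x y hx hdx hy hdy => ?_)
  have hdm' : deg (m + unitOcc i) = c + 1 := by rw [deg_add, deg_unitOcc, hdm]
  have hm := hv.mono (le_self_add : m ≤ m + unitOcc i)
  rw [form₂_comulLin_ev k hv hdm' hdx hdy, map_add, LinearMap.add_apply]
  by_cases h : x + y = m + unitOcc i
  · have hbx : below x i = 0 := by
      have h1 : below (x + y) i = 0 := by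
        rw [h, below_add, below_eq_zero hi, below_unitOcc, if_neg (lt_irrefl i)]
      rw [below_add] at h1
      omega
    have hi' : ((m i : ℤ) + 1) = x i + y i := by
      have := congrFun h i
      rw [Pi.add_apply, Pi.add_apply, unitOcc_self] at this
      exact_mod_cast this.symm
    have hp := pass_pascal k (h ▸ hv) hbx
    rw [hdx, ← hi', add_sub_cancel_right, zpow_natCast] at hp
    rw [if_pos h, form_comulLeft k hm hdm hi hx hy hdx hdy h,
      form_comulRight k hm hdm hi hx hy hdx hdy h, ← mul_add, ← hp, norm_add_unitOcc]
    ring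
  · rw [if_neg h]
    have h1 : tensorForm (k.form n a) (k.form n b) (k.comulLeft i b c (k.ev c m) a)
        (k.ev a x ⊗ₜ k.ev b y) = 0 := by
      cases a with
      | zero => rw [comulLeft, map_zero, LinearMap.zero_apply]
      | succ a =>
        rw [comulLeft, map_smul, LinearMap.smul_apply]
        by_cases h0 : x i = 0
        · rw [tensorForm_map (α := 0) (β := 1)
            (v₀ := 0) (B₀ := k.form n a) (fun z => by rw [form_lm_zero k i hx hdx h0, zero_mul])
            (fun z => (one_mul _).symm), zero_mul, zero_mul, smul_zero]
        · obtain ⟨x, rfl⟩ := exists_eq_add_unitOcc h0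
          rw [deg_add, deg_unitOcc] at hdx
          rw [tensorForm_map (β := 1) (fun z => form_lm k i hx (Nat.succ.inj hdx) z)
            (fun z => (one_mul _).symm), form₂_comulLin_ev k hm hdm (Nat.succ.inj hdx) hdy, if_neg,
            mul_zero, smul_zero]
          rintro rfl
          exact h (add_right_comm _ _ _)
    have h2 : tensorForm (k.form n a) (k.form n b) (k.comulRight i a c (k.ev c m) b)
        (k.ev a x ⊗ₜ k.ev b y) = 0 := by
      cases b with
      | zero => rw [comulRight, map_zero, LinearMap.zero_apply]
      | succ b =>
        rw [comulRight]
        by_cases h0 : y i = 0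
        · rw [tensorForm_map (β := 0) (w₀ := 0) (B₀' := k.form n b)
            (fun z => form_twist k i hx hdx z)
            (fun z => by rw [form_lm_zero k i hy hdy h0, zero_mul]), mul_zero, zero_mul]
        · obtain ⟨y, rfl⟩ := exists_eq_add_unitOcc h0
          rw [deg_add, deg_unitOcc] at hdy
          rw [tensorForm_map (fun z => form_twist k i hx hdx z)
            (fun z => form_lm k i hy (Nat.succ.inj hdy) z),
            form₂_comulLin_ev k hm hdm hdx (Nat.succ.inj hdy), if_neg, mul_zero]
          rintro rfl
          exact h (add_assoc _ _ _).symm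
    rw [h1, h2, add_zero]

end Kind

/-! ### Decompositions of an interval into two increasing sequences -/

/-- Prepending `0` to an increasing sequence. -/
def consEmb {a c : ℕ} (s : Fin a ↪o Fin c) : Fin (a + 1) ↪o Fin (c + 1) :=
  OrderEmbedding.ofStrictMono (Fin.cons 0 (Fin.succ ∘ s)) (by
    intro x y h
    induction y using Fin.cases with
    | zero => exact absurd h (Fin.not_lt_zero x)
    | succ y =>
      induction x using Fin.cases with
      | zero => exact Fin.succ_pos _
      | succ x => exact Fin.succ_lt_succ_iff.mpr (s.strictMono (Fin.succ_lt_succ_iff.mp h)))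

/-- Shifting an increasing sequence by one. -/
def succEmb {a c : ℕ} (s : Fin a ↪o Fin c) : Fin a ↪o Fin (c + 1) := s.trans (Fin.succOrderEmb c)

@[simp] lemma consEmb_zero {a c : ℕ} (s : Fin a ↪o Fin c) : consEmb s 0 = 0 := rfl
@[simp] lemma consEmb_succ {a c : ℕ} (s : Fin a ↪o Fin c) (x : Fin a) :
    consEmb s x.succ = (s x).succ := rfl
@[simp] lemma succEmb_apply {a c : ℕ} (s : Fin a ↪o Fin c) (x : Fin a) :
    succEmb s x = (s x).succ := rfl

lemma exists_succEmb {a c : ℕ} (s : Fin a ↪o Fin (c + 1)) (h : ∀ x, s x ≠ 0) :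
    ∃ s', succEmb s' = s :=
  ⟨OrderEmbedding.ofStrictMono (fun x => (s x).pred (h x))
    (fun _ _ hxy => Fin.pred_lt_pred_iff.mpr (s.strictMono hxy)), by
      ext x
      exact congrArg Fin.val (Fin.succ_pred (s x) (h x))⟩

lemma sumElim_emb_bijective (a c : ℕ) : Function.Bijective
    (Sum.elim consEmb succEmb : (Fin a ↪o Fin c) ⊕ (Fin (a + 1) ↪o Fin c) →
      (Fin (a + 1) ↪o Fin (c + 1))) := by
  constructor
  · rintro (s | s) (t | t) h
    · congr 1
      ext x
      have := DFunLike.congr_fun h x.succ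
      simpa [Fin.ext_iff] using this
    · have := DFunLike.congr_fun h 0
      exact absurd this (Fin.succ_ne_zero _).symm
    · have := DFunLike.congr_fun h 0
      exact absurd this (Fin.succ_ne_zero _)
    · congr 1
      ext x
      have := DFunLike.congr_fun h x
      simpa [Fin.ext_iff] using this
  · intro s
    have hs : ∀ x : Fin a, s x.succ ≠ 0 := fun x hx =>
      absurd (s.strictMono (Fin.succ_pos x)) (by rw [hx]; exact Fin.not_lt_zero _)
    by_cases h0 : s 0 = 0
    · obtain ⟨t, ht⟩ := exists_succEmb ((Fin.succOrderEmb a).trans s) hs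
      refine ⟨Sum.inl t, ?_⟩
      ext x
      induction x using Fin.cases with
      | zero => simp [h0]
      | succ x =>
        have := DFunLike.congr_fun ht x
        exact congrArg Fin.val this
    · obtain ⟨t, ht⟩ := exists_succEmb s (fun x => by
        induction x using Fin.cases with
        | zero => exact h0
        | succ x => exact hs x)
      exact ⟨Sum.inr t, ht⟩

lemma sum_emb_succ {a c : ℕ} {M : Type*} [AddCommMonoid M]
    (G : (Fin (a + 1) ↪o Fin (c + 1)) → M) :
    ∑ s, G s = ∑ s, G (consEmb s) + ∑ s, G (succEmb s) := by
  rw [← (sumElim_emb_bijective a c).sum_comp, Fintype.sum_sum_type]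
  rfl

lemma sum_emb_zero {c : ℕ} {M : Type*} [AddCommMonoid M] (G : (Fin 0 ↪o Fin (c + 1)) → M) :
    ∑ s, G s = ∑ s, G (succEmb s) := by
  refine (Function.Bijective.sum_comp ⟨fun s t _ => ?_, fun s => ?_⟩ G).symm
  · ext x
    exact x.elim0
  · exact exists_succEmb s fun x => x.elim0

lemma not_disjoint_emb {a b c : ℕ} (h : c < a + b) (s : Fin a ↪o Fin c) (t : Fin b ↪o Fin c) :
    ¬∀ x y, s x ≠ t y := by
  intro hd
  have := Fintype.card_le_of_injective (Sum.elim s t)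
    (Function.Injective.sumElim s.injective t.injective hd)
  simp at this
  omega

section SumDecomp
variable {M : Type*} [AddCommMonoid M]

/-- The part of a sum over decompositions in which `0` belongs to the left sequence. -/
def decompLeft {c b : ℕ} : ∀ {a : ℕ}, ((Fin a ↪o Fin (c + 1)) → (Fin b ↪o Fin (c + 1)) → M) → M
  | 0, _ => 0
  | _ + 1, G => ∑ s, ∑ t, if ∀ x y, s x ≠ t y then G (consEmb s) (succEmb t) else 0

/-- The part of a sum over decompositions in which `0` belongs to the right sequence. -/
def decompRight {c a : ℕ} : ∀ {b : ℕ}, ((Fin a ↪o Fin (c + 1)) → (Fin b ↪o Fin (c + 1)) → M) → M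
  | 0, _ => 0
  | _ + 1, G => ∑ s, ∑ t, if ∀ x y, s x ≠ t y then G (succEmb s) (consEmb t) else 0

lemma sum_decomp {a b c : ℕ} (h : a + b = c + 1)
    (G : (Fin a ↪o Fin (c + 1)) → (Fin b ↪o Fin (c + 1)) → M) :
    (∑ s, ∑ t, if ∀ x y, s x ≠ t y then G s t else 0) = decompLeft G + decompRight G := by
  have h0 : (∑ s : Fin a ↪o Fin c, ∑ t : Fin b ↪o Fin c,
      if ∀ x y, succEmb s x ≠ succEmb t y then G (succEmb s) (succEmb t) else 0) = 0 := by
    refine Finset.sum_eq_zero fun s _ => Finset.sum_eq_zero fun t _ => if_neg fun hd => ?_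
    exact not_disjoint_emb (by omega) s t fun x y hxy => hd x y (congrArg Fin.succ hxy)
  have hL : ∀ {a} (s : Fin a ↪o Fin c) (t : Fin b ↪o Fin c),
      (∀ x y, consEmb s x ≠ succEmb t y) ↔ ∀ x y, s x ≠ t y := by
    intro a s t
    simp [Fin.forall_fin_succ, (Fin.succ_ne_zero _).symm]
  have hR : ∀ {b} (s : Fin a ↪o Fin c) (t : Fin b ↪o Fin c),
      (∀ x y, succEmb s x ≠ consEmb t y) ↔ ∀ x y, s x ≠ t y := by
    intro b s t
    simp [Fin.forall_fin_succ]
  rcases a with _ | a <;> rcases b with _ | b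
  · omega
  · rw [sum_emb_zero]
    simp only [sum_emb_succ, Finset.sum_add_distrib]
    rw [h0, add_zero, decompLeft, decompRight, zero_add]
    simp only [hR]
  · rw [sum_emb_succ]
    simp only [sum_emb_zero]
    rw [h0, add_zero, decompLeft, decompRight, add_zero]
    simp only [hL]
  · rw [sum_emb_succ]
    simp only [sum_emb_succ, Finset.sum_add_distrib]
    rw [h0, add_zero, decompLeft, decompRight]
    simp only [hL, hR]
    rw [Finset.sum_eq_zero, zero_add]
    intro s _
    refine Finset.sum_eq_zero fun t _ => if_neg fun hd => hd 0 0 rfl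

end SumDecomp

open scoped Classical in
lemma card_pairs {a b : ℕ} (P : Fin a → Fin b → Prop) :
    Nat.card {p : Fin a × Fin b // P p.1 p.2} = ∑ x, ∑ y, if P x y then 1 else 0 := by
  rw [Nat.card_eq_fintype_card, Fintype.card_subtype, Finset.card_filter, Fintype.sum_prod_type]

open scoped Classical in
lemma card_pairs_succ_left {a b : ℕ} (P : Fin (a + 1) → Fin b → Prop) :
    Nat.card {p : Fin (a + 1) × Fin b // P p.1 p.2} =
      (∑ y, if P 0 y then 1 else 0) + Nat.card {p : Fin a × Fin b // P p.1.succ p.2} := by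
  rw [card_pairs, Fin.sum_univ_succ, card_pairs fun x y => P x.succ y]

open scoped Classical in
lemma card_pairs_succ_right {a b : ℕ} (P : Fin a → Fin (b + 1) → Prop) :
    Nat.card {p : Fin a × Fin (b + 1) // P p.1 p.2} =
      (∑ x, if P x 0 then 1 else 0) + Nat.card {p : Fin a × Fin b // P p.1 p.2.succ} := by
  rw [card_pairs, card_pairs fun x y => P x y.succ, ← Finset.sum_add_distrib]
  exact Finset.sum_congr rfl fun x _ => Fin.sum_univ_succ _

namespace Kind
variable {n : ℕ}

lemma splitCoeff_cons_succ (k : Kind) {a b c : ℕ} (f : Fin (c + 1) → Fin n) (s : Fin a ↪o Fin c)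
    (t : Fin b ↪o Fin c) :
    splitCoeff f (consEmb s) (succEmb t) k = k.r ^ b * splitCoeff (Fin.tail f) s t k := by
  have h1 : Nat.card {p : Fin (a + 1) × Fin b // consEmb s p.1 < succEmb t p.2} =
      b + Nat.card {p : Fin a × Fin b // s p.1 < t p.2} :=
    (card_pairs_succ_left fun x y => consEmb s x < succEmb t y).trans (by simp)
  cases k with
  | ext =>
    have h2 : Nat.card {p : Fin (a + 1) × Fin b // succEmb t p.2 < consEmb s p.1} =
        Nat.card {p : Fin a × Fin b // t p.2 < s p.1} :=
      (card_pairs_succ_left fun x y => succEmb t y < consEmb s x).trans (by simp)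
    rw [splitCoeff, splitCoeff, h1, h2, pow_add, r, mul_assoc]
  | sym =>
    have h2 : Nat.card {p : Fin (a + 1) × Fin b // succEmb t p.2 < consEmb s p.1 ∧
        f (consEmb s p.1) = f (succEmb t p.2)} =
        Nat.card {p : Fin a × Fin b // t p.2 < s p.1 ∧
          Fin.tail f (s p.1) = Fin.tail f (t p.2)} :=
      (card_pairs_succ_left fun x y => succEmb t y < consEmb s x ∧
        f (consEmb s x) = f (succEmb t y)).trans (by simp [Fin.tail])
    rw [splitCoeff, splitCoeff, h1, h2, pow_add, r, mul_inv, inv_pow, mul_assoc]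

open scoped Classical in
lemma cnt_apply {c : ℕ} (f : Fin c → Fin n) (i : Fin n) :
    cnt f i = ∑ x, if f x = i then 1 else 0 := by
  rw [cnt, Finset.sum_apply]
  exact Finset.sum_congr rfl fun x _ => by simp [Pi.single_apply, eq_comm]

lemma splitCoeff_succ_cons (k : Kind) {a b c : ℕ} (f : Fin (c + 1) → Fin n) (s : Fin a ↪o Fin c)
    (t : Fin b ↪o Fin c) :
    splitCoeff f (succEmb s) (consEmb t) k =
      passCoeff (f 0) (cnt (Fin.tail f ∘ s)) k * splitCoeff (Fin.tail f) s t k := by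
  have h1 : Nat.card {p : Fin a × Fin (b + 1) // succEmb s p.1 < consEmb t p.2} =
      Nat.card {p : Fin a × Fin b // s p.1 < t p.2} :=
    (card_pairs_succ_right fun x y => succEmb s x < consEmb t y).trans (by simp)
  cases k with
  | ext =>
    have h2 : Nat.card {p : Fin a × Fin (b + 1) // consEmb t p.2 < succEmb s p.1} =
        a + Nat.card {p : Fin a × Fin b // t p.2 < s p.1} :=
      (card_pairs_succ_right fun x y => consEmb t y < succEmb s x).trans (by simp)
    rw [splitCoeff, splitCoeff, h1, h2, pow_add, passCoeff, deg_cnt, mul_left_comm]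
  | sym =>
    have h2 : Nat.card {p : Fin a × Fin (b + 1) // consEmb t p.2 < succEmb s p.1 ∧
        f (succEmb s p.1) = f (consEmb t p.2)} = cnt (Fin.tail f ∘ s) (f 0) +
        Nat.card {p : Fin a × Fin b // t p.2 < s p.1 ∧
          Fin.tail f (s p.1) = Fin.tail f (t p.2)} :=
      (card_pairs_succ_right fun x y => consEmb t y < succEmb s x ∧
        f (succEmb s x) = f (consEmb t y)).trans (by
          rw [cnt_apply]
          simp only [succEmb_apply, consEmb_zero, consEmb_succ, Fin.succ_pos, true_and,
            Fin.succ_lt_succ_iff, Fin.tail, Function.comp_apply]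
          congr!)
    rw [splitCoeff, splitCoeff, h1, h2, pow_add, passCoeff, mul_left_comm]

lemma vec_comp_consEmb (k : Kind) {a c : ℕ} (f : Fin (c + 1) → Fin n) (s : Fin a ↪o Fin c) :
    k.vec (f ∘ consEmb s) = k.lm (f 0) (k.vec (Fin.tail f ∘ s)) := vec_succ k _

lemma vec_comp_succEmb (k : Kind) {a c : ℕ} (f : Fin (c + 1) → Fin n) (s : Fin a ↪o Fin c) :
    k.vec (f ∘ succEmb s) = k.vec (Fin.tail f ∘ s) := rfl

lemma Increasing.monotone {k : Kind} {c : ℕ} {f : Fin c → Fin n} (h : Increasing f k) :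
    Monotone f := by
  cases k with
  | ext => exact StrictMono.monotone h
  | sym => exact h

lemma Increasing.tail {k : Kind} {c : ℕ} {f : Fin (c + 1) → Fin n} (h : Increasing f k) :
    Increasing (Fin.tail f) k := by
  cases k with
  | ext => exact StrictMono.comp h (Fin.strictMono_succ)
  | sym => exact Monotone.comp h (Fin.strictMono_succ).monotone

lemma Increasing.valid {k : Kind} {c : ℕ} {f : Fin c → Fin n} (h : Increasing f k) :
    k.Valid (cnt f) := by
  rintro rfl i
  have h' : Function.Injective f := StrictMono.injective h
  by_contra! hi
  rw [cnt_apply, ← Finset.card_filter, Finset.one_lt_card] at hi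
  obtain ⟨x, hx, y, hy, hxy⟩ := hi
  rw [Finset.mem_filter] at hx hy
  exact hxy (h' (hx.2.trans hy.2.symm))

lemma comulLin_vec (k : Kind) {a b c : ℕ} (h : a + b = c) (f : Fin c → Fin n)
    (hf : Increasing f k) :
    k.comulLin n a b c (k.vec f) = ∑ s : Fin a ↪o Fin c, ∑ t : Fin b ↪o Fin c,
      if ∀ x y, s x ≠ t y then splitCoeff f s t k • (k.vec (f ∘ s) ⊗ₜ[Kq] k.vec (f ∘ t)) else 0 := by
  induction c generalizing a b with
  | zero =>
    obtain ⟨rfl, rfl⟩ : a = 0 ∧ b = 0 := by omega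
    have : Subsingleton (Fin 0 ↪o Fin 0) := ⟨fun s t => by ext x; exact x.elim0⟩
    have h1 : splitCoeff f (RelEmbedding.refl (α := Fin 0) (· ≤ ·))
        (RelEmbedding.refl (α := Fin 0) (· ≤ ·)) k = 1 := by
      cases k <;> simp [splitCoeff]
    have h2 : ∀ g : Fin 0 → Fin n, k.vec g = k.ev 0 0 := fun g => by
      rw [ev_zero, Subsingleton.elim g Fin.elim0]
    rw [Fintype.sum_subsingleton _ (RelEmbedding.refl (α := Fin 0) (· ≤ ·)),
      Fintype.sum_subsingleton _ (RelEmbedding.refl (α := Fin 0) (· ≤ ·)), if_pos fun x => x.elim0,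
      h1, one_smul, h2, h2, comulLin, mkLin_ev k _ (valid_zero k) deg_zero,
      Finset.sum_eq_single 0]
    · simp [comulCoeff, norm_zero]
    · intro y hy hy0
      exact absurd (le_antisymm (Finset.mem_Iic.mp hy) (fun _ => Nat.zero_le _)) hy0
    · simp
  | succ c ih =>
    have hlow : ∀ l < f 0, cnt (Fin.tail f) l = 0 := fun l hl =>
      cnt_apply_eq_zero fun x hx => absurd (hf.monotone (Fin.zero_le x.succ)) (by
        rw [not_le]; exact (show f x.succ = l from hx) ▸ hl)
    have hd := deg_cnt (Fin.tail f)
    rw [vec_of_monotone k hf.monotone, cnt_succ, comulLin_add_lowest k h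
      (by rw [← cnt_succ]; exact hf.valid) hd hlow, ← vec_of_monotone k hf.tail.monotone,
      sum_decomp h]
    congr 1
    · cases a with
      | zero => rfl
      | succ a =>
        rw [comulLeft, decompLeft, ih (by omega) _ hf.tail, map_sum, Finset.smul_sum]
        refine Finset.sum_congr rfl fun s _ => ?_
        rw [map_sum, Finset.smul_sum]
        refine Finset.sum_congr rfl fun t _ => ?_
        split_ifs
        · rw [splitCoeff_cons_succ, vec_comp_consEmb, vec_comp_succEmb, map_smul,
            TensorProduct.map_tmul, LinearMap.id_apply, smul_smul]
        · rw [map_zero, smul_zero]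
    · cases b with
      | zero => rfl
      | succ b =>
        rw [comulRight, decompRight, ih (by omega) _ hf.tail, map_sum]
        refine Finset.sum_congr rfl fun s _ => ?_
        rw [map_sum]
        refine Finset.sum_congr rfl fun t _ => ?_
        split_ifs
        · have hm : Monotone (Fin.tail f ∘ s) := hf.tail.monotone.comp s.monotone
          rw [splitCoeff_succ_cons, vec_comp_consEmb, vec_comp_succEmb, map_smul,
            TensorProduct.map_tmul, vec_of_monotone k hm, twist_ev k _ (deg_cnt _),
            ← TensorProduct.smul_tmul', smul_smul, mul_comm]
        · rw [map_zero]

lemma isComul_comulHom (k : Kind) {a b c : ℕ} (h : a + b = c) :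
    k.IsComul n a b c (k.comulHom n h) := fun f hf => k.comulLin_vec h f hf

end Kind

namespace WebData
open Functor.LaxMonoidal Functor.OplaxMonoidal
variable {D : Type*} [Category* D] [Preadditive D] [Linear Kq D] [MonoidalCategory D]
  [MonoidalPreadditive D] [MonoidalLinear Kq D] [Limits.HasFiniteBiproducts D] (W : WebData D)

lemma word₁_wordμ_word₂ (a b : ℕ+) :
    ((W.word₁ a).inv ⊗ₘ (W.word₁ b).inv) ≫ (W.wordμ [a] [b]).hom ≫ (W.word₂ a b).hom = 𝟙 _ := by
  change ((ρ_ (W.obj a)).inv ⊗ₘ (ρ_ (W.obj b)).inv) ≫ ((α_ (W.obj a) (𝟙_ D) (W.obj b ⊗ 𝟙_ D)).hom ≫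
    W.obj a ◁ (λ_ (W.obj b ⊗ 𝟙_ D)).hom) ≫ W.obj a ◁ (ρ_ (W.obj b)).hom = 𝟙 _
  monoidal

/-- The value of the functor on a strand. -/
def functorStrand (a : ℕ+) : W.functor.obj (strand a) ≅ W.obj a := W.word₁ a

/-- The value of the functor on two strands. -/
def functorStrands (a b : ℕ+) : W.functor.obj (strand a ⊗ strand b) ≅ W.obj a ⊗ W.obj b :=
  W.word₂ a b

lemma functor_μ_strand (a b : ℕ+) :
    ((W.functorStrand a).inv ⊗ₘ (W.functorStrand b).inv) ≫ μ W.functor (strand a) (strand b) =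
      (W.functorStrands a b).inv := by
  have h2 := W.word₁_wordμ_word₂ a b
  rw [← Category.assoc, Iso.comp_hom_eq_id] at h2
  exact h2

lemma functor_map_merge (a b c : ℕ+) (h : a + b = c) : W.functor.map (mergeWeb a b c h) =
    (W.functorStrands a b).hom ≫ W.merge a b c h ≫ (W.functorStrand c).inv := rfl

lemma functor_map_split (a b c : ℕ+) (h : a + b = c) : W.functor.map (splitWeb a b c h) =
    (W.functorStrand c).hom ≫ W.split a b c h ≫ (W.functorStrands a b).inv := rfl

/-- The value of the extended functor on a strand. -/
def strandIso (a : ℕ+) : (AddClosure.lift W.functor).obj (webEmb.obj (strand a)) ≅ W.obj a :=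
  AddClosure.liftEmb W.functor (strand a) ≪≫ W.functorStrand a

lemma lift_μ_strand (a b : ℕ+) : ((W.strandIso a).inv ⊗ₘ (W.strandIso b).inv) ≫
    μ (webEmb ⋙ AddClosure.lift W.functor) (strand a) (strand b) =
      (W.functorStrands a b).inv ≫
        (AddClosure.liftEmb W.functor (strand a ⊗ strand b)).inv := by
  have h1 := AddClosure.lift_μ_emb W.functor (strand a) (strand b)
  rw [← functor_μ_strand, Category.assoc, ← h1, strandIso, strandIso, Iso.trans_inv, Iso.trans_inv,
    ← tensorHom_comp_tensorHom, Category.assoc]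

lemma lift_merge (a b c : ℕ+) (h : a + b = c) : ((W.strandIso a).inv ⊗ₘ (W.strandIso b).inv) ≫
    μ (webEmb ⋙ AddClosure.lift W.functor) (strand a) (strand b) ≫
      (AddClosure.lift W.functor).map (webEmb.map (mergeWeb a b c h)) ≫ (W.strandIso c).hom =
        W.merge a b c h := by
  have h1 := AddClosure.liftEmb_naturality W.functor (mergeWeb a b c h)
  rw [← Category.assoc, lift_μ_strand, Category.assoc, strandIso, Iso.trans_hom, reassoc_of% h1,
    functor_map_merge]
  simp

lemma lift_split (a b c : ℕ+) (h : a + b = c) : (W.strandIso c).inv ≫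
    (AddClosure.lift W.functor).map (webEmb.map (splitWeb a b c h)) ≫
      δ (webEmb ⋙ AddClosure.lift W.functor) (strand a) (strand b) ≫
        ((W.strandIso a).hom ⊗ₘ (W.strandIso b).hom) = W.split a b c h := by
  have h0 : (δ (webEmb ⋙ AddClosure.lift W.functor) (strand a) (strand b) ≫
      ((W.strandIso a).hom ⊗ₘ (W.strandIso b).hom)) =
      (AddClosure.liftEmb W.functor (strand a ⊗ strand b)).hom ≫ (W.functorStrands a b).hom := by
    have h3 : (((W.strandIso a).inv ⊗ₘ (W.strandIso b).inv) ≫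
        μ (webEmb ⋙ AddClosure.lift W.functor) (strand a) (strand b)) ≫
        (δ (webEmb ⋙ AddClosure.lift W.functor) (strand a) (strand b) ≫
          ((W.strandIso a).hom ⊗ₘ (W.strandIso b).hom)) = 𝟙 _ := by
      rw [Category.assoc, Functor.Monoidal.μ_δ_assoc, tensorHom_comp_tensorHom, Iso.inv_hom_id,
        Iso.inv_hom_id]
      exact id_tensorHom_id _ _
    rw [lift_μ_strand, Category.assoc, Iso.inv_comp_eq, Iso.inv_comp_eq, Category.comp_id] at h3
    exact h3
  have h1 := AddClosure.liftEmb_naturality W.functor (splitWeb a b c h)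
  rw [h0, strandIso, Iso.trans_inv, Category.assoc, reassoc_of% h1, functor_map_split]
  simp

end WebData

lemma nonempty_gammaA (k : Kind) (n : ℕ) : Nonempty (GammaA k n) :=
  ⟨{ functor := AddClosure.lift (k.webData n).functor
     objIso := (k.webData n).strandIso
     map_merge := fun a b c h =>
      (congrArg (k.IsMul n (congrArg PNat.val h)) ((k.webData n).lift_merge a b c h)).mpr
        (k.isMul_mulHom _)
     map_split := fun a b c h =>
      (congrArg (k.IsComul n a b c) ((k.webData n).lift_split a b c h)).mpr
        (k.isComul_comulHom (congrArg PNat.val h)) }⟩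

section Orbit
open Functor.LaxMonoidal Functor.OplaxMonoidal MonoidalLeftAction
variable {C V D : Type*} [Category* C] [MonoidalCategory C] [Category* V] [MonoidalCategory V]
  [Category* D] [MonoidalLeftAction V D] (F : C ⥤ V) (T : D)

/-- The functor `X ↦ F(X) ⊙ T`. -/
def orbit : C ⥤ D where
  obj X := F.obj X ⊙ₗ T
  map f := F.map f ⊵ₗ T

variable [F.Monoidal]

/-- `F(W) ⊙ (F(X) ⊙ T) ≅ F(W ⊗ X) ⊙ T`. -/
def orbitAct (W X : C) : F.obj W ⊙ₗ (orbit F T).obj X ≅ (orbit F T).obj (W ⊗ X) :=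
  Iso.mk (X := F.obj W ⊙ₗ F.obj X ⊙ₗ T) (Y := F.obj (W ⊗ X) ⊙ₗ T)
    ((αₗ (F.obj W) (F.obj X) T).inv ≫ μ F W X ⊵ₗ T)
    (δ F W X ⊵ₗ T ≫ (αₗ (F.obj W) (F.obj X) T).hom)
    (by rw [Category.assoc, ← comp_actionHomLeft_assoc, Functor.Monoidal.μ_δ, id_actionHomLeft,
      Category.id_comp, Iso.inv_hom_id])
    (by rw [Category.assoc, Iso.hom_inv_id_assoc, ← comp_actionHomLeft, Functor.Monoidal.δ_μ,
      id_actionHomLeft])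

lemma orbitAct_natural {W W' X X' : C} (f : W ⟶ W') (g : X ⟶ X') :
    (F.map f ⊙ₗₘ (orbit F T).map g) ≫ (orbitAct F T W' X').hom =
      (orbitAct F T W X).hom ≫ (orbit F T).map (f ⊗ₘ g) := by
  have h := actionAssocIso_inv_naturality (F.map f) (F.map g) (𝟙 T)
  rw [actionHom_id, actionHom_id] at h
  refine (Category.assoc _ _ _).symm.trans ((congrArg (· ≫ μ F W' X' ⊵ₗ T) h).trans ?_)
  refine (Category.assoc _ _ _).trans (Eq.trans ?_ (Category.assoc _ _ _).symm)
  refine congrArg ((αₗ (F.obj W) (F.obj X) T).inv ≫ ·) ?_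
  change (F.map f ⊗ₘ F.map g) ⊵ₗ T ≫ μ F W' X' ⊵ₗ T = μ F W X ⊵ₗ T ≫ F.map (f ⊗ₘ g) ⊵ₗ T
  rw [← comp_actionHomLeft, ← comp_actionHomLeft, μ_natural]

lemma orbitAct_natural_right (W : C) {X X' : C} (g : X ⟶ X') :
    (F.obj W ⊴ₗ (orbit F T).map g) ≫ (orbitAct F T W X').hom =
      (orbitAct F T W X).hom ≫ (orbit F T).map (W ◁ g) := by
  have h := orbitAct_natural F T (𝟙 W) g
  rwa [CategoryTheory.Functor.map_id, id_actionHom, id_tensorHom] at h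

lemma orbitAct_natural_left {W W' : C} (f : W ⟶ W') (X : C) :
    (F.map f ⊵ₗ (orbit F T).obj X) ≫ (orbitAct F T W' X).hom =
      (orbitAct F T W X).hom ≫ (orbit F T).map (f ▷ X) := by
  have h := orbitAct_natural F T f (𝟙 X)
  rwa [CategoryTheory.Functor.map_id, actionHom_id, tensorHom_id] at h

lemma orbitAct_assoc (W X Y : C) :
    (μ F W X ⊵ₗ (orbit F T).obj Y) ≫ (orbitAct F T (W ⊗ X) Y).hom ≫
        (orbit F T).map (α_ W X Y).hom =
      (αₗ (F.obj W) (F.obj X) ((orbit F T).obj Y)).hom ≫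
        (F.obj W ⊴ₗ (orbitAct F T X Y).hom) ≫ (orbitAct F T W (X ⊗ Y)).hom := by
  have e : μ F W X ⊵ₗ (F.obj Y ⊙ₗ T) = (αₗ (F.obj W ⊗ F.obj X) (F.obj Y) T).inv ≫
      (μ F W X ▷ F.obj Y) ⊵ₗ T ≫ (αₗ (F.obj (W ⊗ X)) (F.obj Y) T).hom :=
    actionHomLeft_action _ _ _
  have e2 : F.obj W ⊴ₗ (orbitAct F T X Y).hom = (F.obj W ⊴ₗ (αₗ (F.obj X) (F.obj Y) T).inv) ≫
      (αₗ (F.obj W) (F.obj X ⊗ F.obj Y) T).inv ≫ (F.obj W ◁ μ F X Y) ⊵ₗ T ≫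
        (αₗ (F.obj W) (F.obj (X ⊗ Y)) T).hom := by
    rw [whiskerLeft_actionHomLeft]
    simp only [Category.assoc, Iso.inv_hom_id, Category.comp_id, Iso.inv_hom_id_assoc]
    exact actionHomRight_comp _ _ _
  have h3 := associator_actionHom (F.obj W) (F.obj X) (F.obj Y) T
  have h4 := congrArg (· ⊵ₗ T) (Functor.LaxMonoidal.associativity F W X Y)
  simp only [comp_actionHomLeft] at h4
  rw [e2]
  change μ F W X ⊵ₗ (F.obj Y ⊙ₗ T) ≫ ((αₗ (F.obj (W ⊗ X)) (F.obj Y) T).inv ≫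
    μ F (W ⊗ X) Y ⊵ₗ T) ≫ F.map (α_ W X Y).hom ⊵ₗ T = (αₗ (F.obj W) (F.obj X) (F.obj Y ⊙ₗ T)).hom ≫
    (_ ≫ _ ≫ _ ≫ _) ≫ (αₗ (F.obj W) (F.obj (X ⊗ Y)) T).inv ≫ μ F W (X ⊗ Y) ⊵ₗ T
  rw [e]
  simp only [Category.assoc, Iso.hom_inv_id_assoc, h4]
  rw [Iso.inv_comp_eq, ← reassoc_of% h3, actionHomRight_hom_inv_assoc, Iso.hom_inv_id_assoc]

lemma orbitAct_unit (X : C) :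
    (ε F ⊵ₗ (orbit F T).obj X) ≫ (orbitAct F T (𝟙_ C) X).hom ≫ (orbit F T).map (λ_ X).hom =
      (λₗ ((orbit F T).obj X)).hom := by
  have e : ε F ⊵ₗ (F.obj X ⊙ₗ T) = (αₗ (𝟙_ V) (F.obj X) T).inv ≫
      (ε F ▷ F.obj X) ⊵ₗ T ≫ (αₗ (F.obj (𝟙_ C)) (F.obj X) T).hom :=
    actionHomLeft_action _ _ _
  have h3 := leftUnitor_actionHom (F.obj X) T
  have h4 := congrArg (· ⊵ₗ T) (Functor.LaxMonoidal.left_unitality F X)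
  simp only [comp_actionHomLeft] at h4
  change ε F ⊵ₗ (F.obj X ⊙ₗ T) ≫ ((αₗ (F.obj (𝟙_ C)) (F.obj X) T).inv ≫
    μ F (𝟙_ C) X ⊵ₗ T) ≫ F.map (λ_ X).hom ⊵ₗ T = (λₗ (F.obj X ⊙ₗ T)).hom
  rw [e]
  simp only [Category.assoc, Iso.hom_inv_id_assoc]
  rw [← h4, h3, Iso.inv_hom_id_assoc]

/-- The object `F(1) ⊙ T` is `T`. -/
def orbitUnit : (orbit F T).obj (𝟙_ C) ≅ T :=
  Iso.mk (X := F.obj (𝟙_ C) ⊙ₗ T) (Y := T) (η F ⊵ₗ T ≫ (λₗ T).hom) ((λₗ T).inv ≫ ε F ⊵ₗ T)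
    (by rw [Category.assoc, Iso.hom_inv_id_assoc, ← comp_actionHomLeft, Functor.Monoidal.η_ε,
      id_actionHomLeft])
    (by rw [Category.assoc, ← comp_actionHomLeft_assoc, Functor.Monoidal.ε_η, id_actionHomLeft,
      Category.id_comp, Iso.inv_hom_id])

lemma orbitAct_rightUnit (X : C) :
    (F.obj X ⊴ₗ (orbitUnit F T).inv) ≫ (orbitAct F T X (𝟙_ C)).hom ≫
      (orbit F T).map (ρ_ X).hom = 𝟙 _ := by
  have h4 := congrArg (· ⊵ₗ T) (Functor.LaxMonoidal.right_unitality F X)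
  simp only [comp_actionHomLeft] at h4
  have h5 := whiskerLeft_actionHomLeft (F.obj X) (ε F) T
  have h6 := rightUnitor_actionHom (F.obj X) T
  change (F.obj X ⊴ₗ ((λₗ T).inv ≫ ε F ⊵ₗ T)) ≫ ((αₗ (F.obj X) (F.obj (𝟙_ C)) T).inv ≫
    μ F X (𝟙_ C) ⊵ₗ T) ≫ F.map (ρ_ X).hom ⊵ₗ T = 𝟙 (F.obj X ⊙ₗ T)
  have h7 : F.obj X ⊴ₗ ε F ⊵ₗ T ≫ (αₗ (F.obj X) (F.obj (𝟙_ C)) T).inv =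
      (αₗ _ _ _).inv ≫ (F.obj X ◁ ε F) ⊵ₗ T := by rw [h5, Iso.inv_hom_id_assoc]
  rw [actionHomRight_comp, Category.assoc, Category.assoc, reassoc_of% h7, ← h4, h6,
    Iso.inv_hom_id_assoc, actionHomRight_inv_hom]

variable {F T}

/-- The action of an object `W` on a morphism `F(X) ⊙ T ⟶ F(Y) ⊙ T`. -/
def orbitWhisker (W : C) {X Y : C} (f : (orbit F T).obj X ⟶ (orbit F T).obj Y) :
    (orbit F T).obj (W ⊗ X) ⟶ (orbit F T).obj (W ⊗ Y) :=
  (orbitAct F T W X).inv ≫ (F.obj W ⊴ₗ f) ≫ (orbitAct F T W Y).hom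

lemma orbitAct_whisker (W : C) {X Y : C} (f : (orbit F T).obj X ⟶ (orbit F T).obj Y) :
    (orbitAct F T W X).hom ≫ orbitWhisker W f = (F.obj W ⊴ₗ f) ≫ (orbitAct F T W Y).hom := by
  simp [orbitWhisker]

lemma orbitWhisker_map (W : C) {X Y : C} (f : X ⟶ Y) :
    orbitWhisker W ((orbit F T).map f) = (orbit F T).map (W ◁ f) := by
  rw [orbitWhisker, orbitAct_natural_right, Iso.inv_hom_id_assoc]

lemma orbitWhisker_comp (W : C) {X Y Z : C} (f : (orbit F T).obj X ⟶ (orbit F T).obj Y)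
    (g : (orbit F T).obj Y ⟶ (orbit F T).obj Z) :
    orbitWhisker W (f ≫ g) = orbitWhisker W f ≫ orbitWhisker W g := by
  simp [orbitWhisker]

lemma orbitWhisker_exchange {W X : C} {Y Z : C} (f : W ⟶ X)
    (g : (orbit F T).obj Y ⟶ (orbit F T).obj Z) :
    (orbit F T).map (f ▷ Y) ≫ orbitWhisker X g = orbitWhisker W g ≫ (orbit F T).map (f ▷ Z) := by
  rw [← cancel_epi (orbitAct F T W Y).hom, ← reassoc_of% orbitAct_natural_left F T f Y,
    orbitAct_whisker, reassoc_of% orbitAct_whisker (F := F) W g, ← orbitAct_natural_left,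
    action_exchange_assoc]

lemma orbitWhisker_unit {X Y : C} (f : (orbit F T).obj X ⟶ (orbit F T).obj Y) :
    orbitWhisker (𝟙_ C) f ≫ (orbit F T).map (λ_ Y).hom = (orbit F T).map (λ_ X).hom ≫ f := by
  have e : ∀ X, (λₗ ((orbit F T).obj X)).hom = _ := fun X => (orbitAct_unit F T X).symm
  have : IsIso (ε F ⊵ₗ (orbit F T).obj X) := inferInstance
  rw [← cancel_epi (orbitAct F T _ X).hom, ← cancel_epi (ε F ⊵ₗ (orbit F T).obj X),
    reassoc_of% orbitAct_whisker (F := F) _ f, ← action_exchange_assoc, orbitAct_unit,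
    reassoc_of% orbitAct_unit F T X, actionUnitIso_hom_naturality]

lemma orbitWhisker_tensor (W X : C) {Y Z : C} (f : (orbit F T).obj Y ⟶ (orbit F T).obj Z) :
    orbitWhisker (W ⊗ X) f ≫ (orbit F T).map (α_ W X Z).hom =
      (orbit F T).map (α_ W X Y).hom ≫ orbitWhisker W (orbitWhisker X f) := by
  have h := actionAssocIso_hom_naturality (𝟙 (F.obj W)) (𝟙 (F.obj X)) f
  simp only [id_tensorHom_id, id_actionHom] at h
  rw [← cancel_epi (orbitAct F T _ Y).hom, ← cancel_epi (μ F W X ⊵ₗ (orbit F T).obj Y),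
    reassoc_of% orbitAct_whisker (F := F) _ f, ← action_exchange_assoc, orbitAct_assoc,
    reassoc_of% orbitAct_assoc F T W X Y, orbitAct_whisker, reassoc_of% h,
    ← actionHomRight_comp_assoc, ← actionHomRight_comp_assoc, orbitAct_whisker]

end Orbit

/-- An action of a linear monoidal category that is bilinear on morphisms. -/
class LinearAction (V D : Type*) [Category* V] [Preadditive V] [Linear Kq V] [MonoidalCategory V]
    [Category* D] [Preadditive D] [Linear Kq D] [MonoidalLeftAction V D] : Prop extends
    BiadditiveAction V D where
  smul_left : ∀ (k : Kq) {c c' : V} (f : c ⟶ c') (d : D), (k • f) ⊵ₗ d = k • f ⊵ₗ d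
  smul_right : ∀ (k : Kq) (c : V) {d d' : D} (f : d ⟶ d'), c ⊴ₗ (k • f) = k • c ⊴ₗ f

section OrbitLinear
open MonoidalLeftAction
variable {C V D : Type*} [Category* C] [Preadditive C] [Linear Kq C] [MonoidalCategory C]
  [Category* V] [Preadditive V] [Linear Kq V] [MonoidalCategory V]
  [Category* D] [Preadditive D] [Linear Kq D] [MonoidalLeftAction V D] [LinearAction V D]
  (F : C ⥤ V) [F.Additive] [F.Linear Kq] (T : D)

instance orbit_additive : (orbit F T).Additive where
  map_add {X Y f g} := by
    change F.map (f + g) ⊵ₗ T = F.map f ⊵ₗ T + F.map g ⊵ₗ T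
    rw [Functor.map_add, BiadditiveAction.add_left]

instance orbit_linear : (orbit F T).Linear Kq where
  map_smul f k := by
    change F.map (k • f) ⊵ₗ T = k • F.map f ⊵ₗ T
    rw [Functor.map_smul, LinearAction.smul_left]

variable [F.Monoidal] {F T}

lemma orbitWhisker_add (W : C) {X Y : C} (f g : (orbit F T).obj X ⟶ (orbit F T).obj Y) :
    orbitWhisker W (f + g) = orbitWhisker W f + orbitWhisker W g := by
  simp [orbitWhisker, BiadditiveAction.add_right]

lemma orbitWhisker_smul (W : C) (k : Kq) {X Y : C} (f : (orbit F T).obj X ⟶ (orbit F T).obj Y) :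
    orbitWhisker W (k • f) = k • orbitWhisker W f := by
  simp [orbitWhisker, LinearAction.smul_right]

end OrbitLinear

namespace ModPre
section Eval
variable {C : Type} [Category.{0} C] [Preadditive C] [Linear Kq C] [MonoidalCategory C]
  {V D : Type*} [Category* V] [Preadditive V] [Linear Kq V] [MonoidalCategory V]
  [Category* D] [Preadditive D] [Linear Kq D] [MonoidalLeftAction V D]
  (F : C ⥤ V) [F.Monoidal] (T : D) {Gen : C → C → Type}
  (e : ∀ {X Y : C}, Gen X Y → ((orbit F T).obj X ⟶ (orbit F T).obj Y))

/-- The evaluation of a formal expression on the orbit of an object `T`. -/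
def eval : ∀ {X Y : C}, ModPre Gen X Y → ((orbit F T).obj X ⟶ (orbit F T).obj Y)
  | _, _, of f => (orbit F T).map f
  | _, _, gen g => e g
  | _, _, whisk W f => orbitWhisker W (eval f)
  | _, _, comp f g => eval f ≫ eval g
  | _, _, zero => 0
  | _, _, add f g => eval f + eval g
  | _, _, smul k f => k • eval f

variable [LinearAction V D] [F.Additive] [F.Linear Kq]

lemma eval_rel (P : ModPresentation C)
    (e : ∀ {X Y : C}, P.Gen X Y → ((orbit F T).obj X ⟶ (orbit F T).obj Y))
    (h : ∀ {X Y : C} {f g : ModPre P.Gen X Y}, P.Rel f g → eval F T e f = eval F T e g)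
    {X Y : C} {f g : ModPre P.Gen X Y} (hfg : Rel P f g) : eval F T e f = eval F T e g := by
  induction hfg with
  | rel hr => exact h hr
  | refl => rfl
  | symm _ ih => exact ih.symm
  | trans _ _ ih ih' => exact ih.trans ih'
  | comp_congr _ _ ih ih' => simp only [eval, ih, ih']
  | whisk_congr X _ ih => simp only [eval, ih]
  | add_congr _ _ ih ih' => simp only [eval, ih, ih']
  | smul_congr k _ ih => simp only [eval, ih]
  | id_comp f => simp [eval]
  | comp_id f => simp [eval]
  | comp_assoc f g h => simp [eval]
  | add_assoc f g h => exact _root_.add_assoc _ _ _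
  | add_comm f g => exact _root_.add_comm _ _
  | zero_add f => exact _root_.zero_add _
  | zero_smul f => exact _root_.zero_smul _ _
  | one_smul f => exact _root_.one_smul _ _
  | mul_smul k l f => exact (smul_smul k l _).symm
  | add_smul k l f => exact _root_.add_smul _ _ _
  | smul_add k f g => exact _root_.smul_add _ _ _
  | add_comp f f' g => exact Preadditive.add_comp _ _ _ _ _ _
  | comp_add f g g' => exact Preadditive.comp_add _ _ _ _ _ _
  | smul_comp k f g => exact Linear.smul_comp _ _ _ _ _ _
  | comp_smul k f g => exact Linear.comp_smul _ _ _ _ _ _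
  | of_comp f g => exact (orbit F T).map_comp f g
  | of_add f g => exact (orbit F T).map_add
  | of_smul k f => exact (orbit F T).map_smul k f
  | whisk_of X f => exact orbitWhisker_map X f
  | whisk_comp W f g => exact orbitWhisker_comp W _ _
  | whisk_add W f g => exact orbitWhisker_add W _ _
  | whisk_smul W k f => exact orbitWhisker_smul W k _
  | exchange f g => exact orbitWhisker_exchange f _
  | unit_whisk f => exact orbitWhisker_unit _
  | tensor_whisk W X f => exact orbitWhisker_tensor W X _

end Eval
end ModPre

instance AddClosure.embedding_linear {C : Type} [Category.{0} C] [Preadditive C] [Linear Kq C] :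
    (Mat_.embedding C).Linear Kq where
  map_smul _ _ := rfl

lemma AddClosure.inj_comp {C : Type} [Category.{0} C] [Preadditive C] {M N : Mat_ C} (f : M ⟶ N)
    (i : M.ι) : inj M i ≫ f = ∑ j, (Mat_.embedding C).map (f i j) ≫ inj N j := by
  have h : f = ∑ j, f ≫ prj N j ≫ inj N j := by
    rw [← Preadditive.comp_sum, sum_prj_inj, Category.comp_id]
  refine (congrArg (inj M i ≫ ·) h).trans ((Preadditive.comp_sum _ _ _).trans ?_)
  refine Finset.sum_congr rfl fun j _ => ?_
  refine Eq.trans ?_ (congrArg (· ≫ inj N j) (inj_comp_prj f i j))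
  simp only [Category.assoc]

section OrbitExtension
open MonoidalLeftAction AddClosure
variable {C : Type} [Category.{0} C] [Preadditive C] [Linear Kq C] [MonoidalCategory C]
  {V D : Type*} [Category* V] [Preadditive V] [Linear Kq V] [MonoidalCategory V]
  [Category* D] [Preadditive D] [Linear Kq D] [MonoidalLeftAction V D]

/-- Values of the generators of a presentation on the orbit of `T` that satisfy the relations. -/
structure ModPresentation.Model (P : ModPresentation C) (F : C ⥤ V) [F.Monoidal] (T : D) where
  /-- the values of the generators -/
  val : ∀ {X Y : C}, P.Gen X Y → ((orbit F T).obj X ⟶ (orbit F T).obj Y)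
  rel : ∀ {X Y : C} {f g : ModPre P.Gen X Y}, P.Rel f g →
    ModPre.eval F T val f = ModPre.eval F T val g

namespace ModPresentation.Model
variable {P : ModPresentation C}

section Hom
variable [LinearAction V D] {F : C ⥤ V} [F.Monoidal] [F.Additive] [F.Linear Kq] {T : D}
  (M : P.Model F T)

/-- The value of a morphism. -/
def hom {X Y : ModWeb P} (f : X ⟶ Y) : (orbit F T).obj X.obj ⟶ (orbit F T).obj Y.obj :=
  Quotient.lift (s := ModPre.setoid P X.obj Y.obj) (ModPre.eval F T M.val)
    (fun _ _ h => ModPre.eval_rel F T P M.val M.rel h) f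

lemma hom_id (X : ModWeb P) : M.hom (𝟙 X) = 𝟙 _ := (orbit F T).map_id _

lemma hom_comp {X Y Z : ModWeb P} (f : X ⟶ Y) (g : Y ⟶ Z) : M.hom (f ≫ g) = M.hom f ≫ M.hom g := by
  obtain ⟨f⟩ := f; obtain ⟨g⟩ := g; rfl

lemma hom_zero {X Y : ModWeb P} : M.hom (0 : X ⟶ Y) = 0 := rfl

lemma hom_add {X Y : ModWeb P} (f g : X ⟶ Y) : M.hom (f + g) = M.hom f + M.hom g := by
  obtain ⟨f⟩ := f; obtain ⟨g⟩ := g; rfl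

lemma hom_smul {X Y : ModWeb P} (k : Kq) (f : X ⟶ Y) : M.hom (k • f) = k • M.hom f := by
  obtain ⟨f⟩ := f; rfl

lemma hom_sum {ι : Type*} (s : Finset ι) {X Y : ModWeb P} (f : ι → (X ⟶ Y)) :
    M.hom (∑ i ∈ s, f i) = ∑ i ∈ s, M.hom (f i) :=
  map_sum (AddMonoidHom.mk' (fun f : X ⟶ Y => M.hom f) M.hom_add) f s

lemma hom_whisk (W : C) {X Y : ModWeb P} (f : X ⟶ Y) :
    M.hom (ModWeb.whisk W f) = orbitWhisker W (M.hom f) := by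
  obtain ⟨f⟩ := f; rfl

end Hom

/-- The sum of the objects of `C` underlying a formal direct sum. -/
abbrev under (N : Mat_ (ModWeb P)) : Mat_ C := ⟨N.ι, fun i => (N.X i).obj⟩

section Extend
variable [BiadditiveAction C C] [LinearAction V D] {F : Mat_ C ⥤ V} [F.Monoidal] [F.Additive]
  [F.Linear Kq] {T : D}

variable (F T) in
/-- The inclusion of a summand. -/
def incl (N : Mat_ (ModWeb P)) (i : N.ι) :
    (orbit (Mat_.embedding C ⋙ F) T).obj (N.X i).obj ⟶ (orbit F T).obj (under N) :=
  (orbit F T).map (inj (under N) i)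

variable (F T) in
/-- The projection to a summand. -/
def proj (N : Mat_ (ModWeb P)) (i : N.ι) :
    (orbit F T).obj (under N) ⟶ (orbit (Mat_.embedding C ⋙ F) T).obj (N.X i).obj :=
  (orbit F T).map (prj (under N) i)

lemma incl_proj_self (N : Mat_ (ModWeb P)) (i : N.ι) : incl F T N i ≫ proj F T N i = 𝟙 _ := by
  refine ((orbit F T).map_comp _ _).symm.trans ?_
  rw [inj_prj_self]
  exact (orbit F T).map_id _

lemma incl_proj_ne (N : Mat_ (ModWeb P)) {i j : N.ι} (h : i ≠ j) :
    incl F T N i ≫ proj F T N j = 0 := by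
  refine ((orbit F T).map_comp _ _).symm.trans ?_
  rw [inj_prj_ne (under N) h]
  exact (orbit F T).map_zero _ _

lemma sum_proj_incl (N : Mat_ (ModWeb P)) : ∑ i, proj F T N i ≫ incl F T N i = 𝟙 _ := by
  have h := congrArg (orbit F T).map (sum_prj_inj (under N))
  rw [Functor.map_sum, CategoryTheory.Functor.map_id] at h
  rw [← h]
  exact Finset.sum_congr rfl fun i _ => ((orbit F T).map_comp _ _).symm

lemma incl_ext {N : Mat_ (ModWeb P)} {Z : D} {f g : (orbit F T).obj (under N) ⟶ Z}
    (h : ∀ i, incl F T N i ≫ f = incl F T N i ≫ g) : f = g := by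
  rw [← Category.id_comp f, ← Category.id_comp g, ← sum_proj_incl, Preadditive.sum_comp,
    Preadditive.sum_comp]
  simp only [Category.assoc, h]

variable (M : P.Model (Mat_.embedding C ⋙ F) T)

/-- The value of a matrix of morphisms. -/
def mapMat {N N' : Mat_ (ModWeb P)} (g : N ⟶ N') :
    (orbit F T).obj (under N) ⟶ (orbit F T).obj (under N') :=
  ∑ i, ∑ j, proj F T N i ≫ M.hom (g i j) ≫ incl F T N' j

lemma incl_mapMat {N N' : Mat_ (ModWeb P)} (g : N ⟶ N') (i : N.ι) :
    incl F T N i ≫ M.mapMat g = ∑ j, M.hom (g i j) ≫ incl F T N' j := by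
  simp only [mapMat, Preadditive.comp_sum]
  rw [Finset.sum_eq_single i]
  · refine Finset.sum_congr rfl fun j _ => ?_
    rw [← Category.assoc, incl_proj_self, Category.id_comp]
  · intro i' _ h
    refine Finset.sum_eq_zero fun j _ => ?_
    rw [← Category.assoc, incl_proj_ne N h.symm, Limits.zero_comp]
  · simp

/-- The extension to the additive closure. -/
def extend : Mat_ (ModWeb P) ⥤ D where
  obj N := (orbit F T).obj (under N)
  map := M.mapMat
  map_id N := by
    refine incl_ext fun i => ?_
    rw [incl_mapMat, Finset.sum_eq_single i, Mat_.id_apply_self, hom_id, Category.id_comp,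
      Category.comp_id]
    · intro j _ h
      rw [Mat_.id_apply_of_ne _ _ _ h.symm, hom_zero, Limits.zero_comp]
    · simp
  map_comp {N N' N''} f g := by
    refine incl_ext fun i => ?_
    rw [incl_mapMat, reassoc_of% incl_mapMat M, Preadditive.sum_comp]
    simp only [Category.assoc, incl_mapMat, Mat_.comp_apply, hom_sum, hom_comp,
      Preadditive.sum_comp, Preadditive.comp_sum]
    exact Finset.sum_comm

instance extend_additive : M.extend.Additive where
  map_add {N N' f g} := by
    refine incl_ext fun i => ?_
    change incl F T N i ≫ M.mapMat (f + g) = incl F T N i ≫ (M.mapMat f + M.mapMat g)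
    simp only [Preadditive.comp_add, incl_mapMat, Mat_.add_apply, hom_add, Preadditive.add_comp,
      Finset.sum_add_distrib]

instance extend_linear : M.extend.Linear Kq where
  map_smul {N N'} f k := by
    refine incl_ext fun i => ?_
    change incl F T N i ≫ M.mapMat (k • f) = incl F T N i ≫ (k • M.mapMat f)
    have h : ∀ j, (k • f) i j = k • f i j := fun j => rfl
    simp only [Linear.comp_smul, incl_mapMat, h, hom_smul, Linear.smul_comp, Finset.smul_sum]

/-- The matrix of morphisms `f ⊙ ∅`. -/
def incMat {N N' : Mat_ (ModWeb P)} (f : under N ⟶ under N') : N ⟶ N' :=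
  fun i j => ModWeb.inc (f i j)

lemma mapMat_incMat {N N' : Mat_ (ModWeb P)} (f : under N ⟶ under N') :
    M.mapMat (incMat f) = (orbit F T).map f := by
  refine incl_ext fun i => ?_
  have h : inj (under N) i ≫ f = ∑ j, (Mat_.embedding C).map (f i j) ≫ inj (under N') j := inj_comp f i
  rw [incl_mapMat]
  refine Eq.trans ?_ ((congrArg (orbit F T).map h).symm.trans ((orbit F T).map_comp _ _))
  rw [Functor.map_sum]
  exact Finset.sum_congr rfl fun j _ => ((orbit F T).map_comp _ _).symm

lemma single_inc {N N' : Mat_ (ModWeb P)} (e : N.ι → N'.ι)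
    (φ : ∀ i, (N.X i).obj ⟶ (N'.X (e i)).obj) :
    single (M := N) (N := N') e (fun i => ModWeb.inc (φ i)) =
      incMat (single (M := under N) (N := under N') e φ) := by
  ext i j
  by_cases h : e i = j
  · subst h
    simp [incMat, single]
  · simp only [incMat, single, h, dite_false]
    exact (map_zero (AddMonoidHom.mk' (fun f : (N.X i).obj ⟶ (N'.X j).obj =>
      ModWeb.inc (P := P) f) ModWeb.inc_add)).symm

lemma mapMat_single_inc {N N' : Mat_ (ModWeb P)} (e : N.ι → N'.ι)
    (φ : ∀ i, (N.X i).obj ⟶ (N'.X (e i)).obj) :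
    M.mapMat (single (M := N) (N := N') e (fun i => ModWeb.inc (φ i))) =
      (orbit F T).map (single (M := under N) (N := under N') e φ) := by
  rw [single_inc, mapMat_incMat]

lemma id_eq_incMat (N : Mat_ (ModWeb P)) : 𝟙 N = incMat (𝟙 (under N)) := by
  rw [← single_id N, ← single_id (under N), ← single_inc]
  rfl

lemma actHom_id_eq_incMat {L L' : Mat_ C} (f : L ⟶ L') (N : Mat_ (ModWeb P)) :
    f ⊵ₗ N = incMat (N := L ⊙ₗ N) (N' := L' ⊙ₗ N) (f ▷ under N) := by
  change AddClosure.actHom f (𝟙 N) = _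
  rw [id_eq_incMat N]
  funext p r
  change ModWeb.inc (P := P) (f p.1 r.1 ▷ (N.X p.2).obj) ≫ ModWeb.whisk (L'.X r.1)
    (ModWeb.inc (P := P) ((𝟙 (under N) : under N ⟶ under N) p.2 r.2)) =
      ModWeb.inc (P := P) (f p.1 r.1 ⊗ₘ (𝟙 (under N) : under N ⟶ under N) p.2 r.2)
  rw [MonoidalCategory.tensorHom_def, ModWeb.inc_comp, ← ModWeb.whisk_inc]

lemma mapMat_actHomLeft {L L' : Mat_ C} (f : L ⟶ L') (N : Mat_ (ModWeb P)) :
    M.mapMat (f ⊵ₗ N) = (orbit F T).map (f ▷ under N) := by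
  rw [actHom_id_eq_incMat]
  exact M.mapMat_incMat (N := L ⊙ₗ N) (N' := L' ⊙ₗ N) _

end Extend
end ModPresentation.Model
end OrbitExtension

namespace ModPresentation.Model
open MonoidalLeftAction AddClosure
variable {C : Type} [Category.{0} C] [Preadditive C] [Linear Kq C] [MonoidalCategory C]
  {V D : Type*} [Category.{0} V] [Preadditive V] [Linear Kq V] [MonoidalCategory V]
  [Category.{0} D] [Preadditive D] [Linear Kq D] [MonoidalLeftAction V D] {P : ModPresentation C}
  [BiadditiveAction C C] [LinearAction V D] {F : Mat_ C ⥤ V} [F.Monoidal] [F.Additive]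
  [F.Linear Kq] {T : D}

variable (F) in
/-- The image of the inclusion of a summand. -/
def mapInj (L : Mat_ C) (i : L.ι) : (Mat_.embedding C ⋙ F).obj (L.X i) ⟶ F.obj L :=
  F.map (inj L i)

variable (F) in
/-- The image of the projection to a summand. -/
def mapPrj (L : Mat_ C) (i : L.ι) : F.obj L ⟶ (Mat_.embedding C ⋙ F).obj (L.X i) :=
  F.map (prj L i)

lemma sum_mapPrj_mapInj (L : Mat_ C) : ∑ i, mapPrj F L i ≫ mapInj F L i = 𝟙 _ := by
  have h := congrArg F.map (sum_prj_inj L)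
  rw [Functor.map_sum, CategoryTheory.Functor.map_id] at h
  rw [← h]
  exact Finset.sum_congr rfl fun i _ => (F.map_comp _ _).symm

lemma incl_ext₂ {L : Mat_ C} {N : Mat_ (ModWeb P)} {Z : D}
    {f g : F.obj L ⊙ₗ (orbit F T).obj (under N) ⟶ Z}
    (h : ∀ i j, (mapInj F L i ⊙ₗₘ incl F T N j) ≫ f = (mapInj F L i ⊙ₗₘ incl F T N j) ≫ g) :
    f = g := by
  have key : ∀ f : F.obj L ⊙ₗ (orbit F T).obj (under N) ⟶ Z, f = ∑ i, ∑ j,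
      (mapPrj F L i ⊙ₗₘ proj F T N j) ≫ (mapInj F L i ⊙ₗₘ incl F T N j) ≫ f := by
    intro f
    have h1 : (𝟙 (F.obj L)) ⊙ₗₘ (𝟙 ((orbit F T).obj (under N))) = 𝟙 _ := by
      rw [actionHom_id, id_actionHomLeft]
    rw [← sum_mapPrj_mapInj, ← sum_proj_incl, sum_actionHom] at h1
    simp only [actionHom_sum, actionHom_comp] at h1
    conv_lhs => rw [← Category.id_comp f, ← h1]
    simp only [Preadditive.sum_comp, Category.assoc]
  rw [key f, key g]
  simp only [h]

lemma orbitAct_emb (X Y : C) :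
    (orbitAct F T ((Mat_.embedding C).obj X) ((Mat_.embedding C).obj Y)).hom ≫
      (orbit F T).map (embAct (C := C) (D := C) X Y).hom =
        (orbitAct (Mat_.embedding C ⋙ F) T X Y).hom := by
  refine (Category.assoc _ _ _).trans (congrArg ((αₗ _ _ _).inv ≫ ·) ?_)
  refine (comp_actionHomLeft _ _ _).symm.trans (congrArg (· ⊵ₗ T) ?_)
  exact (Functor.LaxMonoidal.comp_μ _ _ _ _).symm

lemma _root_.AddClosure.inj_tensor_inj (L M : Mat_ C) (i : L.ι) (j : M.ι) :
    (inj L i ⊗ₘ inj M j : (Mat_.embedding C).obj (L.X i) ⊗ (Mat_.embedding C).obj (M.X j) ⟶ L ⊗ M) =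
      (embAct (C := C) (D := C) (L.X i) (M.X j)).hom ≫ inj (L ⊗ M) (i, j) := by
  refine (actHom_single (C := C) (D := C) (M := (Mat_.embedding C).obj (L.X i)) (M' := L)
    (N := (Mat_.embedding C).obj (M.X j)) (N' := M) (fun _ => i) (fun _ => 𝟙 _)
    (fun _ => j) (fun _ => 𝟙 _)).trans ?_
  refine Eq.trans ?_ (single_comp_single (M := actObj ((Mat_.embedding C).obj (L.X i))
    ((Mat_.embedding C).obj (M.X j))) (N := (Mat_.embedding C).obj (L.X i ⊗ M.X j))
    (K := actObj L M) _ _ _ _).symm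
  congr 1
  funext p
  exact (id_tensorHom_id _ _).trans (Category.id_comp _).symm

lemma mapInj_incl_orbitAct (L : Mat_ C) (N : Mat_ (ModWeb P)) (i : L.ι) (j : N.ι) :
    (mapInj F L i ⊙ₗₘ incl F T N j) ≫ (orbitAct F T L (under N)).hom =
      (orbitAct (Mat_.embedding C ⋙ F) T (L.X i) (N.X j).obj).hom ≫
        incl F T (L ⊙ₗ N) (i, j) := by
  refine (orbitAct_natural F T (inj L i) (inj (under N) j)).trans ?_
  refine (congrArg (fun t => (orbitAct F T _ _).hom ≫ (orbit F T).map t)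
    (inj_tensor_inj L (under N) i j)).trans ?_
  refine (congrArg ((orbitAct F T _ _).hom ≫ ·) ((orbit F T).map_comp _ _)).trans ?_
  exact (Category.assoc _ _ _).symm.trans
    (congrArg (· ≫ incl F T (L ⊙ₗ N) (i, j)) (orbitAct_emb (L.X i) (N.X j).obj))

variable (M : P.Model (Mat_.embedding C ⋙ F) T)

lemma mapMat_actHomRight (L : Mat_ C) {N N' : Mat_ (ModWeb P)} (g : N ⟶ N') :
    (F.obj L ⊴ₗ M.mapMat g) ≫ (orbitAct F T L (under N')).hom =
      (orbitAct F T L (under N)).hom ≫ M.mapMat (L ⊴ₗ g) := by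
  refine incl_ext₂ fun i j => ?_
  have h1 : (mapInj F L i ⊙ₗₘ incl F T N j) ≫ F.obj L ⊴ₗ M.mapMat g =
      ∑ j', ((Mat_.embedding C ⋙ F).obj (L.X i) ⊴ₗ M.hom (g j j')) ≫
        (mapInj F L i ⊙ₗₘ incl F T N' j') := by
    rw [← id_actionHom, ← actionHom_comp, incl_mapMat, Category.comp_id]
    refine (actionHom_sum _ _ _).trans (Finset.sum_congr rfl fun j' _ => ?_)
    generalize M.hom (g j j') = u
    rw [← id_actionHom, ← actionHom_comp, Category.id_comp]
  have h2 : incl F T (L ⊙ₗ N) (i, j) ≫ M.mapMat (L ⊴ₗ g) =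
      ∑ j', orbitWhisker (L.X i) (M.hom (g j j')) ≫ incl F T (L ⊙ₗ N') (i, j') := by
    have h3 : ∀ i' j', ((L ⊴ₗ g : L ⊙ₗ N ⟶ L ⊙ₗ N') (i, j) (i', j')) =
        (𝟙 L : L ⟶ L) i i' ⊙ₗₘ g j j' := fun _ _ => rfl
    refine (M.incl_mapMat (L ⊴ₗ g) (i, j)).trans ((Fintype.sum_prod_type _).trans ?_)
    rw [Finset.sum_eq_single i]
    · refine Finset.sum_congr rfl fun j' _ => congrArg (· ≫ incl F T (L ⊙ₗ N') (i, j')) ?_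
      rw [h3, Mat_.id_apply_self, id_actionHom]
      exact M.hom_whisk (L.X i) (g j j')
    · intro i' _ hi
      refine Finset.sum_eq_zero fun j' _ => ?_
      rw [h3, Mat_.id_apply_of_ne _ _ _ hi.symm, zero_actionHom]
      exact (congrArg (· ≫ incl F T (L ⊙ₗ N') (i', j')) M.hom_zero).trans Limits.zero_comp
    · simp
  refine (Category.assoc _ _ _).symm.trans ((congrArg (· ≫ (orbitAct F T L (under N')).hom)
    h1).trans ?_)
  refine Eq.trans ?_ (Category.assoc _ _ _)
  refine Eq.trans ?_ ((congrArg (· ≫ M.mapMat (L ⊴ₗ g)) (mapInj_incl_orbitAct L N i j)).trans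
    ((Category.assoc _ _ _).trans (congrArg _ h2))).symm
  refine (Preadditive.sum_comp _ _ _).trans (Eq.trans ?_ (Preadditive.comp_sum _ _ _).symm)
  refine Finset.sum_congr rfl fun j' _ => ?_
  refine Eq.trans ?_ (Category.assoc _ _ _)
  generalize M.hom (g j j') = u
  rw [Category.assoc, mapInj_incl_orbitAct, orbitAct_whisker]
  exact (Category.assoc _ _ _).symm

/-- The extension of a model to the additive closure is a functor of module categories. -/
def extendAction : ModuleFunctor F M.extend where
  actIso L N := orbitAct F T L (under N)
  natural {L L' N N'} f g := by
    have h1 := M.mapMat_actHomRight L' g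
    have h2 := orbitAct_natural_left F T f (under N)
    rw [actionHom_def f g, Functor.map_comp, actionHom_def]
    refine (Category.assoc _ _ _).trans ((congrArg (F.map f ⊵ₗ _ ≫ ·) h1).trans ?_)
    refine (Category.assoc _ _ _).symm.trans ((congrArg (· ≫ M.mapMat (L' ⊴ₗ g)) h2).trans ?_)
    refine (Category.assoc _ _ _).trans ?_
    exact congrArg (fun t => (orbitAct F T L (under N)).hom ≫ t ≫ M.mapMat (L' ⊴ₗ g))
      (M.mapMat_actHomLeft f N).symm
  assoc X Y Z := by
    have h := M.mapMat_single_inc (N := (X ⊗ Y) ⊙ₗ Z) (N' := X ⊙ₗ Y ⊙ₗ Z)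
      (Equiv.prodAssoc X.ι Y.ι Z.ι) (fun p => (α_ (X.X p.1.1) (Y.X p.1.2) (Z.X p.2).obj).hom)
    exact (congrArg (fun t => (Functor.LaxMonoidal.μ F X Y ⊵ₗ (orbit F T).obj (under Z)) ≫
      (orbitAct F T (X ⊗ Y) (under Z)).hom ≫ t) h).trans (orbitAct_assoc F T X Y (under Z))
  unit Y := by
    have h := M.mapMat_single_inc (N := 𝟙_ (Mat_ C) ⊙ₗ Y) (N' := Y)
      (Equiv.punitProd Y.ι) (fun p => (λ_ (Y.X p.2).obj).hom)
    exact (congrArg (fun t => (Functor.LaxMonoidal.ε F ⊵ₗ (orbit F T).obj (under Y)) ≫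
      (orbitAct F T (𝟙_ _) (under Y)).hom ≫ t) h).trans (orbitAct_unit F T (under Y))

lemma mapMat_embedding {X Y : ModWeb P} (f : X ⟶ Y) :
    M.mapMat ((Mat_.embedding (ModWeb P)).map f) = M.hom f := by
  have h : ∀ X : ModWeb P, incl F T ((Mat_.embedding (ModWeb P)).obj X) PUnit.unit =
      𝟙 ((orbit F T).obj ((Mat_.embedding C).obj X.obj)) := fun X =>
    (congrArg (orbit F T).map (single_id ((Mat_.embedding C).obj X.obj))).trans
      ((orbit F T).map_id _)
  have h1 := M.incl_mapMat ((Mat_.embedding (ModWeb P)).map f) PUnit.unit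
  have h2 := h1.trans (Fintype.sum_unique (ι := PUnit) _)
  refine Eq.trans (Eq.trans ?_ h2) ?_
  · exact ((congrArg (· ≫ M.mapMat ((Mat_.embedding (ModWeb P)).map f)) (h X)).trans
      (Category.id_comp _)).symm
  · exact (congrArg (M.hom f ≫ ·) (h Y)).trans (Category.comp_id _)

end ModPresentation.Model

namespace ModuleFunctor
open MonoidalLeftAction Functor.LaxMonoidal Functor.OplaxMonoidal

section General
variable {C C' C'' D D' D'' : Type*} [Category* C] [MonoidalCategory C] [Category* C']
  [MonoidalCategory C'] [Category* C''] [MonoidalCategory C''] [Category* D]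
  [MonoidalLeftAction C D] [Category* D'] [MonoidalLeftAction C' D'] [Category* D'']
  [MonoidalLeftAction C'' D''] {F : C ⥤ C'} [F.Monoidal] {G : D ⥤ D'} {F' : C' ⥤ C''} [F'.Monoidal]
  {G' : D' ⥤ D''}

lemma natural_left (A : ModuleFunctor F G) {X X' : C} (f : X ⟶ X') (Y : D) :
    (F.map f ⊵ₗ G.obj Y) ≫ (A.actIso X' Y).hom = (A.actIso X Y).hom ≫ G.map (f ⊵ₗ Y) := by
  have h := A.natural f (𝟙 Y)
  rwa [CategoryTheory.Functor.map_id, actionHom_id, actionHom_id] at h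

lemma natural_right (A : ModuleFunctor F G) (X : C) {Y Y' : D} (g : Y ⟶ Y') :
    (F.obj X ⊴ₗ G.map g) ≫ (A.actIso X Y').hom = (A.actIso X Y).hom ≫ G.map (X ⊴ₗ g) := by
  have h := A.natural (𝟙 X) g
  rwa [CategoryTheory.Functor.map_id, id_actionHom, id_actionHom] at h

/-- The composition of functors of module categories. -/
def comp (A : ModuleFunctor F G) (B : ModuleFunctor F' G') : ModuleFunctor (F ⋙ F') (G ⋙ G') where
  actIso X Y := B.actIso (F.obj X) (G.obj Y) ≪≫ G'.mapIso (A.actIso X Y)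
  natural {X X' Y Y'} f g := by
    change (F'.map (F.map f) ⊙ₗₘ G'.map (G.map g)) ≫ (B.actIso _ _).hom ≫ G'.map _ =
      ((B.actIso _ _).hom ≫ G'.map _) ≫ G'.map (G.map _)
    rw [reassoc_of% B.natural (F.map f) (G.map g), Category.assoc, ← G'.map_comp, A.natural,
      G'.map_comp]
  assoc X Y Z := by
    rw [Functor.LaxMonoidal.comp_μ]
    change ((μ F' (F.obj X) (F.obj Y) ≫ F'.map (μ F X Y)) ⊵ₗ G'.obj (G.obj Z)) ≫
      ((B.actIso _ _).hom ≫ G'.map (A.actIso _ _).hom) ≫ G'.map (G.map _) =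
      (αₗ (F'.obj (F.obj X)) (F'.obj (F.obj Y)) (G'.obj (G.obj Z))).hom ≫
        (F'.obj (F.obj X) ⊴ₗ ((B.actIso _ _).hom ≫ G'.map (A.actIso _ _).hom)) ≫
          (B.actIso _ _).hom ≫ G'.map (A.actIso _ _).hom
    rw [comp_actionHomLeft, Category.assoc, Category.assoc,
      reassoc_of% B.natural_left (μ F X Y), ← G'.map_comp, ← G'.map_comp, A.assoc,
      G'.map_comp, reassoc_of% B.assoc (F.obj X) (F.obj Y) (G.obj Z), G'.map_comp,
      actionHomRight_comp, Category.assoc, reassoc_of% B.natural_right]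
  unit Y := by
    rw [Functor.LaxMonoidal.comp_ε]
    change ((ε F' ≫ F'.map (ε F)) ⊵ₗ G'.obj (G.obj Y)) ≫
      ((B.actIso _ _).hom ≫ G'.map (A.actIso _ _).hom) ≫ G'.map (G.map _) = _
    rw [comp_actionHomLeft, Category.assoc, Category.assoc, reassoc_of% B.natural_left (ε F),
      ← G'.map_comp, ← G'.map_comp, A.unit]
    exact B.unit (G.obj Y)

end General

section Embedding
open AddClosure
variable {C D : Type*} [Category.{0} C] [Preadditive C] [MonoidalCategory C]
  [Category.{0} D] [Preadditive D] [MonoidalLeftAction C D]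
  [BiadditiveAction C C] [BiadditiveAction C D]

/-- The inclusion into the additive closure is a functor of module categories. -/
def embedding : ModuleFunctor (Mat_.embedding C) (Mat_.embedding D) where
  actIso X Y := embAct X Y
  natural f g := embAct_naturality f g
  assoc X Y Z := embAct_assoc X Y Z
  unit X := by
    change actHom (𝟙 _) (𝟙 _) ≫ (embAct (𝟙_ C) X).hom ≫ _ = (actUnit _).hom
    rw [actHom_id, Category.id_comp]
    refine hom_ext_equiv (N := (Mat_.embedding D).obj X) (Equiv.punitProd PUnit) ?_
    rintro ⟨⟨⟩, ⟨⟩⟩ ⟨⟨⟩, ⟨⟩⟩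
    erw [single_comp_apply]
    exact (Category.id_comp _).trans (single_apply_self
      (M := actObj (unitObj C) ((Mat_.embedding D).obj X)) (N := (Mat_.embedding D).obj X)
      (Equiv.punitProd PUnit) (fun _ => (λₗ X).hom) (PUnit.unit, PUnit.unit)).symm

end Embedding

section OrbitIso
variable {C : Type} [Category.{0} C] [Preadditive C] [Linear Kq C] [MonoidalCategory C]
  {V D : Type*} [Category* V] [MonoidalCategory V] [Category* D] [MonoidalLeftAction V D]
  {P : ModPresentation C} {F : C ⥤ V} [F.Monoidal] {G : ModWeb P ⥤ D} (A : ModuleFunctor F G)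
  {T : D} (u : G.obj ⟨𝟙_ C⟩ ≅ T)

/-- A functor of module categories is on objects the orbit of its value on `∅`. -/
def orbitIso (X : C) : (orbit F T).obj X ≅ G.obj ⟨X⟩ :=
  Iso.mk (X := F.obj X ⊙ₗ T) (Y := F.obj X ⊙ₗ G.obj ⟨𝟙_ C⟩) (F.obj X ⊴ₗ u.inv) (F.obj X ⊴ₗ u.hom)
    (actionHomRight_inv_hom _ _) (actionHomRight_hom_inv _ _) ≪≫ A.actIso X ⟨𝟙_ C⟩ ≪≫
    G.mapIso (ModWeb.incIso (ρ_ X))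

lemma orbitIso_hom (X : C) : (A.orbitIso u X).hom = (F.obj X ⊴ₗ u.inv) ≫
    (A.actIso X ⟨𝟙_ C⟩).hom ≫ G.map (ModWeb.inc (ρ_ X).hom) := rfl

lemma orbitIso_inc {X Y : C} (f : X ⟶ Y) :
    (A.orbitIso u X).hom ≫ G.map (ModWeb.inc f) = (orbit F T).map f ≫ (A.orbitIso u Y).hom := by
  have h1 : ModWeb.inc (P := P) (ρ_ X).hom ≫ ModWeb.inc f =
      (f ⊵ₗ (⟨𝟙_ C⟩ : ModWeb P)) ≫ ModWeb.inc (ρ_ Y).hom := by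
    refine (ModWeb.inc_comp _ _).symm.trans (Eq.trans ?_ (ModWeb.inc_comp _ _))
    rw [rightUnitor_naturality]
  have h2 := action_exchange (F.map f) u.inv
  have h3 := A.natural_left f ⟨𝟙_ C⟩
  have h4 := congrArg G.map h1
  rw [G.map_comp, G.map_comp] at h4
  change ((F.obj X ⊴ₗ u.inv) ≫ (A.actIso X ⟨𝟙_ C⟩).hom ≫ G.map (ModWeb.inc (ρ_ X).hom)) ≫ _ =
    F.map f ⊵ₗ T ≫ (F.obj Y ⊴ₗ u.inv) ≫ (A.actIso Y ⟨𝟙_ C⟩).hom ≫ G.map (ModWeb.inc (ρ_ Y).hom)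
  rw [Category.assoc, Category.assoc, h4, ← reassoc_of% h2, reassoc_of% h3]

lemma orbitAct_orbitIso (W X : C) :
    (orbitAct F T W X).hom ≫ (A.orbitIso u (W ⊗ X)).hom =
      (F.obj W ⊴ₗ (A.orbitIso u X).hom) ≫ (A.actIso W ⟨X⟩).hom := by
  have h1 : ModWeb.inc (P := P) (ρ_ (W ⊗ X)).hom =
      (αₗ W X (⟨𝟙_ C⟩ : ModWeb P)).hom ≫
        W ⊴ₗ (ModWeb.inc (P := P) (ρ_ X).hom) := by
    refine Eq.trans ?_ (congrArg (ModWeb.inc (P := P) (α_ W X (𝟙_ C)).hom ≫ ·)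
      (ModWeb.whisk_inc W (ρ_ X).hom)).symm
    rw [← ModWeb.inc_comp]
    congr 1
    simp
  have h2 := action_exchange (μ F W X) u.inv
  have h3 := A.assoc W X ⟨𝟙_ C⟩
  have h4 := actionAssocIso_inv_naturality (𝟙 (F.obj W)) (𝟙 (F.obj X)) u.inv
  simp only [id_tensorHom_id, id_actionHom] at h4
  have h5 := A.natural_right W (ModWeb.inc (P := P) (ρ_ X).hom)
  have h6 : G.map (ModWeb.inc (P := P) (ρ_ (W ⊗ X)).hom) = _ := congrArg G.map h1
  rw [G.map_comp] at h6
  have h7 : F.obj W ⊴ₗ (A.orbitIso u X).hom = (F.obj W ⊴ₗ F.obj X ⊴ₗ u.inv) ≫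
      (F.obj W ⊴ₗ (A.actIso X ⟨𝟙_ C⟩).hom) ≫ (F.obj W ⊴ₗ G.map (ModWeb.inc (ρ_ X).hom)) :=
    (actionHomRight_comp _ _ _).trans (congrArg _ (actionHomRight_comp _ _ _))
  rw [orbitIso_hom, h6, h7]
  change ((αₗ (F.obj W) (F.obj X) T).inv ≫ μ F W X ⊵ₗ T) ≫ _ ≫ _ ≫ _ ≫ _ =
    ((F.obj W ⊴ₗ F.obj X ⊴ₗ u.inv) ≫ (F.obj W ⊴ₗ (A.actIso X ⟨𝟙_ C⟩).hom) ≫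
      (F.obj W ⊴ₗ G.map (ModWeb.inc (ρ_ X).hom))) ≫ (A.actIso W ⟨X⟩).hom
  simp only [Category.assoc]
  refine Eq.trans ?_ (congrArg (fun t => (F.obj W ⊴ₗ F.obj X ⊴ₗ u.inv) ≫
    (F.obj W ⊴ₗ (A.actIso X ⟨𝟙_ C⟩).hom) ≫ t) h5.symm)
  rw [← reassoc_of% h2, reassoc_of% h3, ← reassoc_of% h4, Iso.inv_hom_id_assoc]
  rfl

lemma orbitIso_unit : (A.orbitIso u (𝟙_ C)).hom = (orbitUnit F T).hom ≫ u.inv := by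
  have h1 : (ρ_ (𝟙_ C)).hom = (λ_ (𝟙_ C)).hom := unitors_equal.symm
  have h2 := A.unit ⟨𝟙_ C⟩
  have h3 : ε F ⊵ₗ T ≫ (orbitUnit F T).hom = (λₗ T).hom := by
    refine (Category.assoc _ _ _).symm.trans ?_
    rw [← comp_actionHomLeft, Functor.Monoidal.ε_η, id_actionHomLeft, Category.id_comp]
  have h4 := action_exchange (ε F) u.inv
  have : IsIso (ε F ⊵ₗ T) := inferInstance
  refine (cancel_epi (ε F ⊵ₗ T)).mp ?_
  refine Eq.trans ?_ ((congrArg (· ≫ u.inv) h3).symm.trans (Category.assoc _ _ _))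
  rw [orbitIso_hom, ← reassoc_of% h4, h1]
  refine (congrArg ((𝟙_ V ⊴ₗ u.inv) ≫ ·) h2).trans ?_
  exact (actionUnitIso_hom_naturality u.inv).symm

end OrbitIso

section Determined
variable {C : Type} [Category.{0} C] [Preadditive C] [Linear Kq C] [MonoidalCategory C]
  {V D : Type*} [Category* V] [Preadditive V] [Linear Kq V] [MonoidalCategory V]
  [Category* D] [Preadditive D] [Linear Kq D] [MonoidalLeftAction V D]
  {P : ModPresentation C} {F : C ⥤ V} [F.Monoidal] {G : ModWeb P ⥤ D} [G.Additive] [G.Linear Kq]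
  (A : ModuleFunctor F G) {T : D} (u : G.obj ⟨𝟙_ C⟩ ≅ T)

/-- The values of the generators under a functor of module categories. -/
def genVal {X Y : C} (g : P.Gen X Y) : (orbit F T).obj X ⟶ (orbit F T).obj Y :=
  (A.orbitIso u X).hom ≫ G.map (ModWeb.mkHom (.gen g)) ≫ (A.orbitIso u Y).inv

lemma orbitIso_mkHom {X Y : C} (f : ModPre P.Gen X Y) :
    (A.orbitIso u X).hom ≫ G.map (ModWeb.mkHom f) =
      ModPre.eval F T (A.genVal u) f ≫ (A.orbitIso u Y).hom := by
  induction f with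
  | of f => exact A.orbitIso_inc u f
  | gen g => simp [ModPre.eval, genVal]
  | whisk W f ih =>
    rename_i X Y
    have h1 := A.natural_right W (ModWeb.mkHom (P := P) f)
    have h2 : G.map (ModWeb.mkHom (P := P) (.whisk W f)) =
        G.map (W ⊴ₗ ModWeb.mkHom (P := P) f) := rfl
    rw [← cancel_epi (orbitAct F T W X).hom, h2]
    refine (Category.assoc _ _ _).symm.trans ((congrArg (· ≫ G.map (W ⊴ₗ ModWeb.mkHom (P := P) f))
      (A.orbitAct_orbitIso u W X)).trans ?_)
    rw [Category.assoc, ← h1, ← actionHomRight_comp_assoc, ih]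
    simp only [ModPre.eval]
    rw [reassoc_of% orbitAct_whisker (F := F) W _, orbitAct_orbitIso, actionHomRight_comp_assoc]
  | comp f g ih ih' =>
    have h : G.map (ModWeb.mkHom (P := P) (.comp f g)) =
        G.map (ModWeb.mkHom f) ≫ G.map (ModWeb.mkHom g) :=
      G.map_comp (ModWeb.mkHom f) (ModWeb.mkHom g)
    rw [h, reassoc_of% ih, ih', ModPre.eval, Category.assoc]
  | zero =>
    have h : ∀ X Y, G.map (ModWeb.mkHom (P := P) (.zero (X := X) (Y := Y))) = 0 :=
      fun _ _ => G.map_zero _ _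
    rw [h, ModPre.eval, Limits.comp_zero, Limits.zero_comp]
  | add f g ih ih' =>
    have h : G.map (ModWeb.mkHom (P := P) (.add f g)) =
        G.map (ModWeb.mkHom f) + G.map (ModWeb.mkHom g) :=
      G.map_add (f := ModWeb.mkHom f) (g := ModWeb.mkHom g)
    rw [h, Preadditive.comp_add, ih, ih', ModPre.eval, Preadditive.add_comp]
  | smul k f ih =>
    have h : G.map (ModWeb.mkHom (P := P) (.smul k f)) = k • G.map (ModWeb.mkHom f) :=
      G.map_smul k (ModWeb.mkHom f)
    rw [h, Linear.comp_smul, ih, ModPre.eval, Linear.smul_comp]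

variable {G' : ModWeb P ⥤ D} [G'.Additive] [G'.Linear Kq] (A' : ModuleFunctor F G')
  (u' : G'.obj ⟨𝟙_ C⟩ ≅ T)

/-- Functors of module categories that agree on the generators are isomorphic. -/
def isoOfGenVal (h : ∀ {X Y : C} (g : P.Gen X Y), A.genVal u g = A'.genVal u' g) : G ≅ G' :=
  NatIso.ofComponents (fun X => (A.orbitIso u X.obj).symm ≪≫ A'.orbitIso u' X.obj) (by
    rintro ⟨X⟩ ⟨Y⟩ ⟨f⟩
    have h1 := A.orbitIso_mkHom u f
    have h2 := A'.orbitIso_mkHom u' f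
    have h3 : (fun {X Y : C} (g : P.Gen X Y) => A.genVal u g) =
      (fun {X Y : C} (g : P.Gen X Y) => A'.genVal u' g) := by
      funext X Y g
      exact h g
    rw [show ModPre.eval F T (A.genVal u) f = ModPre.eval F T (A'.genVal u') f from
      congrArg (fun e : (∀ {X Y : C}, P.Gen X Y → ((orbit F T).obj X ⟶ (orbit F T).obj Y)) =>
        ModPre.eval F T e f) h3] at h1
    change G.map (ModWeb.mkHom f) ≫ (A.orbitIso u Y).inv ≫ (A'.orbitIso u' Y).hom =
      ((A.orbitIso u X).inv ≫ (A'.orbitIso u' X).hom) ≫ G'.map (ModWeb.mkHom f)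
    rw [Category.assoc, h2, ← cancel_epi (A.orbitIso u X).hom, reassoc_of% h1,
      Iso.hom_inv_id_assoc, Iso.hom_inv_id_assoc])

end Determined
end ModuleFunctor

namespace FinRep
variable {A B : Type} [Ring A] [Bialgebra Kq A] [Ring B] [Algebra Kq B] [ComoduleAlgebra A B]

instance linearAction : LinearAction (FinRep A) (FinRep B) where
  add_left f g _ := hom_ext (TensorProduct.map_add_left (lin f) (lin g) LinearMap.id)
  add_right _ _ _ f g := hom_ext (TensorProduct.map_add_right LinearMap.id (lin f) (lin g))
  smul_left k _ _ f _ := hom_ext (TensorProduct.map_smul_left k (lin f) LinearMap.id)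
  smul_right k _ _ _ f := hom_ext (TensorProduct.map_smul_right k LinearMap.id (lin f))

end FinRep

section RestrictionAction
variable {n : ℕ}

lemma FinRep.extAct_Res (X Y : FinRep (Uq n)) (t : Uq n ⊗[Kq] soCoideal n) :
    FinRep.extAct X (Res Y) t = FinRep.extAct X Y (CoidealSubalgebra.incl (soCoideal n) t) := by
  induction t using TensorProduct.induction_on with
  | zero => rw [map_zero, map_zero, map_zero]; rfl
  | tmul a b => rfl
  | add s t hs ht => rw [map_add, map_add, map_add, ← hs, ← ht]; rfl

lemma FinRep.act_Res_ρ (X Y : FinRep (Uq n)) (s : soCoideal n) :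
    (X ⊙ₗ Res Y : FinRep (soCoideal n)).ρ s = (X ⊗ Y : FinRep (Uq n)).ρ (s : Uq n) :=
  (FinRep.extAct_Res X Y _).trans
    (congrArg (FinRep.extAct X Y) (CoidealSubalgebra.incl_coact (soCoideal n) comul_mem_range s))

/-- Restriction is compatible with the action on the trivial representation. -/
def actResUnit (X : FinRep (Uq n)) : X ⊙ₗ Res (𝟙_ (FinRep (Uq n))) ≅ Res X :=
  FinRep.mkIso (X := X ⊙ₗ Res (𝟙_ (FinRep (Uq n)))) (Y := Res X) (TensorProduct.rid Kq X.V) (by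
    intro s
    have h := FinRep.lin_comm (ρ_ X).hom (s : Uq n)
    rw [FinRep.act_Res_ρ]
    exact h)

/-- The restriction of a morphism. -/
def resMap {X Y : FinRep (Uq n)} (f : X ⟶ Y) : Res X ⟶ Res Y :=
  FinRep.mkHom (X := Res X) (Y := Res Y) (FinRep.lin (X := X) (Y := Y) f)
    fun s => FinRep.lin_comm (X := X) (Y := Y) f s

/-- The restriction of an isomorphism. -/
def resIso {X Y : FinRep (Uq n)} (f : X ≅ Y) : Res X ≅ Res Y where
  hom := resMap f.hom
  inv := resMap f.inv
  hom_inv_id := FinRep.hom_ext (congrArg (FinRep.lin (X := X) (Y := X)) f.hom_inv_id)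
  inv_hom_id := FinRep.hom_ext (congrArg (FinRep.lin (X := Y) (Y := Y)) f.inv_hom_id)

/-- Equivariance for `U'_q(so_n)` can be checked on generators. -/
lemma comm_of_soGen {X Y : FinRep (Uq n)} (f : X.V →ₗ[Kq] Y.V)
    (h : ∀ i, f ∘ₗ X.ρ (soGen i) = Y.ρ (soGen i) ∘ₗ f) (s : soCoideal n) :
    f ∘ₗ X.ρ (s : Uq n) = Y.ρ (s : Uq n) ∘ₗ f := by
  obtain ⟨s, hs⟩ := s
  change f ∘ₗ X.ρ s = Y.ρ s ∘ₗ f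
  induction hs using Algebra.adjoin_induction with
  | mem x hx =>
    obtain ⟨i, rfl⟩ := hx
    exact h i
  | algebraMap r =>
    rw [AlgHom.commutes, AlgHom.commutes]
    ext v
    exact map_smul f r v
  | add x y _ _ hx hy =>
    rw [map_add, map_add]
    exact (LinearMap.comp_add _ _ _).trans ((congrArg₂ _ hx hy).trans (LinearMap.add_comp _ _ _).symm)
  | mul x y _ _ hx hy =>
    rw [map_mul, map_mul]
    exact (LinearMap.comp_assoc _ _ _).symm.trans ((congrArg (· ∘ₗ X.ρ y) hx).trans
      ((LinearMap.comp_assoc _ _ _).trans ((congrArg (Y.ρ x ∘ₗ ·) hy).trans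
        (LinearMap.comp_assoc _ _ _).symm)))

lemma triv_soGen (i : Fin (n - 1)) : (𝟙_ (FinRep (Uq n))).ρ (soGen i) = 0 := by
  have h : Coalgebra.counit (R := Kq) (soGen i) = 0 := by
    have h1 : ∀ i : Fin (n - 1), Coalgebra.counit (R := Kq) (Uq.E i) = 0 := fun i =>
      Uq.counit_E i
    have h2 : ∀ i : Fin (n - 1), Coalgebra.counit (R := Kq) (Uq.F i) = 0 := fun i =>
      Uq.counit_F i
    have h3 := (Bialgebra.counitAlgHom Kq (Uq n)).map_mul (Uq.qh (-coroot i)) (Uq.E i)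
    rw [soGen, map_sub, h2]
    refine (congrArg (0 - ·) h3).trans ?_
    change 0 - _ * Coalgebra.counit (R := Kq) (Uq.E i) = 0
    rw [h1, mul_zero, sub_zero]
  refine LinearMap.ext fun (v : Kq) => ?_
  change Coalgebra.counit (R := Kq) (soGen i) * v = 0
  rw [h, zero_mul]

/-- The equivariant map from the trivial representation given by an invariant vector. -/
def ofInvariant {X : FinRep (Uq n)} (v : X.V) (h : ∀ i, X.ρ (soGen i) v = 0) :
    Res (𝟙_ (FinRep (Uq n))) ⟶ X ⊙ₗ Res (𝟙_ (FinRep (Uq n))) :=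
  FinRep.mkHom (X := Res (𝟙_ (FinRep (Uq n)))) (Y := Res X) (LinearMap.toSpanSingleton Kq X.V v)
    (comm_of_soGen (X := 𝟙_ (FinRep (Uq n))) (Y := X) (LinearMap.toSpanSingleton Kq X.V v) fun i => by
      rw [triv_soGen]
      refine LinearMap.ext fun (k : Kq) => ?_
      change (0 : Kq) • v = X.ρ (soGen i) (k • v)
      rw [map_smul, h, smul_zero, zero_smul]) ≫ (actResUnit X).inv

/-- The equivariant map to the trivial representation given by an invariant functional. -/
def ofCoinvariant {X : FinRep (Uq n)} (φ : X.V →ₗ[Kq] Kq) (h : ∀ i v, φ (X.ρ (soGen i) v) = 0) :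
    X ⊙ₗ Res (𝟙_ (FinRep (Uq n))) ⟶ Res (𝟙_ (FinRep (Uq n))) :=
  (actResUnit X).hom ≫ FinRep.mkHom (X := Res X) (Y := Res (𝟙_ (FinRep (Uq n)))) φ
    (comm_of_soGen (X := X) (Y := 𝟙_ (FinRep (Uq n))) φ fun i => by
      rw [triv_soGen]
      exact LinearMap.ext fun v => h i v)

lemma ofInvariant_apply {X : FinRep (Uq n)} (v : X.V) (h : ∀ i, X.ρ (soGen i) v = 0) (k : Kq) :
    FinRep.lin (ofInvariant v h) k = k • (v ⊗ₜ[Kq] (1 : Kq)) :=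
  rfl

lemma ofCoinvariant_apply {X : FinRep (Uq n)} (φ : X.V →ₗ[Kq] Kq)
    (h : ∀ i v, φ (X.ρ (soGen i) v) = 0) (v : X.V) (k : Kq) :
    FinRep.lin (ofCoinvariant φ h) (v ⊗ₜ[Kq] k) = k * φ v :=
  map_smul φ k v

end RestrictionAction

section OfModel
open AddClosure
variable {k : Kind} {n : ℕ} {Γ : GammaA k n} {P : ModPresentation AWeb}

/-- The trivial representation of `U'_q(so_n)`. -/
abbrev soTriv (n : ℕ) : FinRep (soCoideal n) := Res (𝟙_ (FinRep (Uq n)))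

variable (n) in
/-- The vector `1` of the trivial representation. -/
def soOne : (soTriv n).V := (1 : Kq)

variable (Γ) in
/-- The vector `v ⊗ 1` of the orbit of the trivial representation. -/
def orbitVec (X : AWeb) (v : (Γ.functor.obj (webEmb.obj X)).V) :
    ((orbit (webEmb ⋙ Γ.functor) (soTriv n)).obj X).V := v ⊗ₜ[Kq] (1 : Kq)

lemma GammaMod.ofA_eq (G : GammaMod Γ P) (X : AWeb) (v : (Γ.functor.obj (webEmb.obj X)).V) :
    G.ofA X v = FinRep.lin (X := (orbit (webEmb ⋙ Γ.functor) (soTriv n)).obj X) (G.objIso X).hom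
      (orbitVec Γ X v) := rfl

/-- The functor of module categories given by values on generators. -/
def GammaMod.ofModel (M : P.Model (webEmb ⋙ Γ.functor) (soTriv n)) : GammaMod Γ P where
  functor := M.extend
  action := M.extendAction
  unitIso := orbitUnit (webEmb ⋙ Γ.functor) (soTriv n)

lemma GammaMod.ofModel_objIso (M : P.Model (webEmb ⋙ Γ.functor) (soTriv n)) (X : AWeb) :
    ((GammaMod.ofModel M).objIso X).hom = 𝟙 ((orbit (webEmb ⋙ Γ.functor) (soTriv n)).obj X) := by
  have h1 : M.mapMat (embAct (C := AWeb) (D := ModWeb P) X ⟨𝟙_ AWeb⟩).hom =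
      (orbit Γ.functor (soTriv n)).map (embAct (C := AWeb) (D := AWeb) X (𝟙_ AWeb)).hom :=
    M.mapMat_single_inc (N := actObj (webEmb.obj X) ((modEmb P).obj ⟨𝟙_ AWeb⟩))
      (N' := (modEmb P).obj ⟨X ⊗ 𝟙_ AWeb⟩) (Equiv.punitProd PUnit) (fun _ => 𝟙 (X ⊗ 𝟙_ AWeb))
  have h2 : M.mapMat ((modEmb P).map (ModWeb.inc (ρ_ X).hom)) =
      (orbit (webEmb ⋙ Γ.functor) (soTriv n)).map (ρ_ X).hom :=
    M.mapMat_embedding (X := ⟨X ⊗ 𝟙_ AWeb⟩) (Y := ⟨X⟩) (ModWeb.inc (ρ_ X).hom)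
  have h3 : M.mapMat ((embAct (C := AWeb) (D := ModWeb P) X ⟨𝟙_ AWeb⟩).hom ≫
      (modEmb P).map (ModWeb.inc (ρ_ X).hom)) = _ :=
    (M.extend.map_comp (embAct (C := AWeb) (D := ModWeb P) X ⟨𝟙_ AWeb⟩).hom
      ((modEmb P).map (ModWeb.inc (ρ_ X).hom))).trans (congrArg₂ (· ≫ ·) h1 h2)
  have h4 := orbitAct_rightUnit (webEmb ⋙ Γ.functor) (soTriv n) X
  rw [← ModPresentation.Model.orbitAct_emb] at h4
  refine Eq.trans ?_ h4
  change _ ≫ _ ≫ M.mapMat _ = _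
  refine congrArg (((webEmb ⋙ Γ.functor).obj X ⊴ₗ (orbitUnit (webEmb ⋙ Γ.functor) (soTriv n)).inv) ≫ ·) ?_
  refine Eq.trans ?_ (Category.assoc _ _ _).symm
  exact congrArg ((orbitAct Γ.functor (soTriv n) (webEmb.obj X) (webEmb.obj (𝟙_ AWeb))).hom ≫ ·) h3

lemma GammaMod.ofModel_ofA (M : P.Model (webEmb ⋙ Γ.functor) (soTriv n)) (X : AWeb)
    (v : (Γ.functor.obj (webEmb.obj X)).V) :
    (GammaMod.ofModel M).ofA X v = orbitVec Γ X v :=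
  (GammaMod.ofA_eq _ X v).trans
    (congrArg (fun f => FinRep.lin f (orbitVec Γ X v)) (GammaMod.ofModel_objIso M X))

lemma GammaMod.ofModel_valueOn₁ (M : P.Model (webEmb ⋙ Γ.functor) (soTriv n)) {X : AWeb}
    (f : ModWeb.mk (P := P) (𝟙_ AWeb) ⟶ ⟨X⟩) :
    (GammaMod.ofModel M).valueOn₁ f =
      FinRep.lin ((orbitUnit (webEmb ⋙ Γ.functor) (soTriv n)).inv ≫ M.hom f) (soOne n) :=
  congrArg (fun t => FinRep.lin ((orbitUnit (webEmb ⋙ Γ.functor) (soTriv n)).inv ≫ t) (soOne n))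
    (M.mapMat_embedding (X := ⟨𝟙_ AWeb⟩) (Y := ⟨X⟩) f)

lemma GammaMod.ofModel_value (M : P.Model (webEmb ⋙ Γ.functor) (soTriv n)) {X : AWeb}
    (f : ModWeb.mk (P := P) X ⟶ ⟨𝟙_ AWeb⟩) (v : (Γ.functor.obj (webEmb.obj X)).V) :
    (GammaMod.ofModel M).value f ((GammaMod.ofModel M).ofA X v) =
      FinRep.lin (M.hom f ≫ (orbitUnit (webEmb ⋙ Γ.functor) (soTriv n)).hom) (orbitVec Γ X v) :=
  (congrArg _ (GammaMod.ofModel_ofA M X v)).trans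
    (congrArg (fun t => FinRep.lin (t ≫ (orbitUnit (webEmb ⋙ Γ.functor) (soTriv n)).hom)
      (orbitVec Γ X v))
        (M.mapMat_embedding (X := ⟨X⟩) (Y := ⟨𝟙_ AWeb⟩) f))

lemma GammaMod.ofModel_obj_strand (M : P.Model (webEmb ⋙ Γ.functor) (soTriv n)) (a : ℕ+) :
    Nonempty ((GammaMod.ofModel M).functor.obj ((modEmb P).obj ⟨strand a⟩) ≅ Res (k.pow n a)) :=
  ⟨actResUnit (Γ.functor.obj (webEmb.obj (strand a))) ≪≫ resIso (Γ.objIso a)⟩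

end OfModel

section Unique
open AddClosure
variable {k : Kind} {n : ℕ} {Γ : GammaA k n} {P : ModPresentation AWeb}

namespace GammaMod

/-- The compatibility with the actions before passing to the additive closure. -/
def embAction (G : GammaMod Γ P) : ModuleFunctor (webEmb ⋙ Γ.functor) (modEmb P ⋙ G.functor) :=
  ModuleFunctor.embedding.comp G.action

lemma orbitIso_eq_objIso (G : GammaMod Γ P) (X : AWeb) :
    (G.embAction.orbitIso G.unitIso X).hom = (G.objIso X).hom := by
  refine congrArg (((webEmb ⋙ Γ.functor).obj X ⊴ₗ G.unitIso.inv) ≫ ·) ?_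
  refine (Category.assoc _ _ _).trans (congrArg ((G.action.actIso _ _).hom ≫ ·) ?_)
  exact (G.functor.map_comp _ _).symm

/-- Two functors that agree on the generators are isomorphic. -/
lemma nonempty_iso (G G' : GammaMod Γ P)
    (h : ∀ {X Y : AWeb} (g : P.Gen X Y), G.embAction.genVal G.unitIso g =
      G'.embAction.genVal G'.unitIso g) : Nonempty (G.functor ≅ G'.functor) :=
  ⟨natIsoExt (ModuleFunctor.isoOfGenVal G.embAction G.unitIso G'.embAction G'.unitIso h)⟩

lemma soTriv_hom_ext {Y : FinRep (soCoideal n)} {f g : soTriv n ⟶ Y}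
    (h : FinRep.lin f (soOne n) = FinRep.lin g (soOne n)) : f = g :=
  FinRep.hom_ext (LinearMap.ext_ring (R := Kq) h)

/-- Generators `∅ → X` are determined by the image of `1`. -/
lemma genVal_of_valueOn₁ (G : GammaMod Γ P) {X : AWeb} (g : P.Gen (𝟙_ AWeb) X)
    (v : (Γ.functor.obj (webEmb.obj X)).V)
    (h : G.valueOn₁ (ModWeb.mkHom (.gen g)) = G.ofA X v) :
    FinRep.lin ((orbitUnit (webEmb ⋙ Γ.functor) (soTriv n)).inv ≫
      G.embAction.genVal G.unitIso g) (soOne n) = orbitVec Γ X v := by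
  have h1 : (orbitUnit (webEmb ⋙ Γ.functor) (soTriv n)).inv ≫ G.embAction.genVal G.unitIso g ≫
      (G.embAction.orbitIso G.unitIso X).hom =
        G.unitIso.inv ≫ G.functor.map ((modEmb P).map (ModWeb.mkHom (.gen g))) := by
    have h2 := G.embAction.orbitIso_unit G.unitIso
    rw [ModuleFunctor.genVal, h2]
    simp only [Category.assoc, Iso.inv_hom_id, Category.comp_id, Iso.inv_hom_id_assoc]
    rfl
  have h3 : FinRep.lin (G.embAction.orbitIso G.unitIso X).hom (FinRep.lin
      ((orbitUnit (webEmb ⋙ Γ.functor) (soTriv n)).inv ≫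
        G.embAction.genVal G.unitIso g) (soOne n)) =
      FinRep.lin (G.embAction.orbitIso G.unitIso X).hom (orbitVec Γ X v) := by
    have h6 : FinRep.lin (G.embAction.orbitIso G.unitIso X).hom (orbitVec Γ X v) = G.ofA X v :=
      (congrArg (fun f : (orbit (webEmb ⋙ Γ.functor) (soTriv n)).obj X ⟶
        (modEmb P ⋙ G.functor).obj ⟨X⟩ => FinRep.lin f (orbitVec Γ X v))
        (G.orbitIso_eq_objIso X)).trans (G.ofA_eq X v).symm
    rw [h6, ← h]
    have h7 := congrArg (fun f : soTriv n ⟶ (modEmb P ⋙ G.functor).obj ⟨X⟩ =>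
      FinRep.lin f (soOne n)) ((Category.assoc _ _ _).trans h1)
    exact h7
  have h4 := congrArg (FinRep.lin (G.embAction.orbitIso G.unitIso X).inv) h3
  have h5 : ∀ x, FinRep.lin (G.embAction.orbitIso G.unitIso X).inv
      (FinRep.lin (G.embAction.orbitIso G.unitIso X).hom x) = x := fun x =>
    congrArg (fun f => FinRep.lin f x) (G.embAction.orbitIso G.unitIso X).hom_inv_id
  exact (h5 _).symm.trans (h4.trans (h5 _))

lemma genVal_eq_of_valueOn₁ (G G' : GammaMod Γ P) {X : AWeb} (g : P.Gen (𝟙_ AWeb) X)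
    (v : (Γ.functor.obj (webEmb.obj X)).V)
    (h : G.valueOn₁ (ModWeb.mkHom (.gen g)) = G.ofA X v)
    (h' : G'.valueOn₁ (ModWeb.mkHom (.gen g)) = G'.ofA X v) :
    G.embAction.genVal G.unitIso g = G'.embAction.genVal G'.unitIso g :=
  (cancel_epi (orbitUnit (webEmb ⋙ Γ.functor) (soTriv n)).inv).mp
    (soTriv_hom_ext ((G.genVal_of_valueOn₁ g v h).trans (G'.genVal_of_valueOn₁ g v h').symm))

/-- The values of generators `X → ∅`. -/
lemma genVal_of_value (G : GammaMod Γ P) {X : AWeb} (g : P.Gen X (𝟙_ AWeb))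
    (v : (Γ.functor.obj (webEmb.obj X)).V) :
    FinRep.lin (G.embAction.genVal G.unitIso g ≫
      (orbitUnit (webEmb ⋙ Γ.functor) (soTriv n)).hom) (orbitVec Γ X v) =
      G.value (ModWeb.mkHom (.gen g)) (G.ofA X v) := by
  have h1 : G.embAction.genVal G.unitIso g ≫ (orbitUnit (webEmb ⋙ Γ.functor) (soTriv n)).hom =
      (G.embAction.orbitIso G.unitIso X).hom ≫
        G.functor.map ((modEmb P).map (ModWeb.mkHom (.gen g))) ≫ G.unitIso.hom := by
    have h2 := G.embAction.orbitIso_unit G.unitIso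
    have h3 : (orbitUnit (webEmb ⋙ Γ.functor) (soTriv n)).hom =
        (G.embAction.orbitIso G.unitIso (𝟙_ AWeb)).hom ≫ G.unitIso.hom := by
      rw [h2, Category.assoc, Iso.inv_hom_id, Category.comp_id]
    rw [ModuleFunctor.genVal, h3]
    simp only [Category.assoc, Iso.inv_hom_id_assoc]
    rfl
  refine (congrArg (fun f => FinRep.lin f (orbitVec Γ X v)) h1).trans ?_
  exact congrArg (fun f => FinRep.lin (G.functor.map ((modEmb P).map (ModWeb.mkHom (.gen g))) ≫
    G.unitIso.hom) (FinRep.lin f (orbitVec Γ X v))) (G.orbitIso_eq_objIso X)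

/-- Generators `X → ∅` are determined by their values on a spanning set. -/
lemma genVal_eq_of_value (G G' : GammaMod Γ P) {X : AWeb} (g : P.Gen X (𝟙_ AWeb))
    (S : Set (Γ.functor.obj (webEmb.obj X)).V) (hS : Submodule.span Kq S = ⊤)
    (h : ∀ v ∈ S, G.value (ModWeb.mkHom (.gen g)) (G.ofA X v) =
      G'.value (ModWeb.mkHom (.gen g)) (G'.ofA X v)) :
    G.embAction.genVal G.unitIso g = G'.embAction.genVal G'.unitIso g := by
  refine (cancel_mono (orbitUnit (webEmb ⋙ Γ.functor) (soTriv n)).hom).mp (FinRep.hom_ext ?_)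
  refine TensorProduct.ext (LinearMap.ext_on hS fun v hv => LinearMap.ext_ring (R := Kq) ?_)
  exact (G.genVal_of_value g v).trans ((h v hv).trans (G'.genVal_of_value g v).symm)

end GammaMod
end Unique

section WordSpace
open Functor.LaxMonoidal Functor.OplaxMonoidal
variable {k : Kind} {n : ℕ} (Γ : GammaA k n)

/-- The image of a word under the type `A` functor. -/
def WordSpace (X : List ℕ+) : Type := (Γ.functor.obj (webEmb.obj (wd X))).V

namespace WordSpace

instance (X : List ℕ+) : AddCommGroup (WordSpace Γ X) :=
  inferInstanceAs (AddCommGroup (Γ.functor.obj (webEmb.obj (wd X))).V)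

instance (X : List ℕ+) : Module Kq (WordSpace Γ X) :=
  inferInstanceAs (Module Kq (Γ.functor.obj (webEmb.obj (wd X))).V)

/-- The linear map underlying a morphism between images of words. -/
def hom {X Y : AWeb} (f : Γ.functor.obj (webEmb.obj X) ⟶ Γ.functor.obj (webEmb.obj Y)) :
    WordSpace Γ X.word →ₗ[Kq] WordSpace Γ Y.word := FinRep.lin f

/-- The linear map given by a web. -/
def web {X Y : List ℕ+} (f : AWeb.Pre X Y) : WordSpace Γ X →ₗ[Kq] WordSpace Γ Y :=
  hom Γ (X := wd X) (Y := wd Y) (Γ.functor.map (webEmb.map (AWeb.of f)))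

lemma web_id (X : List ℕ+) : web Γ (.id X) = LinearMap.id :=
  congrArg FinRep.lin ((webEmb ⋙ Γ.functor).map_id (wd X))

lemma web_comp {X Y Z : List ℕ+} (f : AWeb.Pre X Y) (g : AWeb.Pre Y Z) :
    web Γ (.comp f g) = web Γ g ∘ₗ web Γ f :=
  congrArg FinRep.lin ((webEmb ⋙ Γ.functor).map_comp (X := wd X) (AWeb.of f) (AWeb.of g))

lemma web_add {X Y : List ℕ+} (f g : AWeb.Pre X Y) : web Γ (.add f g) = web Γ f + web Γ g :=
  congrArg FinRep.lin ((webEmb ⋙ Γ.functor).map_add (X := wd X) (f := AWeb.of f) (g := AWeb.of g))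

lemma web_smul {X Y : List ℕ+} (c : Kq) (f : AWeb.Pre X Y) : web Γ (.smul c f) = c • web Γ f :=
  congrArg FinRep.lin ((webEmb ⋙ Γ.functor).map_smul c (AWeb.of f))

/-- The horizontal juxtaposition of vectors. -/
def star {X Y : List ℕ+} : WordSpace Γ X →ₗ[Kq] WordSpace Γ Y →ₗ[Kq] WordSpace Γ (X ++ Y) :=
  TensorProduct.curry (FinRep.lin (μ (webEmb ⋙ Γ.functor) (wd X) (wd Y)))

lemma star_hom {X Y X' Y' : AWeb} (f : X ⟶ X') (g : Y ⟶ Y') (x : WordSpace Γ X.word)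
    (y : WordSpace Γ Y.word) :
    hom Γ (Γ.functor.map (webEmb.map (f ⊗ₘ g))) (star Γ x y) =
      star Γ (hom Γ (Γ.functor.map (webEmb.map f)) x) (hom Γ (Γ.functor.map (webEmb.map g)) y) :=
  (congrArg (fun t => FinRep.lin t (x ⊗ₜ[Kq] y))
    (μ_natural (webEmb ⋙ Γ.functor) f g)).symm

lemma web_tensor {X Y X' Y' : List ℕ+} (f : AWeb.Pre X X') (g : AWeb.Pre Y Y')
    (x : WordSpace Γ X) (y : WordSpace Γ Y) :
    web Γ (.tensor f g) (star Γ x y) = star Γ (web Γ f x) (web Γ g y) :=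
  star_hom Γ (X := wd X) (Y := wd Y) (AWeb.of f) (AWeb.of g) x y

lemma hom_associator_star (X Y Z : AWeb) (x : WordSpace Γ X.word) (y : WordSpace Γ Y.word)
    (z : WordSpace Γ Z.word) :
    hom Γ (Γ.functor.map (webEmb.map (α_ X Y Z).hom)) (star Γ (star Γ x y) z) =
      star Γ x (star Γ y z) :=
  congrArg (fun t => FinRep.lin t ((x ⊗ₜ[Kq] y) ⊗ₜ[Kq] z))
    (associativity (webEmb ⋙ Γ.functor) X Y Z)

/-- The vector in the image of the empty word. -/
def one : WordSpace Γ [] := FinRep.lin (ε (webEmb ⋙ Γ.functor)) (1 : Kq)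

lemma hom_rightUnitor_star (X : AWeb) (x : WordSpace Γ X.word) :
    hom Γ (Γ.functor.map (webEmb.map (ρ_ X).hom)) (star Γ x (one Γ)) = x :=
  (congrArg (fun t => FinRep.lin t (x ⊗ₜ[Kq] (1 : Kq)))
    (right_unitality (webEmb ⋙ Γ.functor) X)).symm.trans (one_smul Kq x)

lemma hom_map_id {X : AWeb} (x : WordSpace Γ X.word) :
    hom Γ (Γ.functor.map (webEmb.map (𝟙 X))) x = x :=
  congrArg (fun t => FinRep.lin t x) ((webEmb ⋙ Γ.functor).map_id X)

lemma one_hom_ext {M : Type*} [AddCommGroup M] [Module Kq M] {f g : WordSpace Γ [] →ₗ[Kq] M}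
    (h : f (one Γ) = g (one Γ)) : f = g := by
  refine LinearMap.ext fun x => ?_
  have hx : x = (id (FinRep.lin (η (webEmb ⋙ Γ.functor)) x) : Kq) • one Γ := by
    have h1 := congrArg (fun t => FinRep.lin t x) (Functor.Monoidal.η_ε (webEmb ⋙ Γ.functor))
    refine (Eq.trans ?_ h1).symm
    have h2 := (FinRep.lin (ε (webEmb ⋙ Γ.functor))).map_smul
      (id (FinRep.lin (η (webEmb ⋙ Γ.functor)) x) : Kq) (1 : Kq)
    exact h2.symm.trans (congrArg (FinRep.lin (ε (webEmb ⋙ Γ.functor))) (mul_one (M := Kq) _))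
  rw [hx, map_smul, map_smul, h]

lemma star_hom_ext {X Y : List ℕ+} {M : Type*} [AddCommGroup M] [Module Kq M]
    {f g : WordSpace Γ (X ++ Y) →ₗ[Kq] M} (h : ∀ x y, f (star Γ x y) = g (star Γ x y)) :
    f = g := by
  refine LinearMap.ext fun z => ?_
  have hz : FinRep.lin (μ (webEmb ⋙ Γ.functor) (wd X) (wd Y))
      (FinRep.lin (δ (webEmb ⋙ Γ.functor) (wd X) (wd Y)) z) = z :=
    congrArg (fun t => FinRep.lin t z) (Functor.Monoidal.δ_μ (webEmb ⋙ Γ.functor) (wd X) (wd Y))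
  have key : f ∘ₗ (FinRep.lin (μ (webEmb ⋙ Γ.functor) (wd X) (wd Y)) : _ →ₗ[Kq] WordSpace Γ (X ++ Y)) =
      g ∘ₗ (FinRep.lin (μ (webEmb ⋙ Γ.functor) (wd X) (wd Y)) : _ →ₗ[Kq] WordSpace Γ (X ++ Y)) :=
    TensorProduct.ext' h
  have := LinearMap.congr_fun key (FinRep.lin (δ (webEmb ⋙ Γ.functor) (wd X) (wd Y)) z)
  exact (congrArg f hz).symm.trans (this.trans (congrArg g hz))

/-- The identification of the image of a one-letter word. -/
def strandEquiv (a : ℕ+) : WordSpace Γ [a] ≃ₗ[Kq] (k.pow n a).V :=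
  LinearEquiv.ofLinearMap (FinRep.lin (Γ.objIso a).hom) (FinRep.lin (Γ.objIso a).inv)
    (congrArg FinRep.lin (Γ.objIso a).inv_hom_id) (congrArg FinRep.lin (Γ.objIso a).hom_inv_id)

/-- The linear map underlying a morphism from an orbit to an orbit. -/
def red {X Y : AWeb} (φ : (orbit (webEmb ⋙ Γ.functor) (soTriv n)).obj X ⟶
    (orbit (webEmb ⋙ Γ.functor) (soTriv n)).obj Y) : WordSpace Γ X.word →ₗ[Kq] WordSpace Γ Y.word :=
  (TensorProduct.rid Kq (WordSpace Γ Y.word)).toLinearMap ∘ₗ FinRep.lin φ ∘ₗ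
    (TensorProduct.rid Kq (WordSpace Γ X.word)).symm.toLinearMap

lemma red_injective {X Y : AWeb} {φ ψ : (orbit (webEmb ⋙ Γ.functor) (soTriv n)).obj X ⟶
    (orbit (webEmb ⋙ Γ.functor) (soTriv n)).obj Y} (h : red Γ φ = red Γ ψ) : φ = ψ := by
  refine FinRep.hom_ext (LinearMap.ext fun x => ?_)
  have h1 := LinearMap.congr_fun h (TensorProduct.rid Kq (WordSpace Γ X.word) x)
  have h2 := (TensorProduct.rid Kq (WordSpace Γ Y.word)).injective h1
  have h3 := (TensorProduct.rid Kq (WordSpace Γ X.word)).symm_apply_apply x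
  exact (congrArg (FinRep.lin φ) h3).symm.trans (h2.trans (congrArg (FinRep.lin ψ) h3))

lemma red_comp {X Y Z : AWeb} (φ : (orbit (webEmb ⋙ Γ.functor) (soTriv n)).obj X ⟶
    (orbit (webEmb ⋙ Γ.functor) (soTriv n)).obj Y) (ψ : (orbit (webEmb ⋙ Γ.functor) (soTriv n)).obj Y ⟶
    (orbit (webEmb ⋙ Γ.functor) (soTriv n)).obj Z) : red Γ (φ ≫ ψ) = red Γ ψ ∘ₗ red Γ φ := by
  refine LinearMap.ext fun x => ?_
  refine congrArg (fun t => TensorProduct.rid Kq (WordSpace Γ Z.word) (FinRep.lin ψ t)) ?_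
  exact ((TensorProduct.rid Kq (WordSpace Γ Y.word)).symm_apply_apply _).symm

lemma red_add {X Y : AWeb} (φ ψ : (orbit (webEmb ⋙ Γ.functor) (soTriv n)).obj X ⟶
    (orbit (webEmb ⋙ Γ.functor) (soTriv n)).obj Y) : red Γ (φ + ψ) = red Γ φ + red Γ ψ :=
  LinearMap.ext fun _ => map_add (TensorProduct.rid Kq (WordSpace Γ Y.word)) _ _

lemma red_smul {X Y : AWeb} (c : Kq) (φ : (orbit (webEmb ⋙ Γ.functor) (soTriv n)).obj X ⟶
    (orbit (webEmb ⋙ Γ.functor) (soTriv n)).obj Y) : red Γ (c • φ) = c • red Γ φ :=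
  LinearMap.ext fun _ => map_smul (TensorProduct.rid Kq (WordSpace Γ Y.word)) _ _

lemma red_zero {X Y : AWeb} : red Γ (0 : (orbit (webEmb ⋙ Γ.functor) (soTriv n)).obj X ⟶
    (orbit (webEmb ⋙ Γ.functor) (soTriv n)).obj Y) = 0 :=
  LinearMap.ext fun _ => map_zero (TensorProduct.rid Kq (WordSpace Γ Y.word))

lemma red_map {X Y : AWeb} (f : X ⟶ Y) :
    red Γ ((orbit (webEmb ⋙ Γ.functor) (soTriv n)).map f) =
      hom Γ (Γ.functor.map (webEmb.map f)) :=
  LinearMap.ext fun _ => one_smul Kq _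

lemma lin_orbit_rid {X : AWeb} (v : (orbit (webEmb ⋙ Γ.functor) (soTriv n)).obj X |>.V) :
    orbitVec Γ X (TensorProduct.rid Kq (WordSpace Γ X.word) v) = v :=
  (TensorProduct.rid Kq (WordSpace Γ X.word)).symm_apply_apply v

lemma red_apply {X Y : AWeb} (φ : (orbit (webEmb ⋙ Γ.functor) (soTriv n)).obj X ⟶
    (orbit (webEmb ⋙ Γ.functor) (soTriv n)).obj Y) (x : WordSpace Γ X.word) :
    orbitVec Γ Y (red Γ φ x) = FinRep.lin φ (orbitVec Γ X x) := lin_orbit_rid Γ _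

lemma orbitVec_injective (X : AWeb) : Function.Injective (orbitVec Γ X) :=
  (TensorProduct.rid Kq (WordSpace Γ X.word)).symm.injective

lemma orbitAct_orbitVec (W X : AWeb) (x : WordSpace Γ W.word) (y : WordSpace Γ X.word) :
    FinRep.lin (orbitAct (webEmb ⋙ Γ.functor) (soTriv n) W X).hom (x ⊗ₜ[Kq] orbitVec Γ X y) =
      orbitVec Γ (W ⊗ X) (star Γ x y) := rfl

lemma red_whisker (W : AWeb) {X Y : AWeb} (φ : (orbit (webEmb ⋙ Γ.functor) (soTriv n)).obj X ⟶
    (orbit (webEmb ⋙ Γ.functor) (soTriv n)).obj Y) (x : WordSpace Γ W.word)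
    (y : WordSpace Γ X.word) : red Γ (orbitWhisker W φ) (star Γ x y) = star Γ x (red Γ φ y) := by
  have h := orbitAct_whisker W φ
  apply orbitVec_injective Γ (W ⊗ Y)
  refine (red_apply Γ (orbitWhisker W φ) (star Γ x y)).trans ?_
  have h1 := congrArg (fun t => FinRep.lin t (x ⊗ₜ[Kq] orbitVec Γ X y)) h
  refine Eq.trans ?_ (h1.trans ?_)
  · rfl
  · refine Eq.trans ?_ (orbitAct_orbitVec Γ W Y x (red Γ φ y))
    exact congrArg (fun t => FinRep.lin (orbitAct (webEmb ⋙ Γ.functor) (soTriv n) W Y).hom (x ⊗ₜ[Kq] t))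
      (red_apply Γ φ y).symm

end WordSpace
end WordSpace

namespace Kind
variable {k : Kind} {n : ℕ}

lemma exists_increasing {c : ℕ} {m : Fin n → ℕ} (hv : k.Valid m) (hm : deg m = c) :
    ∃ f : Fin c → Fin n, Increasing f k ∧ cnt f = m := by
  refine occ_induction (P := fun c m => k.Valid m → ∃ f : Fin c → Fin n, Increasing f k ∧ cnt f = m)
    (fun _ => ⟨Fin.elim0, ?_, ?_⟩) ?_ c m hm hv
  · cases k
    · exact fun x => x.elim0
    · exact fun x => x.elim0
  · funext i
    simp [cnt]
  · intro c m j hm hj ih hv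
    obtain ⟨f, hf, rfl⟩ := ih (hv.mono (by intro i; simp))
    have hle : ∀ x, j ≤ f x := by
      intro x
      by_contra h
      have h1 := hj (f x) (not_le.mp h)
      rw [cnt_apply, Finset.sum_eq_zero_iff] at h1
      have h2 := h1 x (Finset.mem_univ x)
      rw [if_pos rfl] at h2
      exact one_ne_zero h2
    refine ⟨Fin.cons j f, ?_, ?_⟩
    · cases k
      · have hlt : ∀ x, j < f x := by
          intro x
          refine lt_of_le_of_ne (hle x) fun h => ?_
          have h1 := hv rfl j
          have h2 : cnt f j = 0 := by
            have : (cnt f + unitOcc j) j = cnt f j + 1 := by simp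
            omega
          rw [cnt_apply, Finset.sum_eq_zero_iff] at h2
          have h3 := h2 x (Finset.mem_univ x)
          rw [if_pos h.symm] at h3
          exact one_ne_zero h3
        intro x y
        refine Fin.cases ?_ (fun x => ?_) x
        · refine Fin.cases (fun h => (lt_irrefl _ h).elim) (fun y _ => ?_) y
          simpa using hlt y
        · refine Fin.cases (fun h => (Fin.not_lt_zero _ h).elim) (fun y h => ?_) y
          simpa using hf (Fin.succ_lt_succ_iff.mp h)
      · intro x y
        refine Fin.cases ?_ (fun x => ?_) x
        · refine Fin.cases (fun _ => le_rfl) (fun y _ => ?_) y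
          simpa using hle y
        · refine Fin.cases (fun h => ?_) (fun y h => ?_) y
          · exact absurd (Fin.succ_pos x) (not_lt.mpr h)
          · simpa using hf (Fin.succ_le_succ_iff.mp h)
    · rw [cnt_succ]
      simp

lemma exists_vec_eq_ev {c : ℕ} {m : Fin n → ℕ} (hv : k.Valid m) (hm : deg m = c) :
    ∃ f : Fin c → Fin n, Increasing f k ∧ k.vec f = k.ev c m := by
  obtain ⟨f, hf, rfl⟩ := exists_increasing hv hm
  exact ⟨f, hf, k.vec_of_monotone hf.monotone⟩

lemma IsMul.lin_eq {a b c : ℕ} {h : a + b = c}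
    {φ : (k.pow n a ⊗ k.pow n b : FinRep (Uq n)) ⟶ k.pow n c} (hφ : k.IsMul n h φ) :
    FinRep.lin φ = k.mulLin n a b c := by
  refine tensor_hom_ext fun x y hx hdx hy hdy => ?_
  obtain ⟨f, -, hf⟩ := exists_vec_eq_ev hx hdx
  obtain ⟨g, -, hg⟩ := exists_vec_eq_ev hy hdy
  rw [← hf, ← hg]
  exact (hφ f g).trans (k.mulLin_vec h f g).symm

lemma IsComul.lin_eq {a b c : ℕ} (h : a + b = c)
    {φ : k.pow n c ⟶ (k.pow n a ⊗ k.pow n b : FinRep (Uq n))} (hφ : k.IsComul n a b c φ) :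
    FinRep.lin φ = k.comulLin n a b c := by
  refine hom_ext fun m hm hdm => ?_
  obtain ⟨f, hf, hfm⟩ := exists_vec_eq_ev hm hdm
  rw [← hfm]
  exact (hφ f hf).trans (k.comulLin_vec h f hf).symm

lemma vec_const (i : Fin n) : k.vec (fun _ : Fin 1 => i) = k.ev 1 (unitOcc i) := by
  rw [k.vec_of_monotone (fun _ _ _ => le_rfl)]
  simp [cnt]

end Kind

namespace WordSpace
open Functor.LaxMonoidal Functor.OplaxMonoidal
variable {k : Kind} {n : ℕ} (Γ : GammaA k n)

lemma strandEquiv_merge {a b c : ℕ+} (h : a + b = c) (x : WordSpace Γ [a]) (y : WordSpace Γ [b]) :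
    strandEquiv Γ c (web Γ (.merge a b c h) (star Γ x y)) =
      k.mulLin n a b c (strandEquiv Γ a x ⊗ₜ strandEquiv Γ b y) := by
  have h1 := LinearMap.congr_fun (Γ.map_merge a b c h).lin_eq
    (strandEquiv Γ a x ⊗ₜ strandEquiv Γ b y)
  refine Eq.trans ?_ h1
  change _ = strandEquiv Γ c (web Γ (.merge a b c h) (star Γ
    ((strandEquiv Γ a).symm (strandEquiv Γ a x)) ((strandEquiv Γ b).symm (strandEquiv Γ b y))))
  rw [LinearEquiv.symm_apply_apply, LinearEquiv.symm_apply_apply]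

/-- The juxtaposition of vectors in the images of two one-letter words. -/
def pair (a b : ℕ+) : (k.pow n a).V ⊗[Kq] (k.pow n b).V →ₗ[Kq] WordSpace Γ ([a] ++ [b]) :=
  TensorProduct.lift ((star Γ (X := [a]) (Y := [b])).compl₁₂ (strandEquiv Γ a).symm.toLinearMap
    (strandEquiv Γ b).symm.toLinearMap)

lemma pair_tmul (a b : ℕ+) (x : (k.pow n a).V) (y : (k.pow n b).V) :
    pair Γ a b (x ⊗ₜ y) = star Γ ((strandEquiv Γ a).symm x) ((strandEquiv Γ b).symm y) := rfl

lemma pair_map (a b : ℕ+) (z : WordSpace Γ ([a] ++ [b])) :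
    pair Γ a b (FinRep.lin (δ (webEmb ⋙ Γ.functor) (strand a) (strand b) ≫
      ((Γ.objIso a).hom ⊗ₘ (Γ.objIso b).hom)) z) = z := by
  have h1 : pair Γ a b ∘ₗ FinRep.lin ((Γ.objIso a).hom ⊗ₘ (Γ.objIso b).hom) =
      FinRep.lin (μ (webEmb ⋙ Γ.functor) (strand a) (strand b)) := by
    refine TensorProduct.ext' fun x y => ?_
    exact congrArg₂ (fun (u : WordSpace Γ [a]) (v : WordSpace Γ [b]) => star Γ u v)
      ((strandEquiv Γ a).symm_apply_apply x) ((strandEquiv Γ b).symm_apply_apply y)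
  refine (LinearMap.congr_fun h1 (FinRep.lin (δ (webEmb ⋙ Γ.functor) (strand a) (strand b)) z)).trans ?_
  exact congrArg (fun t => FinRep.lin t z)
    (Functor.Monoidal.δ_μ (webEmb ⋙ Γ.functor) (strand a) (strand b))

lemma web_split {a b c : ℕ+} (h : a + b = c) (x : WordSpace Γ [c]) :
    web Γ (.split a b c h) x = pair Γ a b (k.comulLin n a b c (strandEquiv Γ c x)) := by
  have h1 := LinearMap.congr_fun ((Γ.map_split a b c h).lin_eq (congrArg PNat.val h))
    (strandEquiv Γ c x)
  refine Eq.trans ?_ (congrArg (pair Γ a b) h1)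
  refine (pair_map Γ a b _).symm.trans ?_
  change _ = pair Γ a b (FinRep.lin (δ (webEmb ⋙ Γ.functor) (strand a) (strand b) ≫
    ((Γ.objIso a).hom ⊗ₘ (Γ.objIso b).hom)) (web Γ (.split a b c h)
      ((strandEquiv Γ c).symm (strandEquiv Γ c x))))
  rw [LinearEquiv.symm_apply_apply]

lemma web_split_symm {a b c : ℕ+} (h : a + b = c) (x : (k.pow n c).V) :
    web Γ (.split a b c h) ((strandEquiv Γ c).symm x) = pair Γ a b (k.comulLin n a b c x) :=
  (web_split Γ h _).trans (congrArg (fun y => pair Γ a b (k.comulLin n a b c y))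
    ((strandEquiv Γ c).apply_symm_apply x))

lemma web_ms {a b c : ℕ+} (h : a + b = c) (t : (k.pow n a).V ⊗[Kq] (k.pow n b).V) :
    web Γ (.comp (.merge a b c h) (.split a b c h)) (pair Γ a b t) =
      pair Γ a b (k.comulLin n a b c (k.mulLin n a b c t)) := by
  rw [web_comp]
  refine (web_split Γ h _).trans (congrArg (fun s => pair Γ a b (k.comulLin n a b c s)) ?_)
  induction t using TensorProduct.induction_on with
  | zero => rw [map_zero, map_zero, map_zero, map_zero]
  | tmul x y =>
    rw [pair_tmul, strandEquiv_merge, LinearEquiv.apply_symm_apply, LinearEquiv.apply_symm_apply]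
  | add s t hs ht => rw [map_add, map_add, map_add, map_add, hs, ht]

end WordSpace

namespace Kind
variable {n : ℕ}

/-- The diagonal coefficients of a merge followed by a split on two thin strands. -/
def diag (k : Kind) (i j : Fin n) : Kq :=
  if i = j then k.mult 2 else if i < j then k.r else k.r⁻¹

/-- The off-diagonal coefficients of a merge followed by a split on two thin strands. -/
def offDiag (k : Kind) (i j : Fin n) : Kq := if i = j then 0 else k.b

lemma comulLin_mulLin_thin (k : Kind) (i j : Fin n) :
    k.comulLin n 1 1 2 (k.mulLin n 1 1 2 (k.ev 1 (unitOcc i) ⊗ₜ k.ev 1 (unitOcc j))) =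
      k.diag i j • (k.ev 1 (unitOcc i) ⊗ₜ[Kq] k.ev 1 (unitOcc j)) +
        k.offDiag i j • (k.ev 1 (unitOcc j) ⊗ₜ[Kq] k.ev 1 (unitOcc i)) := by
  rw [mulLin_thin_right k rfl, map_smul, comulLin_thin_right k rfl]
  by_cases h : i = j
  · subst h
    rw [Finset.sum_eq_single i]
    · simp [thinR, diag, offDiag, above_add, below_add, above_unitOcc, below_unitOcc]
    · intro l _ hl
      simp [thinR, unitOcc_of_ne hl, mult_zero]
    · simp
  · have hs : ∀ f : Fin n → (k.pow n 1).V ⊗[Kq] (k.pow n 1).V,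
        (∀ l, l ≠ i → l ≠ j → f l = 0) → ∑ l, f l = f j + f i := by
      intro f hf
      rw [← Finset.add_sum_erase _ _ (Finset.mem_univ j), Finset.sum_eq_single i]
      · intro l hl h'
        exact hf l h' (Finset.ne_of_mem_erase hl)
      · intro h'
        exact absurd (Finset.mem_erase.mpr ⟨h, Finset.mem_univ i⟩) h'
    rw [hs _ (fun l h1 h2 => by simp [thinR, unitOcc_of_ne h1, unitOcc_of_ne h2, mult_zero])]
    rw [smul_add, smul_smul, smul_smul, add_tsub_cancel_right, add_tsub_cancel_left]
    have h1 := k.s_mul_r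
    have h2 := k.b_sq
    rcases lt_or_gt_of_ne h with h' | h'
    · simp [thinR, diag, offDiag, above_add, below_add, above_unitOcc, below_unitOcc, h', h,
        not_lt.mpr h'.le, unitOcc_of_ne h, unitOcc_of_ne (Ne.symm h), mult_one]
    · have h4 : k.s * k.b = k.r⁻¹ := by
        refine eq_inv_of_mul_eq_one_left ?_
        rw [mul_right_comm, h1, h2]
      simp [thinR, diag, offDiag, above_add, below_add, above_unitOcc, below_unitOcc, h', h,
        not_lt.mpr h'.le, unitOcc_of_ne h, unitOcc_of_ne (Ne.symm h), mult_one, h1, h4]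

end Kind

namespace WordSpace
variable {k : Kind} {n : ℕ} (Γ : GammaA k n)

/-- The basis of the image of a thin strand. -/
def e (i : Fin n) : WordSpace Γ [1] := (strandEquiv Γ 1).symm (k.ev 1 (unitOcc i))

/-- The basis of the image of two thin strands. -/
def w₂ (i j : Fin n) : WordSpace Γ [1, 1] := star Γ (X := [1]) (Y := [1]) (e Γ i) (e Γ j)

/-- The basis of the image of three thin strands. -/
def w₃ (i j l : Fin n) : WordSpace Γ [1, 1, 1] := star Γ (X := [1]) (Y := [1, 1]) (e Γ i) (w₂ Γ j l)

/-- The basis of the image of four thin strands. -/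
def w₄ (i j l m : Fin n) : WordSpace Γ [1, 1, 1, 1] :=
  star Γ (X := [1, 1]) (Y := [1, 1]) (w₂ Γ i j) (w₂ Γ l m)

lemma vec_one_eq (i : Fin n) : Γ.vec 1 (fun _ => i) = e Γ i :=
  congrArg (strandEquiv Γ 1).symm (Kind.vec_const i)

lemma vec₂_eq (i j : Fin n) : Γ.vec₂ i j = w₂ Γ i j :=
  congrArg₂ (fun (x y : WordSpace Γ [1]) => star Γ x y) (vec_one_eq Γ i) (vec_one_eq Γ j)

lemma e_hom_ext {M : Type*} [AddCommGroup M] [Module Kq M] {f g : WordSpace Γ [1] →ₗ[Kq] M}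
    (h : ∀ i, f (e Γ i) = g (e Γ i)) : f = g := by
  have h1 : f ∘ₗ (strandEquiv Γ 1).symm.toLinearMap = g ∘ₗ (strandEquiv Γ 1).symm.toLinearMap := by
    refine Kind.hom_ext fun m _ hd => ?_
    obtain ⟨i, rfl⟩ := Kind.eq_unitOcc_of_deg hd
    exact h i
  refine LinearMap.ext fun x => ?_
  have h2 : (strandEquiv Γ 1).symm (strandEquiv Γ 1 x) = x := LinearEquiv.symm_apply_apply _ x
  exact (congrArg f h2).symm.trans ((LinearMap.congr_fun h1 (strandEquiv Γ 1 x)).trans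
    (congrArg g h2))

lemma span_eq_top_of_hom_ext {V : Type*} [AddCommGroup V] [Module Kq V] {ι : Type*} {w : ι → V}
    (hw : ∀ {f g : V →ₗ[Kq] Kq}, (∀ i, f (w i) = g (w i)) → f = g) :
    Submodule.span Kq (Set.range w) = ⊤ := by
  by_contra hne
  obtain ⟨φ, hφ, hle⟩ := Submodule.exists_le_ker_of_lt_top _ (lt_top_iff_ne_top.mpr hne)
  exact hφ (hw fun i => hle (Submodule.subset_span ⟨i, rfl⟩))

lemma star_basis_hom_ext {X Y : List ℕ+} {ι κ : Type*} {u : ι → WordSpace Γ X}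
    {v : κ → WordSpace Γ Y} (hu : Submodule.span Kq (Set.range u) = ⊤)
    (hv : Submodule.span Kq (Set.range v) = ⊤) {M : Type*} [AddCommGroup M] [Module Kq M]
    {f g : WordSpace Γ (X ++ Y) →ₗ[Kq] M}
    (h : ∀ i j, f (star Γ (u i) (v j)) = g (star Γ (u i) (v j))) : f = g := by
  refine star_hom_ext Γ fun x y => ?_
  have h1 : (star Γ (X := X) (Y := Y)).compr₂ f = (star Γ).compr₂ g := by
    refine LinearMap.ext_on hu ?_
    rintro _ ⟨i, rfl⟩
    refine LinearMap.ext_on hv ?_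
    rintro _ ⟨j, rfl⟩
    exact h i j
  exact LinearMap.congr_fun₂ h1 x y

lemma w₂_hom_ext {M : Type*} [AddCommGroup M] [Module Kq M] {f g : WordSpace Γ [1, 1] →ₗ[Kq] M}
    (h : ∀ i j, f (w₂ Γ i j) = g (w₂ Γ i j)) : f = g :=
  star_basis_hom_ext Γ (X := [1]) (Y := [1]) (u := e Γ) (v := e Γ)
    (span_eq_top_of_hom_ext (e_hom_ext Γ)) (span_eq_top_of_hom_ext (e_hom_ext Γ)) h

lemma span_w₂ : Submodule.span Kq (Set.range fun p : Fin n × Fin n => w₂ Γ p.1 p.2) = ⊤ :=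
  span_eq_top_of_hom_ext fun h => w₂_hom_ext Γ fun i j => h (i, j)

lemma w₄_hom_ext {M : Type*} [AddCommGroup M] [Module Kq M]
    {f g : WordSpace Γ [1, 1, 1, 1] →ₗ[Kq] M}
    (h : ∀ i j l m, f (w₄ Γ i j l m) = g (w₄ Γ i j l m)) : f = g :=
  star_basis_hom_ext Γ (X := [1, 1]) (Y := [1, 1]) (span_w₂ Γ) (span_w₂ Γ)
    fun p r => h p.1 p.2 r.1 r.2

lemma star_one_strand (a : ℕ+) (x : WordSpace Γ [a]) : star Γ (X := [a]) (Y := []) x (one Γ) = x :=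
  (hom_map_id Γ (X := wd [a]) _).symm.trans (hom_rightUnitor_star Γ (wd [a]) x)

lemma star_one_pair (x : WordSpace Γ [1, 1]) : star Γ (X := [1, 1]) (Y := []) x (one Γ) = x :=
  (hom_map_id Γ (X := wd [1, 1]) _).symm.trans (hom_rightUnitor_star Γ (wd [1, 1]) x)

lemma w₃_eq (i j l : Fin n) : w₃ Γ i j l = star Γ (X := [1, 1]) (Y := [1]) (w₂ Γ i j) (e Γ l) :=
  ((hom_map_id Γ (X := wd [1, 1, 1]) _).symm.trans
    (hom_associator_star Γ (wd [1]) (wd [1]) (wd [1]) (e Γ i) (e Γ j) (e Γ l))).symm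

lemma w₄_eq (i j l m : Fin n) : w₄ Γ i j l m = star Γ (X := [1]) (Y := [1, 1, 1]) (e Γ i)
    (star Γ (X := [1, 1]) (Y := [1]) (w₂ Γ j l) (e Γ m)) := by
  rw [← w₃_eq]
  exact (hom_map_id Γ (X := wd [1, 1, 1, 1]) _).symm.trans
    (hom_associator_star Γ (wd [1]) (wd [1]) (wd [1, 1]) (e Γ i) (e Γ j) (w₂ Γ l m))

/-- A web on two thin strands that is a combination of the identity and the flip, with coefficients
depending on the weights. -/
def IsSwap (f : AWeb.Pre [1, 1] [1, 1]) (a b : Fin n → Fin n → Kq) : Prop :=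
  ∀ i j, web Γ f (w₂ Γ i j) = a i j • w₂ Γ i j + b i j • w₂ Γ j i

lemma isSwap_ms : IsSwap Γ (.ms 1 1) k.diag k.offDiag := by
  intro i j
  refine (web_ms Γ (a := 1) (b := 1) rfl (k.ev 1 (unitOcc i) ⊗ₜ k.ev 1 (unitOcc j))).trans ?_
  refine (congrArg (pair Γ 1 1) (k.comulLin_mulLin_thin i j)).trans ?_
  exact (map_add (pair Γ 1 1) _ _).trans
    (congrArg₂ _ (map_smul (pair Γ 1 1) _ _) (map_smul (pair Γ 1 1) _ _))

variable {Γ}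

lemma IsSwap.add_id {f : AWeb.Pre [1, 1] [1, 1]} {a b : Fin n → Fin n → Kq} (h : IsSwap Γ f a b)
    (c : Kq) : IsSwap Γ (.add (.smul c (.id [1, 1])) f) (fun i j => c + a i j) b := by
  intro i j
  rw [web_add, LinearMap.add_apply, h, web_smul, web_id, add_smul, add_assoc]
  rfl

lemma IsSwap.on₁₂ {f : AWeb.Pre [1, 1] [1, 1]} {a b : Fin n → Fin n → Kq} (h : IsSwap Γ f a b)
    (i j l : Fin n) : web Γ (.on₁₂ f) (w₃ Γ i j l) = a i j • w₃ Γ i j l + b i j • w₃ Γ j i l := by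
  simp only [w₃_eq]
  refine (web_tensor Γ f (.id [1]) (w₂ Γ i j) (e Γ l)).trans ?_
  rw [h, web_id, map_add, map_smul, map_smul]
  rfl

lemma IsSwap.pos₁ {f : AWeb.Pre [1, 1] [1, 1]} {a b : Fin n → Fin n → Kq} (h : IsSwap Γ f a b)
    (i j l m : Fin n) :
    web Γ (.pos₁ f) (w₄ Γ i j l m) = a i j • w₄ Γ i j l m + b i j • w₄ Γ j i l m := by
  refine (web_tensor Γ f (.id [1, 1]) (w₂ Γ i j) (w₂ Γ l m)).trans ?_
  rw [h, web_id, map_add, map_smul, map_smul]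
  rfl

lemma IsSwap.pos₃ {f : AWeb.Pre [1, 1] [1, 1]} {a b : Fin n → Fin n → Kq} (h : IsSwap Γ f a b)
    (i j l m : Fin n) :
    web Γ (.pos₃ f) (w₄ Γ i j l m) = a l m • w₄ Γ i j l m + b l m • w₄ Γ i j m l := by
  refine (web_tensor Γ (.id [1, 1]) f (w₂ Γ i j) (w₂ Γ l m)).trans ?_
  rw [h, web_id, map_add, map_smul, map_smul]
  rfl

lemma IsSwap.pos₂ {f : AWeb.Pre [1, 1] [1, 1]} {a b : Fin n → Fin n → Kq} (h : IsSwap Γ f a b)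
    (i j l m : Fin n) :
    web Γ (.pos₂ f) (w₄ Γ i j l m) = a j l • w₄ Γ i j l m + b j l • w₄ Γ i l j m := by
  simp only [w₄_eq]
  refine (web_tensor Γ (.id [1]) (.tensor f (.id [1])) (e Γ i)
    (star Γ (X := [1, 1]) (Y := [1]) (w₂ Γ j l) (e Γ m))).trans ?_
  have h1 : web Γ (.tensor f (.id [1])) (star Γ (X := [1, 1]) (Y := [1]) (w₂ Γ j l) (e Γ m)) =
      a j l • star Γ (X := [1, 1]) (Y := [1]) (w₂ Γ j l) (e Γ m) +
        b j l • star Γ (X := [1, 1]) (Y := [1]) (w₂ Γ l j) (e Γ m) := by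
    refine (web_tensor Γ f (.id [1]) (w₂ Γ j l) (e Γ m)).trans ?_
    rw [h, web_id, map_add, map_smul, map_smul]
    rfl
  rw [web_id, LinearMap.id_apply]
  refine (congrArg (star Γ (X := [1]) (Y := [1, 1, 1]) (e Γ i)) h1).trans ?_
  exact (map_add _ _ _).trans (congrArg₂ _ (map_smul _ _ _) (map_smul _ _ _))

lemma IsSwap.pos₁₃ {f g : AWeb.Pre [1, 1] [1, 1]} {a b a' b' : Fin n → Fin n → Kq}
    (h : IsSwap Γ f a b) (h' : IsSwap Γ g a' b') (i j l m : Fin n) :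
    web Γ (.pos₁₃ f g) (w₄ Γ i j l m) =
      (a i j * a' l m) • w₄ Γ i j l m + (a i j * b' l m) • w₄ Γ i j m l +
        (b i j * a' l m) • w₄ Γ j i l m + (b i j * b' l m) • w₄ Γ j i m l := by
  refine (web_tensor Γ f g (w₂ Γ i j) (w₂ Γ l m)).trans ?_
  rw [h, h']
  simp only [map_add, map_smul, LinearMap.add_apply, LinearMap.smul_apply, smul_add, smul_smul]
  rw [mul_comm (a' l m), mul_comm (b' l m), mul_comm (a' l m), mul_comm (b' l m)]
  change (a i j * a' l m) • w₄ Γ i j l m + (b i j * a' l m) • w₄ Γ j i l m +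
    ((a i j * b' l m) • w₄ Γ i j m l + (b i j * b' l m) • w₄ Γ j i m l) = _
  abel

end WordSpace

section CapSums
variable {n : ℕ}

lemma skew_one (i : Fin n) : skew (fun _ => 1) i = 2 * (i : ℤ) + 1 - n := by
  have h := Kind.skew_natCast (fun _ : Fin n => 1) i
  simp only [Nat.cast_one] at h
  rw [h]
  have h1 : below (fun _ : Fin n => 1) i = i := by simp [below]
  have h2 := deg_eq (fun _ : Fin n => 1) i
  have h3 : deg (fun _ : Fin n => 1) = n := by simp [deg]
  omega

lemma capCoeff_eq (i : Fin n) : capCoeff i = q ^ (-skew (fun _ => 1) i) := by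
  rw [skew_one, capCoeff]
  congr 1
  ring

lemma skew_single (a i : Fin n) :
    skew (Pi.single a 1) i = if a < i then 1 else if i < a then -1 else 0 := by
  rw [skew, Finset.sum_eq_single a]
  · simp [skewTerm]
  · intro k _ hk
    simp [skewTerm, hk]
  · simp

lemma skew_single_self (a : Fin n) : skew (Pi.single a 1) a = 0 := by simp [skew_single]

lemma Kind.diag_of_ne (k : Kind) {a i : Fin n} (h : a ≠ i) :
    k.diag a i = q ^ (k.rExp * skew (Pi.single a 1) i) := by
  rw [diag, if_neg h, skew_single, r_eq]
  rcases lt_or_gt_of_ne h with h' | h'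
  · rw [if_pos h', if_pos h', mul_one]
  · rw [if_neg (not_lt.mpr h'.le), if_neg (not_lt.mpr h'.le), if_pos h', mul_neg_one, zpow_neg]

lemma Kind.ext_diag_self (a : Fin n) : ext.diag a a = 0 := by simp [diag, mult]

/-- The matrix of the cap. -/
def capVal (i j : Fin n) : Kq := if i = j then capCoeff i else 0

lemma capVal_self (i : Fin n) : capVal i i = capCoeff i := if_pos rfl

lemma capVal_of_ne {i j : Fin n} (h : i ≠ j) : capVal i j = 0 := if_neg h

lemma sum_capCoeff : ∑ i : Fin n, capCoeff i = qnum n := by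
  have h := sum_skew_qnum (e := -1) (Or.inr rfl) (fun _ : Fin n => 1)
  simp only [qnum_one, mul_one, neg_one_mul] at h
  simp only [capCoeff_eq, h]
  simp

lemma sum_diag_capCoeff (a : Fin n) :
    ∑ i, Kind.ext.diag a i * capCoeff i = qnum ((n : ℤ) - 1) := by
  have h := sum_skew_qnum (e := -1) (Or.inr rfl)
    (fun i : Fin n => (fun _ => 1 : Fin n → ℤ) i - (Pi.single a 1 : Fin n → ℤ) i)
  rw [Finset.sum_sub_distrib] at h
  simp only [Finset.sum_pi_single', Finset.mem_univ, if_true, Finset.sum_const, Finset.card_univ,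
    Fintype.card_fin, nsmul_eq_mul, mul_one] at h
  rw [← h]
  refine Finset.sum_congr rfl fun i _ => ?_
  by_cases hi : a = i
  · subst hi
    simp [Kind.ext_diag_self, qnum_zero]
  · rw [skew_sub, Kind.diag_of_ne _ hi, capCoeff_eq, Pi.single_eq_of_ne (Ne.symm hi), sub_zero,
      qnum_one, mul_one, ← zpow_add₀ Uq.q_ne_zero]
    congr 1
    simp only [Kind.rExp]
    ring

lemma sum_diag_diag_capCoeff (a b : Fin n) :
    ∑ i, Kind.ext.diag a i * Kind.ext.diag b i * capCoeff i = qnum ((n : ℤ) - 2) + capVal a b := by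
  have h := sum_skew_qnum (e := -1) (Or.inr rfl)
    (fun i : Fin n => (fun j => (fun _ => 1 : Fin n → ℤ) j - (Pi.single a 1 : Fin n → ℤ) j) i -
      (Pi.single b 1 : Fin n → ℤ) i)
  rw [Finset.sum_sub_distrib, Finset.sum_sub_distrib] at h
  simp only [Finset.sum_pi_single', Finset.mem_univ, if_true, Finset.sum_const, Finset.card_univ,
    Fintype.card_fin, nsmul_eq_mul, mul_one] at h
  rw [show (n : ℤ) - 2 = n - 1 - 1 by ring, ← h]
  have hc : capVal a b = ∑ i, if i = a then capVal i b else 0 := by simp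
  rw [hc, ← Finset.sum_add_distrib]
  refine Finset.sum_congr rfl fun i _ => ?_
  rw [skew_sub, skew_sub, capCoeff_eq]
  by_cases hi : a = i
  · subst hi
    by_cases hb : b = a
    · subst hb
      simp only [Kind.ext_diag_self, skew_single_self, Pi.single_eq_same, if_true, capVal_self,
        sub_zero, capCoeff_eq]
      rw [show (1 : ℤ) - 1 - 1 = -1 by norm_num, qnum_neg, qnum_one]
      simp
    · rw [Kind.ext_diag_self, Pi.single_eq_same, Pi.single_eq_of_ne (Ne.symm hb), if_pos rfl,
        capVal_of_ne (Ne.symm hb)]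
      simp [qnum_zero]
  · rw [if_neg (Ne.symm hi), Kind.diag_of_ne _ hi, Pi.single_eq_of_ne (Ne.symm hi)]
    by_cases hb : b = i
    · subst hb
      simp [Kind.ext_diag_self, qnum_zero]
    · rw [Kind.diag_of_ne _ hb, Pi.single_eq_of_ne (Ne.symm hb), sub_zero, sub_zero, qnum_one,
        mul_one, add_zero, ← zpow_add₀ Uq.q_ne_zero, ← zpow_add₀ Uq.q_ne_zero]
      congr 1
      simp only [Kind.rExp]
      ring

lemma zqnum_one_q_pow (n : ℕ) (s : ℤ) : zqnum 1 (q ^ n) s = qnum (n + s) := by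
  rw [zqnum, qnum, ← zpow_natCast q n, ← zpow_neg, ← zpow_add₀ Uq.q_ne_zero, ← zpow_add₀ Uq.q_ne_zero,
    pow_one]
  congr 3
  · push_cast; ring
  · push_cast; ring

end CapSums

namespace WordSpace
variable {k : Kind} {n : ℕ} (Γ : GammaA k n) {Gen : AWeb → AWeb → Type}
  (val : ∀ {X Y : AWeb}, Gen X Y → ((orbit (webEmb ⋙ Γ.functor) (soTriv n)).obj X ⟶
    (orbit (webEmb ⋙ Γ.functor) (soTriv n)).obj Y))

/-- The linear map given by a formal expression and values on generators. -/
def evalLin {X Y : AWeb} (f : ModPre Gen X Y) : WordSpace Γ X.word →ₗ[Kq] WordSpace Γ Y.word :=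
  red Γ (ModPre.eval (webEmb ⋙ Γ.functor) (soTriv n) val f)

variable {X Y Z : AWeb}

lemma evalLin_comp (f : ModPre Gen X Y) (g : ModPre Gen Y Z) (x : WordSpace Γ X.word) :
    evalLin Γ val (.comp f g) x = evalLin Γ val g (evalLin Γ val f x) :=
  LinearMap.congr_fun (red_comp Γ _ _) x

lemma evalLin_add (f g : ModPre Gen X Y) (x : WordSpace Γ X.word) :
    evalLin Γ val (.add f g) x = evalLin Γ val f x + evalLin Γ val g x :=
  LinearMap.congr_fun (red_add Γ _ _) x

lemma evalLin_smul (c : Kq) (f : ModPre Gen X Y) (x : WordSpace Γ X.word) :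
    evalLin Γ val (.smul c f) x = c • evalLin Γ val f x :=
  LinearMap.congr_fun (red_smul Γ _ _) x

lemma evalLin_zero (x : WordSpace Γ X.word) : evalLin Γ val (.zero : ModPre Gen X Y) x = 0 :=
  LinearMap.congr_fun (red_zero Γ) x

lemma evalLin_id (x : WordSpace Γ X.word) : evalLin Γ val (.of (𝟙 X)) x = x :=
  (LinearMap.congr_fun (red_map Γ (𝟙 X)) x).trans (hom_map_id Γ x)

lemma evalLin_web {X Y : List ℕ+} (f : AWeb.Pre X Y) (x : WordSpace Γ X) :
    evalLin Γ val (_root_.web f) x = web Γ f x :=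
  LinearMap.congr_fun (red_map Γ (X := wd X) (Y := wd Y) (AWeb.of f)) x

lemma evalLin_whisk (W : AWeb) (f : ModPre Gen X Y) (x : WordSpace Γ W.word)
    (y : WordSpace Γ X.word) :
    evalLin Γ val (.whisk W f) (star Γ x y) = star Γ x (evalLin Γ val f y) :=
  red_whisker Γ W _ x y

lemma eval_eq_of_evalLin {f g : ModPre Gen X Y} (h : evalLin Γ val f = evalLin Γ val g) :
    ModPre.eval (webEmb ⋙ Γ.functor) (soTriv n) val f =
      ModPre.eval (webEmb ⋙ Γ.functor) (soTriv n) val g := red_injective Γ h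

section CupCap
variable {cup : ModPre Gen (wd []) (wd [1, 1])} {cap : ModPre Gen (wd [1, 1]) (wd [])}

/-- The expected value of a cup. -/
def IsCup (cup : ModPre Gen (wd []) (wd [1, 1])) : Prop :=
  evalLin Γ val cup (one Γ) = ∑ i, w₂ Γ i i

/-- The expected values of a cap. -/
def IsCap (cap : ModPre Gen (wd [1, 1]) (wd [])) : Prop :=
  ∀ i j, evalLin Γ val cap (w₂ Γ i j) = capVal i j • one Γ

variable {Γ val}

lemma IsCup.whisk_one (h : IsCup Γ val cup) (a : Fin n) :
    evalLin Γ val (X := wd [1]) (Y := wd [1, 1, 1]) (.whisk (wd [1]) cup) (e Γ a) =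
      ∑ i, w₃ Γ a i i := by
  refine (congrArg _ (star_one_strand Γ 1 (e Γ a)).symm).trans ?_
  refine (evalLin_whisk Γ val (wd [1]) cup (e Γ a) (one Γ)).trans ?_
  exact (congrArg (star Γ (X := [1]) (Y := [1, 1]) (e Γ a)) h).trans (map_sum _ _ _)

lemma IsCup.whisk_two (h : IsCup Γ val cup) (a b : Fin n) :
    evalLin Γ val (X := wd [1, 1]) (Y := wd [1, 1, 1, 1]) (.whisk (wd [1, 1]) cup) (w₂ Γ a b) =
      ∑ i, w₄ Γ a b i i := by
  refine (congrArg _ (star_one_pair Γ (w₂ Γ a b)).symm).trans ?_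
  refine (evalLin_whisk Γ val (wd [1, 1]) cup (w₂ Γ a b) (one Γ)).trans ?_
  exact (congrArg (star Γ (X := [1, 1]) (Y := [1, 1]) (w₂ Γ a b)) h).trans (map_sum _ _ _)

lemma IsCap.whisk_one (h : IsCap Γ val cap) (a i j : Fin n) :
    evalLin Γ val (X := wd [1, 1, 1]) (Y := wd [1]) (.whisk (wd [1]) cap) (w₃ Γ a i j) =
      capVal i j • e Γ a := by
  refine (evalLin_whisk Γ val (wd [1]) cap (e Γ a) (w₂ Γ i j)).trans ?_
  refine (congrArg (star Γ (X := [1]) (Y := []) (e Γ a)) (h i j)).trans ?_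
  exact (map_smul _ _ _).trans (congrArg _ (star_one_strand Γ 1 (e Γ a)))

lemma IsCap.whisk_two (h : IsCap Γ val cap) (a b i j : Fin n) :
    evalLin Γ val (X := wd [1, 1, 1, 1]) (Y := wd [1, 1]) (.whisk (wd [1, 1]) cap) (w₄ Γ a b i j) =
      capVal i j • w₂ Γ a b := by
  refine (evalLin_whisk Γ val (wd [1, 1]) cap (w₂ Γ a b) (w₂ Γ i j)).trans ?_
  refine (congrArg (star Γ (X := [1, 1]) (Y := []) (w₂ Γ a b)) (h i j)).trans ?_
  exact (map_smul _ _ _).trans (congrArg _ (star_one_pair Γ (w₂ Γ a b)))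

lemma diag_self_eq (i j : Fin n) : k.diag i i = k.diag j j := by simp [Kind.diag]

lemma offDiag_self (i : Fin n) : k.offDiag i i = 0 := if_pos rfl

lemma offDiag_comm (i j : Fin n) : k.offDiag i j = k.offDiag j i := by
  simp only [Kind.offDiag, eq_comm]

lemma eval_slide (hcup : IsCup Γ val cup) (hcap : IsCap Γ val cap) {f g : ModPre Gen X Y}
    (h : SlideRel cup cap f g) : ModPre.eval (webEmb ⋙ Γ.functor) (soTriv n) val f =
      ModPre.eval (webEmb ⋙ Γ.functor) (soTriv n) val g := by
  have hs := isSwap_ms Γ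
  cases h with
  | cap =>
    refine eval_eq_of_evalLin Γ val (w₄_hom_ext Γ fun a b c d => ?_)
    have key : ∀ i j l m, evalLin Γ val (.comp (Y := wd [1, 1, 1, 1])
        (_root_.web (.pos₂ (.ms 1 1))) (.comp (X := wd [1, 1, 1, 1]) (.whisk (wd [1, 1]) cap) cap))
          (w₄ Γ i j l m) = (k.diag j l * (capVal l m * capVal i j) +
            k.offDiag j l * (capVal j m * capVal i l)) • one Γ := by
      intro i j l m
      have h1 : ∀ i j l m, evalLin Γ val (.comp (X := wd [1, 1, 1, 1]) (.whisk (wd [1, 1]) cap) cap)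
          (w₄ Γ i j l m) = (capVal l m * capVal i j) • one Γ := by
        intro i j l m
        refine (evalLin_comp Γ val (X := wd [1, 1, 1, 1]) _ cap _).trans ?_
        refine (congrArg (evalLin Γ val cap) (hcap.whisk_two i j l m)).trans ?_
        rw [map_smul, hcap, smul_smul]
      refine (evalLin_comp Γ val (_root_.web (.pos₂ (.ms 1 1))) _ _).trans ?_
      rw [evalLin_web, hs.pos₂, map_add, map_smul, map_smul, h1, h1, smul_smul, smul_smul, ← add_smul]
    refine (evalLin_comp Γ val (_root_.web (.pos₁ (.ms 1 1))) _ _).trans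
      (Eq.trans ?_ (evalLin_comp Γ val (_root_.web (.pos₃ (.ms 1 1))) _ _).symm)
    rw [evalLin_web, evalLin_web, hs.pos₁, hs.pos₃, map_add, map_smul, map_smul, map_add, map_smul,
      map_smul, key, key, key, smul_smul, smul_smul, smul_smul, smul_smul, ← add_smul, ← add_smul]
    congr 1
    by_cases h1 : a = b
    · subst h1
      by_cases h2 : c = d
      · subst h2
        rw [diag_self_eq a c, offDiag_self, offDiag_self]
      · by_cases h3 : a = c
        · subst h3
          simp [capVal_of_ne h2, capVal_of_ne (Ne.symm h2), offDiag_self]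
        · simp [capVal_of_ne h2, capVal_of_ne (Ne.symm h2), capVal_of_ne h3, offDiag_self]
    · by_cases h2 : c = d
      · subst h2
        by_cases h3 : b = c
        · subst h3
          simp [capVal_of_ne h1, capVal_of_ne (Ne.symm h1), offDiag_self]
        · simp [capVal_of_ne h1, capVal_of_ne (Ne.symm h1), capVal_of_ne h3, offDiag_self]
      · by_cases h3 : a = c
        · subst h3
          by_cases h4 : b = d
          · subst h4
            simp [capVal_of_ne h1, capVal_of_ne (Ne.symm h1), capVal_of_ne h2]
          · simp [capVal_of_ne h1, capVal_of_ne h2, capVal_of_ne h4, capVal_of_ne (Ne.symm h1)]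
        · by_cases h4 : a = d
          · subst h4
            by_cases h5 : b = c
            · subst h5
              simp only [capVal_of_ne h1, capVal_of_ne h2, offDiag_comm b a, capVal_self]
              ring
            · simp [capVal_of_ne h1, capVal_of_ne h2, capVal_of_ne h3, capVal_of_ne h5]
          · simp [capVal_of_ne h1, capVal_of_ne h2, capVal_of_ne h3, capVal_of_ne h4]
  | cup =>
    refine eval_eq_of_evalLin Γ val (one_hom_ext Γ ?_)
    have h1 : evalLin Γ val (.comp (Z := wd [1, 1, 1, 1]) cup (.whisk (wd [1, 1]) cup)) (one Γ) =
        ∑ i, ∑ j, w₄ Γ i i j j := by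
      refine (evalLin_comp Γ val cup (Z := wd [1, 1, 1, 1]) (.whisk (wd [1, 1]) cup) _).trans ?_
      refine (congrArg _ hcup).trans ((map_sum _ _ _).trans ?_)
      exact Finset.sum_congr rfl fun i _ => hcup.whisk_two i i
    have h2 : web Γ (.pos₂ (.ms 1 1)) (∑ i, ∑ j, w₄ Γ i i j j) = ∑ i, ∑ j,
        (k.diag i j • w₄ Γ i i j j + k.offDiag i j • w₄ Γ i j i j) := by
      rw [map_sum]
      refine Finset.sum_congr rfl fun i _ => ?_
      rw [map_sum]
      exact Finset.sum_congr rfl fun j _ => hs.pos₂ i i j j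
    refine (evalLin_comp Γ val (Y := wd [1, 1, 1, 1]) _ _ _).trans
      (Eq.trans ?_ (evalLin_comp Γ val (Y := wd [1, 1, 1, 1]) _ _ _).symm)
    rw [h1, evalLin_comp, evalLin_comp, evalLin_web, evalLin_web, evalLin_web, h2]
    simp only [map_sum, map_add, map_smul, hs.pos₁, hs.pos₃, offDiag_self, zero_smul, add_zero,
      smul_add, Finset.sum_add_distrib, smul_smul]
    congr 1
    · exact Finset.sum_congr rfl fun i _ => Finset.sum_congr rfl fun j _ => by
        rw [diag_self_eq i j]
    · congr 1
      rw [Finset.sum_comm]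
      exact Finset.sum_congr rfl fun i _ => Finset.sum_congr rfl fun j _ => by
        rw [offDiag_comm j i]

end CupCap
end WordSpace

namespace WordSpace
section CupRelations
variable {n : ℕ} {Γ : GammaA .ext n}
  {val : ∀ {X Y : AWeb}, CupGen X Y → ((orbit (webEmb ⋙ Γ.functor) (soTriv n)).obj X ⟶
    (orbit (webEmb ⋙ Γ.functor) (soTriv n)).obj Y)}

lemma lasso_term (hcap : IsCap Γ val cap₀) (a b i : Fin n) :
    evalLin Γ val (.comp (X := wd [1, 1, 1, 1]) (Z := wd [1, 1]) (_root_.web (.pos₂ .underCross))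
      (.comp (_root_.web (.pos₁₃ (.ms 1 1) (.ms 1 1)))
        (.comp (_root_.web (.pos₂ .overCross)) (.whisk (wd [1, 1]) cap₀)))) (w₄ Γ a b i i) =
      (Kind.ext.diag a i * Kind.ext.diag b i * capCoeff i) • w₂ Γ a b +
        (if i = a then 0 else capVal a b) • w₂ Γ i i := by
  have hs := isSwap_ms Γ
  have hu := hs.add_id (-q)
  have ho := hs.add_id (-q⁻¹)
  have h1 : ∀ i j l m, evalLin Γ val (.comp (Y := wd [1, 1, 1, 1]) (Z := wd [1, 1])
      (_root_.web (.pos₂ .overCross)) (.whisk (wd [1, 1]) cap₀)) (w₄ Γ i j l m) =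
        ((-q⁻¹ + Kind.ext.diag j l) * capVal l m) • w₂ Γ i j +
          (Kind.ext.offDiag j l * capVal j m) • w₂ Γ i l := by
    intro i j l m
    refine (evalLin_comp Γ val (Y := wd [1, 1, 1, 1]) (Z := wd [1, 1]) _ _ _).trans ?_
    rw [evalLin_web]
    refine (congrArg _ (ho.pos₂ i j l m)).trans ((map_add _ _ _).trans ?_)
    refine (congrArg₂ _ (map_smul _ _ _) (map_smul _ _ _)).trans ?_
    rw [mul_smul, mul_smul]
    exact congrArg₂ (fun x y => (-q⁻¹ + Kind.ext.diag j l) • x + Kind.ext.offDiag j l • y)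
      (hcap.whisk_two i j l m) (hcap.whisk_two i l j m)
  have h0 : web Γ (.pos₁₃ (.ms 1 1) (.ms 1 1)) (w₄ Γ a b i i) = 0 := by
    rw [hs.pos₁₃ hs, Kind.ext_diag_self, offDiag_self]
    simp
  refine (evalLin_comp Γ val _ _ _).trans ?_
  rw [evalLin_web]
  refine (congrArg _ (hu.pos₂ a b i i)).trans ?_
  refine (evalLin_comp Γ val _ _ _).trans ?_
  rw [evalLin_web, map_add, map_smul, map_smul, h0, smul_zero, zero_add, hs.pos₁₃ hs]
  simp only [map_smul, map_add, h1]
  by_cases hb : b = i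
  · subst hb
    rw [offDiag_self, zero_smul, Kind.ext_diag_self, mul_zero, zero_mul, zero_smul, zero_add]
    by_cases ha : b = a
    · rw [if_pos ha, zero_smul]
    · rw [if_neg ha, capVal_of_ne (Ne.symm ha), zero_smul]
  · rw [capVal_of_ne hb, capVal_of_ne (Ne.symm hb), offDiag_self, capVal_self]
    simp only [mul_zero, zero_smul, zero_add, add_zero, zero_mul, smul_zero, smul_smul]
    by_cases ha : i = a
    · subst ha
      simp [offDiag_self, Kind.ext_diag_self]
    · rw [if_neg ha, capVal_of_ne (Ne.symm ha), mul_zero, mul_zero, zero_smul, add_zero, smul_add,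
        smul_smul, smul_smul]
      have h2 : Kind.ext.offDiag b i = -1 := if_neg hb
      have h3 : Kind.ext.offDiag i b = -1 := if_neg (Ne.symm hb)
      have h4 : Kind.ext.offDiag a i = -1 := if_neg (Ne.symm ha)
      rw [h2, h3, h4]
      congr 2
      · ring
      · ring

lemma eval_cupRel (hcup : IsCup Γ val cup₀) (hcap : IsCap Γ val cap₀) {X Y : AWeb}
    {f g : ModPre CupGen X Y} (h : CupRel (q ^ n) f g) :
    ModPre.eval (webEmb ⋙ Γ.functor) (soTriv n) val f =
      ModPre.eval (webEmb ⋙ Γ.functor) (soTriv n) val g := by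
  have hs := isSwap_ms Γ
  cases h with
  | circle =>
    refine eval_eq_of_evalLin Γ val (one_hom_ext Γ ?_)
    rw [evalLin_smul, evalLin_id, evalLin_comp, hcup, map_sum, zqnum_one_q_pow, add_zero,
      ← sum_capCoeff, Finset.sum_smul]
    exact Finset.sum_congr rfl fun i _ => (hcap i i).trans (by rw [capVal_self])
  | bubble =>
    refine eval_eq_of_evalLin Γ val (e_hom_ext Γ fun a => ?_)
    rw [evalLin_smul, evalLin_id, zqnum_one_q_pow, ← sub_eq_add_neg, ← sum_diag_capCoeff a,
      Finset.sum_smul]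
    refine (evalLin_comp Γ val (X := wd [1]) _ _ _).trans ?_
    refine (congrArg _ (hcup.whisk_one a)).trans ((map_sum _ _ _).trans ?_)
    refine Finset.sum_congr rfl fun i _ => ?_
    refine (evalLin_comp Γ val (X := wd [1, 1, 1]) (Z := wd [1]) _ _ _).trans ?_
    rw [evalLin_web]
    refine (congrArg _ (hs.on₁₂ a i i)).trans ((map_add _ _ _).trans ?_)
    refine (congrArg₂ _ (map_smul _ _ _) (map_smul _ _ _)).trans ?_
    refine (congrArg₂ (fun x y => Kind.ext.diag a i • x + Kind.ext.offDiag a i • y)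
      (hcap.whisk_one a i i) (hcap.whisk_one i a i)).trans ?_
    by_cases ha : a = i
    · subst ha
      rw [offDiag_self, zero_smul, add_zero, capVal_self, smul_smul]
    · rw [capVal_of_ne ha, zero_smul, smul_zero, add_zero, capVal_self, smul_smul]
  | lasso =>
    refine eval_eq_of_evalLin Γ val (w₂_hom_ext Γ fun a b => ?_)
    rw [evalLin_add, evalLin_smul, evalLin_id, zqnum_one_q_pow, ← sub_eq_add_neg]
    refine (evalLin_comp Γ val (X := wd [1, 1]) _ _ _).trans ?_
    refine (congrArg _ (hcup.whisk_two a b)).trans ((map_sum _ _ _).trans ?_)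
    refine (Finset.sum_congr rfl fun i _ => lasso_term hcap a b i).trans ?_
    rw [Finset.sum_add_distrib, ← Finset.sum_smul, sum_diag_diag_capCoeff, add_smul, evalLin_comp,
      hcap, map_smul, hcup]
    have h1 : capVal a b • w₂ Γ a b + ∑ i, (if i = a then 0 else capVal a b) • w₂ Γ i i =
        capVal a b • ∑ i, w₂ Γ i i := by
      by_cases hab : a = b
      · subst hab
        rw [← Finset.add_sum_erase _ (fun i => w₂ Γ i i) (Finset.mem_univ a), smul_add,
          ← Finset.add_sum_erase _ _ (Finset.mem_univ a), if_pos rfl, zero_smul, zero_add,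
          Finset.smul_sum]
        congr 1
        refine Finset.sum_congr rfl fun i hi => ?_
        rw [if_neg (Finset.ne_of_mem_erase hi)]
      · simp [capVal_of_ne hab]
    rw [← h1]
    abel
  | lollipop_cup =>
    refine eval_eq_of_evalLin Γ val (one_hom_ext Γ ?_)
    rw [evalLin_zero, evalLin_comp, hcup, evalLin_web, map_sum]
    refine Finset.sum_eq_zero fun i _ => (strandEquiv Γ 2).injective ?_
    refine (strandEquiv_merge Γ (a := 1) (b := 1) (c := 2) rfl (e Γ i) (e Γ i)).trans ?_
    rw [map_zero]
    have h1 : strandEquiv Γ 1 (e Γ i) = Kind.ext.ev 1 (unitOcc i) :=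
      LinearEquiv.apply_symm_apply _ _
    rw [h1]
    refine (Kind.mulLin_thin_right .ext (a := 1) rfl _ i).trans ?_
    have hz : Kind.ext.ev 2 (unitOcc i + unitOcc i) = 0 := by
      refine Kind.ev_of_not_valid _ _ _ fun hv => ?_
      have := hv rfl i
      simp at this
    exact (congrArg _ hz).trans (smul_zero _)
  | lollipop_cap =>
    refine eval_eq_of_evalLin Γ val ?_
    have h1 : ∀ x, evalLin Γ val (.comp (_root_.web .split₁₁) cap₀) ((strandEquiv Γ 2).symm x) = 0 := by
      refine fun x => LinearMap.congr_fun (f := (evalLin Γ val (.comp (_root_.web .split₁₁) cap₀)) ∘ₗ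
        (strandEquiv Γ 2).symm.toLinearMap) (g := 0) (Kind.hom_ext fun m hv hd => ?_) x
      refine (evalLin_comp Γ val _ _ _).trans ?_
      rw [evalLin_web]
      have h2 := web_split_symm Γ (a := 1) (b := 1) (c := 2) rfl (Kind.ext.ev 2 m)
      refine (congrArg _ (h2.trans (congrArg (pair Γ 1 1)
        (Kind.comulLin_thin_right .ext (a := 1) rfl m)))).trans ?_
      refine (congrArg _ (map_sum (pair Γ 1 1) _ _)).trans ((map_sum _ _ _).trans ?_)
      refine Finset.sum_eq_zero fun i _ => ?_
      refine (congrArg _ (map_smul (pair Γ 1 1) _ _)).trans ((map_smul _ _ _).trans ?_)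
      by_cases hm : m i = 0
      · have h3 : Kind.ext.thinR m i = 0 := by simp [Kind.thinR, hm, Kind.mult_zero]
        rw [h3, zero_smul]
      · obtain ⟨m', rfl⟩ := Kind.exists_eq_add_unitOcc hm
        rw [deg_add, deg_unitOcc] at hd
        obtain ⟨j, rfl⟩ := Kind.eq_unitOcc_of_deg (Nat.succ_injective hd)
        rw [add_tsub_cancel_right]
        have hij : j ≠ i := by
          rintro rfl
          have := hv rfl j
          simp at this
        have h3 : evalLin Γ val cap₀ (w₂ Γ j i) = 0 := by
          rw [hcap, capVal_of_ne hij, zero_smul]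
        exact (congrArg _ h3).trans (smul_zero _)
    refine LinearMap.ext fun x => ?_
    have h2 : (strandEquiv Γ 2).symm (strandEquiv Γ 2 x) = x := LinearEquiv.symm_apply_apply _ x
    exact (congrArg _ h2).symm.trans ((h1 _).trans (evalLin_zero Γ val x).symm)
  | slide h => exact eval_slide hcup hcap h

end CupRelations
end WordSpace

section Invariants
variable {n : ℕ}

lemma FinRep.ρ_soGen_tmul (X Y : FinRep (Uq n)) (l : Fin (n - 1)) (x : X.V) (y : Y.V) :
    (X ⊗ Y).ρ (soGen l) (x ⊗ₜ[Kq] y) =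
      X.ρ (soGen l) x ⊗ₜ[Kq] y + X.ρ (Uq.qh (-coroot l)) x ⊗ₜ[Kq] Y.ρ (soGen l) y := by
  have h : (X ⊗ Y).ρ (soGen l) = FinRep.extAct X Y (Coalgebra.comul (R := Kq) (soGen l)) := rfl
  rw [h, comul_soGen, map_add]
  have h2 : ∀ (f g : Module.End Kq (X.V ⊗[Kq] Y.V)) (t), (f + g) t = f t + g t :=
    fun _ _ _ => rfl
  refine (h2 _ _ _).trans (congrArg₂ _ ?_ rfl)
  change X.ρ (soGen l) x ⊗ₜ[Kq] Y.ρ 1 y = _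
  rw [map_one]
  rfl

namespace Kind
variable (k : Kind)

lemma ρ_soGen_ev_one (l : Fin (n - 1)) (i : Fin n) :
    (k.pow n 1).ρ (soGen l) (k.ev 1 (unitOcc i)) =
      (if i = lo l then k.ev 1 (unitOcc (hi l)) else 0) -
        (if i = hi l then q⁻¹ • k.ev 1 (unitOcc (lo l)) else 0) := by
  have h1 : ∀ j j' : Fin n, move (unitOcc j) j j' = unitOcc j' := by
    intro j j'
    simp [move]
  rw [soGen, map_sub, map_mul]
  change (k.pow n 1).ρ (Uq.F l) _ - (k.pow n 1).ρ (Uq.qh (-coroot l)) ((k.pow n 1).ρ (Uq.E l) _) = _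
  rw [ρ_F_ev k 1 l _ (k.valid_unitOcc i), ρ_E_ev k 1 l _ (k.valid_unitOcc i), map_smul, ρ_qh_ev,
    weight_neg_coroot]
  congr 1
  · by_cases h : i = lo l
    · subst h
      rw [if_pos rfl, h1, unitOcc_self]
      simp [qnum_one]
    · rw [if_neg h, unitOcc_of_ne (Ne.symm h)]
      simp [qnum_zero]
  · by_cases h : i = hi l
    · subst h
      rw [if_pos rfl, h1, unitOcc_self, unitOcc_self,
        unitOcc_of_ne (lo_lt_hi l).ne']
      simp [qnum_one]
    · rw [if_neg h, unitOcc_of_ne (Ne.symm h)]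
      simp [qnum_zero]

lemma ρ_qh_ev_one (h : Fin n → ℤ) (i : Fin n) :
    (k.pow n 1).ρ (Uq.qh h) (k.ev 1 (unitOcc i)) = q ^ h i • k.ev 1 (unitOcc i) := by
  rw [ρ_qh_ev, weight_unitOcc]

/-- The invariant vector of the tensor square of the vector representation. -/
def cupVec (n : ℕ) : (k.pow n 1 ⊗ k.pow n 1 : FinRep (Uq n)).V :=
  ∑ i : Fin n, k.ev 1 (unitOcc i) ⊗ₜ[Kq] k.ev 1 (unitOcc i)

lemma cupVec_invariant (l : Fin (n - 1)) :
    (k.pow n 1 ⊗ k.pow n 1 : FinRep (Uq n)).ρ (soGen l) (k.cupVec n) = 0 := by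
  have h1 : ∀ i : Fin n, (k.pow n 1 ⊗ k.pow n 1 : FinRep (Uq n)).ρ (soGen l)
      (k.ev 1 (unitOcc i) ⊗ₜ[Kq] k.ev 1 (unitOcc i)) =
      (if i = lo l then k.ev 1 (unitOcc (hi l)) ⊗ₜ[Kq] k.ev 1 (unitOcc (lo l)) +
        q⁻¹ • (k.ev 1 (unitOcc (lo l)) ⊗ₜ[Kq] k.ev 1 (unitOcc (hi l))) else 0) -
      (if i = hi l then q⁻¹ • (k.ev 1 (unitOcc (lo l)) ⊗ₜ[Kq] k.ev 1 (unitOcc (hi l))) +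
        k.ev 1 (unitOcc (hi l)) ⊗ₜ[Kq] k.ev 1 (unitOcc (lo l)) else 0) := by
    intro i
    refine (FinRep.ρ_soGen_tmul _ _ l _ _).trans ?_
    rw [ρ_soGen_ev_one, ρ_qh_ev_one]
    have hne := (lo_lt_hi l).ne
    by_cases h : i = lo l
    · subst h
      rw [if_pos rfl, if_neg hne, if_pos rfl, if_neg hne, sub_zero, sub_zero, Pi.neg_apply,
        coroot_lo, TensorProduct.smul_tmul', zpow_neg_one]
    · by_cases h' : i = hi l
      · subst h'
        rw [if_neg h, if_pos rfl, if_neg h, if_pos rfl, zero_sub, zero_sub, Pi.neg_apply, coroot_hi,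
          neg_neg, zpow_one, TensorProduct.neg_tmul, TensorProduct.tmul_neg,
          TensorProduct.smul_tmul_smul, mul_inv_cancel₀ Uq.q_ne_zero, one_smul,
          TensorProduct.smul_tmul']
        abel
      · simp only [if_neg h, if_neg h', sub_zero]
        simp
        rfl
  refine (map_sum ((k.pow n 1 ⊗ k.pow n 1 : FinRep (Uq n)).ρ (soGen l)) _ _).trans ?_
  have h2 : ∀ {M : Type} [AddCommGroup M] (u v : M), ∑ i, ((if i = lo l then u + v else 0) -
      (if i = hi l then v + u else 0)) = 0 := by
    intro M _ u v
    rw [Finset.sum_sub_distrib, Finset.sum_ite_eq', Finset.sum_ite_eq', if_pos (Finset.mem_univ _),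
      if_pos (Finset.mem_univ _), add_comm, sub_self]
  exact (Finset.sum_congr rfl fun i _ => h1 i).trans (h2 _ _)

/-- The invariant bilinear form on the vector representation. -/
def capForm (n : ℕ) : (k.pow n 1).V ⊗[Kq] (k.pow n 1).V →ₗ[Kq] Kq :=
  TensorProduct.lift (k.mkLin 1 fun m => (∑ i, (m i : Kq) * capCoeff i) • k.form n 1 (k.ev 1 m))

lemma capForm_ev (i j : Fin n) :
    k.capForm n (k.ev 1 (unitOcc i) ⊗ₜ k.ev 1 (unitOcc j)) = capVal i j := by
  refine (LinearMap.congr_fun (k.mkLin_ev _ (k.valid_unitOcc i) (deg_unitOcc i)) _).trans ?_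
  rw [LinearMap.smul_apply, k.form_ev_ev (k.valid_unitOcc i) (deg_unitOcc i), norm_unitOcc,
    Finset.sum_eq_single i]
  · by_cases h : i = j
    · subst h
      simp [capVal_self]
    · have h' : unitOcc j ≠ unitOcc i := by
        intro he
        have := congrFun he i
        rw [unitOcc_of_ne h, unitOcc_self] at this
        exact zero_ne_one this
      rw [if_neg h', capVal_of_ne h, smul_zero]
  · intro l _ hl
    rw [unitOcc_of_ne hl, Nat.cast_zero, zero_mul]
  · simp

lemma capCoeff_hi (l : Fin (n - 1)) : capCoeff (hi l) = q⁻¹ * q⁻¹ * capCoeff (lo l) := by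
  rw [capCoeff, capCoeff, ← zpow_neg_one, ← zpow_add₀ Uq.q_ne_zero, ← zpow_add₀ Uq.q_ne_zero]
  congr 1
  simp only [hi, lo]
  push_cast
  ring

lemma capForm_coinvariant (l : Fin (n - 1)) (v : (k.pow n 1 ⊗ k.pow n 1 : FinRep (Uq n)).V) :
    k.capForm n ((k.pow n 1 ⊗ k.pow n 1 : FinRep (Uq n)).ρ (soGen l) v) = 0 := by
  have key : k.capForm n ∘ₗ (k.pow n 1 ⊗ k.pow n 1 : FinRep (Uq n)).ρ (soGen l) = 0 := by
    refine tensor_hom_ext fun x y _ hx _ hy => ?_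
    obtain ⟨i, rfl⟩ := eq_unitOcc_of_deg hx
    obtain ⟨j, rfl⟩ := eq_unitOcc_of_deg hy
    refine (congrArg (k.capForm n) (FinRep.ρ_soGen_tmul _ _ l _ _)).trans ?_
    rw [ρ_soGen_ev_one, ρ_soGen_ev_one, ρ_qh_ev_one]
    have hne := (lo_lt_hi l).ne
    have h3 := capCoeff_hi l
    have hq := Uq.q_ne_zero
    by_cases hi1 : i = lo l
    · subst hi1
      by_cases hj : j = hi l
      · subst hj
        rw [if_pos rfl, if_neg hne, if_neg hne.symm, if_pos rfl, sub_zero, zero_sub, Pi.neg_apply,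
          coroot_lo, TensorProduct.tmul_neg, TensorProduct.smul_tmul_smul, map_add, map_neg,
          map_smul, capForm_ev, capForm_ev, capVal_self, capVal_self, h3, zpow_neg_one]
        simp
        rfl
      · rw [if_pos rfl, if_neg hne, if_neg hj, sub_zero, sub_zero, map_add, capForm_ev,
          capVal_of_ne (Ne.symm hj), zero_add]
        by_cases hj' : j = lo l
        · rw [if_pos hj', ← TensorProduct.smul_tmul', map_smul, capForm_ev, capVal_of_ne hne, smul_zero]
          rfl
        · rw [if_neg hj', TensorProduct.tmul_zero, map_zero]
          rfl
    · by_cases hi2 : i = hi l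
      · subst hi2
        by_cases hj : j = lo l
        · subst hj
          rw [if_pos rfl, if_neg hne, if_neg hne.symm, if_pos rfl, sub_zero, zero_sub, Pi.neg_apply,
            coroot_hi, neg_neg, zpow_one, TensorProduct.neg_tmul, map_add, map_neg,
            ← TensorProduct.smul_tmul', ← TensorProduct.smul_tmul', map_smul, map_smul, capForm_ev,
            capForm_ev, capVal_self, capVal_self, h3]
          simp only [smul_eq_mul]
          rw [mul_assoc, mul_inv_cancel_left₀ hq, neg_add_cancel]
          rfl
        · rw [if_neg hi1, if_pos rfl, if_neg hj, zero_sub, zero_sub, map_add, TensorProduct.neg_tmul,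
            map_neg, ← TensorProduct.smul_tmul', map_smul, capForm_ev, capVal_of_ne (Ne.symm hj),
            smul_zero, neg_zero, zero_add]
          by_cases hj' : j = hi l
          · rw [if_pos hj', TensorProduct.tmul_neg, TensorProduct.smul_tmul_smul, map_neg, map_smul,
              capForm_ev, capVal_of_ne hne.symm, smul_zero, neg_zero]
            rfl
          · rw [if_neg hj', neg_zero, TensorProduct.tmul_zero, map_zero]
            rfl
      · rw [if_neg hi1, if_neg hi2, sub_zero, TensorProduct.zero_tmul, zero_add,
          ← TensorProduct.smul_tmul', map_smul]
        by_cases hj : j = lo l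
        · subst hj
          rw [if_pos rfl, if_neg hne, sub_zero, capForm_ev, capVal_of_ne hi2, smul_zero]
          rfl
        · rw [if_neg hj, zero_sub]
          by_cases hj' : j = hi l
          · rw [if_pos hj', TensorProduct.tmul_neg, TensorProduct.tmul_smul, map_neg, map_smul,
              capForm_ev, capVal_of_ne hi1, smul_zero, neg_zero, smul_zero]
            rfl
          · rw [if_neg hj', neg_zero, TensorProduct.tmul_zero, map_zero, smul_zero]
            rfl
  exact LinearMap.congr_fun key v

end Kind
end Invariants

namespace Kind
variable {n : ℕ}

lemma qnum_two_ne_zero : qnum 2 ≠ 0 := qnum_natCast_ne_zero (k := 2) two_ne_zero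

/-- The invariant functional on the symmetric square. -/
def endForm (n : ℕ) : (sym.pow n 2).V →ₗ[Kq] Kq :=
  (qnum 2)⁻¹ • (sym.capForm n ∘ₗ sym.comulLin n 1 1 2)

/-- The invariant vector of the symmetric square. -/
def dotVec (n : ℕ) : (sym.pow n 2).V :=
  (qnum 2)⁻¹ • ∑ i : Fin n, sym.ev 2 (unitOcc i + unitOcc i)

lemma mulLin_unitOcc (i j : Fin n) :
    sym.mulLin n 1 1 2 (sym.ev 1 (unitOcc i) ⊗ₜ sym.ev 1 (unitOcc j)) =
      sym.s ^ above (unitOcc i) j • sym.ev 2 (unitOcc i + unitOcc j) :=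
  sym.mulLin_thin_right rfl _ j

lemma mulLin_unitOcc_self (i : Fin n) :
    sym.mulLin n 1 1 2 (sym.ev 1 (unitOcc i) ⊗ₜ sym.ev 1 (unitOcc i)) =
      sym.ev 2 (unitOcc i + unitOcc i) := by
  rw [mulLin_unitOcc, above_unitOcc, if_neg (lt_irrefl i), pow_zero, one_smul]

lemma endForm_mulLin (i j : Fin n) :
    endForm n (sym.mulLin n 1 1 2 (sym.ev 1 (unitOcc i) ⊗ₜ sym.ev 1 (unitOcc j))) = capVal i j := by
  have h : endForm n (sym.mulLin n 1 1 2 (sym.ev 1 (unitOcc i) ⊗ₜ sym.ev 1 (unitOcc j))) =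
      (qnum 2)⁻¹ * (sym.diag i j * capVal i j + sym.offDiag i j * capVal j i) := by
    refine (congrArg (fun t => (qnum 2)⁻¹ * sym.capForm n t) (sym.comulLin_mulLin_thin i j)).trans ?_
    rw [map_add, map_smul, map_smul, capForm_ev, capForm_ev]
    rfl
  rw [h]
  by_cases hij : i = j
  · subst hij
    rw [offDiag, if_pos rfl, zero_mul, add_zero, diag, if_pos rfl,
      ← mul_assoc]
    have : sym.mult 2 = qnum 2 := rfl
    rw [this, inv_mul_cancel₀ qnum_two_ne_zero, one_mul]
  · rw [capVal_of_ne hij, capVal_of_ne (Ne.symm hij)]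
    ring

lemma endForm_self (i : Fin n) : endForm n (sym.ev 2 (unitOcc i + unitOcc i)) = capCoeff i := by
  rw [← mulLin_unitOcc_self, endForm_mulLin, capVal_self]

lemma endForm_of_ne {i j : Fin n} (h : i ≠ j) :
    endForm n (sym.ev 2 (unitOcc i + unitOcc j)) = 0 := by
  have h1 := endForm_mulLin i j
  rw [mulLin_unitOcc, map_smul, capVal_of_ne h, smul_eq_mul] at h1
  exact (mul_eq_zero.mp h1).resolve_left (pow_ne_zero _ sym.s_ne_zero)

lemma endForm_dotVec : endForm n (dotVec n) = (qnum 2)⁻¹ * qnum n := by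
  rw [dotVec, map_smul, map_sum, Finset.sum_congr rfl fun i _ => endForm_self i, sum_capCoeff,
    smul_eq_mul]

/-- Contracting the right component of the comultiplication with the invariant functional. -/
def contract (n a c : ℕ) : (sym.pow n c).V →ₗ[Kq] (sym.pow n a).V :=
  (TensorProduct.rid Kq _).toLinearMap ∘ₗ TensorProduct.map LinearMap.id (endForm n) ∘ₗ
    sym.comulLin n a 2 c

lemma contract_ev {a c : ℕ} (hc : a + 2 = c) (m : Fin n → ℕ) :
    contract n a c (sym.ev c m) = (qnum 2)⁻¹ • ∑ j, (sym.thinR m j * sym.thinR (m - unitOcc j) j *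
      capCoeff j) • sym.ev a (m - unitOcc j - unitOcc j) := by
  have h1 : ∀ t : (sym.pow n a).V ⊗[Kq] (sym.pow n 2).V,
      TensorProduct.rid Kq _ (TensorProduct.map LinearMap.id (endForm n) t) =
        (qnum 2)⁻¹ • TensorProduct.rid Kq _ (TensorProduct.map LinearMap.id (sym.capForm n)
          (TensorProduct.map LinearMap.id (sym.comulLin n 1 1 2) t)) := by
    intro t
    induction t using TensorProduct.induction_on with
    | zero => simp only [map_zero, smul_zero]
    | tmul x y => simp [endForm, smul_smul]
    | add s t hs ht => simp only [map_add, smul_add, hs, ht]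
  refine (h1 _).trans (congrArg _ ?_)
  rw [← sym.comulLin_coassoc (a := a) (b := 1) (c := 1) (ab := a + 1) (bc := 2) (abc := c) rfl rfl,
    comulLin_thin_right sym (a := a + 1) (by omega), map_sum, map_sum, map_sum, map_sum]
  refine Finset.sum_congr rfl fun j _ => ?_
  rw [map_smul, TensorProduct.map_tmul, LinearMap.id_apply, comulLin_thin_right sym rfl,
    TensorProduct.sum_tmul]
  simp only [map_smul, map_sum, ← TensorProduct.smul_tmul', TensorProduct.assoc_tmul,
    TensorProduct.map_tmul, LinearMap.id_apply, capForm_ev, TensorProduct.rid_tmul]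
  rw [Finset.sum_eq_single j]
  · rw [capVal_self, smul_smul, smul_smul, mul_assoc]
  · intro i _ hi
    rw [capVal_of_ne hi, zero_smul, smul_zero]
  · simp

/-- The endomorphism of the symmetric power given by multiplication with the invariant vector followed
by contraction with the invariant functional. -/
def kLin (n a c : ℕ) : (sym.pow n a).V →ₗ[Kq] (sym.pow n a).V :=
  contract n a c ∘ₗ sym.mulLin n a 2 c ∘ₗ (TensorProduct.mk Kq _ _).flip (dotVec n)

lemma thinR_thinR (m : Fin n → ℕ) (j : Fin n) : sym.thinR m j * sym.thinR (m - unitOcc j) j =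
    q ^ (-2 * (below m j : ℤ)) * (qnum (m j) * qnum ((m j : ℤ) - 1)) := by
  by_cases h : m j = 0
  · simp [thinR, h, mult_zero, qnum_zero]
  · obtain ⟨p, rfl⟩ := exists_eq_add_unitOcc h
    have hb : below (p + unitOcc j) j = below p j := by simp [below_add, below_unitOcc]
    have hm : ((p + unitOcc j) j : ℤ) - 1 = p j := by simp
    rw [add_tsub_cancel_right, thinR, thinR, hb, hm]
    have h2 : sym.r = q⁻¹ := rfl
    have h3 : sym.b = 1 := rfl
    have h4 : q⁻¹ ^ below p j * q⁻¹ ^ below p j = q ^ (-2 * (below p j : ℤ)) := by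
      rw [← pow_add, inv_pow, ← zpow_natCast, ← zpow_neg]
      congr 1
      push_cast
      ring
    rw [h2, h3, one_pow, one_pow, ← h4]
    change _ * 1 * qnum _ * (_ * 1 * qnum _) = _
    ring

lemma qnum_product (a : ℤ) :
    qnum (a + 2) * qnum (a + 1) = qnum 2 * qnum (2 * a + 1) + qnum a * qnum (a - 1) := by
  have hq := Uq.q_ne_zero
  simp only [qnum, zpow_add₀ hq, zpow_sub₀ hq, neg_add, neg_sub, zpow_neg, two_mul, zpow_one]
  have hz : q ^ a ≠ 0 := zpow_ne_zero _ hq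
  rw [show (2 : ℤ) = 1 + 1 by norm_num, zpow_add₀ hq, zpow_one]
  generalize q ^ a = x at *
  have : q - q⁻¹ ≠ 0 ∨ q - q⁻¹ = 0 := (em _).symm
  rcases this with h | h
  · simp only [div_mul_div_comm, ← add_div]
    congr 1
    field_simp
    ring
  · simp [h]

/-- The off-diagonal coefficients of the operator `kLin`. -/
def kCoeff (m : Fin n → ℕ) (i j : Fin n) : Kq :=
  q ^ (2 * (above m i : ℤ) - 2 * below m j - if i < j then 4 else 0) *
    (qnum (m j) * qnum ((m j : ℤ) - 1)) * capCoeff j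

lemma kCoeff_of_le_one {m : Fin n → ℕ} {j : Fin n} (h : m j ≤ 1) (i : Fin n) : kCoeff m i j = 0 := by
  rw [kCoeff]
  interval_cases m j
  · simp [qnum_zero]
  · simp [qnum_zero]

lemma kLin_ev {a c : ℕ} (hc : a + 2 = c) {m : Fin n → ℕ} (hm : deg m = a) :
    kLin n a c (sym.ev a m) = ((qnum 2)⁻¹ * qnum ((n : ℤ) + 2 * a)) • sym.ev a m +
      ((qnum 2)⁻¹ * (qnum 2)⁻¹) • ∑ i, ∑ j, kCoeff m i j •
        sym.ev a (m + (unitOcc i + unitOcc i) - unitOcc j - unitOcc j) := by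
  have hterm : ∀ i j, (q ^ (2 * (above m i : ℤ)) * (sym.thinR (m + (unitOcc i + unitOcc i)) j *
      sym.thinR (m + (unitOcc i + unitOcc i) - unitOcc j) j * capCoeff j)) •
        sym.ev a (m + (unitOcc i + unitOcc i) - unitOcc j - unitOcc j) =
      (if i = j then (qnum 2 * (q ^ (-1 * skew (fun k => (2 * m k + 1 : ℕ)) i) *
        qnum ((2 * m i + 1 : ℕ)))) • sym.ev a m else 0) + kCoeff m i j •
          sym.ev a (m + (unitOcc i + unitOcc i) - unitOcc j - unitOcc j) := by
    intro i j
    rw [thinR_thinR]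
    by_cases hij : i = j
    · subst hij
      have h1 : m + (unitOcc i + unitOcc i) - unitOcc i - unitOcc i = m := by
        rw [← add_assoc, add_tsub_cancel_right, add_tsub_cancel_right]
      have h2 : below (m + (unitOcc i + unitOcc i)) i = below m i := by
        simp [below_add, below_unitOcc]
      have h3 : (((m + (unitOcc i + unitOcc i)) i : ℕ) : ℤ) = m i + 2 := by
        simp only [Pi.add_apply, unitOcc_self]
        push_cast
        ring
      have h4 : skew (fun k => (2 * m k + 1 : ℕ)) i =
          2 * ((below m i : ℤ) - above m i) + skew (fun _ => 1) i := by
        have h5 : (fun k => ((2 * m k + 1 : ℕ) : ℤ)) = fun k =>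
            (fun k => ((m k : ℕ) : ℤ)) k - (fun k => (fun _ => (-1 : ℤ)) k - ((m k : ℕ) : ℤ)) k := by
          funext k
          push_cast
          ring
        have h6 : skew (fun _ : Fin n => (-1 : ℤ)) i = - skew (fun _ => 1) i := by
          have := skew_sub (fun _ : Fin n => (0 : ℤ)) (fun _ => 1) i
          simp only [zero_sub] at this
          rw [this]
          simp [skew, skewTerm]
        rw [h5, skew_sub, skew_sub, h6, skew_natCast]
        ring
      rw [if_pos rfl, h1, h2, h3, ← add_smul, kCoeff, if_neg (lt_irrefl i), h4]
      congr 1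
      rw [show (m i : ℤ) + 2 - 1 = m i + 1 by ring, qnum_product, capCoeff_eq,
        show ((2 * m i + 1 : ℕ) : ℤ) = 2 * m i + 1 by push_cast; ring, mul_add, sub_zero]
      have hq := Uq.q_ne_zero
      have e1 : q ^ (-1 * (2 * ((below m i : ℤ) - above m i) + skew (fun _ => 1) i)) =
          q ^ (2 * (above m i : ℤ)) * q ^ (-2 * (below m i : ℤ)) * q ^ (-skew (fun _ => 1) i) := by
        rw [← zpow_add₀ hq, ← zpow_add₀ hq]
        congr 1
        ring
      have e2 : q ^ (2 * (above m i : ℤ) - 2 * below m i) =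
          q ^ (2 * (above m i : ℤ)) * q ^ (-2 * (below m i : ℤ)) := by
        rw [← zpow_add₀ hq]
        congr 1
      rw [e1, e2]
      ring
    · rw [if_neg hij, zero_add, kCoeff]
      have h2 : (below (m + (unitOcc i + unitOcc i)) j : ℤ) =
          below m j + if i < j then 2 else 0 := by
        rw [below_add, below_add, below_unitOcc]
        split_ifs <;> push_cast <;> ring
      have h3 : (m + (unitOcc i + unitOcc i)) j = m j := by
        simp [unitOcc_of_ne (Ne.symm hij)]
      rw [h2, h3, ← mul_assoc, ← mul_assoc, ← zpow_add₀ Uq.q_ne_zero]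
      congr 4
      split_ifs <;> ring
  have h0 : kLin n a c (sym.ev a m) = (qnum 2)⁻¹ • ∑ i, q ^ (2 * (above m i : ℤ)) •
      contract n a c (sym.ev c (m + (unitOcc i + unitOcc i))) := by
    change contract n a c (sym.mulLin n a 2 c (sym.ev a m ⊗ₜ dotVec n)) = _
    rw [dotVec, TensorProduct.tmul_smul, TensorProduct.tmul_sum, map_smul, map_smul, map_sum, map_sum]
    refine congrArg _ (Finset.sum_congr rfl fun i _ => ?_)
    rw [mulLin_ev sym hm (by rw [deg_add, deg_unitOcc]), map_smul, cross_add_left,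
      cross_unitOcc_left, ← two_mul]
    congr 1
  have h5 : ∑ i, ∑ j, (q ^ (2 * (above m i : ℤ)) * (sym.thinR (m + (unitOcc i + unitOcc i)) j *
      sym.thinR (m + (unitOcc i + unitOcc i) - unitOcc j) j * capCoeff j)) •
        sym.ev a (m + (unitOcc i + unitOcc i) - unitOcc j - unitOcc j) =
      (qnum 2 * qnum ((n : ℤ) + 2 * a)) • sym.ev a m + ∑ i, ∑ j, kCoeff m i j •
        sym.ev a (m + (unitOcc i + unitOcc i) - unitOcc j - unitOcc j) := by
    simp only [hterm, Finset.sum_add_distrib, Finset.sum_ite_eq, Finset.mem_univ, if_true,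
      ← Finset.sum_smul, ← Finset.mul_sum]
    rw [sum_skew_qnum (Or.inr rfl)]
    have h6 : ∑ i, ((2 * m i + 1 : ℕ) : ℤ) = n + 2 * a := by
      rw [← hm, deg]
      push_cast
      rw [Finset.sum_add_distrib, ← Finset.mul_sum]
      simp
      ring
    rw [h6]
  have h6 : ∀ i, q ^ (2 * (above m i : ℤ)) • contract n a c (sym.ev c (m + (unitOcc i + unitOcc i))) =
      (qnum 2)⁻¹ • ∑ j, (q ^ (2 * (above m i : ℤ)) * (sym.thinR (m + (unitOcc i + unitOcc i)) j *
        sym.thinR (m + (unitOcc i + unitOcc i) - unitOcc j) j * capCoeff j)) •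
          sym.ev a (m + (unitOcc i + unitOcc i) - unitOcc j - unitOcc j) := by
    intro i
    rw [contract_ev hc, smul_comm, Finset.smul_sum]
    simp only [smul_smul]
  rw [h0, Finset.sum_congr rfl fun i _ => h6 i, ← Finset.smul_sum, h5, smul_smul, smul_add, smul_smul]
  congr 2
  rw [mul_assoc, inv_mul_cancel_left₀ qnum_two_ne_zero]

lemma kLin_one (i : Fin n) {c : ℕ} (hc : 1 + 2 = c) : kLin n 1 c (sym.ev 1 (unitOcc i)) =
    ((qnum 2)⁻¹ * qnum ((n : ℤ) + 2)) • sym.ev 1 (unitOcc i) := by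
  rw [kLin_ev hc (deg_unitOcc i)]
  have h : ∀ j l, kCoeff (unitOcc i) j l = 0 := fun j l => kCoeff_of_le_one (by
    by_cases h : l = i
    · simp [h]
    · simp [h]) j
  simp [h]

lemma kLin_two {c : ℕ} (hc : 2 + 2 = c) (x : (sym.pow n 2).V) : kLin n 2 c x =
    ((qnum 2)⁻¹ * qnum ((n : ℤ) + 4)) • x + endForm n x • dotVec n := by
  have key : kLin n 2 c = ((qnum 2)⁻¹ * qnum ((n : ℤ) + 4)) • LinearMap.id +
      (endForm n).smulRight (dotVec n) := by
    refine hom_ext fun m _ hm => ?_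
    rw [kLin_ev hc hm]
    refine congrArg₂ _ (by norm_num) ?_
    change _ = endForm n (sym.ev 2 m) • dotVec n
    have h0 : m ≠ 0 := by rintro rfl; simp [deg] at hm
    obtain ⟨l, m', rfl, -⟩ := exists_lowest h0
    rw [deg_add, deg_unitOcc] at hm
    obtain ⟨p, rfl⟩ := eq_unitOcc_of_deg (Nat.succ_injective hm)
    by_cases hpl : p = l
    · subst hpl
      rw [endForm_self, dotVec, smul_comm, mul_smul]
      congr 1
      rw [Finset.smul_sum, Finset.smul_sum]
      refine Finset.sum_congr rfl fun i _ => ?_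
      rw [Finset.sum_eq_single p]
      · rw [smul_smul, show unitOcc p + unitOcc p + (unitOcc i + unitOcc i) - unitOcc p - unitOcc p =
          unitOcc i + unitOcc i by
            rw [add_assoc, add_tsub_cancel_left, add_tsub_cancel_left]]
        congr 1
        have h1 : (2 * (above (unitOcc p + unitOcc p) i : ℤ) - 2 * below (unitOcc p + unitOcc p) p -
            if i < p then 4 else 0) = 0 := by
          rw [above_add, below_add, above_unitOcc, below_unitOcc, if_neg (lt_irrefl p)]
          split_ifs <;> norm_num
        rw [kCoeff, h1, zpow_zero, one_mul]
        simp only [Pi.add_apply, unitOcc_self]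
        norm_num
        rw [qnum_one, mul_one, inv_mul_cancel_left₀ qnum_two_ne_zero]
      · intro j _ hj
        rw [kCoeff_of_le_one, zero_smul]
        simp [unitOcc_of_ne hj]
      · simp
    · rw [endForm_of_ne hpl, zero_smul]
      have h : ∀ i j, kCoeff (unitOcc p + unitOcc l) i j = 0 := fun i j => kCoeff_of_le_one (by
        by_cases h : j = p
        · subst h
          simp [unitOcc_of_ne hpl]
        · by_cases h' : j = l
          · subst h'
            simp [unitOcc_of_ne h]
          · simp [unitOcc_of_ne h, unitOcc_of_ne h']) i
      simp [h]
  exact LinearMap.congr_fun key x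

lemma zqnum_two (n : ℕ) (t : ℤ) :
    zqnum 2 (-(q ^ n)⁻¹) (-t) = (qnum 2)⁻¹ * qnum ((n : ℤ) + 2 * t) := by
  have hq := Uq.q_ne_zero
  have e : q ^ ((n : ℤ) + 2 * t) = q ^ n * q ^ (2 * t) := by rw [zpow_add₀ hq, zpow_natCast]
  have h2 : q ^ (2 : ℤ) = q ^ 2 := by rw [← zpow_natCast]; rfl
  have h3 := qnum_two_ne_zero
  rw [qnum] at h3
  have h4 : q - q⁻¹ ≠ 0 := by
    intro h
    simp [h] at h3
  rw [zqnum, qnum, qnum, zpow_neg q ((n : ℤ) + 2 * t), e, zpow_neg, h2, inv_div, div_mul_div_comm,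
    mul_comm (q - q⁻¹), mul_div_mul_right _ _ h4, zpow_neg, h2]
  congr 1
  rw [show ((2 : ℕ) : ℤ) * -t = -(2 * t) by push_cast; ring, zpow_neg]
  have h5 : q ^ n ≠ 0 := pow_ne_zero _ hq
  have h6 : q ^ (2 * t) ≠ 0 := zpow_ne_zero _ hq
  field_simp
  ring

end Kind

namespace WordSpace
section DotRelations
variable {n : ℕ} {Γ : GammaA .sym n}
  {val : ∀ {X Y : AWeb}, DotGen X Y → ((orbit (webEmb ⋙ Γ.functor) (soTriv n)).obj X ⟶
    (orbit (webEmb ⋙ Γ.functor) (soTriv n)).obj Y)}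

variable (Γ val) in
/-- The expected value of the start dot. -/
def IsStartDot : Prop :=
  evalLin Γ val startDot₀ (one Γ) = (strandEquiv Γ 2).symm (Kind.dotVec n)

variable (Γ val) in
/-- The expected values of the end dot. -/
def IsEndDot : Prop := ∀ x : (Kind.sym.pow n 2).V,
  evalLin Γ val endDot₀ ((strandEquiv Γ 2).symm x) = Kind.endForm n x • one Γ

lemma IsStartDot.isCup (h : IsStartDot Γ val) :
    IsCup Γ val (.comp startDot₀ (_root_.web .split₁₁)) := by
  refine (evalLin_comp Γ val startDot₀ _ _).trans ?_
  rw [evalLin_web, h]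
  refine (web_split_symm Γ (a := 1) (b := 1) (c := 2) rfl (Kind.dotVec n)).trans ?_
  have h1 : Kind.sym.comulLin n 1 1 2 (Kind.dotVec n) = Kind.sym.cupVec n := by
    rw [Kind.dotVec, map_smul, map_sum, Finset.smul_sum]
    refine Finset.sum_congr rfl fun i _ => ?_
    rw [← Kind.mulLin_unitOcc_self, Kind.comulLin_mulLin_thin, offDiag_self, zero_smul, add_zero,
      Kind.diag, if_pos rfl, smul_smul]
    have : Kind.sym.mult 2 = qnum 2 := rfl
    rw [this, inv_mul_cancel₀ Kind.qnum_two_ne_zero, one_smul]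
  exact (congrArg (pair Γ 1 1) h1).trans (map_sum (pair Γ 1 1) _ _)

lemma IsEndDot.isCap (h : IsEndDot Γ val) :
    IsCap Γ val (.comp (_root_.web .merge₁₁) endDot₀) := by
  intro i j
  refine (evalLin_comp Γ val (_root_.web .merge₁₁) endDot₀ _).trans ?_
  rw [evalLin_web]
  have h1 := strandEquiv_merge Γ (a := 1) (b := 1) (c := 2) rfl (e Γ i) (e Γ j)
  have h2 : ∀ i, strandEquiv Γ 1 (e Γ i) = Kind.sym.ev 1 (unitOcc i) := fun i =>
    LinearEquiv.apply_symm_apply _ _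
  rw [h2, h2, ← LinearEquiv.eq_symm_apply] at h1
  refine (congrArg _ h1).trans ((h _).trans ?_)
  exact congrArg (· • one Γ) (Kind.endForm_mulLin i j)

lemma IsStartDot.whisk (h : IsStartDot Γ val) (a : ℕ+) (x : (Kind.sym.pow n a).V) :
    evalLin Γ val (X := wd [a]) (Y := wd [a, 2]) (.whisk (wd [a]) startDot₀)
      ((strandEquiv Γ a).symm x) = pair Γ a 2 (x ⊗ₜ Kind.dotVec n) := by
  refine (congrArg _ (star_one_strand Γ a _).symm).trans ?_
  refine (evalLin_whisk Γ val (wd [a]) startDot₀ _ (one Γ)).trans ?_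
  exact congrArg (star Γ (X := [a]) (Y := [2]) _) h

lemma IsEndDot.whisk (h : IsEndDot Γ val) (a : ℕ+)
    (t : (Kind.sym.pow n a).V ⊗[Kq] (Kind.sym.pow n 2).V) :
    evalLin Γ val (X := wd [a, 2]) (Y := wd [a]) (.whisk (wd [a]) endDot₀) (pair Γ a 2 t) =
      (strandEquiv Γ a).symm (TensorProduct.rid Kq _
        (TensorProduct.map LinearMap.id (Kind.endForm n) t)) := by
  induction t using TensorProduct.induction_on with
  | zero => exact (congrArg _ (map_zero _)).trans ((map_zero _).trans (by simp))
  | tmul x y =>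
    refine (evalLin_whisk Γ val (wd [a]) endDot₀ _ ((strandEquiv Γ 2).symm y)).trans ?_
    refine (congrArg (star Γ (X := [a]) (Y := []) _) (h y)).trans ?_
    refine (map_smul _ _ _).trans ((congrArg _ (star_one_strand Γ a _)).trans ?_)
    rw [← map_smul]
    rfl
  | add s t hs ht =>
    refine (congrArg _ (map_add _ _ _)).trans ((map_add _ _ _).trans ?_)
    refine (congrArg₂ _ hs ht).trans ?_
    rw [map_add, map_add, map_add]

lemma evalLin_kWeb (h : IsStartDot Γ val) (h' : IsEndDot Γ val) (a : ℕ+)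
    (x : (Kind.sym.pow n a).V) :
    evalLin Γ val (.comp (X := wd [a]) (Y := wd [a, 2]) (Z := wd [a]) (.whisk (wd [a]) startDot₀)
      (.comp (_root_.web (.ms a 2)) (.whisk (wd [a]) endDot₀))) ((strandEquiv Γ a).symm x) =
        (strandEquiv Γ a).symm (Kind.kLin n a (a + 2 : ℕ+) x) := by
  refine (evalLin_comp Γ val (X := wd [a]) (Y := wd [a, 2]) (Z := wd [a]) _ _ _).trans ?_
  refine (congrArg _ (h.whisk a x)).trans ?_
  refine (evalLin_comp Γ val (Y := wd [a, 2]) (Z := wd [a]) _ _ _).trans ?_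
  rw [evalLin_web]
  refine (congrArg _ (web_ms Γ (a := a) (b := 2) rfl (x ⊗ₜ Kind.dotVec n))).trans ?_
  exact h'.whisk a _

lemma strand_hom_ext (a : ℕ+) {M : Type*} [AddCommGroup M] [Module Kq M]
    {f g : WordSpace Γ [a] →ₗ[Kq] M}
    (h : ∀ x, f ((strandEquiv Γ a).symm x) = g ((strandEquiv Γ a).symm x)) : f = g := by
  refine LinearMap.ext fun x => ?_
  have h2 : (strandEquiv Γ a).symm (strandEquiv Γ a x) = x := LinearEquiv.symm_apply_apply _ x
  exact (congrArg f h2).symm.trans ((h _).trans (congrArg g h2))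

lemma eval_dotRel (h : IsStartDot Γ val) (h' : IsEndDot Γ val) {X Y : AWeb}
    {f g : ModPre DotGen X Y} (hr : DotRel (-(q ^ n)⁻¹) f g) :
    ModPre.eval (webEmb ⋙ Γ.functor) (soTriv n) val f =
      ModPre.eval (webEmb ⋙ Γ.functor) (soTriv n) val g := by
  cases hr with
  | barbell =>
    refine eval_eq_of_evalLin Γ val (one_hom_ext Γ ?_)
    rw [evalLin_smul, evalLin_id, ← neg_zero, Kind.zqnum_two, mul_zero, add_zero]
    refine (evalLin_comp Γ val startDot₀ endDot₀ _).trans ((congrArg _ h).trans ?_)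
    exact (h' _).trans (congrArg (· • one Γ) Kind.endForm_dotVec)
  | thin_K =>
    refine eval_eq_of_evalLin Γ val (e_hom_ext Γ fun i => ?_)
    rw [evalLin_smul, evalLin_id, Kind.zqnum_two, mul_one]
    refine (evalLin_kWeb h h' 1 _).trans ?_
    exact (congrArg (strandEquiv Γ 1).symm (Kind.kLin_one i rfl)).trans (map_smul _ _ _)
  | thick_K =>
    refine eval_eq_of_evalLin Γ val (strand_hom_ext 2 fun x => ?_)
    rw [evalLin_add, evalLin_smul, evalLin_id, Kind.zqnum_two]
    refine (evalLin_kWeb h h' 2 _).trans ?_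
    refine (congrArg (strandEquiv Γ 2).symm (Kind.kLin_two rfl x)).trans ?_
    refine (map_add _ _ _).trans ((add_comm _ _).trans ?_)
    refine congrArg₂ _ ((map_smul _ _ _).trans ?_) ((map_smul _ _ _).trans ?_)
    · refine (congrArg _ h.symm).trans ((map_smul _ _ _).symm.trans ?_)
      exact (congrArg _ (h' x).symm).trans (evalLin_comp Γ val endDot₀ startDot₀ _).symm
    · rfl
  | slide hr => exact eval_slide h.isCup h'.isCap hr

end DotRelations

section Values
variable {k : Kind} {n : ℕ} (Γ : GammaA k n)

lemma orbitUnit_inv_soOne :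
    FinRep.lin (orbitUnit (webEmb ⋙ Γ.functor) (soTriv n)).inv (soOne n) =
      orbitVec Γ (wd []) (one Γ) := rfl

lemma orbitUnit_hom_one :
    FinRep.lin (orbitUnit (webEmb ⋙ Γ.functor) (soTriv n)).hom (orbitVec Γ (wd []) (one Γ)) =
      soOne n :=
  congrArg (fun t => FinRep.lin t (soOne n))
    (orbitUnit (webEmb ⋙ Γ.functor) (soTriv n)).inv_hom_id

/-- The value of a generator `∅ → X` given by an invariant vector. -/
def onUnit {X : AWeb} (v : (Γ.functor.obj (webEmb.obj X)).V)
    (h : ∀ i, (Γ.functor.obj (webEmb.obj X)).ρ (soGen i) v = 0) :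
    (orbit (webEmb ⋙ Γ.functor) (soTriv n)).obj (wd []) ⟶
      (orbit (webEmb ⋙ Γ.functor) (soTriv n)).obj X :=
  (orbitUnit (webEmb ⋙ Γ.functor) (soTriv n)).hom ≫ ofInvariant v h

/-- The value of a generator `X → ∅` given by an invariant functional. -/
def toUnit {X : AWeb} (φ : (Γ.functor.obj (webEmb.obj X)).V →ₗ[Kq] Kq)
    (h : ∀ i v, φ ((Γ.functor.obj (webEmb.obj X)).ρ (soGen i) v) = 0) :
    (orbit (webEmb ⋙ Γ.functor) (soTriv n)).obj X ⟶
      (orbit (webEmb ⋙ Γ.functor) (soTriv n)).obj (wd []) :=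
  ofCoinvariant φ h ≫ (orbitUnit (webEmb ⋙ Γ.functor) (soTriv n)).inv

lemma red_onUnit {X : AWeb} (v : (Γ.functor.obj (webEmb.obj X)).V)
    (h : ∀ i, (Γ.functor.obj (webEmb.obj X)).ρ (soGen i) v = 0) :
    red Γ (onUnit Γ v h) (one Γ) = v := by
  apply orbitVec_injective Γ X
  refine (red_apply Γ (onUnit Γ v h) (one Γ)).trans ?_
  refine (congrArg (FinRep.lin (ofInvariant v h)) (orbitUnit_hom_one Γ)).trans ?_
  exact (ofInvariant_apply v h 1).trans (one_smul Kq _)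

lemma red_toUnit {X : AWeb} (φ : (Γ.functor.obj (webEmb.obj X)).V →ₗ[Kq] Kq)
    (h : ∀ i v, φ ((Γ.functor.obj (webEmb.obj X)).ρ (soGen i) v) = 0) (x : WordSpace Γ X.word) :
    red Γ (toUnit Γ φ h) x = (φ x) • one Γ := by
  apply orbitVec_injective Γ (wd [])
  refine (red_apply Γ (toUnit Γ φ h) x).trans ?_
  have h1 : FinRep.lin (ofCoinvariant φ h) (orbitVec Γ X x) = (φ x) • soOne n :=
    (ofCoinvariant_apply φ h x 1).trans (mul_comm (1 : Kq) (φ x))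
  refine (congrArg (FinRep.lin (orbitUnit (webEmb ⋙ Γ.functor) (soTriv n)).inv) h1).trans ?_
  refine (map_smul _ _ _).trans ?_
  exact (congrArg _ (orbitUnit_inv_soOne Γ)).trans rfl

variable {P : ModPresentation AWeb} (M : P.Model (webEmb ⋙ Γ.functor) (soTriv n))
variable {Γ}

lemma ofModel_valueOn₁_eq {X : AWeb} (f : ModPre P.Gen (𝟙_ AWeb) X)
    (v : (Γ.functor.obj (webEmb.obj X)).V) (h : evalLin Γ M.val f (one Γ) = v) :
    (GammaMod.ofModel M).valueOn₁ (ModWeb.mkHom f) = (GammaMod.ofModel M).ofA X v := by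
  refine (GammaMod.ofModel_valueOn₁ M _).trans (Eq.trans ?_ (GammaMod.ofModel_ofA M X v).symm)
  exact (red_apply Γ (M.hom (ModWeb.mkHom f)) (one Γ)).symm.trans (congrArg (orbitVec Γ X) h)

lemma ofModel_value_eq {X : AWeb} (f : ModPre P.Gen X (𝟙_ AWeb))
    (v : (Γ.functor.obj (webEmb.obj X)).V) (c : Kq) (h : evalLin Γ M.val f v = c • one Γ) :
    (GammaMod.ofModel M).value (ModWeb.mkHom f) ((GammaMod.ofModel M).ofA X v) = c := by
  refine (GammaMod.ofModel_value M _ v).trans ?_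
  have h1 : FinRep.lin (M.hom (ModWeb.mkHom f)) (orbitVec Γ X v) =
      c • orbitVec Γ (wd []) (one Γ) :=
    (red_apply Γ (M.hom (ModWeb.mkHom f)) v).symm.trans
      ((congrArg (orbitVec Γ (wd [])) h).trans rfl)
  refine (congrArg (FinRep.lin (orbitUnit (webEmb ⋙ Γ.functor) (soTriv n)).hom) h1).trans ?_
  refine (map_smul _ _ _).trans ((congrArg _ (orbitUnit_hom_one Γ)).trans ?_)
  exact mul_one (M := Kq) c

end Values
end WordSpace

lemma FinRep.lin_ρ {n : ℕ} {X Y : FinRep (Uq n)} (f : X ⟶ Y) (a : Uq n) (v : X.V) :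
    FinRep.lin f (X.ρ a v) = Y.ρ a (FinRep.lin f v) :=
  LinearMap.congr_fun (FinRep.lin_comm f a) v

namespace WordSpace
open Functor.LaxMonoidal Functor.OplaxMonoidal
variable {k : Kind} {n : ℕ} (Γ : GammaA k n)

/-- The isomorphism `pair` as a morphism of representations. -/
def pairHom : (k.pow n 1 ⊗ k.pow n 1 : FinRep (Uq n)) ⟶
    Γ.functor.obj (webEmb.obj (wd [1, 1])) :=
  ((Γ.objIso 1).inv ⊗ₘ (Γ.objIso 1).inv) ≫ μ (webEmb ⋙ Γ.functor) (strand 1) (strand 1)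

/-- The inverse of `pair` as a morphism of representations. -/
def pairInv : Γ.functor.obj (webEmb.obj (wd [1, 1])) ⟶
    (k.pow n 1 ⊗ k.pow n 1 : FinRep (Uq n)) :=
  δ (webEmb ⋙ Γ.functor) (strand 1) (strand 1) ≫ ((Γ.objIso 1).hom ⊗ₘ (Γ.objIso 1).hom)

lemma lin_pairHom : FinRep.lin (pairHom Γ) = pair Γ 1 1 :=
  TensorProduct.ext' fun _ _ => rfl

lemma lin_pairInv_pair (t : (k.pow n 1).V ⊗[Kq] (k.pow n 1).V) :
    FinRep.lin (pairInv Γ) (pair Γ 1 1 t) = t := by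
  have h : pairHom Γ ≫ pairInv Γ = 𝟙 _ := by
    refine (Category.assoc _ _ _).trans ?_
    refine (congrArg (((Γ.objIso 1).inv ⊗ₘ (Γ.objIso 1).inv) ≫ ·)
      (Functor.Monoidal.μ_δ_assoc (F := webEmb ⋙ Γ.functor) (strand 1) (strand 1) _)).trans ?_
    refine (MonoidalCategory.tensorHom_comp_tensorHom _ _ _ _).trans ?_
    exact (congrArg₂ (· ⊗ₘ ·) (Γ.objIso 1).inv_hom_id (Γ.objIso 1).inv_hom_id).trans
      (MonoidalCategory.id_tensorHom_id _ _)
  rw [← lin_pairHom]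
  exact congrArg (fun f => FinRep.lin f t) h

lemma pair_invariant (l : Fin (n - 1)) :
    (Γ.functor.obj (webEmb.obj (wd [1, 1]))).ρ (soGen l) (pair Γ 1 1 (k.cupVec n)) = 0 := by
  rw [← lin_pairHom]
  exact (FinRep.lin_ρ (pairHom Γ) _ _).symm.trans
    ((congrArg _ (k.cupVec_invariant l)).trans (map_zero _))

lemma capForm_pairInv_coinvariant (l : Fin (n - 1))
    (v : (Γ.functor.obj (webEmb.obj (wd [1, 1]))).V) :
    (k.capForm n ∘ₗ FinRep.lin (pairInv Γ))
      ((Γ.functor.obj (webEmb.obj (wd [1, 1]))).ρ (soGen l) v) = 0 :=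
  (congrArg (k.capForm n) (FinRep.lin_ρ (pairInv Γ) _ _)).trans (k.capForm_coinvariant l _)

end WordSpace

namespace Kind
variable {n : ℕ}

lemma dotVec_invariant (l : Fin (n - 1)) : (sym.pow n 2).ρ (soGen l) (dotVec n) = 0 := by
  have h : dotVec n = (qnum 2)⁻¹ • FinRep.lin (sym.mulHom n (a := 1) (b := 1) (c := 2) rfl)
      (sym.cupVec n) := by
    refine congrArg _ (Eq.trans ?_ (map_sum (sym.mulLin n 1 1 2) _ _).symm)
    exact Finset.sum_congr rfl fun i _ => (mulLin_unitOcc_self i).symm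
  rw [h, map_smul, ← FinRep.lin_ρ]
  refine (congrArg ((qnum 2)⁻¹ • ·) ((congrArg _ (sym.cupVec_invariant l)).trans
    (map_zero _))).trans (smul_zero _)

lemma endForm_coinvariant (l : Fin (n - 1)) (v : (sym.pow n 2).V) :
    endForm n ((sym.pow n 2).ρ (soGen l) v) = 0 := by
  refine (congrArg (fun t => (qnum 2)⁻¹ * sym.capForm n t)
    (FinRep.lin_ρ (sym.comulHom n (a := 1) (b := 1) (c := 2) rfl) (soGen l) v)).trans ?_
  exact (congrArg ((qnum 2)⁻¹ * ·) (sym.capForm_coinvariant l _)).trans (mul_zero _)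

lemma vec_pair {i j : Fin n} (h : i ≤ j) : sym.vec ![i, j] = sym.ev 2 (unitOcc i + unitOcc j) := by
  have hm : Monotone ![i, j] := by
    intro a b hab
    fin_cases a <;> fin_cases b <;> simp_all
  rw [sym.vec_of_monotone hm]
  congr 1

end Kind

open WordSpace

section Existence
variable {n : ℕ}

/-- The values of the generators of the cup-web category. -/
def cupGenVal (Γ : GammaA .ext n) : ∀ {X Y : AWeb}, CupGen X Y →
    ((orbit (webEmb ⋙ Γ.functor) (soTriv n)).obj X ⟶
      (orbit (webEmb ⋙ Γ.functor) (soTriv n)).obj Y)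
  | _, _, .cup => onUnit Γ (X := wd [1, 1]) (pair Γ 1 1 (Kind.ext.cupVec n)) (pair_invariant Γ)
  | _, _, .cap => toUnit Γ (X := wd [1, 1]) (Kind.ext.capForm n ∘ₗ FinRep.lin (pairInv Γ))
      (capForm_pairInv_coinvariant Γ)

lemma isCup_cupGenVal (Γ : GammaA .ext n) : IsCup Γ (cupGenVal Γ) cup₀ :=
  (red_onUnit Γ (X := wd [1, 1]) _ _).trans (map_sum (pair Γ 1 1) _ _)

lemma isCap_cupGenVal (Γ : GammaA .ext n) : IsCap Γ (cupGenVal Γ) cap₀ := fun i j => by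
  refine (red_toUnit Γ (X := wd [1, 1]) _ _ _).trans (congrArg (· • one Γ) ?_)
  exact (congrArg (Kind.ext.capForm n) (lin_pairInv_pair Γ
    (Kind.ext.ev 1 (unitOcc i) ⊗ₜ Kind.ext.ev 1 (unitOcc j)))).trans (Kind.ext.capForm_ev i j)

/-- The model of the cup-web category in the orbit of the trivial representation. -/
def cupModel (Γ : GammaA .ext n) :
    (cupPresentation (q ^ n)).Model (webEmb ⋙ Γ.functor) (soTriv n) where
  val := cupGenVal Γ
  rel := eval_cupRel (isCup_cupGenVal Γ) (isCap_cupGenVal Γ)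

lemma nonempty_gammaExt (Γ : GammaA .ext n) : Nonempty (GammaExt Γ) :=
  ⟨{ GammaMod.ofModel (cupModel Γ) with
      obj_strand := GammaMod.ofModel_obj_strand (cupModel Γ)
      map_cup := by
        refine ofModel_valueOn₁_eq (cupModel Γ) cup₀ _ ((isCup_cupGenVal Γ).trans ?_)
        exact Finset.sum_congr rfl fun i _ => (vec₂_eq Γ i i).symm
      map_cap := fun i j => by
        refine ofModel_value_eq (cupModel Γ) cap₀ _ _ ?_
        rw [vec₂_eq]
        exact isCap_cupGenVal Γ i j }⟩

/-- The values of the generators of the dot-web category. -/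
def dotGenVal (Γ : GammaA .sym n) : ∀ {X Y : AWeb}, DotGen X Y →
    ((orbit (webEmb ⋙ Γ.functor) (soTriv n)).obj X ⟶
      (orbit (webEmb ⋙ Γ.functor) (soTriv n)).obj Y)
  | _, _, .startDot => onUnit Γ (X := wd [2]) (FinRep.lin (Γ.objIso 2).inv (Kind.dotVec n))
      fun l => (FinRep.lin_ρ (Γ.objIso 2).inv _ _).symm.trans
        ((congrArg _ (Kind.dotVec_invariant l)).trans (map_zero _))
  | _, _, .endDot => toUnit Γ (X := wd [2]) (Kind.endForm n ∘ₗ FinRep.lin (Γ.objIso 2).hom)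
      fun l _ => (congrArg (Kind.endForm n) (FinRep.lin_ρ (Γ.objIso 2).hom _ _)).trans
        (Kind.endForm_coinvariant l _)

lemma isStartDot_dotGenVal (Γ : GammaA .sym n) : IsStartDot Γ (dotGenVal Γ) :=
  red_onUnit Γ (X := wd [2]) _ _

lemma isEndDot_dotGenVal (Γ : GammaA .sym n) : IsEndDot Γ (dotGenVal Γ) := fun x => by
  refine (red_toUnit Γ (X := wd [2]) _ _ _).trans (congrArg (· • one Γ) ?_)
  exact congrArg (Kind.endForm n) ((strandEquiv Γ 2).apply_symm_apply x)

/-- The model of the dot-web category in the orbit of the trivial representation. -/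
def dotModel (Γ : GammaA .sym n) :
    (dotPresentation (-(q ^ n)⁻¹)).Model (webEmb ⋙ Γ.functor) (soTriv n) where
  val := dotGenVal Γ
  rel := eval_dotRel (isStartDot_dotGenVal Γ) (isEndDot_dotGenVal Γ)

lemma GammaMod.ofA_smul {k : Kind} {Γ : GammaA k n} {P : ModPresentation AWeb} (G : GammaMod Γ P)
    (X : AWeb) (c : Kq) (v : (Γ.functor.obj (webEmb.obj X)).V) :
    G.ofA X (c • v) = c • G.ofA X v :=
  (congrArg (FinRep.lin (G.objIso X).hom) (TensorProduct.smul_tmul' c v _).symm).trans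
    (map_smul _ _ _)

lemma smul_sum_vec_eq (Γ : GammaA .sym n) :
    (qnum 2)⁻¹ • ∑ i, Γ.vec 2 ![i, i] = (strandEquiv Γ 2).symm (Kind.dotVec n) := by
  refine Eq.trans (congrArg _ ?_) (map_smul (strandEquiv Γ 2).symm _ _).symm
  refine Eq.trans (Finset.sum_congr rfl fun i _ => ?_) (map_sum (strandEquiv Γ 2).symm _ _).symm
  exact congrArg (strandEquiv Γ 2).symm (Kind.vec_pair le_rfl)

lemma nonempty_gammaSym (Γ : GammaA .sym n) : Nonempty (GammaSym Γ) :=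
  ⟨{ GammaMod.ofModel (dotModel Γ) with
      obj_strand := GammaMod.ofModel_obj_strand (dotModel Γ)
      map_startDot := by
        refine Eq.trans ?_ (GammaMod.ofA_smul _ _ _ _)
        refine ofModel_valueOn₁_eq (dotModel Γ) startDot₀ _ ((isStartDot_dotGenVal Γ).trans ?_)
        exact (smul_sum_vec_eq Γ).symm
      map_endDot := fun i j hij => by
        refine ofModel_value_eq (dotModel Γ) endDot₀ _ _ ?_
        refine (congrArg _ (congrArg (strandEquiv Γ 2).symm (Kind.vec_pair hij))).trans ?_
        refine (isEndDot_dotGenVal Γ _).trans (congrArg (· • one Γ) ?_)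
        by_cases h : i = j
        · subst h
          rw [if_pos rfl, Kind.endForm_self]
        · rw [if_neg h, Kind.endForm_of_ne h] }⟩

end Existence

section Uniqueness
variable {n : ℕ}

lemma GammaExt.nonempty_iso {Γ : GammaA .ext n} (G G' : GammaExt Γ) :
    Nonempty (G.functor ≅ G'.functor) := by
  refine GammaMod.nonempty_iso G.toGammaMod G'.toGammaMod fun g => ?_
  cases g with
  | cup => exact GammaMod.genVal_eq_of_valueOn₁ _ _ _ _ G.map_cup G'.map_cup
  | cap =>
    refine GammaMod.genVal_eq_of_value G.toGammaMod G'.toGammaMod (X := wd [1, 1]) _ _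
      (span_w₂ Γ) ?_
    rintro _ ⟨⟨i, j⟩, rfl⟩
    have h := vec₂_eq Γ i j
    refine (congrArg (fun v => G.value (capWeb _) (G.ofA (wd [1, 1]) v)) h.symm).trans ?_
    refine Eq.trans ?_ (congrArg (fun v => G'.value (capWeb _) (G'.ofA (wd [1, 1]) v)) h)
    exact (G.map_cap i j).trans (G'.map_cap i j).symm

lemma span_vec_two (Γ : GammaA .sym n) : Submodule.span Kq
    (Set.range fun p : {p : Fin n × Fin n // p.1 ≤ p.2} => Γ.vec 2 ![p.1.1, p.1.2]) = ⊤ := by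
  refine span_eq_top_of_hom_ext (V := WordSpace Γ [2]) fun {f g} h => ?_
  have h1 : f ∘ₗ (strandEquiv Γ 2).symm.toLinearMap = g ∘ₗ (strandEquiv Γ 2).symm.toLinearMap := by
    refine Kind.hom_ext fun m hv hd => ?_
    obtain ⟨u, hu, hum⟩ := Kind.exists_vec_eq_ev hv hd
    have hu' : u = ![u 0, u 1] := by
      funext i
      fin_cases i <;> rfl
    rw [← hum, hu']
    exact h ⟨(u 0, u 1), hu (by decide)⟩
  exact strand_hom_ext 2 fun x => LinearMap.congr_fun h1 x

lemma GammaSym.nonempty_iso {Γ : GammaA .sym n} (G G' : GammaSym Γ) :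
    Nonempty (G.functor ≅ G'.functor) := by
  refine GammaMod.nonempty_iso G.toGammaMod G'.toGammaMod fun g => ?_
  cases g with
  | startDot =>
    exact GammaMod.genVal_eq_of_valueOn₁ _ _ _ ((qnum 2)⁻¹ • ∑ i, Γ.vec 2 ![i, i])
      (G.map_startDot.trans (GammaMod.ofA_smul _ _ _ _).symm)
      (G'.map_startDot.trans (GammaMod.ofA_smul _ _ _ _).symm)
  | endDot =>
    refine GammaMod.genVal_eq_of_value G.toGammaMod G'.toGammaMod (X := wd [2]) _ _
      (span_vec_two Γ) ?_
    rintro _ ⟨⟨⟨i, j⟩, hij⟩, rfl⟩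
    exact (G.map_endDot i j hij).trans (G'.map_endDot i j hij).symm

end Uniqueness

/-- The presentation functors for `U'_q(so_n)` are well defined: the type `A` presentation functors
exist, and for each of them there is, up to isomorphism, exactly one functor from the cup-web
category at `z = q^n` (exterior case), respectively from the dot-web category at `z = -q^{-n}`
(symmetric case), to the representations of `U'_q(so_n)` that is compatible with the actions of the
two sides of the type `A` functor and has the prescribed values on generators. -/
theorem proposition5p7 (n : ℕ) :
    (Nonempty (GammaA .ext n) ∧ ∀ Γ : GammaA .ext n,
      Nonempty (GammaExt Γ) ∧ ∀ G G' : GammaExt Γ, Nonempty (G.functor ≅ G'.functor)) ∧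
    (Nonempty (GammaA .sym n) ∧ ∀ Γ : GammaA .sym n,
      Nonempty (GammaSym Γ) ∧ ∀ G G' : GammaSym Γ, Nonempty (G.functor ≅ G'.functor)) :=
  ⟨⟨nonempty_gammaA .ext n, fun Γ => ⟨nonempty_gammaExt Γ, GammaExt.nonempty_iso⟩⟩,
    ⟨nonempty_gammaA .sym n, fun Γ => ⟨nonempty_gammaSym Γ, GammaSym.nonempty_iso⟩⟩⟩
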